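/- **Setting.** Let $d\ge 1$, $\Omega=[0,1]^d$, $\Omega^*=[-1/2,1/2]^d$. Let $V\in L^\infty(\mathbb R^d)$ be real and $\mathbb Z^d$-periodic, and let $Q\in H^\sigma(\mathbb R^d)$ be real with $\sigma>d$. For $k\in\mathbb R^d$ let $E_0(k)$ be the smallest eigenvalue of $-(\nabla+2\pi i k)^2+V$ on $H^2_{\rm per}(\Omega)$. Assume that $E_0\in C^3(\Omega^*)$ and that normalized eigenfunctions $p_0(\cdot;k)$, $k\in\Omega^*$, can be chosen with $p_0\in L^2_{\rm per}(\Omega;C^3(\Omega^*))$. Assume that the lowest band edge $E_*=E_0(0)$ is a simple eigenvalue with real eigenfunction $w\in H^2_{\rm per}(\Omega)$, $\|w\|_{L^2(\Omega)}=1$, that $\nabla E_0(0)=0$, and that the matrix $A=\frac1{8\pi^2}D^2E_0(0)$ is positive or negative definite; let $\mathrm{sgn}(A)=\pm1$ accordingly. Assume that $L_{A,Q}=-\nabla\cdot A\nabla+Q$ has a simple eigenvalue $e_{A,Q}$ with $\mathrm{sgn}(A)\,e_{A,Q}<0$ and real eigenfunction $F_{A,Q}\in H^2(\mathbb R^d)$,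 $\int F_{A,Q}^2=1$. Let $L_*=-\Delta+V-E_*$ on $H^2_{\rm per}(\Omega)$ and, for $g\in L^2_{\rm per}(\Omega)$ orthogonal to $w$, let $L_*^{-1}g$ be the solution of $L_*U=g$ orthogonal to $w$ in $L^2(\Omega)$. For $\varepsilon>0$ let $H_\varepsilon=-\Delta+V(x)+\varepsilon^2Q(\varepsilon x)$ and, for $0\neq u\in H^1(\mathbb R^d)$, $$\mathcal E[u]=\frac{\int_{\mathbb R^d}\{|\nabla u|^2+[V(x)+\varepsilon^2Q(\varepsilon x)-E_0(0)]|u|^2\}\,dx}{\int_{\mathbb R^d}|u|^2\,dx}.$$ Define the trial functions $$u_\varepsilon^{(2)}(x)=F_{A,Q}(\varepsilon x)w(x)+2\,\nabla_x[F_{A,Q}(\varepsilon x)]\cdot L_*^{-1}\{\nabla w\}(x),$$ and, for an eigenfunction $F_{I,Q}$ of $L_{I,Q}=-\Delta+Q$, $u_\varepsilon^{(1)}(x)=F_{I,Q}(\varepsilon x)w(x)$. **Proposition B.1.** The functions $L_*^{-1}\{\partial_{x_j}w\}$, $1\le j\le d$, exist, and: 1. There is $\varepsilon_0>0$ such that for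 all $0<\varepsilon<\varepsilon_0$ one has $u_\varepsilon^{(2)}\in H^1(\mathbb R^d)$ and $\mathcal E[u_\varepsilon^{(2)}]<0$, and $H_\varepsilon$ has a ground state below the band edge: there are $\mu<E_0(0)$ and $0\ne\psi\in H^2(\mathbb R^d)$ with $H_\varepsilon\psi=\mu\psi$ and $\mu\le E_0(0)+\mathcal E[v]$ for all $0\ne v\in H^1(\mathbb R^d)$. 2. Suppose in addition that $V$ is not almost everywhere equal to a constant and that $e_{A,Q}$ is the lowest eigenvalue of $L_{A,Q}$. If $L_{I,Q}=-\Delta+Q$ has a simple eigenvalue $e_{I,Q}<0$ with eigenfunction $F_{I,Q}\in H^2(\mathbb R^d)$, then there is $\varepsilon_0>0$ such that for all $0<\varepsilon<\varepsilon_0$ both trial functions lie in $H^1(\mathbb R^d)$ and $$\mathcal E[u_\varepsilon^{(2)}]<\mathcal E[u_\varepsilon^{(1)}]<0 .$$ -/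

import Mathlib

open MeasureTheory Set Filter
open scoped ContDiff

noncomputable section

namespace DefectModes

/-- Euclidean space `ℝ^d`. -/
abbrev Rd (d : ℕ) := EuclideanSpace ℝ (Fin d)

/-- The `j`-th standard basis vector of `ℝ^d`. -/
def stdVec {d : ℕ} (j : Fin d) : Rd d := EuclideanSpace.single j (1 : ℝ)

/-- The fundamental period cell `Ω = [0,1]^d`. -/
def cell (d : ℕ) : Set (Rd d) := {x | ∀ j, x j ∈ Set.Icc (0 : ℝ) 1}

/-- The Brillouin zone `Ω* = [-1/2,1/2]^d`. -/
def brillouin (d : ℕ) : Set (Rd d) := {k | ∀ j, k j ∈ Set.Icc (-1 / 2 : ℝ) (1 / 2)}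

/-- Lebesgue measure on the period cell. -/
def cellMeasure (d : ℕ) : Measure (Rd d) := (volume : Measure (Rd d)).restrict (cell d)

/-! ### Weak derivatives and Sobolev spaces -/

section Weak

variable {d : ℕ} {𝕜 : Type*} [RCLike 𝕜]

/-- `g` is the `j`-th weak (distributional) partial derivative of `f` on `ℝ^d`. -/
def HasWeakPartial (j : Fin d) (f g : Rd d → 𝕜) : Prop :=
  LocallyIntegrable f ∧ LocallyIntegrable g ∧
    ∀ φ : Rd d → ℝ, ContDiff ℝ ∞ φ → HasCompactSupport φ →
      ∫ x, (fderiv ℝ φ x (stdVec j)) • f x = - ∫ x, φ x • g x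

open Classical in
/-- The `j`-th weak partial derivative of `f` (unique up to a null set when it exists, and `0` by
convention when it does not exist). -/
def weakPartial (j : Fin d) (f : Rd d → 𝕜) : Rd d → 𝕜 :=
  if h : ∃ g, HasWeakPartial j f g then h.choose else 0

/-- `Δ f`, through weak derivatives. -/
def weakLaplacian (f : Rd d → 𝕜) : Rd d → 𝕜 :=
  fun x => ∑ j, weakPartial j (weakPartial j f) x

/-- `f` and its first weak partial derivatives on `ℝ^d` are square integrable for `μ`. With
`μ` Lebesgue measure this is `H¹(ℝ^d)`. -/
def SqIntOrder1 (μ : Measure (Rd d)) (f : Rd d → 𝕜) : Prop :=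
  MemLp f 2 μ ∧ ∀ j, ∃ g, HasWeakPartial j f g ∧ MemLp g 2 μ

/-- `f` and its weak partial derivatives on `ℝ^d` of order at most two are square integrable
for `μ`. -/
def SqIntOrder2 (μ : Measure (Rd d)) (f : Rd d → 𝕜) : Prop :=
  MemLp f 2 μ ∧ ∀ j, ∃ g, HasWeakPartial j f g ∧ SqIntOrder1 μ g

/-- `f ∈ H¹(ℝ^d)`. -/
def MemH1 (f : Rd d → 𝕜) : Prop := SqIntOrder1 (volume : Measure (Rd d)) f

/-- `f ∈ H²(ℝ^d)`. -/
def MemH2 (f : Rd d → 𝕜) : Prop := SqIntOrder2 (volume : Measure (Rd d)) f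

/-- `f` is periodic with respect to the lattice `ℤ^d`. -/
def LatticePeriodic {β : Type*} (f : Rd d → β) : Prop :=
  ∀ j : Fin d, Function.Periodic f (stdVec j)

/-- `f ∈ H²_per(Ω)`: a periodic function whose weak derivatives (taken on all of `ℝ^d`, that is,
as a periodic distribution) of order at most two are square integrable over a period cell. -/
def MemH2Per (f : Rd d → 𝕜) : Prop := LatticePeriodic f ∧ SqIntOrder2 (cellMeasure d) f

end Weak

variable {d : ℕ}

/-- `Q ∈ H^σ(ℝ^d)` for a real order `σ`. -/
def MemHs (σ : ℝ) (Q : Rd d → ℝ) : Prop :=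
  ∃ hQ : MemLp (fun x => (Q x : ℂ)) 2 (volume : Measure (Rd d)),
    TemperedDistribution.MemSobolev σ 2
      (MeasureTheory.Lp.toTemperedDistribution (hQ.toLp (fun x => (Q x : ℂ))))

/-! ### Floquet-Bloch theory at the lowest band -/

/-- The operator `∂_{x_j} + 2πi k_j`. -/
def blochPartial (k : Rd d) (j : Fin d) (p : Rd d → ℂ) : Rd d → ℂ :=
  fun x => weakPartial j p x + 2 * (Real.pi : ℂ) * Complex.I * (k j : ℂ) * p x

/-- `p ∈ H²_per(Ω)` solves `(-(∇ + 2πik)² + V) p = E p`. -/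
def SolvesBloch (V : Rd d → ℝ) (k : Rd d) (E : ℝ) (p : Rd d → ℂ) : Prop :=
  MemH2Per p ∧
    ∀ᵐ x, -(∑ j, blochPartial k j (blochPartial k j p) x) + (V x : ℂ) * p x = (E : ℂ) * p x

/-- The lowest band function: `E_0(k)` is the smallest eigenvalue of `-(∇ + 2πik)² + V` with
periodic boundary conditions. -/
def bandE0 (V : Rd d → ℝ) (k : Rd d) : ℝ :=
  sInf {E : ℝ | ∃ p : Rd d → ℂ, SolvesBloch V k E p ∧ ¬ (p =ᵐ[volume] 0)}

/-- Regularity of the lowest band: `E_0 ∈ C³(Ω*)`, and there is a choice of normalized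
eigenfunctions `p_0(·;k)` (written `p k`) with `p_0 ∈ L²_per(Ω; C³(Ω*))`. -/
def BandRegular (V : Rd d → ℝ) : Prop :=
  ContDiffOn ℝ 3 (bandE0 V) (brillouin d) ∧
  ∃ p : Rd d → Rd d → ℂ,
    (∀ k ∈ brillouin d, SolvesBloch V k (bandE0 V k) (p k) ∧ ∫ x in cell d, ‖p k x‖ ^ 2 = 1) ∧
    ∃ M : Rd d → ℝ, MemLp M 2 (cellMeasure d) ∧
      ∀ᵐ x ∂(cellMeasure d), ContDiffOn ℝ 3 (fun k => p k x) (brillouin d) ∧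
        ∀ n : ℕ, n ≤ 3 → ∀ k ∈ brillouin d,
          ‖iteratedFDerivWithin ℝ n (fun k => p k x) (brillouin d) k‖ ≤ M x

/-- `w` is a real band edge state at the lowest band edge `E_0(0)`: a periodic eigenfunction
normalized in `L²(Ω)`, and `E_0(0)` is a simple eigenvalue. -/
def IsSimpleBandEdgeState (V w : Rd d → ℝ) : Prop :=
  SolvesBloch V 0 (bandE0 V 0) (fun x => (w x : ℂ)) ∧
  ∫ x in cell d, w x ^ 2 = 1 ∧
  ∀ p : Rd d → ℂ, SolvesBloch V 0 (bandE0 V 0) p →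
    ∃ c : ℂ, p =ᵐ[volume] fun x => c * (w x : ℂ)

/-- The inverse effective mass matrix `A = (1/(8π²)) D²E_0(0)`. -/
def effMass (V : Rd d → ℝ) : Matrix (Fin d) (Fin d) ℝ :=
  Matrix.of fun j l =>
    1 / (8 * Real.pi ^ 2) * iteratedFDeriv ℝ 2 (bandE0 V) 0 ![stdVec j, stdVec l]

/-- `U ∈ H²_per(Ω)` is the solution, orthogonal to `w` in `L²(Ω)`, of
`(-Δ + V - E_0(0)) U = g`. -/
def SolvesLstar (V w g U : Rd d → ℝ) : Prop :=
  MemH2Per U ∧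
  (∀ᵐ x, -weakLaplacian U x + (V x - bandE0 V 0) * U x = g x) ∧
  ∫ x in cell d, w x * U x = 0

open Classical in
/-- `L_*⁻¹ g`, where `L_* = -Δ + V - E_0(0)` has kernel spanned by `w`: the solution of
`L_* U = g` orthogonal to `w` (and `0` by convention if there is none). -/
def LstarInv (V w g : Rd d → ℝ) : Rd d → ℝ :=
  if h : ∃ U, SolvesLstar V w g U then h.choose else 0

/-! ### The homogenized operator -/

/-- `L_{A,Q} F = -∇·A∇F + Q F`. -/
def homOp (A : Matrix (Fin d) (Fin d) ℝ) (Q F : Rd d → ℝ) : Rd d → ℝ :=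
  fun x => -(∑ j, ∑ l, weakPartial j (fun y => A j l * weakPartial l F y) x) + Q x * F x

/-- `F ∈ H²(ℝ^d)`, `F ≠ 0`, is an eigenfunction of `L_{A,Q}` with eigenvalue `e`. -/
def IsHomEigenpair (A : Matrix (Fin d) (Fin d) ℝ) (Q : Rd d → ℝ) (e : ℝ) (F : Rd d → ℝ) : Prop :=
  MemH2 F ∧ ¬ (F =ᵐ[volume] 0) ∧ ∀ᵐ x, homOp A Q F x = e * F x

/-- `e` is a simple eigenvalue of `L_{A,Q}` with eigenfunction `F`. -/
def IsSimpleHomEigenpair (A : Matrix (Fin d) (Fin d) ℝ) (Q : Rd d → ℝ) (e : ℝ)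
    (F : Rd d → ℝ) : Prop :=
  IsHomEigenpair A Q e F ∧
  ∀ G, IsHomEigenpair A Q e G → ∃ c : ℝ, G =ᵐ[volume] fun x => c * F x

/-! ### The perturbed operator, its Rayleigh quotient and the trial functions -/

/-- The Rayleigh quotient of `H_ε - E_0(0)`, where `H_ε = -Δ + V(x) + ε² Q(εx)`. -/
def rayleigh (V Q : Rd d → ℝ) (ε : ℝ) (u : Rd d → ℝ) : ℝ :=
  (∫ x, ((∑ j, weakPartial j u x ^ 2) +
      (V x + ε ^ 2 * Q (ε • x) - bandE0 V 0) * u x ^ 2)) / ∫ x, u x ^ 2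

/-- The one-term trial function `F(εx) w(x)`. -/
def oneTerm (ε : ℝ) (w F : Rd d → ℝ) : Rd d → ℝ := fun x => F (ε • x) * w x

/-- The two-term trial function `F(εx) w(x) + 2 ∇_x[F(εx)] · L_*⁻¹{∇w}(x)`. -/
def twoTerm (V : Rd d → ℝ) (ε : ℝ) (w F : Rd d → ℝ) : Rd d → ℝ :=
  fun x => F (ε • x) * w x +
    2 * ∑ j, weakPartial j (fun z => F (ε • z)) x * LstarInv V w (weakPartial j w) x

/-- `ψ ∈ H²(ℝ^d)`, `ψ ≠ 0`, is a ground state of `H_ε` with energy `m`: an eigenfunction whose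
eigenvalue `m` is a lower bound for the Rayleigh quotient of `H_ε` on `H¹(ℝ^d)`. -/
def IsGroundState (V Q : Rd d → ℝ) (ε m : ℝ) (ψ : Rd d → ℝ) : Prop :=
  MemH2 ψ ∧ ¬ (ψ =ᵐ[volume] 0) ∧
  (∀ᵐ x, -weakLaplacian ψ x + (V x + ε ^ 2 * Q (ε • x)) * ψ x = m * ψ x) ∧
  ∀ v : Rd d → ℝ, MemH1 v → ¬ (v =ᵐ[volume] 0) → m ≤ bandE0 V 0 + rayleigh V Q ε v

end DefectModes

end

/-! The band edge state `w` is the periodic ground state of `-Δ + V`, so it has no zeros. Writing a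
trial function as `u = w v` turns its energy above the band edge into `∫ w² |∇v|²`, because the two
integrands differ by the divergence of `w v² ∇w` (`Edge.wform_whole`). What remains is periodic
homogenization of a divergence form operator with coefficient `w²`. The two-term function is `w`
times `F(εx) + ε ∑ (∂_j F)(εx) χ_j(x)` with `χ_j = 2 L_*⁻¹{∂_j w} / w`, the usual corrector ansatz,
and the one-term function is the same ansatz with `χ = 0`. Averaging of oscillating functions shows
that `ε⁻²` times the Rayleigh quotient tends to `(∫ ∇F · A_χ ∇F + ∫ Q F²) / ∫ F²`, where `A_χ` is
the matrix `hom` (`tendsto_rayleigh`).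

For `χ = 0` this matrix is the identity. For the true correctors its quadratic form is that of the
effective mass matrix: second order perturbation theory for the Bloch eigenvalue gives
`D²E_0(0)[ξ,ξ] = 8π²|ξ|² - 32π² ∫ U_ξ ∂_ξ w` with `U_ξ = L_*⁻¹{∂_ξ w}` (`hessian_eq`), and the
substitution `2U = w χ` on the cell gives the matching formula for `hom` (`exists_corrector`). The
assumed regularity of the band bounds the difference quotients of the Bloch functions; their weak
limits solve the first and second order equations, and the first order equation also provides the
solutions `L_*⁻¹{∂_j w}`. Since `hom` is a Gram matrix, the negative definite case cannot occur.
Hence the two scaled limits are `e` and `e_I`, both negative.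

The ground state comes from the direct method (`exists_ground_state`). The periodic part of the form
is nonnegative, again by `u = w v`, and `Q`, bounded and square integrable, acts compactly on
bounded sets of `H¹`. If a minimizing sequence at a negative level converged weakly to zero, the `Q`
term would disappear in the limit and the energy could not be negative.

The comparison rests on `|ξ|² - ξ·Aξ = ∑_i ∫ (w ∑_j ξ_j ∂_i χ_j)²`. So `A ≤ I`, and if all diagonal
entries were one, every `χ_j` would be constant, `L_*⁻¹{∂_j w}` would be a multiple of `w`, `∂_j w`
would vanish, and `V` would be constant. Otherwise the `A`-energy of `F_I` is strictly below `e_I`,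
as a nonzero square integrable function is not constant along any direction. The direct method
applied to `L_{A,Q}` then produces an eigenvalue below `e_I`, and `e` is the lowest one.

As `F` is only in `H²`, the correctors and their gradients must be bounded. Regularity, positivity
and boundedness are all proved by mollifying the equation, which makes it a pointwise identity
between smooth functions; `PCell` treats `ℝ^d` and the period cell at once. -/

section

open scoped Topology Convolution ENNReal Pointwise

open scoped Topology Convolution ENNReal

namespace DefectModes

/-! ### Directional derivatives of smooth functions. -/

section Derivatives

variable {d : ℕ}

/-- The derivative of `φ` in the direction `v`. -/
noncomputable def pd (v : Rd d) (φ : Rd d → ℝ) : Rd d → ℝ := fun x => fderiv ℝ φ x v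

theorem contDiff_pd {φ : Rd d → ℝ} (h : ContDiff ℝ ∞ φ) (v : Rd d) : ContDiff ℝ ∞ (pd v φ) :=
  (h.fderiv_right (m := ∞) (by simp)).clm_apply contDiff_const

theorem hasCompactSupport_pd {φ : Rd d → ℝ} (h : HasCompactSupport φ) (v : Rd d) :
    HasCompactSupport (pd v φ) := h.fderiv_apply ℝ v

theorem contDiff_differentiableAt {φ : Rd d → ℝ} (h : ContDiff ℝ ∞ φ) (x : Rd d) :
    DifferentiableAt ℝ φ x := (h.differentiable (by simp)).differentiableAt

theorem pd_mul {f g : Rd d → ℝ} (hf : ContDiff ℝ ∞ f) (hg : ContDiff ℝ ∞ g) (v : Rd d) :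
    pd v (fun x => f x * g x) = fun x => pd v f x * g x + f x * pd v g x := by
  ext x
  simp only [pd]
  rw [fderiv_fun_mul (contDiff_differentiableAt hf x) (contDiff_differentiableAt hg x)]
  simp
  ring

theorem pd_add {f g : Rd d → ℝ} (hf : ContDiff ℝ ∞ f) (hg : ContDiff ℝ ∞ g) (v : Rd d) :
    pd v (fun x => f x + g x) = fun x => pd v f x + pd v g x := by
  ext x
  simp only [pd]
  rw [fderiv_fun_add (contDiff_differentiableAt hf x) (contDiff_differentiableAt hg x)]
  simp

theorem pd_const_mul {f : Rd d → ℝ} (hf : ContDiff ℝ ∞ f) (v : Rd d) (a : ℝ) :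
    pd v (fun x => a * f x) = fun x => a * pd v f x := by
  ext x
  simp only [pd]
  rw [fderiv_const_mul (contDiff_differentiableAt hf x)]
  simp

theorem pd_sub {f g : Rd d → ℝ} (hf : ContDiff ℝ ∞ f) (hg : ContDiff ℝ ∞ g) (v : Rd d) :
    pd v (fun x => f x - g x) = fun x => pd v f x - pd v g x := by
  ext x
  simp only [pd]
  rw [fderiv_fun_sub (contDiff_differentiableAt hf x) (contDiff_differentiableAt hg x)]
  simp

theorem pd_sum {ι : Type*} (s : Finset ι) {f : ι → Rd d → ℝ} (hf : ∀ i, ContDiff ℝ ∞ (f i))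
    (v : Rd d) : pd v (fun x => ∑ i ∈ s, f i x) = fun x => ∑ i ∈ s, pd v (f i) x := by
  ext x
  simp only [pd]
  rw [fderiv_fun_sum (fun i _ => contDiff_differentiableAt (hf i) x)]
  simp

theorem pd_comm {f : Rd d → ℝ} (hf : ContDiff ℝ ∞ f) (v w : Rd d) :
    pd v (pd w f) = pd w (pd v f) := by
  ext x
  have h : IsSymmSndFDerivAt ℝ f x := hf.contDiffAt.isSymmSndFDerivAt (by
    simp only [minSmoothness_of_isRCLikeNormedField]; exact WithTop.coe_le_coe.2 le_top)
  have h1 : ∀ a b : Rd d, pd a (pd b f) x = fderiv ℝ (fderiv ℝ f) x a b := by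
    intro a b
    change fderiv ℝ (fun y => fderiv ℝ f y b) x a = _
    rw [fderiv_clm_apply]
    · simp
    · exact ((hf.fderiv_right (m := ∞) (by simp)).differentiable (by simp)).differentiableAt
    · exact differentiableAt_const _
  rw [h1, h1, h.eq]

theorem pd_comp_sub (f : Rd d → ℝ) (x v : Rd d) :
    pd v (fun y => f (x - y)) = fun y => -pd v f (x - y) := by
  ext y
  simp only [pd]
  rw [show (fun y => f (x - y)) = f ∘ (fun y => x - y) from rfl]
  by_cases h : DifferentiableAt ℝ f (x - y)
  · rw [fderiv_comp y h (by fun_prop)]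
    have e : fderiv ℝ (fun y => x - y) y = -ContinuousLinearMap.id ℝ (Rd d) :=
      ((hasFDerivAt_id y).const_sub x).fderiv
    rw [e]; simp
  -- The reflection `y ↦ x - y` is an involution, so differentiability transfers both ways; where it
  -- fails, both sides are the default value zero of `fderiv`.
  · have h' : ¬ DifferentiableAt ℝ (f ∘ fun y => x - y) y := by
      intro h'
      apply h
      have h2 : DifferentiableAt ℝ (f ∘ fun y => x - y) ((fun z : Rd d => x - z) (x - y)) := by
        simpa using h'
      have := h2.comp (x - y) (by fun_prop : DifferentiableAt ℝ (fun z : Rd d => x - z) (x - y))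
      simpa [Function.comp_def] using this
    rw [fderiv_zero_of_not_differentiableAt h, fderiv_zero_of_not_differentiableAt h']
    simp

theorem pd_comp_add (f : Rd d → ℝ) (a v : Rd d) :
    pd v (fun y => f (a + y)) = fun y => pd v f (a + y) := by
  ext y
  simp only [pd]
  rw [fderiv_comp_add_left]

theorem pd_eq_sum (f : Rd d → ℝ) (v : Rd d) (x : Rd d) :
    pd v f x = ∑ j, v j * pd (stdVec j) f x := by
  simp only [pd]
  have hv : v = ∑ j, v j • stdVec j := by
    ext i
    simp [stdVec, Finset.sum_apply, Pi.single_apply]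
  conv_lhs => rw [hv]
  simp

theorem pd_mul_compact {f : Rd d → ℝ} {φ : Rd d → ℝ} (hf : ContDiff ℝ ∞ f)
    (hφ : ContDiff ℝ ∞ φ) (hc : HasCompactSupport φ) (v : Rd d) :
    ∫ x, pd v φ x * f x = -∫ x, φ x * pd v f x := by
  have := integral_mul_fderiv_eq_neg_fderiv_mul_of_integrable (μ := (volume : Measure (Rd d)))
    (f := φ) (g := f) (v := v)
    (((contDiff_pd hφ v).continuous.mul hf.continuous).integrable_of_hasCompactSupport
      ((hasCompactSupport_pd hc v).mul_right))
    ((hφ.continuous.mul (contDiff_pd hf v).continuous).integrable_of_hasCompactSupport hc.mul_right)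
    ((hφ.continuous.mul hf.continuous).integrable_of_hasCompactSupport hc.mul_right)
    (fun x _ => contDiff_differentiableAt hφ x) (fun x _ => contDiff_differentiableAt hf x)
  simp only [pd]
  rw [this]; simp

end Derivatives

/-! ### Calculus of weak partial derivatives. -/

section WeakDerivatives

variable {d : ℕ} {𝕜 : Type*} [RCLike 𝕜]

theorem integrable_smul_test {f : Rd d → 𝕜} (hf : LocallyIntegrable f) {φ : Rd d → ℝ}
    (hφ : Continuous φ) (hc : HasCompactSupport φ) : Integrable (fun x => φ x • f x) :=
  hf.integrable_smul_left_of_hasCompactSupport hφ hc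

theorem hasWeakPartial_of_contDiff {f : Rd d → ℝ} (hf : ContDiff ℝ ∞ f) (j : Fin d) :
    HasWeakPartial j f (pd (stdVec j) f) := by
  refine ⟨hf.continuous.locallyIntegrable, (contDiff_pd hf _).continuous.locallyIntegrable, ?_⟩
  intro φ hφ hc
  exact pd_mul_compact hf hφ hc (stdVec j)

theorem HasWeakPartial.unique {j : Fin d} {f g g' : Rd d → 𝕜} (h : HasWeakPartial j f g)
    (h' : HasWeakPartial j f g') : g =ᵐ[volume] g' := by
  refine ae_eq_of_integral_contDiff_smul_eq h.2.1 h'.2.1 fun φ hφ hc => ?_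
  have := (h.2.2 φ hφ hc).symm.trans (h'.2.2 φ hφ hc)
  exact neg_injective this

theorem HasWeakPartial.weakPartial_eq {j : Fin d} {f g : Rd d → 𝕜} (h : HasWeakPartial j f g) :
    weakPartial j f =ᵐ[volume] g := by
  have hex : ∃ g, HasWeakPartial j f g := ⟨g, h⟩
  rw [weakPartial, dif_pos hex]
  exact hex.choose_spec.unique h

theorem HasWeakPartial.congr {j : Fin d} {f g f' g' : Rd d → 𝕜} (h : HasWeakPartial j f g)
    (hf : f =ᵐ[volume] f') (hg : g =ᵐ[volume] g') : HasWeakPartial j f' g' := by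
  refine ⟨h.1.congr hf, h.2.1.congr hg, fun φ hφ hc => ?_⟩
  have h1 := h.2.2 φ hφ hc
  have e1 : ∫ x, (fderiv ℝ φ x (stdVec j)) • f x = ∫ x, (fderiv ℝ φ x (stdVec j)) • f' x :=
    integral_congr_ae (by filter_upwards [hf] with x hx using by rw [hx])
  have e2 : ∫ x, φ x • g x = ∫ x, φ x • g' x :=
    integral_congr_ae (by filter_upwards [hg] with x hx using by rw [hx])
  rw [← e1, ← e2, h1]

theorem HasWeakPartial.spec {j : Fin d} {f g : Rd d → 𝕜} (h : HasWeakPartial j f g) :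
    HasWeakPartial j f (DefectModes.weakPartial j f) := h.congr ae_eq_rfl h.weakPartial_eq.symm

theorem HasWeakPartial.add {j : Fin d} {f g f' g' : Rd d → 𝕜} (h : HasWeakPartial j f g)
    (h' : HasWeakPartial j f' g') :
    HasWeakPartial j (fun x => f x + f' x) (fun x => g x + g' x) := by
  refine ⟨h.1.add h'.1, h.2.1.add h'.2.1, fun φ hφ hc => ?_⟩
  have hd := (hφ.fderiv_right (m := ∞) (by simp)).clm_apply (contDiff_const (c := stdVec j))
  have hdc := hc.fderiv_apply ℝ (stdVec j)
  simp only [smul_add]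
  rw [integral_add (integrable_smul_test h.1 hd.continuous hdc)
    (integrable_smul_test h'.1 hd.continuous hdc),
    integral_add (integrable_smul_test h.2.1 hφ.continuous hc)
    (integrable_smul_test h'.2.1 hφ.continuous hc), h.2.2 φ hφ hc, h'.2.2 φ hφ hc]
  ring

theorem HasWeakPartial.const_mul {j : Fin d} {f g : Rd d → 𝕜} (h : HasWeakPartial j f g)
    (a : 𝕜) : HasWeakPartial j (fun x => a * f x) (fun x => a * g x) := by
  refine ⟨h.1.smul a, h.2.1.smul a, fun φ hφ hc => ?_⟩
  have key : ∀ (r : ℝ) (z : 𝕜), r • (a * z) = a * (r • z) := fun r z => mul_smul_comm r a z |>.symm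
  simp only [key]
  rw [integral_const_mul, integral_const_mul, h.2.2 φ hφ hc]
  ring

theorem HasWeakPartial.zero (j : Fin d) :
    HasWeakPartial j (fun _ => (0 : 𝕜)) (fun _ => 0) :=
  ⟨locallyIntegrable_zero, locallyIntegrable_zero, fun φ _ _ => by simp⟩

theorem HasWeakPartial.sum {ι : Type*} (s : Finset ι) {j : Fin d} {f g : ι → Rd d → 𝕜}
    (h : ∀ i, HasWeakPartial j (f i) (g i)) :
    HasWeakPartial j (fun x => ∑ i ∈ s, f i x) (fun x => ∑ i ∈ s, g i x) := by
  classical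
  induction s using Finset.induction_on with
  | empty => simpa using HasWeakPartial.zero j
  | insert a s ha ih => simpa [Finset.sum_insert ha] using (h a).add ih

theorem HasWeakPartial.test {j : Fin d} {f g : Rd d → ℝ} (h : HasWeakPartial j f g)
    {φ : Rd d → ℝ} (hφ : ContDiff ℝ ∞ φ) (hc : HasCompactSupport φ) :
    ∫ x, pd (stdVec j) φ x * f x = -∫ x, φ x * g x := h.2.2 φ hφ hc

theorem HasWeakPartial.ofReal {j : Fin d} {f g : Rd d → ℝ} (h : HasWeakPartial j f g) :
    HasWeakPartial j (fun x => (f x : ℂ)) (fun x => (g x : ℂ)) := by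
  have key : ∀ u : Rd d → ℝ, LocallyIntegrable u → LocallyIntegrable (fun x => (u x : ℂ)) := by
    intro u hu
    exact hu.mono (Complex.continuous_ofReal.comp_aestronglyMeasurable hu.aestronglyMeasurable)
      (by simp)
  refine ⟨key f h.1, key g h.2.1, fun φ hφ hc => ?_⟩
  have h1 := h.2.2 φ hφ hc
  simp only [Complex.real_smul, ← Complex.ofReal_mul]
  rw [integral_complex_ofReal, integral_complex_ofReal]
  simp only [smul_eq_mul] at h1
  rw [h1]; simp

theorem HasWeakPartial.re {j : Fin d} {f g : Rd d → ℂ} (h : HasWeakPartial j f g) :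
    HasWeakPartial j (fun x => (f x).re) (fun x => (g x).re) := by
  have key : ∀ u : Rd d → ℂ, LocallyIntegrable u → LocallyIntegrable (fun x => (u x).re) := by
    intro u hu
    exact hu.mono (Complex.continuous_re.comp_aestronglyMeasurable hu.aestronglyMeasurable)
      (ae_of_all _ fun x => by simpa using Complex.abs_re_le_norm (u x))
  refine ⟨key f h.1, key g h.2.1, fun φ hφ hc => ?_⟩
  have hd := (hφ.fderiv_right (m := ∞) (by simp)).clm_apply (contDiff_const (c := stdVec j))
  have hdc := hc.fderiv_apply ℝ (stdVec j)
  have h1 := congrArg Complex.re (h.2.2 φ hφ hc)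
  have e1 := integral_re (𝕜 := ℂ) (integrable_smul_test h.1 hd.continuous hdc)
  have e2 := integral_re (𝕜 := ℂ) (integrable_smul_test h.2.1 hφ.continuous hc)
  simp only [RCLike.re_to_complex, Complex.real_smul, Complex.re_ofReal_mul, Complex.neg_re]
    at e1 e2 h1
  simp only [smul_eq_mul]
  rw [e1, e2, h1]

end WeakDerivatives

end DefectModes

open scoped Topology Convolution ENNReal

namespace DefectModes

/-! ### Convergence in `L²` and the Cauchy-Schwarz inequality. -/

section SquareIntegrable

variable {α : Type*} {m : MeasurableSpace α} {μ : Measure α}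

/-- Continuity of the `L²` inner product, phrased for functions. It carries bilinear identities from
mollified functions over to their limits. -/
theorem tendsto_integral_mul_of_tendsto {ι : Type*} {l : Filter ι} {f g : ι → α → ℝ}
    {f₀ g₀ : α → ℝ} (hf : ∀ i, MemLp (f i) 2 μ) (hg : ∀ i, MemLp (g i) 2 μ)
    (hf₀ : MemLp f₀ 2 μ) (hg₀ : MemLp g₀ 2 μ)
    (tf : Tendsto (fun i => eLpNorm (f i - f₀) 2 μ) l (𝓝 0))
    (tg : Tendsto (fun i => eLpNorm (g i - g₀) 2 μ) l (𝓝 0)) :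
    Tendsto (fun i => ∫ x, f i x * g i x ∂μ) l (𝓝 (∫ x, f₀ x * g₀ x ∂μ)) := by
  have key : ∀ {a b : α → ℝ} (ha : MemLp a 2 μ) (hb : MemLp b 2 μ),
      ∫ x, a x * b x ∂μ = inner ℝ (ha.toLp a) (hb.toLp b) := by
    intro a b ha hb
    rw [L2.inner_def]
    refine integral_congr_ae ?_
    filter_upwards [ha.coeFn_toLp, hb.coeFn_toLp] with x h1 h2
    rw [h1, h2]
    simp [mul_comm]
  simp_rw [key (hf _) (hg _)]
  rw [key hf₀ hg₀]
  exact ((Lp.tendsto_Lp_iff_tendsto_eLpNorm'' f hf f₀ hf₀).2 tf).inner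
    ((Lp.tendsto_Lp_iff_tendsto_eLpNorm'' g hg g₀ hg₀).2 tg)

theorem eLpNorm_two_le_of_lintegral_le {f g : α → ℝ} {c : ℝ≥0∞}
    (h : ∫⁻ x, ‖f x‖ₑ ^ 2 ∂μ ≤ c ^ 2 * ∫⁻ x, ‖g x‖ₑ ^ 2 ∂μ) :
    eLpNorm f 2 μ ≤ c * eLpNorm g 2 μ := by
  rw [eLpNorm_eq_lintegral_rpow_enorm_toReal (by norm_num) (by norm_num),
    eLpNorm_eq_lintegral_rpow_enorm_toReal (by norm_num) (by norm_num)]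
  simp only [ENNReal.toReal_ofNat, ENNReal.rpow_ofNat]
  calc (∫⁻ x, ‖f x‖ₑ ^ 2 ∂μ) ^ (1 / 2 : ℝ)
      ≤ (c ^ 2 * ∫⁻ x, ‖g x‖ₑ ^ 2 ∂μ) ^ (1 / 2 : ℝ) :=
        ENNReal.rpow_le_rpow h (by norm_num)
    _ = c * (∫⁻ x, ‖g x‖ₑ ^ 2 ∂μ) ^ (1 / 2 : ℝ) := by
        rw [ENNReal.mul_rpow_of_nonneg _ _ (by norm_num), ← ENNReal.rpow_natCast, ← ENNReal.rpow_mul]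
        norm_num

theorem eLpNorm_two_sq (f : α → ℝ) : eLpNorm f 2 μ ^ 2 = ∫⁻ x, ‖f x‖ₑ ^ 2 ∂μ := by
  rw [eLpNorm_eq_lintegral_rpow_enorm_toReal (by norm_num) (by norm_num)]
  simp only [ENNReal.toReal_ofNat, ENNReal.rpow_ofNat]
  rw [← ENNReal.rpow_natCast, ← ENNReal.rpow_mul]
  norm_num

theorem eLpNorm_two_sq_eq_integral {f : α → ℝ} (hf : MemLp f 2 μ) :
    eLpNorm f 2 μ ^ 2 = ENNReal.ofReal (∫ x, f x ^ 2 ∂μ) := by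
  rw [eLpNorm_two_sq, ofReal_integral_eq_lintegral_ofReal hf.integrable_sq
    (ae_of_all _ fun x => sq_nonneg _)]
  refine lintegral_congr fun x => ?_
  rw [Real.enorm_eq_ofReal_abs, ← ENNReal.ofReal_pow (abs_nonneg _), sq_abs]

/-- Square integrable functions that converge almost everywhere, and whose norms do not exceed that
of the limit, converge in `L²`. -/
theorem tendsto_eLpNorm_two_of_ae {f : ℕ → α → ℝ} {f₀ : α → ℝ} (hf : ∀ n, MemLp (f n) 2 μ)
    (hf₀ : MemLp f₀ 2 μ) (hae : ∀ᵐ x ∂μ, Tendsto (fun n => f n x) atTop (𝓝 (f₀ x)))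
    (hle : ∀ n, ∫ x, f n x ^ 2 ∂μ ≤ ∫ x, f₀ x ^ 2 ∂μ) :
    Tendsto (fun n => eLpNorm (f n - f₀) 2 μ) atTop (𝓝 0) := by
  set I := ∫ x, f₀ x ^ 2 ∂μ with hI
  have hadd : ∀ n, MemLp (f n + f₀) 2 μ := fun n => (hf n).add hf₀
  have hsub : ∀ n, MemLp (f n - f₀) 2 μ := fun n => (hf n).sub hf₀
  -- By the parallelogram identity `‖f n - f₀‖² + ‖f n + f₀‖² ≤ 4‖f₀‖²`, while Fatou bounds the
  -- limit inferior of `‖f n + f₀‖²` from below by `4‖f₀‖²`; so `‖f n - f₀‖²` must tend to zero.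
  have para : ∀ n, ∫ x, (f n - f₀) x ^ 2 ∂μ + ∫ x, (f n + f₀) x ^ 2 ∂μ ≤ 4 * I := by
    intro n
    rw [← integral_add (hsub n).integrable_sq (hadd n).integrable_sq]
    have : ∫ x, (f n - f₀) x ^ 2 + (f n + f₀) x ^ 2 ∂μ
        = 2 * ∫ x, f n x ^ 2 ∂μ + 2 * I := by
      rw [hI, ← integral_const_mul, ← integral_const_mul,
        ← integral_add ((hf n).integrable_sq.const_mul 2) (hf₀.integrable_sq.const_mul 2)]
      refine integral_congr_ae (ae_of_all _ fun x => ?_)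
      simp only [Pi.sub_apply, Pi.add_apply]; ring
    rw [this]
    linarith [hle n]
  have fatou : ENNReal.ofReal (4 * I) ≤ liminf (fun n => ENNReal.ofReal
      (∫ x, (f n + f₀) x ^ 2 ∂μ)) atTop := by
    have h1 : ∫⁻ x, liminf (fun n => ENNReal.ofReal ((f n + f₀) x ^ 2)) atTop ∂μ
        = ENNReal.ofReal (4 * I) := by
      rw [hI, ← integral_const_mul, ofReal_integral_eq_lintegral_ofReal
        (hf₀.integrable_sq.const_mul 4) (ae_of_all _ fun x => by positivity)]
      refine lintegral_congr_ae ?_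
      filter_upwards [hae] with x hx
      refine Tendsto.liminf_eq ?_
      refine (ENNReal.continuous_ofReal.tendsto _).comp ?_
      have := ((hx.add_const (f₀ x)).pow 2)
      convert! this using 2
      ring
    rw [← h1]
    refine (lintegral_liminf_le' fun n =>
      (hadd n).integrable_sq.aestronglyMeasurable.aemeasurable.ennreal_ofReal).trans (le_of_eq ?_)
    congr 1
    ext n
    rw [ofReal_integral_eq_lintegral_ofReal (hadd n).integrable_sq
      (ae_of_all _ fun x => sq_nonneg _)]
  have hlim : Tendsto (fun n => ∫ x, (f n - f₀) x ^ 2 ∂μ) atTop (𝓝 0) := by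
    rw [tendsto_order]
    constructor
    · intro a ha
      exact Eventually.of_forall fun n => ha.trans_le (integral_nonneg fun x => sq_nonneg _)
    · intro a ha
      by_cases h4 : 4 * I < a
      · refine Eventually.of_forall fun n => ?_
        have := para n
        have h0 : 0 ≤ ∫ x, (f n + f₀) x ^ 2 ∂μ := integral_nonneg fun x => sq_nonneg _
        linarith
      push Not at h4
      have hlt : ENNReal.ofReal (4 * I - a) < liminf (fun n => ENNReal.ofReal
          (∫ x, (f n + f₀) x ^ 2 ∂μ)) atTop :=
        lt_of_lt_of_le ((ENNReal.ofReal_lt_ofReal_iff (by linarith)).2 (by linarith)) fatou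
      filter_upwards [eventually_lt_of_lt_liminf hlt] with n hn
      have := para n
      have hn' := (ENNReal.ofReal_lt_ofReal_iff_of_nonneg (by linarith)).1 hn
      linarith
  have h2 : ∀ n, eLpNorm (f n - f₀) 2 μ
      = ENNReal.ofReal (Real.sqrt (∫ x, (f n - f₀) x ^ 2 ∂μ)) := by
    intro n
    have := eLpNorm_two_sq_eq_integral (hsub n)
    have hnn : 0 ≤ ∫ x, (f n - f₀) x ^ 2 ∂μ := integral_nonneg fun x => sq_nonneg _
    rw [← Real.sq_sqrt hnn, ENNReal.ofReal_pow (Real.sqrt_nonneg _)] at this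
    exact (ENNReal.pow_right_strictMono two_ne_zero).injective this
  simp_rw [h2]
  rw [← ENNReal.ofReal_zero]
  refine (ENNReal.continuous_ofReal.tendsto 0).comp ?_
  have := (Real.continuous_sqrt.tendsto 0).comp hlim
  simpa [Function.comp_def] using this

/-- The Cauchy--Schwarz inequality. -/
theorem sq_integral_mul_le {f g : α → ℝ} (hf : MemLp f 2 μ) (hg : MemLp g 2 μ) :
    (∫ x, f x * g x ∂μ) ^ 2 ≤ (∫ x, f x ^ 2 ∂μ) * ∫ x, g x ^ 2 ∂μ := by
  have hfg : Integrable (fun x => f x * g x) μ := hf.integrable_mul hg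
  have key : ∀ t : ℝ, 0 ≤ (∫ x, g x ^ 2 ∂μ) * (t * t) + (2 * ∫ x, f x * g x ∂μ) * t
      + ∫ x, f x ^ 2 ∂μ := by
    intro t
    have h0 : 0 ≤ ∫ x, (f x + t * g x) ^ 2 ∂μ := integral_nonneg fun x => sq_nonneg _
    have h1 : ∫ x, (f x + t * g x) ^ 2 ∂μ = ∫ x, (f x ^ 2 + (2 * t) * (f x * g x))
        + (t * t) * g x ^ 2 ∂μ := integral_congr_ae (ae_of_all _ fun x => by ring)
    have h2 : Integrable (fun x => f x ^ 2 + (2 * t) * (f x * g x)) μ :=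
      hf.integrable_sq.add (hfg.const_mul _)
    rw [h1, integral_add h2 (hg.integrable_sq.const_mul _),
      integral_add hf.integrable_sq (hfg.const_mul _), integral_const_mul, integral_const_mul] at h0
    linarith
  have := discrim_le_zero key
  rw [discrim] at this
  nlinarith

end SquareIntegrable

/-! ### Convolution with test kernels and mollification. -/

section Convolution

variable {d : ℕ}

/-- Convolution of `f` with the kernel `κ`. -/
noncomputable def conv (κ f : Rd d → ℝ) : Rd d → ℝ := fun x => ∫ y, κ (x - y) * f y

theorem conv_eq_convolution (κ f : Rd d → ℝ) :
    conv κ f = f ⋆[ContinuousLinearMap.mul ℝ ℝ, volume] κ := by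
  ext x
  simp [conv, convolution_def, mul_comm]

theorem conv_eq_swap (κ f : Rd d → ℝ) (x : Rd d) : conv κ f x = ∫ t, κ t * f (x - t) := by
  rw [conv, ← integral_sub_left_eq_self (fun t => κ t * f (x - t)) volume x]
  simp

/-- A smooth kernel with compact support. -/
def IsTest (κ : Rd d → ℝ) : Prop := ContDiff ℝ ∞ κ ∧ HasCompactSupport κ

theorem IsTest.pd {κ : Rd d → ℝ} (h : IsTest κ) (v : Rd d) : IsTest (pd v κ) :=
  ⟨contDiff_pd h.1 v, hasCompactSupport_pd h.2 v⟩

theorem IsTest.comp_sub {κ : Rd d → ℝ} (h : IsTest κ) (x : Rd d) : IsTest (fun y => κ (x - y)) :=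
  ⟨h.1.comp (contDiff_const.sub contDiff_id),
    h.2.comp_homeomorph (Homeomorph.subLeft x)⟩

theorem contDiff_conv {κ f : Rd d → ℝ} (hκ : IsTest κ) (hf : LocallyIntegrable f) :
    ContDiff ℝ ∞ (conv κ f) := by
  rw [conv_eq_convolution]
  exact hκ.2.contDiff_convolution_right _ hf hκ.1

theorem pd_conv {κ f : Rd d → ℝ} (hκ : IsTest κ) (hf : LocallyIntegrable f) (v : Rd d) :
    pd v (conv κ f) = conv (pd v κ) f := by
  ext x
  rw [conv_eq_convolution, conv_eq_convolution, pd,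
    (hκ.2.hasFDerivAt_convolution_right _ hf (hκ.1.of_le (by simp)) x).fderiv,
    convolution_precompR_apply _ hf (hκ.2.fderiv ℝ) (hκ.1.continuous_fderiv (by simp))]
  rfl

/-- The function `y ↦ κ (x - y)` is itself a test function, and the sign produced by the reflection
cancels the sign in the definition of a weak derivative. -/
theorem conv_pd_eq {κ f g : Rd d → ℝ} (hκ : IsTest κ) {j : Fin d} (h : HasWeakPartial j f g) :
    conv (pd (stdVec j) κ) f = conv κ g := by
  ext x
  have := h.test (hκ.comp_sub x).1 (hκ.comp_sub x).2
  rw [pd_comp_sub] at this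
  simp only [neg_mul, integral_neg] at this
  exact neg_injective this

theorem pd_conv_eq {κ f g : Rd d → ℝ} (hκ : IsTest κ) {j : Fin d} (h : HasWeakPartial j f g) :
    pd (stdVec j) (conv κ f) = conv κ g := by
  rw [pd_conv hκ h.1, conv_pd_eq hκ h]

theorem conv_congr {κ f g : Rd d → ℝ} (h : f =ᵐ[volume] g) : conv κ f = conv κ g := by
  ext x
  exact integral_congr_ae (by filter_upwards [h] with y hy using by rw [hy])

theorem integrable_conv {κ f : Rd d → ℝ} (hκ : IsTest κ) (hf : LocallyIntegrable f) (x : Rd d) :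
    Integrable (fun y => κ (x - y) * f y) :=
  integrable_smul_test hf (hκ.comp_sub x).1.continuous (hκ.comp_sub x).2

theorem conv_const_mul (κ f : Rd d → ℝ) (a : ℝ) :
    conv κ (fun x => a * f x) = fun x => a * conv κ f x := by
  ext x
  simp only [conv]
  rw [← integral_const_mul]
  congr 1; ext y; ring

theorem conv_sub {κ f g : Rd d → ℝ} (hκ : IsTest κ) (hf : LocallyIntegrable f)
    (hg : LocallyIntegrable g) : conv κ (fun x => f x - g x) = fun x => conv κ f x - conv κ g x := by
  ext x
  simp only [conv, mul_sub]
  exact integral_sub (integrable_conv hκ hf x) (integrable_conv hκ hg x)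

theorem conv_sum {ι : Type*} (s : Finset ι) {κ : Rd d → ℝ} {f : ι → Rd d → ℝ} (hκ : IsTest κ)
    (hf : ∀ i, LocallyIntegrable (f i)) :
    conv κ (fun x => ∑ i ∈ s, f i x) = fun x => ∑ i ∈ s, conv κ (f i) x := by
  ext x
  simp only [conv, Finset.mul_sum]
  exact integral_finsetSum _ fun i _ => integrable_conv hκ (hf i) x

theorem conv_mono {κ f g : Rd d → ℝ} (hκ : IsTest κ) (hpos : ∀ x, 0 ≤ κ x)
    (hf : LocallyIntegrable f) (hg : LocallyIntegrable g) (h : f ≤ᵐ[volume] g) (x : Rd d) :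
    conv κ f x ≤ conv κ g x :=
  integral_mono_ae (integrable_conv hκ hf x) (integrable_conv hκ hg x)
    (by filter_upwards [h] with y hy using mul_le_mul_of_nonneg_left hy (hpos _))

theorem conv_const {κ : Rd d → ℝ} (c : ℝ) (x : Rd d) :
    conv κ (fun _ => c) x = (∫ t, κ t) * c := by
  rw [conv_eq_swap, integral_mul_const]

theorem abs_conv_le {κ f : Rd d → ℝ} (hκ : IsTest κ) {C : ℝ} (h : ∀ᵐ x, |f x| ≤ C) (x : Rd d) :
    |conv κ f x| ≤ (∫ t, |κ t|) * C := by
  have hi : Integrable (fun y => |κ (x - y)|) :=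
    ((hκ.comp_sub x).1.continuous.integrable_of_hasCompactSupport (hκ.comp_sub x).2).abs
  calc |conv κ f x| ≤ ∫ y, |κ (x - y)| * C := by
        rw [conv, ← Real.norm_eq_abs]
        refine norm_integral_le_of_norm_le (hi.mul_const C) ?_
        filter_upwards [h] with y hy
        rw [Real.norm_eq_abs, abs_mul]
        exact mul_le_mul_of_nonneg_left hy (abs_nonneg _)
    _ = _ := by
        rw [integral_mul_const, integral_sub_left_eq_self (fun t => |κ t|) volume x]

/-- A sequence of bump functions that concentrate at the origin. -/
noncomputable def bump (d n : ℕ) : ContDiffBump (0 : Rd d) where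
  rIn := 1 / (n + 2)
  rOut := 2 / (n + 2)
  rIn_pos := by positivity
  rIn_lt_rOut := by gcongr; norm_num

/-- The mollifying kernels. -/
noncomputable def mollKernel (d n : ℕ) : Rd d → ℝ := (bump d n).normed volume

/-- Mollification. -/
noncomputable def moll {d : ℕ} (n : ℕ) (f : Rd d → ℝ) : Rd d → ℝ := conv (mollKernel d n) f

theorem isTest_mollKernel (d n : ℕ) : IsTest (mollKernel d n) :=
  ⟨(bump d n).contDiff_normed, (bump d n).hasCompactSupport_normed⟩

theorem mollKernel_nonneg (n : ℕ) (x : Rd d) : 0 ≤ mollKernel d n x := (bump d n).nonneg_normed x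

theorem integral_mollKernel (n : ℕ) : ∫ x, mollKernel d n x = 1 := (bump d n).integral_normed

theorem integral_abs_mollKernel (n : ℕ) : ∫ x, |mollKernel d n x| = 1 := by
  simp_rw [abs_of_nonneg (mollKernel_nonneg n _)]
  exact integral_mollKernel n

theorem mollKernel_eq_zero {n : ℕ} {x : Rd d} (h : 2 / ((n : ℝ) + 2) ≤ ‖x‖) :
    mollKernel d n x = 0 := by
  have : x ∉ Function.support (mollKernel d n) := by
    rw [mollKernel, ContDiffBump.support_normed_eq]
    simp only [Metric.mem_ball, dist_zero_right, not_lt]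
    exact h
  simpa using this

theorem moll_neg_eq (n : ℕ) (x : Rd d) : mollKernel d n (-x) = mollKernel d n x :=
  (bump d n).normed_neg x

theorem ae_tendsto_moll {f : Rd d → ℝ} (hf : LocallyIntegrable f) :
    ∀ᵐ x, Tendsto (fun n => moll n f x) atTop (𝓝 (f x)) := by
  -- Outer and inner radii keep the fixed ratio 2, so the kernels are comparable to averages over
  -- balls and Lebesgue differentiation applies to any locally integrable function.
  have h := ContDiffBump.ae_convolution_tendsto_right_of_locallyIntegrable (μ := volume)
    (φ := fun n => bump d n) (l := atTop) (K := 2) (g := f) ?_ ?_ hf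
  · filter_upwards [h] with x hx
    convert hx using 2 with n
    rw [moll, conv_eq_swap, convolution_def]
    rfl
  · change Tendsto (fun n : ℕ => 2 / ((n : ℝ) + 2)) atTop (𝓝 0)
    exact tendsto_const_nhds.div_atTop
      (tendsto_atTop_add_const_right _ _ tendsto_natCast_atTop_atTop)
  · exact Eventually.of_forall fun n => by
      change 2 / ((n : ℝ) + 2) ≤ 2 * (1 / (n + 2)); ring_nf; rfl

theorem abs_moll_le {f : Rd d → ℝ} {C : ℝ} (h : ∀ᵐ x, |f x| ≤ C) (n : ℕ) (x : Rd d) :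
    |moll n f x| ≤ C := by
  have := abs_conv_le (isTest_mollKernel d n) h x
  rwa [integral_abs_mollKernel, one_mul] at this

theorem contDiff_moll {f : Rd d → ℝ} (hf : LocallyIntegrable f) (n : ℕ) :
    ContDiff ℝ ∞ (moll n f) := contDiff_conv (isTest_mollKernel d n) hf

theorem pd_moll {f g : Rd d → ℝ} {j : Fin d} (h : HasWeakPartial j f g) (n : ℕ) :
    pd (stdVec j) (moll n f) = moll n g := pd_conv_eq (isTest_mollKernel d n) h

end Convolution

end DefectModes

/-! ### Fundamental domains and square integrable invariant functions. -/

namespace DefectModes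

/-- A countable group of translations of `ℝ^d` with a fundamental domain. The two cases of interest
are the trivial group, with domain `ℝ^d`, and the lattice `ℤ^d`, with the unit cell. -/
structure PCell (d : ℕ) where
  Γ : AddSubgroup (Rd d)
  D : Set (Rd d)
  countable : Countable Γ
  fund : IsAddFundamentalDomain Γ D (volume : Measure (Rd d))
  -- Local finiteness: a compactly supported test function meets only finitely many translates of
  -- the domain.
  finite_near : ∀ R : ℝ, {γ : Γ | ∃ x ∈ D, ‖(γ : Rd d) + x‖ ≤ R}.Finite
  -- Extends data on the domain to an exactly invariant function. It makes limits in `L²(D)` into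
  -- functions on `ℝ^d` and replaces almost everywhere invariance by pointwise invariance.
  rep : ∀ g : Rd d → ℝ, AEStronglyMeasurable g (volume.restrict D) →
    ∃ g' : Rd d → ℝ, (∀ (γ : Γ) (x : Rd d), g' (γ + x) = g' x) ∧
      g' =ᵐ[volume.restrict D] g ∧ AEStronglyMeasurable g' volume

namespace PCell

variable {d : ℕ} (c : PCell d)

instance : Countable c.Γ := c.countable

/-- Lebesgue measure on the fundamental domain. -/
noncomputable def μ : Measure (Rd d) := volume.restrict c.D

/-- Almost everywhere invariance under the group. -/
def Per (f : Rd d → ℝ) : Prop := ∀ γ : c.Γ, ∀ᵐ x, f (γ + x) = f x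

/-- Pointwise invariance under the group. -/
def PerE {β : Type*} (f : Rd d → β) : Prop := ∀ (γ : c.Γ) (x : Rd d), f (γ + x) = f x

/-- Square integrability over the fundamental domain of an invariant function. -/
def L2 (f : Rd d → ℝ) : Prop := c.Per f ∧ AEStronglyMeasurable f volume ∧ MemLp f 2 c.μ

variable {c}

instance : SFinite c.μ := inferInstanceAs (SFinite (volume.restrict c.D))

theorem ae_shift {p : Rd d → Prop} (h : ∀ᵐ x, p x) (γ : Rd d) : ∀ᵐ x, p (γ + x) :=
  (measurePreserving_add_left volume γ).quasiMeasurePreserving.ae h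

theorem ae_mu {p : Rd d → Prop} (h : ∀ᵐ x, p x) : ∀ᵐ x ∂c.μ, p x := ae_restrict_of_ae h

/-- Almost every point has a translate in `D`, and a countable union of null sets is null. -/
theorem ae_of_ae_mu {p : Rd d → Prop} (hp : ∀ γ : c.Γ, ∀ᵐ x, p (γ + x) → p x)
    (h : ∀ᵐ x ∂c.μ, p x) : ∀ᵐ x, p x := by
  have h1 : ∀ᵐ x, x ∈ c.D → p x := (ae_restrict_iff'₀ c.fund.nullMeasurableSet).1 h
  have h2 : ∀ᵐ x, ∀ γ : c.Γ, ((γ : Rd d) + x ∈ c.D → p (γ + x)) :=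
    ae_all_iff.2 fun γ => ae_shift h1 γ
  filter_upwards [c.fund.ae_covers, h2, ae_all_iff.2 hp] with x ⟨γ, hγ⟩ h2 h3
  exact h3 γ (h2 γ hγ)

theorem PerE.per {f : Rd d → ℝ} (h : c.PerE f) : c.Per f := fun γ => ae_of_all _ (h γ)

theorem Per.congr {f g : Rd d → ℝ} (hf : c.Per f) (h : f =ᵐ[volume] g) : c.Per g := by
  intro γ
  filter_upwards [hf γ, h, ae_shift h γ] with x h1 h2 h3
  rw [← h2, ← h3, h1]

theorem Per.ae_eq {f g : Rd d → ℝ} (hf : c.Per f) (hg : c.Per g) (h : f =ᵐ[c.μ] g) :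
    f =ᵐ[volume] g := by
  refine ae_of_ae_mu (fun γ => ?_) h
  filter_upwards [hf γ, hg γ] with x h1 h2 h3
  rw [← h1, ← h2, h3]

theorem Per.comp₂ {f g : Rd d → ℝ} (hf : c.Per f) (hg : c.Per g) (G : ℝ → ℝ → ℝ) :
    c.Per (fun x => G (f x) (g x)) := by
  intro γ
  filter_upwards [hf γ, hg γ] with x h1 h2
  rw [h1, h2]

theorem Per.comp {f : Rd d → ℝ} (hf : c.Per f) (G : ℝ → ℝ) : c.Per (fun x => G (f x)) :=
  hf.comp₂ hf fun a _ => G a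

theorem Per.exists_rep {f : Rd d → ℝ} (hf : c.Per f) (hm : AEStronglyMeasurable f volume) :
    ∃ f', c.PerE f' ∧ f' =ᵐ[volume] f ∧ AEStronglyMeasurable f' volume := by
  obtain ⟨g, h1, h2, h3⟩ := c.rep f hm.restrict
  exact ⟨g, h1, Per.ae_eq (PerE.per h1) hf h2, h3⟩

theorem L2.congr {f g : Rd d → ℝ} (hf : c.L2 f) (h : f =ᵐ[volume] g) : c.L2 g :=
  ⟨hf.1.congr h, hf.2.1.congr h, (memLp_congr_ae (ae_mu h)).1 hf.2.2⟩

theorem L2.exists_rep {f : Rd d → ℝ} (hf : c.L2 f) : ∃ f', c.PerE f' ∧ f' =ᵐ[volume] f ∧ c.L2 f' := by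
  obtain ⟨g, h1, h2, h3⟩ := hf.1.exists_rep hf.2.1
  exact ⟨g, h1, h2, hf.congr h2.symm⟩

theorem L2.add {f g : Rd d → ℝ} (hf : c.L2 f) (hg : c.L2 g) : c.L2 (fun x => f x + g x) :=
  ⟨hf.1.comp₂ hg.1 (· + ·), hf.2.1.add hg.2.1, hf.2.2.add hg.2.2⟩

theorem L2.sub {f g : Rd d → ℝ} (hf : c.L2 f) (hg : c.L2 g) : c.L2 (fun x => f x - g x) :=
  ⟨hf.1.comp₂ hg.1 (· - ·), hf.2.1.sub hg.2.1, hf.2.2.sub hg.2.2⟩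

theorem L2.const_mul {f : Rd d → ℝ} (hf : c.L2 f) (a : ℝ) : c.L2 (fun x => a * f x) :=
  ⟨hf.1.comp (a * ·), hf.2.1.const_mul a, hf.2.2.const_mul a⟩

theorem L2.zero : c.L2 (fun _ => 0) :=
  ⟨fun _ => ae_of_all _ fun _ => rfl, aestronglyMeasurable_const, MemLp.zero⟩

theorem L2.sum {ι : Type*} (s : Finset ι) {f : ι → Rd d → ℝ} (hf : ∀ i, c.L2 (f i)) :
    c.L2 (fun x => ∑ i ∈ s, f i x) := by
  classical
  induction s using Finset.induction_on with
  | empty => simpa using L2.zero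
  | insert a s ha ih => simpa [Finset.sum_insert ha] using (hf a).add ih

theorem L2.bdd_mul {f b : Rd d → ℝ} (hf : c.L2 f) (hb : c.Per b)
    (hbm : AEStronglyMeasurable b volume) {C : ℝ} (hC : ∀ᵐ x, |b x| ≤ C) :
    c.L2 (fun x => b x * f x) := by
  refine ⟨hb.comp₂ hf.1 (· * ·), hbm.mul hf.2.1, ?_⟩
  refine (hf.2.2.const_mul C).mono (hbm.mul hf.2.1).restrict (ae_mu ?_)
  filter_upwards [hC] with x hx
  rw [norm_mul, norm_mul]
  exact mul_le_mul_of_nonneg_right (hx.trans (le_abs_self C)) (norm_nonneg _)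

theorem L2.integrable_mul {f g : Rd d → ℝ} (hf : c.L2 f) (hg : c.L2 g) :
    Integrable (fun x => f x * g x) c.μ := hf.2.2.integrable_mul hg.2.2

/-- Translation invariance of the integral over a fundamental domain. -/
theorem setLIntegral_shift {F : Rd d → ℝ≥0∞} (hF : c.PerE F) (t : Rd d) :
    ∫⁻ x, F (x - t) ∂c.μ = ∫⁻ x, F x ∂c.μ := by
  have h4 : MeasurePreserving (fun x : Rd d => x - t) volume volume :=
    measurePreserving_sub_right _ t
  have h5 := h4.setLIntegral_comp_preimage_emb
    (Homeomorph.subRight t).measurableEmbedding F (-t +ᵥ c.D)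
  have h6 : (fun x : Rd d => x - t) ⁻¹' (-t +ᵥ c.D) = c.D := by
    ext x
    simp [Set.mem_vadd_set_iff_neg_vadd_mem, sub_eq_add_neg]
  rw [h6] at h5
  rw [μ, h5]
  -- A translate of a fundamental domain is again one, and the integral of an invariant function
  -- does not depend on the choice of fundamental domain.
  exact (c.fund.setLIntegral_eq (c.fund.vadd_of_comm (-t)) F hF).symm

theorem integral_shift {F : Rd d → ℝ} (hF : c.PerE F) (t : Rd d) :
    ∫ x, F (x - t) ∂c.μ = ∫ x, F x ∂c.μ := by
  have h4 : MeasurePreserving (fun x : Rd d => x - t) volume volume :=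
    measurePreserving_sub_right _ t
  have h5 := h4.setIntegral_preimage_emb
    (Homeomorph.subRight t).measurableEmbedding F (-t +ᵥ c.D)
  have h6 : (fun x : Rd d => x - t) ⁻¹' (-t +ᵥ c.D) = c.D := by
    ext x
    simp [Set.mem_vadd_set_iff_neg_vadd_mem, sub_eq_add_neg]
  rw [h6] at h5
  rw [μ, h5]
  exact (c.fund.setIntegral_eq (c.fund.vadd_of_comm (-t)) hF).symm

/-- The translates of the fundamental domain that meet a ball. -/
noncomputable def near (c : PCell d) (R : ℝ) : Finset c.Γ := (c.finite_near R).toFinset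

/-- The ball is covered by the finitely many translates in `near R`, and each of them contributes at
most the integral over `D`. -/
theorem setLIntegral_ball_le {F : Rd d → ℝ≥0∞} (hF : c.PerE F) (R : ℝ) :
    ∫⁻ x in Metric.closedBall 0 R, F x ≤ (c.near R).card * ∫⁻ x, F x ∂c.μ := by
  rw [← lintegral_indicator Metric.isClosed_closedBall.measurableSet,
    c.fund.lintegral_eq_tsum'']
  rw [tsum_eq_sum (s := c.near R)]
  · calc _ ≤ ∑ γ ∈ c.near R, ∫⁻ x, F x ∂c.μ := by
          refine Finset.sum_le_sum fun γ _ => lintegral_mono fun x => ?_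
          refine (Set.indicator_le_self _ _ _).trans (le_of_eq ?_)
          exact hF γ x
      _ = _ := by simp
  · intro γ hγ
    refine lintegral_eq_zero_of_ae_eq_zero ((ae_restrict_iff'₀ c.fund.nullMeasurableSet).2
      (ae_of_all _ fun x hx => ?_))
    refine Set.indicator_of_notMem (fun hmem => hγ ?_) _
    simp only [near, Set.Finite.mem_toFinset, Set.mem_ofPred_eq]
    exact ⟨x, hx, by simpa [AddSubgroup.vadd_def] using hmem⟩

theorem L2.memLp_ball {f : Rd d → ℝ} (hf : c.L2 f) (R : ℝ) :
    MemLp f 2 (volume.restrict (Metric.closedBall 0 R)) := by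
  obtain ⟨g, hg, hgf, hg2⟩ := hf.exists_rep
  rw [← memLp_congr_ae (ae_restrict_of_ae hgf)]
  refine ⟨hg2.2.1.restrict, ?_⟩
  have h1 : ∫⁻ x in Metric.closedBall 0 R, ‖g x‖ₑ ^ 2 ≤ (c.near R).card * ∫⁻ x, ‖g x‖ₑ ^ 2 ∂c.μ :=
    setLIntegral_ball_le (F := fun x => ‖g x‖ₑ ^ 2) (fun γ x => by simp only [hg γ x]) R
  rw [← eLpNorm_two_sq, ← eLpNorm_two_sq] at h1
  have h2 := h1.trans_lt (ENNReal.mul_lt_top (by simp) (ENNReal.pow_lt_top hg2.2.2.2))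
  exact (ENNReal.pow_lt_top_iff.1 h2).resolve_right two_ne_zero

theorem L2.locallyIntegrable {f : Rd d → ℝ} (hf : c.L2 f) : LocallyIntegrable f := by
  rw [locallyIntegrable_iff]
  intro K hK
  obtain ⟨R, hR⟩ := hK.isBounded.subset_closedBall 0
  have : IsFiniteMeasure (volume.restrict (Metric.closedBall (0 : Rd d) R)) :=
    ⟨by simpa using measure_closedBall_lt_top⟩
  exact IntegrableOn.mono_set (s := K) ((hf.memLp_ball R).integrable (by norm_num)) hR

theorem PerE.conv {κ f : Rd d → ℝ} (hf : c.PerE f) : c.PerE (conv κ f) := by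
  intro γ x
  rw [conv_eq_swap, conv_eq_swap]
  congr 1
  ext t
  rw [add_sub_assoc, hf]

theorem Per.conv {κ f : Rd d → ℝ} (hf : c.Per f) (hm : AEStronglyMeasurable f volume) :
    c.PerE (DefectModes.conv κ f) := by
  obtain ⟨g, h1, h2, -⟩ := hf.exists_rep hm
  rw [← conv_congr h2]
  exact h1.conv

/-- Young's inequality on the fundamental domain: split `|κ|` into two square roots, apply
Cauchy-Schwarz for fixed `x`, then Tonelli and translation invariance. -/
theorem eLpNorm_conv_le {κ f : Rd d → ℝ} (hκ : IsTest κ) (hf : c.L2 f) :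
    eLpNorm (conv κ f) 2 c.μ ≤ (∫⁻ t, ‖κ t‖ₑ) * eLpNorm f 2 c.μ := by
  obtain ⟨g, hg, hgf, hg2⟩ := hf.exists_rep
  rw [← conv_congr hgf, ← eLpNorm_congr_ae (ae_mu hgf)]
  refine eLpNorm_two_le_of_lintegral_le ?_
  have hκm : AEMeasurable (fun t => ‖κ t‖ₑ) volume :=
    hκ.1.continuous.aestronglyMeasurable.enorm
  have hgm : ∀ x, AEMeasurable (fun t => ‖g (x - t)‖ₑ) volume := fun x =>
    (hg2.2.1.comp_quasiMeasurePreserving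
      (quasiMeasurePreserving_sub_left_of_right_invariant volume x)).enorm
  have h1 : ∀ x, ‖conv κ g x‖ₑ ^ 2 ≤ (∫⁻ t, ‖κ t‖ₑ) * ∫⁻ t, ‖κ t‖ₑ * ‖g (x - t)‖ₑ ^ 2 := by
    intro x
    rw [conv_eq_swap]
    have h2 : ‖∫ t, κ t * g (x - t)‖ₑ ≤ ∫⁻ t, ‖κ t‖ₑ ^ (1 / 2 : ℝ) *
        (‖κ t‖ₑ ^ (1 / 2 : ℝ) * ‖g (x - t)‖ₑ) := by
      refine (enorm_integral_le_lintegral_enorm _).trans (lintegral_mono fun t => ?_)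
      rw [← mul_assoc, ← ENNReal.rpow_add_of_nonneg _ _ (by norm_num) (by norm_num), enorm_mul]
      norm_num
    have h3 := ENNReal.lintegral_mul_le_Lp_mul_Lq volume Real.HolderConjugate.two_two
      (hκm.pow_const (1 / 2 : ℝ)) ((hκm.pow_const (1 / 2 : ℝ)).mul (hgm x))
    have h4 := h2.trans h3
    calc _ ≤ _ := ENNReal.pow_le_pow_left h4 (n := 2)
      _ = _ := by
        rw [mul_pow, ← ENNReal.rpow_natCast, ← ENNReal.rpow_natCast, ← ENNReal.rpow_mul,
          ← ENNReal.rpow_mul]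
        norm_num
        congr 1
        · congr 1; ext t
          rw [← ENNReal.rpow_natCast, ← ENNReal.rpow_mul]; norm_num
        · congr 1; ext t
          rw [mul_pow, ← ENNReal.rpow_natCast, ← ENNReal.rpow_mul]; norm_num
  calc ∫⁻ x, ‖conv κ g x‖ₑ ^ 2 ∂c.μ
      ≤ ∫⁻ x, (∫⁻ t, ‖κ t‖ₑ) * (∫⁻ t, ‖κ t‖ₑ * ‖g (x - t)‖ₑ ^ 2) ∂c.μ := lintegral_mono (μ := c.μ) h1
    _ = (∫⁻ t, ‖κ t‖ₑ) * ∫⁻ x, (∫⁻ t, ‖κ t‖ₑ * ‖g (x - t)‖ₑ ^ 2) ∂c.μ := by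
        rw [lintegral_const_mul' _ _ (hκ.1.continuous.integrable_of_hasCompactSupport
          hκ.2).hasFiniteIntegral.ne]
    _ = (∫⁻ t, ‖κ t‖ₑ) * ∫⁻ t, (∫⁻ x, ‖κ t‖ₑ * ‖g (x - t)‖ₑ ^ 2 ∂c.μ) := by
        rw [lintegral_lintegral_swap]
        have : AEMeasurable (fun p : Rd d × Rd d => ‖g (p.1 - p.2)‖ₑ) (volume.prod volume) :=
          (hg2.2.1.comp_quasiMeasurePreserving (quasiMeasurePreserving_sub _ _)).enorm
        have h5 : AEMeasurable (fun p : Rd d × Rd d => ‖κ p.2‖ₑ * ‖g (p.1 - p.2)‖ₑ ^ 2)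
            (volume.prod volume) :=
          ((hκ.1.continuous.comp continuous_snd).enorm.aemeasurable).mul (this.pow_const 2)
        exact h5.mono_ac ((Measure.restrict_le_self.absolutelyContinuous).prod
          Measure.AbsolutelyContinuous.rfl)
    _ = (∫⁻ t, ‖κ t‖ₑ) * ∫⁻ t, ‖κ t‖ₑ * (∫⁻ x, ‖g x‖ₑ ^ 2 ∂c.μ) := by
        congr 1; congr 1; ext t
        rw [lintegral_const_mul' _ _ (by simp),
          setLIntegral_shift (F := fun x => ‖g x‖ₑ ^ 2) (fun γ x => by simp only [hg γ x])]
    _ = _ := by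
        rw [lintegral_mul_const'' _ hκm]; ring

theorem L2.conv {κ f : Rd d → ℝ} (hκ : IsTest κ) (hf : c.L2 f) : c.L2 (conv κ f) := by
  have hc := (contDiff_conv hκ hf.locallyIntegrable).continuous.aestronglyMeasurable
    (μ := (volume : Measure (Rd d)))
  refine ⟨(hf.1.conv hf.2.1).per, hc, hc.restrict, (eLpNorm_conv_le hκ hf).trans_lt ?_⟩
  exact ENNReal.mul_lt_top (hκ.1.continuous.integrable_of_hasCompactSupport
          hκ.2).hasFiniteIntegral hf.2.2.2

theorem L2.moll {f : Rd d → ℝ} (hf : c.L2 f) (n : ℕ) : c.L2 (moll n f) :=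
  hf.conv (isTest_mollKernel d n)

theorem integral_moll_sq_le {f : Rd d → ℝ} (hf : c.L2 f) (n : ℕ) :
    ∫ x, moll n f x ^ 2 ∂c.μ ≤ ∫ x, f x ^ 2 ∂c.μ := by
  have h1 := eLpNorm_conv_le (isTest_mollKernel d n) hf
  have h2 : ∫⁻ t, ‖mollKernel d n t‖ₑ = 1 := by
    have := ofReal_integral_norm_eq_lintegral_enorm
      ((isTest_mollKernel d n).1.continuous.integrable_of_hasCompactSupport (μ := volume)
        (isTest_mollKernel d n).2)
    rw [← this]
    simp only [Real.norm_eq_abs, integral_abs_mollKernel, ENNReal.ofReal_one]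
  rw [h2, one_mul] at h1
  have h3 := ENNReal.pow_le_pow_left h1 (n := 2)
  change eLpNorm (DefectModes.moll n f) 2 c.μ ^ 2 ≤ _ at h3
  rw [eLpNorm_two_sq_eq_integral (hf.moll n).2.2, eLpNorm_two_sq_eq_integral hf.2.2] at h3
  exact (ENNReal.ofReal_le_ofReal_iff (integral_nonneg fun x => sq_nonneg _)).1 h3

/-- The mollifications converge almost everywhere, and their norms do not exceed the norm of `f`
because the kernels have mass one. -/
theorem tendsto_moll {f : Rd d → ℝ} (hf : c.L2 f) :
    Tendsto (fun n => eLpNorm (moll n f - f) 2 c.μ) atTop (𝓝 0) :=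
  tendsto_eLpNorm_two_of_ae (fun n => (hf.moll n).2.2) hf.2.2
    (ae_mu (ae_tendsto_moll hf.locallyIntegrable)) (fun n => integral_moll_sq_le hf n)

end PCell

end DefectModes

/-! ### Integration by parts on a fundamental domain and elliptic regularity. -/

namespace DefectModes

namespace PCell

variable {d : ℕ} {c : PCell d}

theorem PerE.integrable_shift {F : Rd d → ℝ} (hF : c.PerE F) (hm : AEStronglyMeasurable F volume)
    (hi : Integrable F c.μ) (t : Rd d) : Integrable (fun x => F (x - t)) c.μ := by
  refine ⟨(hm.comp_quasiMeasurePreserving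
    (measurePreserving_sub_right volume t).quasiMeasurePreserving).restrict, ?_⟩
  rw [hasFiniteIntegral_iff_enorm,
    setLIntegral_shift (F := fun x => ‖F x‖ₑ) (fun γ x => by simp only [hF γ x])]
  exact hi.2

theorem PerE.pd {φ : Rd d → ℝ} (h : c.PerE φ) (v : Rd d) : c.PerE (pd v φ) := by
  intro γ x
  have h1 := congrFun (pd_comp_add φ γ v) x
  rw [show (fun y => φ (γ + y)) = φ from funext (h γ)] at h1
  exact h1.symm

/-- The integral of a derivative of an invariant function over a fundamental domain vanishes. -/
theorem integral_pd_eq_zero {F : Rd d → ℝ} (hF : ContDiff ℝ ∞ F) (hp : c.PerE F)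
    (hi : Integrable F c.μ) (v : Rd d) (hi' : Integrable (pd v F) c.μ) :
    ∫ x, pd v F x ∂c.μ = 0 := by
  have hG := hp.pd v
  have hGc : Continuous (pd v F) := (contDiff_pd hF v).continuous
  -- The increment of `F` over `v` integrates to zero by translation invariance. Writing it as an
  -- integral of `pd v F` along the segment and swapping the integrals gives the integral of `pd v
  -- F`, as all its translates have the same integral.
  have ftc : ∀ x : Rd d, F (x + v) - F x = ∫ s in (0 : ℝ)..1, pd v F (x + s • v) := by
    intro x
    have hd : ∀ s ∈ Set.uIcc (0 : ℝ) 1, HasDerivAt (fun s : ℝ => F (x + s • v))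
        (pd v F (x + s • v)) s := by
      intro s _
      have h1 : HasDerivAt (fun s : ℝ => x + s • v) v s := by
        simpa using ((hasDerivAt_id s).smul_const v).const_add x
      exact (contDiff_differentiableAt hF (x + s • v)).hasFDerivAt.comp_hasDerivAt s h1
    rw [intervalIntegral.integral_eq_sub_of_hasDerivAt hd]
    · simp
    · exact (hGc.comp (by fun_prop)).intervalIntegrable _ _
  have shift : ∀ t : Rd d, ∫ x, F (x + t) ∂c.μ = ∫ x, F x ∂c.μ := fun t => by
    simpa using integral_shift hp (-t)
  have shiftG : ∀ t : Rd d, ∫ x, pd v F (x + t) ∂c.μ = ∫ x, pd v F x ∂c.μ := fun t => by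
    simpa using integral_shift hG (-t)
  have h0 : ∫ x, (F (x + v) - F x) ∂c.μ = 0 := by
    have := hp.integrable_shift hF.continuous.aestronglyMeasurable hi (-v)
    simp only [sub_neg_eq_add] at this
    rw [integral_sub this hi, shift, sub_self]
  simp_rw [ftc, intervalIntegral.integral_of_le zero_le_one] at h0
  rw [integral_integral_swap] at h0
  · simp_rw [shiftG] at h0
    simpa using h0
  · have hc : Continuous (Function.uncurry fun (x : Rd d) (s : ℝ) => pd v F (x + s • v)) :=
      hGc.comp (by fun_prop)
    refine (integrable_prod_iff' hc.aestronglyMeasurable).2 ⟨ae_of_all _ fun s => ?_, ?_⟩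
    · simpa using hG.integrable_shift hGc.aestronglyMeasurable hi' (-(s • v))
    · have : (fun s : ℝ => ∫ x, ‖pd v F (x + s • v)‖ ∂c.μ) = fun _ => ∫ x, ‖pd v F x‖ ∂c.μ := by
        ext s
        have hn : c.PerE (fun x => ‖pd v F x‖) := fun γ x => by simp only [hG γ x]
        simpa using integral_shift hn (-(s • v))
      exact (integrable_const (∫ x, ‖pd v F x‖ ∂c.μ)).congr
        (ae_of_all _ fun s => (congrFun this s).symm)

/-- Smooth invariant functions all of whose derivatives are square integrable. -/
def Sm (c : PCell d) (φ : Rd d → ℝ) : Prop :=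
  ContDiff ℝ ∞ φ ∧ c.PerE φ ∧ ∀ vs : List (Rd d), c.L2 (vs.foldr DefectModes.pd φ)

theorem Sm.l2 {φ : Rd d → ℝ} (h : c.Sm φ) : c.L2 φ := h.2.2 []

theorem Sm.pd {φ : Rd d → ℝ} (h : c.Sm φ) (v : Rd d) : c.Sm (pd v φ) :=
  ⟨contDiff_pd h.1 v, h.2.1.pd v, fun vs => by simpa using h.2.2 (vs ++ [v])⟩

theorem foldr_pd_sub {φ ψ : Rd d → ℝ} (hφ : ContDiff ℝ ∞ φ) (hψ : ContDiff ℝ ∞ ψ)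
    (vs : List (Rd d)) : ContDiff ℝ ∞ (vs.foldr DefectModes.pd φ) ∧
      vs.foldr DefectModes.pd (fun x => φ x - ψ x)
        = fun x => vs.foldr DefectModes.pd φ x - vs.foldr DefectModes.pd ψ x := by
  induction vs generalizing φ ψ with
  | nil => exact ⟨hφ, rfl⟩
  | cons a l ih =>
    refine ⟨contDiff_pd (ih hφ hψ).1 a, ?_⟩
    simp only [List.foldr_cons]
    rw [(ih hφ hψ).2, pd_sub (ih hφ hψ).1 (ih hψ hφ).1]

theorem Sm.sub {φ ψ : Rd d → ℝ} (hφ : c.Sm φ) (hψ : c.Sm ψ) : c.Sm (fun x => φ x - ψ x) := by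
  refine ⟨hφ.1.sub hψ.1, fun γ x => by simp only [hφ.2.1 γ x, hψ.2.1 γ x], fun vs => ?_⟩
  rw [(foldr_pd_sub hφ.1 hψ.1 vs).2]
  exact (hφ.2.2 vs).sub (hψ.2.2 vs)

theorem L2.sm_conv {κ f : Rd d → ℝ} (hκ : IsTest κ) (hf : c.L2 f) : c.Sm (DefectModes.conv κ f) := by
  refine ⟨contDiff_conv hκ hf.locallyIntegrable, hf.1.conv hf.2.1, fun vs => ?_⟩
  have : ∃ κ', IsTest κ' ∧ vs.foldr DefectModes.pd (DefectModes.conv κ f) = DefectModes.conv κ' f := by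
    induction vs with
    | nil => exact ⟨κ, hκ, rfl⟩
    | cons a l ih =>
      obtain ⟨κ', h1, h2⟩ := ih
      refine ⟨_, h1.pd a, ?_⟩
      rw [List.foldr_cons, h2, pd_conv h1 hf.locallyIntegrable]
  obtain ⟨κ', h1, h2⟩ := this
  rw [h2]
  exact hf.conv h1

theorem L2.sm_moll {f : Rd d → ℝ} (hf : c.L2 f) (n : ℕ) : c.Sm (DefectModes.moll n f) :=
  hf.sm_conv (isTest_mollKernel d n)

/-- Integration by parts for smooth functions. -/
theorem Sm.integral_pd_mul {φ ψ : Rd d → ℝ} (hφ : c.Sm φ) (hψ : c.Sm ψ) (v : Rd d) :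
    ∫ x, DefectModes.pd v φ x * ψ x ∂c.μ = -∫ x, φ x * DefectModes.pd v ψ x ∂c.μ := by
  have h1 : Integrable (fun x => DefectModes.pd v φ x * ψ x) c.μ := (hφ.pd v).l2.integrable_mul hψ.l2
  have h2 : Integrable (fun x => φ x * DefectModes.pd v ψ x) c.μ := hφ.l2.integrable_mul (hψ.pd v).l2
  have h := integral_pd_eq_zero (c := c) (hφ.1.mul hψ.1)
    (fun γ x => by simp only [hφ.2.1 γ x, hψ.2.1 γ x]) (hφ.l2.integrable_mul hψ.l2) v
    (by rw [pd_mul hφ.1 hψ.1]; exact h1.add h2)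
  rw [pd_mul hφ.1 hψ.1, integral_add h1 h2] at h
  linarith

/-- Integration by parts for functions with square integrable weak derivatives. -/
theorem integral_weak_mul {f f' g g' : Rd d → ℝ} {j : Fin d} (hf : HasWeakPartial j f f')
    (hg : HasWeakPartial j g g') (hf2 : c.L2 f) (hf2' : c.L2 f') (hg2 : c.L2 g) (hg2' : c.L2 g') :
    ∫ x, f' x * g x ∂c.μ = -∫ x, f x * g' x ∂c.μ := by
  have h1 := tendsto_integral_mul_of_tendsto (fun n => (hf2'.moll n).2.2) (fun n => (hg2.moll n).2.2)
    hf2'.2.2 hg2.2.2 (tendsto_moll hf2') (tendsto_moll hg2)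
  have h2 := tendsto_integral_mul_of_tendsto (fun n => (hf2.moll n).2.2) (fun n => (hg2'.moll n).2.2)
    hf2.2.2 hg2'.2.2 (tendsto_moll hf2) (tendsto_moll hg2')
  refine tendsto_nhds_unique h1 (h2.neg.congr fun n => ?_)
  have := (hf2.sm_moll n).integral_pd_mul (hg2.sm_moll n) (stdVec j)
  rw [pd_moll hf, pd_moll hg] at this
  exact this.symm

/-- Two integrations by parts together with the symmetry of second derivatives. This is why the
square of a Laplacian controls the full Hessian. -/
theorem Sm.integral_pd_pd_mul {φ : Rd d → ℝ} (hφ : c.Sm φ) (a b : Rd d) :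
    ∫ x, DefectModes.pd a (DefectModes.pd a φ) x * DefectModes.pd b (DefectModes.pd b φ) x ∂c.μ
      = ∫ x, DefectModes.pd a (DefectModes.pd b φ) x ^ 2 ∂c.μ := by
  rw [(hφ.pd a).integral_pd_mul ((hφ.pd b).pd b) a, pd_comm (contDiff_pd hφ.1 b) a b]
  have := (hφ.pd a).integral_pd_mul ((hφ.pd b).pd a) b
  rw [← neg_eq_iff_eq_neg.2 this, neg_neg, pd_comm hφ.1 b a]
  congr 1
  ext x
  ring

/-- The energy identity behind the `H²` estimate. -/
theorem Sm.energy {φ : Rd d → ℝ} (hφ : c.Sm φ) {m : ℕ} (b : Fin m → Rd d) :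
    ∫ x, (∑ i, DefectModes.pd (b i) (DefectModes.pd (b i) φ) x) ^ 2 ∂c.μ
      = ∑ i, ∑ k, ∫ x, DefectModes.pd (b i) (DefectModes.pd (b k) φ) x ^ 2 ∂c.μ := by
  have h1 : ∀ i k, Integrable (fun x => DefectModes.pd (b i) (DefectModes.pd (b i) φ) x *
      DefectModes.pd (b k) (DefectModes.pd (b k) φ) x) c.μ := fun i k =>
    ((hφ.pd _).pd _).l2.integrable_mul ((hφ.pd _).pd _).l2
  simp_rw [← hφ.integral_pd_pd_mul, sq, Finset.sum_mul_sum]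
  rw [integral_finsetSum _ fun i _ => integrable_finsetSum _ fun k _ => h1 i k]
  exact Finset.sum_congr rfl fun i _ => integral_finsetSum _ fun k _ => h1 i k

/-- One integration by parts gives `∫ |∂φ|² = -∫ φ ∂²φ`, and the product is dominated by the two
squares. -/
theorem Sm.grad_le {φ : Rd d → ℝ} (hφ : c.Sm φ) (a : Rd d) :
    ∫ x, DefectModes.pd a φ x ^ 2 ∂c.μ
      ≤ ∫ x, φ x ^ 2 ∂c.μ + ∫ x, DefectModes.pd a (DefectModes.pd a φ) x ^ 2 ∂c.μ := by
  have h := hφ.integral_pd_mul (hφ.pd a) a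
  simp_rw [← sq] at h
  rw [h, ← integral_neg, ← integral_add hφ.l2.2.2.integrable_sq ((hφ.pd a).pd a).l2.2.2.integrable_sq]
  refine integral_mono (hφ.l2.integrable_mul ((hφ.pd a).pd a).l2).neg
    (hφ.l2.2.2.integrable_sq.add ((hφ.pd a).pd a).l2.2.2.integrable_sq) fun x => ?_
  simp only [Pi.add_apply, Pi.neg_apply]
  nlinarith [sq_nonneg (φ x + DefectModes.pd a (DefectModes.pd a φ) x),
    sq_nonneg (φ x), sq_nonneg (DefectModes.pd a (DefectModes.pd a φ) x)]

/-- Expand both directions in the frame `b`, use Cauchy-Schwarz in each expansion, and insert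
`Sm.energy`. Coordinate directions written in terms of `b` are the case of interest. -/
theorem Sm.hessian_le {φ : Rd d → ℝ} (hφ : c.Sm φ) {m : ℕ} (b : Fin m → Rd d)
    (p q : Fin m → ℝ) :
    ∫ x, DefectModes.pd (∑ i, p i • b i) (DefectModes.pd (∑ i, q i • b i) φ) x ^ 2 ∂c.μ
      ≤ ((∑ i, p i ^ 2) * ∑ i, q i ^ 2) *
        ∫ x, (∑ i, DefectModes.pd (b i) (DefectModes.pd (b i) φ) x) ^ 2 ∂c.μ := by
  have lin : ∀ (r : Fin m → ℝ) {ψ : Rd d → ℝ}, DefectModes.pd (∑ i, r i • b i) ψ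
      = fun x => ∑ i, r i * DefectModes.pd (b i) ψ x := by
    intro r ψ
    ext x
    simp [DefectModes.pd]
  have h2 : ∀ i k, Integrable (fun x => DefectModes.pd (b i) (DefectModes.pd (b k) φ) x ^ 2) c.μ :=
    fun i k => ((hφ.pd _).pd _).l2.2.2.integrable_sq
  rw [hφ.energy]
  have h3 : ∑ i, ∑ k, ∫ x, DefectModes.pd (b i) (DefectModes.pd (b k) φ) x ^ 2 ∂c.μ
      = ∫ x, ∑ i, ∑ k, DefectModes.pd (b i) (DefectModes.pd (b k) φ) x ^ 2 ∂c.μ := by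
    rw [integral_finsetSum _ fun i _ => integrable_finsetSum _ fun k _ => h2 i k]
    exact Finset.sum_congr rfl fun i _ => (integral_finsetSum _ fun k _ => h2 i k).symm
  rw [h3, ← integral_const_mul]
  refine integral_mono ((hφ.pd _).pd _).l2.2.2.integrable_sq
    ((integrable_finsetSum _ fun i _ => integrable_finsetSum _ fun k _ => h2 i k).const_mul _)
    fun x => ?_
  have hsm : ∀ k, ContDiff ℝ ∞ (fun x => q k * DefectModes.pd (b k) φ x) := fun k =>
    contDiff_const.mul (contDiff_pd hφ.1 _)
  have hexp : DefectModes.pd (∑ i, p i • b i) (DefectModes.pd (∑ i, q i • b i) φ) x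
      = ∑ i, p i * ∑ k, q k * DefectModes.pd (b i) (DefectModes.pd (b k) φ) x := by
    rw [lin p, lin q]
    refine Finset.sum_congr rfl fun i _ => ?_
    rw [pd_sum _ hsm]
    simp only [pd_const_mul (contDiff_pd hφ.1 _)]
  simp only [hexp]
  calc (∑ i, p i * ∑ k, q k * DefectModes.pd (b i) (DefectModes.pd (b k) φ) x) ^ 2
      ≤ (∑ i, p i ^ 2) * ∑ i, (∑ k, q k * DefectModes.pd (b i) (DefectModes.pd (b k) φ) x) ^ 2 :=
        Finset.sum_mul_sq_le_sq_mul_sq _ _ _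
    _ ≤ (∑ i, p i ^ 2) * ∑ i, ((∑ k, q k ^ 2) *
          ∑ k, DefectModes.pd (b i) (DefectModes.pd (b k) φ) x ^ 2) := by
        gcongr with i _
        exact Finset.sum_mul_sq_le_sq_mul_sq _ _ _
    _ = _ := by rw [← Finset.mul_sum]; ring

theorem norm_toLp_sq {α : Type*} {m : MeasurableSpace α} {μ : Measure α} {f : α → ℝ}
    (hf : MemLp f 2 μ) : ‖hf.toLp f‖ ^ 2 = ∫ x, f x ^ 2 ∂μ := by
  rw [Lp.norm_toLp, ← ENNReal.toReal_pow, eLpNorm_two_sq_eq_integral hf,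
    ENNReal.toReal_ofReal (integral_nonneg fun x => sq_nonneg _)]

/-- Completeness: a sequence controlled by two convergent sequences converges. -/
theorem exists_limit {F u f : ℕ → Rd d → ℝ} {u₀ f₀ : Rd d → ℝ} (hF : ∀ n, c.L2 (F n))
    (hu : ∀ n, c.L2 (u n)) (hf : ∀ n, c.L2 (f n)) (hu₀ : c.L2 u₀) (hf₀ : c.L2 f₀)
    (tu : Tendsto (fun n => eLpNorm (u n - u₀) 2 c.μ) atTop (𝓝 0))
    (tf : Tendsto (fun n => eLpNorm (f n - f₀) 2 c.μ) atTop (𝓝 0)) {K : ℝ} (hK : 0 ≤ K)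
    (h : ∀ n k, ∫ x, (F n x - F k x) ^ 2 ∂c.μ
      ≤ ∫ x, (u n x - u k x) ^ 2 ∂c.μ + K * ∫ x, (f n x - f k x) ^ 2 ∂c.μ) :
    ∃ g, c.L2 g ∧ Tendsto (fun n => eLpNorm (F n - g) 2 c.μ) atTop (𝓝 0) := by
  have cu := ((Lp.tendsto_Lp_iff_tendsto_eLpNorm'' u (fun n => (hu n).2.2) u₀ hu₀.2.2).2 tu).cauchySeq
  have cf := ((Lp.tendsto_Lp_iff_tendsto_eLpNorm'' f (fun n => (hf n).2.2) f₀ hf₀.2.2).2 tf).cauchySeq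
  have sq_dist : ∀ {G : ℕ → Rd d → ℝ} (hG : ∀ n, c.L2 (G n)) (n k : ℕ),
      dist ((hG n).2.2.toLp (G n)) ((hG k).2.2.toLp (G k)) ^ 2 = ∫ x, (G n x - G k x) ^ 2 ∂c.μ := by
    intro G hG n k
    rw [dist_eq_norm, ← MemLp.toLp_sub, norm_toLp_sq]
    rfl
  have cF : CauchySeq fun n => (hF n).2.2.toLp (F n) := by
    rw [Metric.cauchySeq_iff] at cu cf ⊢
    intro ε hε
    -- With this radius the second term is at most `K ε² / (4 (K + 1)²) ≤ ε² / 4`, and the first is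
    -- below `ε² / 4`.
    have hε' : 0 < ε / (2 * (K + 1)) := by positivity
    obtain ⟨N₁, h1⟩ := cu (ε / 2) (by positivity)
    obtain ⟨N₂, h2⟩ := cf (ε / (2 * (K + 1))) hε'
    refine ⟨max N₁ N₂, fun n hn k hk => ?_⟩
    have h3 := h1 n (le_of_max_le_left hn) k (le_of_max_le_left hk)
    have h4 := h2 n (le_of_max_le_right hn) k (le_of_max_le_right hk)
    have h5 := h n k
    rw [← sq_dist hF, ← sq_dist hu, ← sq_dist hf] at h5
    refine lt_of_pow_lt_pow_left₀ 2 hε.le (h5.trans_lt ?_)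
    have h6 := pow_lt_pow_left₀ h3 dist_nonneg two_ne_zero
    have h7 := pow_le_pow_left₀ dist_nonneg h4.le 2
    have h8 : K * (ε / (2 * (K + 1))) ^ 2 ≤ ε ^ 2 / 4 := by
      rw [div_pow, mul_pow]
      rw [mul_div_assoc', div_le_div_iff₀ (by positivity) (by norm_num)]
      nlinarith [sq_nonneg ε, mul_nonneg (sq_nonneg ε) hK, mul_nonneg (sq_nonneg ε) (mul_nonneg hK hK)]
    nlinarith [mul_le_mul_of_nonneg_left h7 hK]
  obtain ⟨g, hg⟩ := cauchySeq_tendsto_of_complete cF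
  obtain ⟨g', h1, h2, h3⟩ := c.rep g (Lp.aestronglyMeasurable g)
  have hg' : c.L2 g' := ⟨h1 |> PerE.per, h3, (memLp_congr_ae h2).2 (Lp.memLp g)⟩
  refine ⟨g', hg', ?_⟩
  rw [← Lp.tendsto_Lp_iff_tendsto_eLpNorm'' F (fun n => (hF n).2.2) g' hg'.2.2]
  convert hg
  exact Lp.ext (hg'.2.2.coeFn_toLp.trans h2)

/-- The natural constant is the square root of the number `N` of translates; `N + 1` is a cruder
one, justified by `N ≤ (N + 1)²`. -/
theorem eLpNorm_ball_le {f : Rd d → ℝ} (hf : c.L2 f) (R : ℝ) :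
    eLpNorm f 2 (volume.restrict (Metric.closedBall 0 R))
      ≤ (((c.near R).card : ℝ≥0∞) + 1) * eLpNorm f 2 c.μ := by
  obtain ⟨g, hg, hgf, hg2⟩ := hf.exists_rep
  rw [← eLpNorm_congr_ae (ae_restrict_of_ae hgf), ← eLpNorm_congr_ae (ae_mu hgf)]
  have h1 : ∫⁻ x in Metric.closedBall 0 R, ‖g x‖ₑ ^ 2 ≤ (c.near R).card * ∫⁻ x, ‖g x‖ₑ ^ 2 ∂c.μ :=
    setLIntegral_ball_le (F := fun x => ‖g x‖ₑ ^ 2) (fun γ x => by simp only [hg γ x]) R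
  rw [← eLpNorm_two_sq, ← eLpNorm_two_sq] at h1
  refine (ENNReal.pow_le_pow_left_iff two_ne_zero).1 (h1.trans ?_)
  rw [mul_pow]
  gcongr
  rw [sq]
  calc ((c.near R).card : ℝ≥0∞) ≤ (c.near R).card + 1 := le_self_add
    _ = ((c.near R).card + 1) * 1 := (mul_one _).symm
    _ ≤ _ := by gcongr; exact le_add_self

theorem tendsto_integral_test {f : ℕ → Rd d → ℝ} {f₀ : Rd d → ℝ} (hf : ∀ n, c.L2 (f n))
    (hf₀ : c.L2 f₀) (t : Tendsto (fun n => eLpNorm (f n - f₀) 2 c.μ) atTop (𝓝 0))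
    {ψ : Rd d → ℝ} (hψ : Continuous ψ) (hc : HasCompactSupport ψ) :
    Tendsto (fun n => ∫ x, ψ x * f n x) atTop (𝓝 (∫ x, ψ x * f₀ x)) := by
  obtain ⟨R, hR⟩ := hc.isCompact.isBounded.subset_closedBall 0
  have key : ∀ g : Rd d → ℝ, ∫ x, ψ x * g x = ∫ x in Metric.closedBall 0 R, ψ x * g x := by
    intro g
    refine (setIntegral_eq_integral_of_forall_compl_eq_zero fun x hx => ?_).symm
    rw [image_eq_zero_of_notMem_tsupport (fun h => hx (hR h)), zero_mul]
  simp_rw [key]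
  have hψ2 : MemLp ψ 2 (volume.restrict (Metric.closedBall (0 : Rd d) R)) :=
    (hψ.memLp_of_hasCompactSupport hc).restrict _
  refine tendsto_integral_mul_of_tendsto (fun _ => hψ2) (fun n => (hf n).memLp_ball R) hψ2
    (hf₀.memLp_ball R) (by simp) ?_
  have h1 : ∀ n, eLpNorm (f n - f₀) 2 (volume.restrict (Metric.closedBall 0 R))
      ≤ (((c.near R).card : ℝ≥0∞) + 1) * eLpNorm (f n - f₀) 2 c.μ :=
    fun n => eLpNorm_ball_le ((hf n).sub hf₀) R
  have h2 := ENNReal.Tendsto.const_mul (a := ((c.near R).card : ℝ≥0∞) + 1) t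
    (Or.inr (by simp))
  rw [mul_zero] at h2
  exact tendsto_of_tendsto_of_tendsto_of_le_of_le tendsto_const_nhds h2 (fun _ => zero_le) h1

theorem hasWeakPartial_of_tendsto {u : ℕ → Rd d → ℝ} {u₀ g : Rd d → ℝ} {j : Fin d}
    (hu : ∀ n, c.Sm (u n)) (hu₀ : c.L2 u₀) (hg : c.L2 g)
    (t : Tendsto (fun n => eLpNorm (u n - u₀) 2 c.μ) atTop (𝓝 0))
    (t' : Tendsto (fun n => eLpNorm (DefectModes.pd (stdVec j) (u n) - g) 2 c.μ) atTop (𝓝 0)) :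
    HasWeakPartial j u₀ g := by
  refine ⟨hu₀.locallyIntegrable, hg.locallyIntegrable, fun φ hφ hc => ?_⟩
  have h1 := tendsto_integral_test (fun n => (hu n).l2) hu₀ t
    (contDiff_pd hφ (stdVec j)).continuous (hasCompactSupport_pd hc (stdVec j))
  have h2 := tendsto_integral_test (fun n => ((hu n).pd _).l2) hg t' hφ.continuous hc
  refine tendsto_nhds_unique h1 (h2.neg.congr fun n => ?_)
  rw [pd_mul_compact (hu n).1 hφ hc]

/-- A locally integrable function is recovered almost everywhere from its mollifications. Identities
between mollifications thereby become almost everywhere identities. -/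
theorem moll_sub_tendsto {f : Rd d → ℝ} (hf : c.L2 f) {g : Rd d → ℝ} (hg : c.L2 g)
    (h : ∀ n, moll n f = moll n g) : f =ᵐ[volume] g := by
  filter_upwards [ae_tendsto_moll hf.locallyIntegrable, ae_tendsto_moll hg.locallyIntegrable]
    with x h1 h2
  exact tendsto_nhds_unique h1 (by simpa only [h] using h2)

/-- Elliptic regularity for a constant coefficient operator in the form of a sum of squares. -/
theorem regularity {m : ℕ} {b : Fin m → Rd d} {C : Fin d → Fin m → ℝ}
    (hC : ∀ j, stdVec j = ∑ i, C j i • b i) {u f : Rd d → ℝ} (hu : c.L2 u) (hf : c.L2 f)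
    (h : ∀ n x, ∑ i, DefectModes.pd (b i) (DefectModes.pd (b i) (moll n u)) x = moll n f x) :
    ∃ (g : Fin d → Rd d → ℝ) (k : Fin d → Fin d → Rd d → ℝ),
      (∀ j, HasWeakPartial j u (g j) ∧ c.L2 (g j)) ∧
      (∀ j l, HasWeakPartial l (g j) (k j l) ∧ c.L2 (k j l)) ∧
      f =ᵐ[volume] fun x => ∑ i, ∑ j, ∑ l, b i j * b i l * k j l x := by
  have hs := fun n => hu.sm_moll n
  have hdiff : ∀ n n' (v w : Rd d), (fun x => DefectModes.pd v (DefectModes.pd w (moll n u)) x -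
      DefectModes.pd v (DefectModes.pd w (moll n' u)) x)
      = DefectModes.pd v (DefectModes.pd w (fun x => moll n u x - moll n' u x)) := by
    intro n n' v w
    rw [pd_sub (hs n).1 (hs n').1, pd_sub ((hs n).pd w).1 ((hs n').pd w).1]
  have hL : ∀ n n' x, ∑ i, DefectModes.pd (b i) (DefectModes.pd (b i)
      (fun x => moll n u x - moll n' u x)) x = moll n f x - moll n' f x := by
    intro n n' x
    rw [← h, ← h, ← Finset.sum_sub_distrib]
    exact Finset.sum_congr rfl fun i _ => (congrFun (hdiff n n' (b i) (b i)) x).symm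
  -- The operator applied to `moll n u - moll n' u` is `moll n f - moll n' f`. So the Hessian
  -- estimate makes the second derivatives of the mollifications a Cauchy sequence, and `Sm.grad_le`
  -- does the same for the first ones.
  have hess : ∀ j l n n', ∫ x, (DefectModes.pd (stdVec l) (DefectModes.pd (stdVec j) (moll n u)) x -
      DefectModes.pd (stdVec l) (DefectModes.pd (stdVec j) (moll n' u)) x) ^ 2 ∂c.μ
      ≤ ((∑ i, C l i ^ 2) * ∑ i, C j i ^ 2) * ∫ x, (moll n f x - moll n' f x) ^ 2 ∂c.μ := by
    intro j l n n'
    have h1 := ((hs n).sub (hs n')).hessian_le b (C l) (C j)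
    simp_rw [hL, ← hC, ← hdiff] at h1
    exact h1
  have limH : ∀ j l, ∃ k, c.L2 k ∧ Tendsto (fun n => eLpNorm (DefectModes.pd (stdVec l)
      (DefectModes.pd (stdVec j) (moll n u)) - k) 2 c.μ) atTop (𝓝 0) := by
    intro j l
    refine exists_limit (u := fun n => moll n u) (f := fun n => moll n f)
      (fun n => (((hs n).pd _).pd _).l2) (fun n => (hs n).l2)
      (fun n => hf.moll n) hu hf (tendsto_moll hu) (tendsto_moll hf)
      (K := (∑ i, C l i ^ 2) * ∑ i, C j i ^ 2) (by positivity) fun n n' => ?_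
    have : 0 ≤ ∫ x, (moll n u x - moll n' u x) ^ 2 ∂c.μ := integral_nonneg fun x => sq_nonneg _
    linarith [hess j l n n']
  have limG : ∀ j, ∃ k, c.L2 k ∧ Tendsto (fun n => eLpNorm (DefectModes.pd (stdVec j) (moll n u) - k)
      2 c.μ) atTop (𝓝 0) := by
    intro j
    refine exists_limit (u := fun n => moll n u) (f := fun n => moll n f)
      (fun n => ((hs n).pd _).l2) (fun n => (hs n).l2)
      (fun n => hf.moll n) hu hf (tendsto_moll hu) (tendsto_moll hf)
      (K := (∑ i, C j i ^ 2) * ∑ i, C j i ^ 2) (by positivity) fun n n' => ?_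
    have h1 := ((hs n).sub (hs n')).grad_le (stdVec j)
    simp only [← hdiff] at h1
    rw [pd_sub (hs n).1 (hs n').1] at h1
    linarith [hess j j n n']
  choose g hg using limG
  choose k hk using limH
  have hw1 : ∀ j, HasWeakPartial j u (g j) := fun j =>
    hasWeakPartial_of_tendsto hs hu (hg j).1 (tendsto_moll hu) (hg j).2
  have hw2 : ∀ j l, HasWeakPartial l (g j) (k j l) := fun j l =>
    hasWeakPartial_of_tendsto (fun n => (hs n).pd _) (hg j).1 (hk j l).1 (hg j).2 (hk j l).2
  refine ⟨g, k, fun j => ⟨hw1 j, (hg j).1⟩, fun j l => ⟨hw2 j l, (hk j l).1⟩, ?_⟩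
  have hkL2 : c.L2 (fun x => ∑ i, ∑ j, ∑ l, b i j * b i l * k j l x) :=
    L2.sum _ fun i => L2.sum _ fun j => L2.sum _ fun l => (hk j l).1.const_mul _
  refine moll_sub_tendsto hf hkL2 fun n => ?_
  have hκ := isTest_mollKernel d n
  ext x
  rw [← h]
  have hli : ∀ j l, LocallyIntegrable (k j l) := fun j l => (hk j l).1.locallyIntegrable
  have e1 : moll n (fun x => ∑ i, ∑ j, ∑ l, b i j * b i l * k j l x) x
      = ∑ i, ∑ j, ∑ l, b i j * b i l * moll n (k j l) x := by
    unfold moll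
    rw [conv_sum _ hκ fun i => (L2.sum _ fun j => L2.sum _ fun l =>
      (hk j l).1.const_mul (b i j * b i l)).locallyIntegrable]
    refine Finset.sum_congr rfl fun i _ => ?_
    rw [conv_sum _ hκ fun j => (L2.sum _ fun l =>
      (hk j l).1.const_mul (b i j * b i l)).locallyIntegrable]
    refine Finset.sum_congr rfl fun j _ => ?_
    rw [conv_sum _ hκ fun l => ((hk j l).1.const_mul (b i j * b i l)).locallyIntegrable]
    refine Finset.sum_congr rfl fun l _ => ?_
    rw [conv_const_mul]
  rw [e1]
  refine Finset.sum_congr rfl fun i _ => ?_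
  have e2 : DefectModes.pd (b i) (moll n u) = fun x => ∑ j, b i j * moll n (g j) x := by
    ext x
    rw [pd_eq_sum]
    exact Finset.sum_congr rfl fun j _ => by rw [pd_moll (hw1 j)]
  have hsm : ∀ j, ContDiff ℝ ∞ (fun x => b i j * moll n (g j) x) := fun j =>
    contDiff_const.mul (contDiff_moll (hg j).1.locallyIntegrable n)
  rw [e2, pd_eq_sum]
  simp_rw [pd_sum _ hsm, pd_const_mul (contDiff_moll (hg _).1.locallyIntegrable n),
    pd_moll (hw2 _ _), Finset.mul_sum]
  rw [Finset.sum_comm]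
  exact Finset.sum_congr rfl fun j _ => Finset.sum_congr rfl fun l _ => by ring

end PCell

end DefectModes

/-! ### The two instances `ℝ^d` and the unit cell; weak compactness; testing. -/

namespace DefectModes

variable {d : ℕ}

/-- All of `ℝ^d`, with the trivial group. -/
noncomputable def whole (d : ℕ) : PCell d where
  Γ := ⊥
  D := Set.univ
  countable := inferInstance
  fund := IsAddFundamentalDomain.mk' MeasurableSet.univ.nullMeasurableSet fun x =>
    ⟨0, Set.mem_univ _, fun y _ => Subsingleton.elim _ _⟩
  finite_near := fun R => Set.toFinite _
  rep := fun g hg => ⟨g, fun γ x => by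
    have : (γ : Rd d) = 0 := AddSubgroup.mem_bot.1 γ.2
    rw [this, zero_add], ae_eq_rfl, by simpa using hg⟩

theorem whole_mu : (whole d).μ = volume := by
  simp [PCell.μ, whole]

theorem whole_per (f : Rd d → ℝ) : (whole d).Per f := fun γ => by
  have : (γ : Rd d) = 0 := AddSubgroup.mem_bot.1 γ.2
  simp [this]

theorem whole_l2 {f : Rd d → ℝ} (hf : MemLp f 2 volume) : (whole d).L2 f :=
  ⟨whole_per f, hf.1, by rwa [whole_mu]⟩

theorem L2_whole_iff {f : Rd d → ℝ} : (whole d).L2 f ↔ MemLp f 2 volume :=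
  ⟨fun h => by simpa [whole_mu] using h.2.2, whole_l2⟩

/-- The lattice `ℤ^d`. -/
def intLattice (d : ℕ) : AddSubgroup (Rd d) where
  carrier := {x | ∀ j, ∃ n : ℤ, x j = n}
  zero_mem' := fun j => ⟨0, by simp⟩
  add_mem' := fun {a b} ha hb j => by
    obtain ⟨m, hm⟩ := ha j
    obtain ⟨n, hn⟩ := hb j
    exact ⟨m + n, by simp [hm, hn]⟩
  neg_mem' := fun {a} ha j => by
    obtain ⟨m, hm⟩ := ha j
    exact ⟨-m, by simp [hm]⟩

/-- The half-open unit cell. -/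
def cellIco (d : ℕ) : Set (Rd d) := {x | ∀ j, x j ∈ Set.Ico (0 : ℝ) 1}

theorem measurableSet_cellIco : MeasurableSet (cellIco d) := by
  have : cellIco d = ⋂ j, (fun x : Rd d => x j) ⁻¹' Set.Ico (0 : ℝ) 1 := by
    ext x; simp [cellIco]
  rw [this]
  exact MeasurableSet.iInter fun j => measurableSet_Ico.preimage (by fun_prop)

theorem cellIco_ae_eq_cell : cellIco d =ᵐ[volume] cell d := by
  have h := (EuclideanSpace.volume_preserving_symm_measurableEquiv_toLp (Fin d)).quasiMeasurePreserving.preimage_ae_eq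
    (Measure.univ_pi_Ico_ae_eq_Icc (μ := fun _ : Fin d => (volume : Measure ℝ))
      (f := fun _ => 0) (g := fun _ => 1))
  have h1 : cellIco d = (MeasurableEquiv.toLp 2 (Fin d → ℝ)).symm ⁻¹'
      Set.univ.pi fun _ => Set.Ico 0 1 := by
    ext x; simp [cellIco, Set.mem_pi]
  have h2 : cell d = (MeasurableEquiv.toLp 2 (Fin d → ℝ)).symm ⁻¹'
      Set.Icc (fun _ => 0) (fun _ => 1) := by
    ext x; simp [cell, Set.mem_Icc, Pi.le_def, forall_and]
  rw [h1, h2]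
  exact h

/-- The coordinatewise fractional part. -/
noncomputable def fractPart (x : Rd d) : Rd d := WithLp.toLp 2 fun j => Int.fract (x j)

theorem fractPart_apply (x : Rd d) (j : Fin d) : fractPart x j = Int.fract (x j) := rfl

theorem measurable_fractPart : Measurable (fractPart : Rd d → Rd d) := by
  refine (MeasurableEquiv.toLp 2 (Fin d → ℝ)).measurable.comp (measurable_pi_lambda _ fun j => ?_)
  exact measurable_fract.comp (by fun_prop)

theorem intLattice_ext {γ γ' : intLattice d} (h : ∀ j, ⌊(γ : Rd d) j⌋ = ⌊(γ' : Rd d) j⌋) : γ = γ' := by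
  refine Subtype.ext (PiLp.ext fun j => ?_)
  obtain ⟨m, hm⟩ := γ.2 j
  obtain ⟨n, hn⟩ := γ'.2 j
  have := h j
  rw [hm, hn, Int.floor_intCast, Int.floor_intCast] at this
  rw [hm, hn, this]

instance : Countable (intLattice d) :=
  Function.Injective.countable (f := fun γ : intLattice d => fun j => ⌊(γ : Rd d) j⌋)
    fun _ _ h => intLattice_ext (congrFun h)

/-- The unit cell with the lattice `ℤ^d`. -/
noncomputable def lattice (d : ℕ) : PCell d where
  Γ := intLattice d
  D := cellIco d
  countable := inferInstance
  fund := IsAddFundamentalDomain.mk' measurableSet_cellIco.nullMeasurableSet fun x => by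
    refine ⟨⟨WithLp.toLp 2 fun j => -(⌊x j⌋ : ℝ), fun j => ⟨-⌊x j⌋, by simp⟩⟩, ?_, ?_⟩
    · intro j
      change -(⌊x j⌋ : ℝ) + x j ∈ _
      rw [neg_add_eq_sub]
      exact ⟨Int.fract_nonneg (x j), Int.fract_lt_one (x j)⟩
    · intro γ hγ
      refine Subtype.ext (PiLp.ext fun j => ?_)
      obtain ⟨n, hn⟩ := γ.2 j
      have h1 : (γ : Rd d) j + x j ∈ Set.Ico (0 : ℝ) 1 := hγ j
      rw [hn] at h1
      have h2 : ⌊x j⌋ = -n := by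
        rw [Int.floor_eq_iff]
        push_cast
        exact ⟨by linarith [h1.1], by linarith [h1.2]⟩
      rw [hn]
      change (n : ℝ) = -(⌊x j⌋ : ℝ)
      rw [h2]; simp
  finite_near := fun R => by
    refine Set.Finite.of_finite_image (f := fun γ : intLattice d => fun j => ⌊(γ : Rd d) j⌋) ?_
      (fun _ _ _ _ h => intLattice_ext (congrFun h))
    refine (Set.Finite.pi' fun _ : Fin d => Set.finite_Icc (-(⌈R⌉ + 2)) (⌈R⌉ + 2)).subset ?_
    rintro _ ⟨γ, ⟨x, hx, hR⟩, rfl⟩ j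
    have h1 : |(γ : Rd d) j + x j| ≤ R := (PiLp.norm_apply_le ((γ : Rd d) + x) j).trans hR
    have h2 := hx j
    have h3 := abs_le.1 h1
    have h4 := Int.le_ceil R
    constructor
    · rw [Int.le_floor]; push_cast; linarith [h2.1, h2.2, h3.1]
    · have : ((⌊(γ : Rd d) j⌋ : ℤ) : ℝ) ≤ ((⌈R⌉ + 2 : ℤ) : ℝ) := by
        push_cast
        linarith [Int.floor_le ((γ : Rd d) j), h2.1, h3.2]
      exact_mod_cast this
  rep := fun g hg => by
    refine ⟨fun x => hg.mk g (fractPart x), ?_, ?_, ?_⟩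
    · intro γ x
      have : fractPart ((γ : Rd d) + x) = fractPart x := by
        refine PiLp.ext fun j => ?_
        obtain ⟨n, hn⟩ := γ.2 j
        rw [fractPart_apply, fractPart_apply, PiLp.add_apply, hn, Int.fract_intCast_add]
      simp only [this]
    · filter_upwards [hg.ae_eq_mk, ae_restrict_mem measurableSet_cellIco] with x h1 h2
      have : fractPart x = x := PiLp.ext fun j => by
        rw [fractPart_apply, Int.fract_eq_self]; exact h2 j
      rw [this, h1]
    · exact (hg.stronglyMeasurable_mk.comp_measurable measurable_fractPart).aestronglyMeasurable

theorem lattice_mu : (lattice d).μ = cellMeasure d := by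
  simp only [PCell.μ, lattice, cellMeasure]
  exact Measure.restrict_congr_set cellIco_ae_eq_cell

theorem volume_cell : volume (cell d) = 1 := by
  have h := (EuclideanSpace.volume_preserving_symm_measurableEquiv_toLp (Fin d)).measure_preimage_equiv
    (Set.Icc (0 : Fin d → ℝ) 1)
  rw [Real.volume_Icc_pi] at h
  simp only [Pi.one_apply, Pi.zero_apply, sub_zero, ENNReal.ofReal_one, Finset.prod_const_one] at h
  rw [← h]
  congr 1
  ext x
  simp [cell, Set.mem_Icc, Pi.le_def, forall_and]

instance : IsProbabilityMeasure (lattice d).μ :=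
  ⟨by rw [lattice_mu, cellMeasure, Measure.restrict_apply_univ, volume_cell]⟩

theorem stdVec_apply (j i : Fin d) : (stdVec j : Rd d) i = if i = j then 1 else 0 := by
  simp [stdVec]

theorem LatticePeriodic.perE {β : Type*} {f : Rd d → β} (h : LatticePeriodic f) :
    (lattice d).PerE f := by
  intro γ x
  have h1 : ∀ (s : Finset (Fin d)) (n : Fin d → ℤ), Function.Periodic f (∑ j ∈ s, n j • stdVec j) := by
    classical
    intro s n
    induction s using Finset.induction_on with
    | empty => intro x; simp
    | insert a s ha ih =>
      rw [Finset.sum_insert ha]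
      exact ((h a).zsmul (n a)).add_period ih
  choose n hn using γ.2
  have h2 : (γ : Rd d) = ∑ j, n j • stdVec j := by
    refine PiLp.ext fun i => ?_
    rw [hn]
    simp [stdVec_apply]
  rw [h2, add_comm]
  exact h1 Finset.univ n x

theorem PerE.latticePeriodic {β : Type*} {f : Rd d → β} (h : (lattice d).PerE f) :
    LatticePeriodic f := by
  intro j x
  have := h ⟨stdVec j, fun i => ⟨if i = j then 1 else 0, by rw [stdVec_apply]; split_ifs <;> simp⟩⟩ x
  rwa [add_comm] at this

namespace PCell

variable {c : PCell d}

/-- Sequential Banach-Alaoglu in the separable space `L²(D)`, with functionals represented by Riesz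
and the limit extended invariantly by `rep`. -/
theorem exists_weak_subseq {u : ℕ → Rd d → ℝ} (hu : ∀ n, c.L2 (u n)) {C : ℝ}
    (hC : ∀ n, ∫ x, u n x ^ 2 ∂c.μ ≤ C) :
    ∃ v, c.L2 v ∧ ∃ s : ℕ → ℕ, StrictMono s ∧ ∀ g, MemLp g 2 c.μ →
      Tendsto (fun n => ∫ x, u (s n) x * g x ∂c.μ) atTop (𝓝 (∫ x, v x * g x ∂c.μ)) := by
  have : Fact ((2 : ℝ≥0∞) ≠ ⊤) := ⟨by norm_num⟩
  have : SecondCountableTopology (Lp ℝ 2 c.μ) := Lp.SecondCountableTopology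
  let U : ℕ → Lp ℝ 2 c.μ := fun n => (hu n).2.2.toLp (u n)
  have hU : ∀ n, ‖U n‖ ≤ Real.sqrt C := fun n => by
    refine Real.le_sqrt_of_sq_le ?_
    rw [norm_toLp_sq]; exact hC n
  let T : ℕ → WeakDual ℝ (Lp ℝ 2 c.μ) := fun n =>
    StrongDual.toWeakDual (InnerProductSpace.toDual ℝ (Lp ℝ 2 c.μ) (U n))
  obtain ⟨L, -, s, hs, hL⟩ := WeakDual.isSeqCompact_closedBall ℝ (Lp ℝ 2 c.μ) 0 (Real.sqrt C)
    (x := T) (fun n => by simpa [T] using hU n)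
  let w : Lp ℝ 2 c.μ := (InnerProductSpace.toDual ℝ (Lp ℝ 2 c.μ)).symm (WeakDual.toStrongDual L)
  obtain ⟨v, h1, h2, h3⟩ := c.rep w (Lp.aestronglyMeasurable w)
  have hv : c.L2 v := ⟨PerE.per h1, h3, (memLp_congr_ae h2).2 (Lp.memLp w)⟩
  refine ⟨v, hv, s, hs, fun g hg => ?_⟩
  have key : ∀ {a b : Rd d → ℝ} (ha : MemLp a 2 c.μ) (hb : MemLp b 2 c.μ),
      ∫ x, a x * b x ∂c.μ = inner ℝ (ha.toLp a) (hb.toLp b) := by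
    intro a b ha hb
    rw [L2.inner_def]
    refine integral_congr_ae ?_
    filter_upwards [ha.coeFn_toLp, hb.coeFn_toLp] with x h1 h2
    rw [h1, h2]
    simp [mul_comm]
  have h4 : hv.2.2.toLp v = w := Lp.ext (hv.2.2.coeFn_toLp.trans h2)
  have h5 := ((WeakDual.eval_continuous (𝕜 := ℝ) (hg.toLp g)).tendsto L).comp hL
  rw [key hv.2.2 hg, h4]
  have h6 : L (hg.toLp g) = inner ℝ w (hg.toLp g) := by
    simp only [w, InnerProductSpace.toDual_symm_apply]
    rfl
  rw [← h6]
  refine h5.congr fun n => ?_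
  rw [key (hu (s n)).2.2 hg]
  rfl

/-- Integration against a test function on `ℝ^d` is integration over the fundamental domain
against its periodization. -/
theorem exists_periodization {ψ : Rd d → ℝ} (hψ : Continuous ψ) (hc : HasCompactSupport ψ) :
    ∃ Ψ : Rd d → ℝ, MemLp Ψ 2 c.μ ∧ ∀ f, c.L2 f → ∫ x, ψ x * f x = ∫ x, f x * Ψ x ∂c.μ := by
  obtain ⟨R, hR⟩ := hc.isCompact.isBounded.subset_closedBall 0
  have hmem : ∀ γ : c.Γ, MemLp (fun x => ψ ((γ : Rd d) + x)) 2 c.μ := fun γ =>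
    ((hψ.memLp_of_hasCompactSupport hc (p := 2) (μ := volume)).comp_measurePreserving
      (measurePreserving_add_left volume (γ : Rd d))).restrict _
  refine ⟨fun x => ∑ γ ∈ c.near R, ψ ((γ : Rd d) + x), ?_, fun f hf => ?_⟩
  · exact memLp_finsetSum _ fun γ _ => hmem γ
  · obtain ⟨g, hg, hgf, hg2⟩ := hf.exists_rep
    have e1 : ∫ x, ψ x * f x = ∫ x, ψ x * g x :=
      integral_congr_ae (by filter_upwards [hgf] with x hx using by rw [hx])
    have e2 : ∫ x, f x * (∑ γ ∈ c.near R, ψ ((γ : Rd d) + x)) ∂c.μ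
        = ∫ x, g x * (∑ γ ∈ c.near R, ψ ((γ : Rd d) + x)) ∂c.μ :=
      integral_congr_ae (by filter_upwards [ae_mu (c := c) hgf] with x hx using by rw [hx])
    have hint : Integrable (fun x => ψ x * g x) := integrable_smul_test hg2.locallyIntegrable hψ hc
    rw [e1, e2, c.fund.integral_eq_tsum'' _ hint, tsum_eq_sum (s := c.near R)]
    · simp_rw [Finset.mul_sum]
      have hi : ∀ γ : c.Γ, Integrable (fun x => g x * ψ ((γ : Rd d) + x)) c.μ := fun γ =>
        hg2.2.2.integrable_mul (hmem γ)
      rw [integral_finsetSum _ fun γ _ => hi γ]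
      refine Finset.sum_congr rfl fun γ _ => integral_congr_ae (ae_of_all _ fun x => ?_)
      change ψ ((γ : Rd d) + x) * g ((γ : Rd d) + x) = _
      rw [hg, mul_comm]
    · intro γ hγ
      refine integral_eq_zero_of_ae ((ae_restrict_iff'₀ c.fund.nullMeasurableSet).2
        (ae_of_all _ fun x hx => ?_))
      change ψ ((γ : Rd d) + x) * _ = 0
      rw [image_eq_zero_of_notMem_tsupport (f := ψ) (x := (γ : Rd d) + x), zero_mul]
      intro hmem
      refine hγ ?_
      simp only [near, Set.Finite.mem_toFinset, Set.mem_ofPred_eq]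
      exact ⟨x, hx, by simpa using hR hmem⟩

/-- Cauchy-Schwarz on the support of the kernel. After translation to the origin a fixed number of
cells suffices, so the constant depends neither on `f` nor on the point. -/
theorem abs_conv_le_sqrt {κ : Rd d → ℝ} (hκ : IsTest κ) :
    ∃ B : ℝ, 0 ≤ B ∧ ∀ f, c.L2 f → ∀ x, |DefectModes.conv κ f x| ≤ B * Real.sqrt (∫ y, f y ^ 2 ∂c.μ) := by
  have hκ' : HasCompactSupport (fun s => κ (-s)) := hκ.2.comp_homeomorph (Homeomorph.neg _)
  have hκc : Continuous (fun s => κ (-s)) := hκ.1.continuous.comp continuous_neg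
  obtain ⟨R, hR⟩ := hκ'.isCompact.isBounded.subset_closedBall 0
  have hκ2 : MemLp (fun s => κ (-s)) 2 (volume.restrict (Metric.closedBall (0 : Rd d) R)) :=
    (hκc.memLp_of_hasCompactSupport hκ').restrict _
  set J := ∫ s in Metric.closedBall 0 R, κ (-s) ^ 2 with hJ
  have hJ0 : 0 ≤ J := integral_nonneg fun x => sq_nonneg _
  refine ⟨Real.sqrt (J * (c.near R).card), Real.sqrt_nonneg _, fun f hf x => ?_⟩
  obtain ⟨g, hg, hgf, hg2⟩ := hf.exists_rep
  rw [← conv_congr hgf, show ∫ y, f y ^ 2 ∂c.μ = ∫ y, g y ^ 2 ∂c.μ from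
    integral_congr_ae (by filter_upwards [ae_mu (c := c) hgf] with x hx using by rw [hx]),
    ← Real.sqrt_mul (by positivity)]
  refine Real.abs_le_sqrt ?_
  have hgs : c.L2 (fun s => g (s - (-x))) := by
    have hm : AEStronglyMeasurable (fun s => g (s - (-x))) volume :=
      hg2.2.1.comp_quasiMeasurePreserving
        (measurePreserving_sub_right volume (-x)).quasiMeasurePreserving
    refine ⟨PerE.per fun γ y => ?_, hm, hm.restrict, ?_⟩
    · rw [add_sub_assoc, hg]
    · have h0 : eLpNorm (fun s => g (s - (-x))) 2 c.μ ^ 2 = eLpNorm g 2 c.μ ^ 2 := by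
        rw [eLpNorm_two_sq, eLpNorm_two_sq]
        exact setLIntegral_shift (F := fun s => ‖g s‖ₑ ^ 2) (fun γ x => by simp only [hg γ x]) _
      rw [ENNReal.pow_right_strictMono two_ne_zero |>.injective h0]
      exact hg2.2.2.2
  have e1 : DefectModes.conv κ g x = ∫ s in Metric.closedBall 0 R, κ (-s) * g (s - (-x)) := by
    rw [conv_eq_swap, ← integral_neg_eq_self]
    rw [setIntegral_eq_integral_of_forall_compl_eq_zero]
    · congr 1; ext s; congr 2; abel
    · intro s hs
      rw [show κ (-s) = 0 from
        image_eq_zero_of_notMem_tsupport (f := fun s => κ (-s)) (fun h => hs (hR h)), zero_mul]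
  rw [e1]
  refine (sq_integral_mul_le hκ2 (hgs.memLp_ball R)).trans ?_
  rw [mul_assoc]
  refine mul_le_mul_of_nonneg_left ?_ hJ0
  have h1 : ∫⁻ s in Metric.closedBall 0 R, ‖g (s - (-x))‖ₑ ^ 2
      ≤ (c.near R).card * ∫⁻ s, ‖g s‖ₑ ^ 2 ∂c.μ := by
    refine (setLIntegral_ball_le (c := c) (F := fun s => ‖g (s - (-x))‖ₑ ^ 2)
      (fun γ y => by simp only [add_sub_assoc, hg γ]) R).trans (le_of_eq ?_)
    congr 1
    exact setLIntegral_shift (F := fun s => ‖g s‖ₑ ^ 2) (fun γ x => by simp only [hg γ x]) _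
  rw [← eLpNorm_two_sq, ← eLpNorm_two_sq, eLpNorm_two_sq_eq_integral (hgs.memLp_ball R),
    eLpNorm_two_sq_eq_integral hg2.2.2, ← ENNReal.ofReal_natCast, ← ENNReal.ofReal_mul (by simp)]
    at h1
  exact (ENNReal.ofReal_le_ofReal_iff (by
    have : 0 ≤ ∫ y, g y ^ 2 ∂c.μ := integral_nonneg fun x => sq_nonneg _
    positivity)).1 h1

/-- Test with the reflected kernel `y ↦ κ (x - y)`; the two signs from differentiating twice cancel.
-/
theorem moll_equation_of_test {m : ℕ} {b : Fin m → Rd d} {u f : Rd d → ℝ}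
    (hu : LocallyIntegrable u) (h : ∀ ψ, IsTest ψ →
      ∫ x, (∑ i, DefectModes.pd (b i) (DefectModes.pd (b i) ψ) x) * u x = ∫ x, ψ x * f x) (n : ℕ) (x : Rd d) :
    ∑ i, DefectModes.pd (b i) (DefectModes.pd (b i) (moll n u)) x = moll n f x := by
  have hκ := isTest_mollKernel d n
  have h1 := h _ (hκ.comp_sub x)
  have h2 : ∀ i, DefectModes.pd (b i) (DefectModes.pd (b i) fun y => mollKernel d n (x - y))
      = fun y => DefectModes.pd (b i) (DefectModes.pd (b i) (mollKernel d n)) (x - y) := by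
    intro i
    rw [pd_comp_sub]
    have := pd_comp_sub (fun z => DefectModes.pd (b i) (mollKernel d n) z) x (b i)
    have h3 := pd_const_mul ((hκ.pd (b i)).comp_sub x).1 (b i) (-1)
    simp only [neg_mul, one_mul] at h3
    rw [h3, this]
    simp
  have h3 : ∀ i, DefectModes.pd (b i) (DefectModes.pd (b i) (moll n u)) x
      = DefectModes.conv (DefectModes.pd (b i) (DefectModes.pd (b i) (mollKernel d n))) u x := by
    intro i
    rw [moll, pd_conv hκ hu, pd_conv (hκ.pd _) hu]
  simp_rw [h3]
  change _ = ∫ y, mollKernel d n (x - y) * f y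
  rw [← h1]
  simp_rw [h2, Finset.sum_mul]
  rw [integral_finsetSum _ fun i _ => integrable_conv ((hκ.pd _).pd _) hu x]
  rfl

end PCell

end DefectModes

/-! ### Mollification error in `H¹` and compactness of decaying potentials. -/

namespace DefectModes

/-- Jensen's inequality for squares: the variance of `h` under the probability density `ρ` is
nonnegative. -/
theorem sq_integral_weight_le {α : Type*} {m : MeasurableSpace α} {ν : Measure α} {ρ h : α → ℝ}
    (hρ : ∀ x, 0 ≤ ρ x) (h1 : ∫ x, ρ x ∂ν = 1) (hi : Integrable ρ ν)
    (hi1 : Integrable (fun x => ρ x * h x) ν) (hi2 : Integrable (fun x => ρ x * h x ^ 2) ν) :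
    (∫ x, ρ x * h x ∂ν) ^ 2 ≤ ∫ x, ρ x * h x ^ 2 ∂ν := by
  set m := ∫ x, ρ x * h x ∂ν with hm
  have h0 : 0 ≤ ∫ x, ρ x * (h x - m) ^ 2 ∂ν :=
    integral_nonneg fun x => mul_nonneg (hρ x) (sq_nonneg _)
  have h2 : ∫ x, ρ x * (h x - m) ^ 2 ∂ν
      = ∫ x, ((ρ x * h x ^ 2 - (2 * m) * (ρ x * h x)) + m ^ 2 * ρ x) ∂ν :=
    integral_congr_ae (ae_of_all _ fun x => by ring)
  have h3 : Integrable (fun x => ρ x * h x ^ 2 - (2 * m) * (ρ x * h x)) ν :=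
    hi2.sub (hi1.const_mul _)
  rw [h2, integral_add h3 (hi.const_mul _), integral_sub hi2 (hi1.const_mul _),
    integral_const_mul, integral_const_mul, h1, ← hm] at h0
  nlinarith

namespace PCell

variable {d : ℕ} {c : PCell d}

/-- Write the increment as the integral of the derivative along the segment, then use Jensen in `s`
and Cauchy-Schwarz in the coordinates. -/
theorem sq_sub_le {φ : Rd d → ℝ} (hφ : ContDiff ℝ ∞ φ) (x t : Rd d) :
    (φ (x - t) - φ x) ^ 2
      ≤ ‖t‖ ^ 2 * ∫ s in Set.Ioc (0 : ℝ) 1, ∑ j, pd (stdVec j) φ (x - s • t) ^ 2 := by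
  have hc : Continuous (fun s : ℝ => pd t φ (x - s • t)) :=
    (contDiff_pd hφ t).continuous.comp (by fun_prop)
  have hG : Continuous (fun s : ℝ => ∑ j, pd (stdVec j) φ (x - s • t) ^ 2) :=
    continuous_finsetSum _ fun j _ =>
      ((contDiff_pd hφ (stdVec j)).continuous.comp (by fun_prop)).pow 2
  have ftc : φ (x - t) - φ x = ∫ s in (0 : ℝ)..1, -pd t φ (x - s • t) := by
    have hd : ∀ s ∈ Set.uIcc (0 : ℝ) 1, HasDerivAt (fun s : ℝ => φ (x - s • t))
        (-pd t φ (x - s • t)) s := by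
      intro s _
      have h1 : HasDerivAt (fun s : ℝ => x - s • t) (-t) s := by
        simpa using ((hasDerivAt_id s).smul_const t).const_sub x
      have := (contDiff_differentiableAt hφ (x - s • t)).hasFDerivAt.comp_hasDerivAt s h1
      convert! this using 1
      simp [pd]
    rw [intervalIntegral.integral_eq_sub_of_hasDerivAt hd]
    · simp
    · exact hc.neg.intervalIntegrable _ _
  rw [ftc, intervalIntegral.integral_of_le zero_le_one]
  have hii : ∀ {f : ℝ → ℝ}, Continuous f → Integrable f (volume.restrict (Set.Ioc (0 : ℝ) 1)) :=
    fun hf => (hf.integrableOn_Icc).mono_set Set.Ioc_subset_Icc_self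
  have h1 := sq_integral_weight_le (ν := volume.restrict (Set.Ioc (0 : ℝ) 1)) (ρ := fun _ => 1)
    (h := fun s => -pd t φ (x - s • t)) (fun _ => zero_le_one) (by simp) (hii continuous_const)
    (by simpa using hii hc.neg) (by simpa only [one_mul] using! hii (hc.neg.pow 2))
  simp only [one_mul] at h1
  refine h1.trans ?_
  rw [← integral_const_mul]
  refine integral_mono (hii (hc.neg.pow 2)) ((hii hG).const_mul _) fun s => ?_
  change (-pd t φ (x - s • t)) ^ 2 ≤ _
  rw [neg_sq, pd_eq_sum]
  refine (Finset.sum_mul_sq_le_sq_mul_sq _ _ _).trans (le_of_eq ?_)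
  rw [EuclideanSpace.real_norm_sq_eq]

/-- The kernel lives in the ball of radius `2 / (n + 2)`, so each increment costs at most that
radius times the gradient. The rate depends on the gradient norm alone, hence is uniform on sets
bounded in `H¹`. -/
theorem Sm.integral_moll_sub_sq_le {φ : Rd d → ℝ} (hφ : c.Sm φ) (n : ℕ) :
    ∫ x, (moll n φ x - φ x) ^ 2 ∂c.μ
      ≤ (2 / ((n : ℝ) + 2)) ^ 2 * ∫ x, ∑ j, DefectModes.pd (stdVec j) φ x ^ 2 ∂c.μ := by
  set ρ := mollKernel d n with hρ
  have hκ := isTest_mollKernel d n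
  set r : ℝ := 2 / ((n : ℝ) + 2) with hr
  set G : Rd d → ℝ := fun x => ∑ j, DefectModes.pd (stdVec j) φ x ^ 2 with hG
  have hGc : Continuous G := continuous_finsetSum _ fun j _ =>
    ((contDiff_pd hφ.1 (stdVec j)).continuous).pow 2
  have hG0 : ∀ x, 0 ≤ G x := fun x => Finset.sum_nonneg fun j _ => sq_nonneg _
  have hGp : c.PerE G := fun γ x => by
    simp only [hG, (hφ.2.1.pd _) γ x]
  have hGi : Integrable G c.μ := integrable_finsetSum _ fun j _ => (hφ.pd _).l2.2.2.integrable_sq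
  have hci : ∀ {f : Rd d → ℝ}, Continuous f → Integrable (fun t => ρ t * f t) := fun hf =>
    (hκ.1.continuous.mul hf).integrable_of_hasCompactSupport hκ.2.mul_right
  have hk : ∀ x, Continuous (fun t => φ (x - t) - φ x) := fun x =>
    (hφ.1.continuous.comp (by fun_prop)).sub continuous_const
  have hm : ∀ x, moll n φ x - φ x = ∫ t, ρ t * (φ (x - t) - φ x) := by
    intro x
    simp_rw [mul_sub]
    have hk' : Continuous (fun t => φ (x - t)) := hφ.1.continuous.comp (by fun_prop)
    rw [integral_sub (hci hk') (hci continuous_const),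
      integral_mul_const, integral_mollKernel, one_mul, moll, conv_eq_swap]
  have step : ∀ x, ENNReal.ofReal ((moll n φ x - φ x) ^ 2)
      ≤ ENNReal.ofReal (r ^ 2) * ∫⁻ t, ∫⁻ s in Set.Ioc (0 : ℝ) 1,
        ENNReal.ofReal (ρ t) * ENNReal.ofReal (G (x - s • t)) := by
    intro x
    have h1 : (moll n φ x - φ x) ^ 2 ≤ ∫ t, ρ t * (φ (x - t) - φ x) ^ 2 := by
      rw [hm]
      exact sq_integral_weight_le (mollKernel_nonneg n) (integral_mollKernel n)
        (hκ.1.continuous.integrable_of_hasCompactSupport hκ.2) (hci (hk x)) (hci ((hk x).pow 2))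
    refine (ENNReal.ofReal_le_ofReal h1).trans ?_
    have hi2 : Integrable (fun t => ρ t * (φ (x - t) - φ x) ^ 2) := hci ((hk x).pow 2)
    rw [ofReal_integral_eq_lintegral_ofReal hi2
      (ae_of_all _ fun t => mul_nonneg (mollKernel_nonneg n t) (sq_nonneg _)),
      ← lintegral_const_mul' _ _ ENNReal.ofReal_ne_top]
    refine lintegral_mono fun t => ?_
    rw [lintegral_const_mul' _ _ ENNReal.ofReal_ne_top]
    have hGs : Continuous (fun s : ℝ => G (x - s • t)) := hGc.comp (by fun_prop)
    rw [← ofReal_integral_eq_lintegral_ofReal (μ := volume.restrict (Set.Ioc (0 : ℝ) 1))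
      (hGs.integrableOn_Icc.mono_set Set.Ioc_subset_Icc_self)
      (ae_of_all _ fun s => hG0 _), ← ENNReal.ofReal_mul (mollKernel_nonneg n t),
      ← ENNReal.ofReal_mul (sq_nonneg _)]
    refine ENNReal.ofReal_le_ofReal ?_
    by_cases ht : r ≤ ‖t‖
    · simp [hρ, mollKernel_eq_zero ht]
    · have h2 := sq_sub_le hφ.1 x t
      have h3 : 0 ≤ ∫ s in Set.Ioc (0 : ℝ) 1, G (x - s • t) := integral_nonneg fun s => hG0 _
      have h4 : ‖t‖ ^ 2 ≤ r ^ 2 := pow_le_pow_left₀ (norm_nonneg _) (not_le.1 ht).le 2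
      calc ρ t * (φ (x - t) - φ x) ^ 2
          ≤ ρ t * (r ^ 2 * ∫ s in Set.Ioc (0 : ℝ) 1, G (x - s • t)) :=
            mul_le_mul_of_nonneg_left (h2.trans (mul_le_mul_of_nonneg_right h4 h3))
              (mollKernel_nonneg n t)
        _ = _ := by ring
  have h1 : ENNReal.ofReal (∫ x, (moll n φ x - φ x) ^ 2 ∂c.μ)
      ≤ ENNReal.ofReal (r ^ 2 * ∫ x, G x ∂c.μ) := by
    rw [ofReal_integral_eq_lintegral_ofReal ((hφ.l2.moll n).sub hφ.l2).2.2.integrable_sq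
      (ae_of_all _ fun x => sq_nonneg _)]
    refine (lintegral_mono step).trans ?_
    rw [lintegral_const_mul' _ _ ENNReal.ofReal_ne_top, ENNReal.ofReal_mul (sq_nonneg _)]
    gcongr
    have hmeas : Measurable (Function.uncurry fun (x : Rd d) (p : Rd d × ℝ) =>
        ENNReal.ofReal (ρ p.1) * ENNReal.ofReal (G (x - p.2 • p.1))) := by
      have c1 : Continuous fun q : Rd d × Rd d × ℝ => ρ q.2.1 := hκ.1.continuous.comp (by fun_prop)
      have c2 : Continuous fun q : Rd d × Rd d × ℝ => G (q.1 - q.2.2 • q.2.1) :=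
        hGc.comp (by fun_prop)
      exact c1.measurable.ennreal_ofReal.mul c2.measurable.ennreal_ofReal
    have e1 : ∀ x, ∫⁻ t, ∫⁻ s in Set.Ioc (0 : ℝ) 1, ENNReal.ofReal (ρ t) * ENNReal.ofReal (G (x - s • t))
        = ∫⁻ p, ENNReal.ofReal (ρ p.1) * ENNReal.ofReal (G (x - p.2 • p.1))
          ∂((volume : Measure (Rd d)).prod (volume.restrict (Set.Ioc (0 : ℝ) 1))) := by
      intro x
      rw [lintegral_prod]
      exact (hmeas.comp measurable_prodMk_left).aemeasurable
    simp_rw [e1]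
    rw [lintegral_lintegral_swap hmeas.aemeasurable]
    have e2 : ∀ p : Rd d × ℝ, ∫⁻ x, ENNReal.ofReal (ρ p.1) * ENNReal.ofReal (G (x - p.2 • p.1)) ∂c.μ
        = ENNReal.ofReal (ρ p.1) * ∫⁻ x, ENNReal.ofReal (G x) ∂c.μ := by
      intro p
      rw [lintegral_const_mul' _ _ ENNReal.ofReal_ne_top,
        setLIntegral_shift (F := fun x => ENNReal.ofReal (G x)) (fun γ x => by simp only [hGp γ x])]
    simp_rw [e2]
    rw [lintegral_mul_const _ (by
      have c1 : Continuous fun q : Rd d × ℝ => ρ q.1 := hκ.1.continuous.comp (by fun_prop)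
      exact c1.measurable.ennreal_ofReal), ofReal_integral_eq_lintegral_ofReal hGi (ae_of_all _ hG0)]
    have e3 : ∫⁻ p, ENNReal.ofReal (ρ p.1)
        ∂((volume : Measure (Rd d)).prod (volume.restrict (Set.Ioc (0 : ℝ) 1))) = 1 := by
      rw [lintegral_prod]
      · simp only [lintegral_const, Measure.restrict_apply_univ, Real.volume_Ioc, sub_zero,
          ENNReal.ofReal_one, mul_one]
        rw [← ofReal_integral_eq_lintegral_ofReal
          (hκ.1.continuous.integrable_of_hasCompactSupport hκ.2) (ae_of_all _ (mollKernel_nonneg n)),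
          integral_mollKernel, ENNReal.ofReal_one]
      · have c1 : Continuous fun q : Rd d × ℝ => ρ q.1 := hκ.1.continuous.comp (by fun_prop)
        exact c1.measurable.ennreal_ofReal.aemeasurable
    rw [e3, one_mul]
  have h0 : 0 ≤ ∫ x, G x ∂c.μ := integral_nonneg hG0
  exact (ENNReal.ofReal_le_ofReal_iff (by positivity)).1 h1

theorem tendsto_integral_sq {f : ℕ → Rd d → ℝ} {f₀ : Rd d → ℝ} (hf : ∀ n, c.L2 (f n))
    (hf₀ : c.L2 f₀) (t : Tendsto (fun n => eLpNorm (f n - f₀) 2 c.μ) atTop (𝓝 0)) :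
    Tendsto (fun n => ∫ x, f n x ^ 2 ∂c.μ) atTop (𝓝 (∫ x, f₀ x ^ 2 ∂c.μ)) := by
  have := tendsto_integral_mul_of_tendsto (fun n => (hf n).2.2) (fun n => (hf n).2.2) hf₀.2.2
    hf₀.2.2 t t
  simpa only [← sq] using this

/-- Mollification approximates functions with a square integrable weak gradient uniformly. -/
theorem integral_moll_sub_sq_le {f : Rd d → ℝ} {g : Fin d → Rd d → ℝ} (hf : c.L2 f)
    (hg : ∀ j, HasWeakPartial j f (g j) ∧ c.L2 (g j)) (n : ℕ) :
    ∫ x, (moll n f x - f x) ^ 2 ∂c.μ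
      ≤ (2 / ((n : ℝ) + 2)) ^ 2 * ∑ j, ∫ x, g j x ^ 2 ∂c.μ := by
  have h1 : ∀ k, ∫ x, (moll n (moll k f) x - moll k f x) ^ 2 ∂c.μ
      ≤ (2 / ((n : ℝ) + 2)) ^ 2 * ∑ j, ∫ x, g j x ^ 2 ∂c.μ := by
    intro k
    refine ((hf.sm_moll k).integral_moll_sub_sq_le n).trans ?_
    gcongr
    rw [integral_finsetSum _ fun j _ => ((hf.sm_moll k).pd _).l2.2.2.integrable_sq]
    refine Finset.sum_le_sum fun j _ => ?_
    rw [pd_moll (hg j).1]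
    exact DefectModes.PCell.integral_moll_sq_le (hg j).2 k
  have h2 : Tendsto (fun k => ∫ x, (moll n (moll k f) x - moll k f x) ^ 2 ∂c.μ) atTop
      (𝓝 (∫ x, (moll n f x - f x) ^ 2 ∂c.μ)) := by
    refine tendsto_integral_sq (fun k => ((hf.moll k).moll n).sub (hf.moll k)) ((hf.moll n).sub hf) ?_
    have e : ∀ k, ((fun x => moll n (moll k f) x - moll k f x) - fun x => moll n f x - f x)
        = moll n (fun x => moll k f x - f x) - fun x => moll k f x - f x := by
      intro k
      ext x
      simp only [Pi.sub_apply, moll]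
      rw [conv_sub (isTest_mollKernel d n) (hf.conv (isTest_mollKernel d k)).locallyIntegrable
        hf.locallyIntegrable]
      ring
    have hsub : ∀ k, c.L2 (fun x => moll k f x - f x) := fun k => (hf.moll k).sub hf
    have h3 : ∀ k, eLpNorm ((fun x => moll n (moll k f) x - moll k f x) - fun x => moll n f x - f x)
        2 c.μ ≤ ((∫⁻ t, ‖mollKernel d n t‖ₑ) + 1) * eLpNorm (moll k f - f) 2 c.μ := by
      intro k
      rw [e, add_mul, one_mul]
      refine (eLpNorm_sub_le ((hsub k).moll n).2.2.1 (hsub k).2.2.1 (by norm_num)).trans ?_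
      exact add_le_add (eLpNorm_conv_le (isTest_mollKernel d n) (hsub k)) le_rfl
    have h4 := ENNReal.Tendsto.const_mul (a := (∫⁻ t, ‖mollKernel d n t‖ₑ) + 1) (tendsto_moll hf)
      (Or.inr (by
        have := ((isTest_mollKernel d n).1.continuous.integrable_of_hasCompactSupport
          (μ := volume) (isTest_mollKernel d n).2).hasFiniteIntegral
        exact ENNReal.add_ne_top.2 ⟨this.ne, by simp⟩))
    rw [mul_zero] at h4
    exact tendsto_of_tendsto_of_tendsto_of_le_of_le tendsto_const_nhds h4 (fun _ => zero_le) h3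
  exact le_of_tendsto h2 (Eventually.of_forall h1)

/-- A bounded square integrable potential acts compactly: along sequences that are bounded in `H¹`
and converge weakly to zero, its quadratic form converges to zero. -/
theorem tendsto_integral_potential {u : ℕ → Rd d → ℝ} {g : ℕ → Fin d → Rd d → ℝ} {Q : Rd d → ℝ}
    {B C : ℝ} (hu : ∀ n, c.L2 (u n)) (hg : ∀ n j, HasWeakPartial j (u n) (g n j) ∧ c.L2 (g n j))
    (hC : ∀ n, ∫ x, u n x ^ 2 ∂c.μ ≤ C) (hC' : ∀ n, ∑ j, ∫ x, g n j x ^ 2 ∂c.μ ≤ C)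
    (hQ : c.L2 Q) (hB : ∀ᵐ x, |Q x| ≤ B)
    (hw : ∀ ψ : Rd d → ℝ, Continuous ψ → HasCompactSupport ψ →
      Tendsto (fun n => ∫ x, ψ x * u n x) atTop (𝓝 0)) :
    Tendsto (fun n => ∫ x, Q x * u n x ^ 2 ∂c.μ) atTop (𝓝 0) := by
  have hB0 : 0 ≤ B := by
    obtain ⟨x, hx⟩ := hB.exists
    exact (abs_nonneg _).trans hx
  have hC0 : 0 ≤ C := (integral_nonneg fun x => sq_nonneg _).trans (hC 0)
  have hQa : ∀ k n, c.L2 (fun x => Q x * moll k (u n) x) := fun k n =>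
    ((hu n).moll k).bdd_mul hQ.1 hQ.2.1 hB
  have hQd : ∀ k n, c.L2 (fun x => Q x * (moll k (u n) x - u n x)) := fun k n =>
    (((hu n).moll k).sub (hu n)).bdd_mul hQ.1 hQ.2.1 hB
  -- For fixed `k` weak convergence makes the mollifications tend to zero at every point; they are
  -- uniformly bounded, so a multiple of `Q²` dominates.
  have lim1 : ∀ k, Tendsto (fun n => ∫ x, (Q x * moll k (u n) x) ^ 2 ∂c.μ) atTop (𝓝 0) := by
    intro k
    obtain ⟨M, hM0, hM⟩ := abs_conv_le_sqrt (c := c) (isTest_mollKernel d k)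
    have hM' : ∀ n x, |moll k (u n) x| ≤ M * Real.sqrt C := fun n x =>
      (hM _ (hu n) x).trans (mul_le_mul_of_nonneg_left (Real.sqrt_le_sqrt (hC n)) hM0)
    have h0 : Tendsto (fun n => ∫ x, (Q x * moll k (u n) x) ^ 2 ∂c.μ) atTop
        (𝓝 (∫ x, (0 : ℝ) ∂c.μ)) := by
      refine tendsto_integral_of_dominated_convergence
        (fun x => (M * Real.sqrt C) ^ 2 * Q x ^ 2)
        (fun n => (hQa k n).2.2.integrable_sq.aestronglyMeasurable)
        (hQ.2.2.integrable_sq.const_mul _) (fun n => ae_of_all _ fun x => ?_)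
        (ae_of_all _ fun x => ?_)
      · rw [Real.norm_eq_abs, abs_of_nonneg (sq_nonneg _), mul_pow, mul_comm]
        refine mul_le_mul_of_nonneg_right ?_ (sq_nonneg _)
        rw [← sq_abs]
        exact pow_le_pow_left₀ (abs_nonneg _) (hM' n x) 2
      · have h1 := hw _ ((isTest_mollKernel d k).comp_sub x).1.continuous
          ((isTest_mollKernel d k).comp_sub x).2
        have h2 : Tendsto (fun n => (Q x * moll k (u n) x) ^ 2) atTop (𝓝 ((Q x * 0) ^ 2)) :=
          (h1.const_mul (Q x)).pow 2
        simpa using h2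
    simpa using h0
  -- One factor `u n` is replaced by its mollification; the error is small uniformly in `n`, which
  -- allows `k` to be fixed before `n` tends to infinity.
  have bound : ∀ k n : ℕ, |∫ x, Q x * u n x ^ 2 ∂c.μ| ≤ B * (2 / ((k : ℝ) + 2)) * C
      + Real.sqrt (C * ∫ x, (Q x * moll k (u n) x) ^ 2 ∂c.μ) := by
    intro k n
    have e : ∫ x, Q x * u n x ^ 2 ∂c.μ = ∫ x, (Q x * moll k (u n) x) * u n x ∂c.μ
        - ∫ x, (Q x * (moll k (u n) x - u n x)) * u n x ∂c.μ := by
      rw [← integral_sub ((hQa k n).integrable_mul (hu n)) ((hQd k n).integrable_mul (hu n))]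
      exact integral_congr_ae (ae_of_all _ fun x => by ring)
    have b1 : |∫ x, (Q x * moll k (u n) x) * u n x ∂c.μ|
        ≤ Real.sqrt (C * ∫ x, (Q x * moll k (u n) x) ^ 2 ∂c.μ) := by
      refine Real.abs_le_sqrt ((sq_integral_mul_le (hQa k n).2.2 (hu n).2.2).trans ?_)
      rw [mul_comm]
      exact mul_le_mul_of_nonneg_right (hC n) (integral_nonneg fun x => sq_nonneg _)
    have b2 : |∫ x, (Q x * (moll k (u n) x - u n x)) * u n x ∂c.μ|
        ≤ B * (2 / ((k : ℝ) + 2)) * C := by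
      refine abs_le_of_sq_le_sq ?_ (by positivity)
      refine (sq_integral_mul_le (hQd k n).2.2 (hu n).2.2).trans ?_
      have b3 : ∫ x, (Q x * (moll k (u n) x - u n x)) ^ 2 ∂c.μ
          ≤ B ^ 2 * ((2 / ((k : ℝ) + 2)) ^ 2 * C) := by
        calc _ ≤ ∫ x, B ^ 2 * (moll k (u n) x - u n x) ^ 2 ∂c.μ := by
              refine integral_mono_ae (hQd k n).2.2.integrable_sq
                ((((hu n).moll k).sub (hu n)).2.2.integrable_sq.const_mul _) (ae_mu ?_)
              filter_upwards [hB] with x hx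
              simp only [mul_pow]
              refine mul_le_mul_of_nonneg_right ?_ (sq_nonneg _)
              rw [← sq_abs (Q x)]
              exact pow_le_pow_left₀ (abs_nonneg _) hx 2
          _ ≤ _ := by
              rw [integral_const_mul]
              gcongr
              exact (integral_moll_sub_sq_le (hu n) (hg n) k).trans
                (mul_le_mul_of_nonneg_left (hC' n) (by positivity))
      calc _ ≤ B ^ 2 * ((2 / ((k : ℝ) + 2)) ^ 2 * C) * C :=
            mul_le_mul b3 (hC n) (integral_nonneg fun x => sq_nonneg _) (by positivity)
        _ = _ := by ring
    rw [e]
    exact (abs_sub _ _).trans (by linarith)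
  rw [Metric.tendsto_atTop]
  intro ε hε
  have hk : ∃ k : ℕ, B * (2 / ((k : ℝ) + 2)) * C < ε / 2 := by
    have h1 : Tendsto (fun k : ℕ => B * (2 / ((k : ℝ) + 2)) * C) atTop (𝓝 (B * 0 * C)) :=
      ((tendsto_const_nhds.div_atTop (tendsto_atTop_add_const_right _ _
        tendsto_natCast_atTop_atTop)).const_mul B).mul_const C
    rw [mul_zero, zero_mul] at h1
    exact (h1.eventually_lt_const (by positivity)).exists
  obtain ⟨k, hk⟩ := hk
  have h2 : Tendsto (fun n => Real.sqrt (C * ∫ x, (Q x * moll k (u n) x) ^ 2 ∂c.μ)) atTop (𝓝 0) := by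
    have := (Real.continuous_sqrt.tendsto (C * 0)).comp ((lim1 k).const_mul C)
    simpa [Function.comp_def] using this
  obtain ⟨N, hN⟩ := eventually_atTop.1 (h2.eventually_lt_const (half_pos hε))
  refine ⟨N, fun n hn => ?_⟩
  rw [Real.dist_eq, sub_zero]
  linarith [bound k n, hN n hn]

end PCell

end DefectModes

/-! ### Radial averages, mean value inequalities and a gradient bound. -/

namespace DefectModes

variable {d : ℕ}

theorem hasDerivAt_expNegInvGlue (t : ℝ) :
    HasDerivAt expNegInvGlue ((t⁻¹) ^ 2 * expNegInvGlue t) t := by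
  have h := expNegInvGlue.hasDerivAt_polynomial_eval_inv_mul 1 t
  simpa using h

theorem contDiff_inv_sq_mul_expNegInvGlue :
    ContDiff ℝ ∞ (fun t : ℝ => (t⁻¹) ^ 2 * expNegInvGlue t) := by
  have h := expNegInvGlue.contDiff_polynomial_eval_inv_mul (n := ⊤) ((Polynomial.X : Polynomial ℝ) ^ 2)
  simpa using h

/-- A pair of radial test functions `0 ≤ ψ ≤ η` with `∇ψ(y) = -η(y) y` and `∫ η = 1`. -/
theorem exists_radial_kernel (d : ℕ) : ∃ ψ η : Rd d → ℝ, IsTest ψ ∧ IsTest η ∧ (∀ y, 0 ≤ ψ y) ∧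
    (∀ y, ψ y ≤ η y) ∧ (∀ j y, pd (stdVec j) ψ y = -(y j * η y)) ∧ ∫ y, η y = 1 ∧
    (∀ y, η (-y) = η y) ∧ ∃ κ : ℝ, 0 < κ ∧ ∀ y, ‖y‖ ≤ 1 / 2 → κ ≤ η y := by
  set g : ℝ → ℝ := fun t => (t⁻¹) ^ 2 * expNegInvGlue t with hg
  have gpos : ∀ t, 0 ≤ g t := fun t => mul_nonneg (sq_nonneg _) (expNegInvGlue.nonneg t)
  set ψ₀ : Rd d → ℝ := fun y => expNegInvGlue (1 - ‖y‖ ^ 2) with hψ₀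
  -- Forced by the chain rule: `g` is the derivative of `expNegInvGlue`, and the gradient of `1 -
  -- ‖y‖²` is `-2y`. The comparison `ψ₀ ≤ η₀` holds since `1 - ‖y‖² ≤ 1` makes the factor `2 (1 -
  -- ‖y‖²)⁻²` at least one inside the ball.
  set η₀ : Rd d → ℝ := fun y => 2 * g (1 - ‖y‖ ^ 2) with hη₀
  have hsm : ContDiff ℝ ∞ (fun y : Rd d => 1 - ‖y‖ ^ 2) := contDiff_const.sub (contDiff_norm_sq ℝ)
  have hψs : ContDiff ℝ ∞ ψ₀ := expNegInvGlue.contDiff.comp hsm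
  have hηs : ContDiff ℝ ∞ η₀ := contDiff_const.mul (contDiff_inv_sq_mul_expNegInvGlue.comp hsm)
  have hz : ∀ y : Rd d, y ∉ Metric.closedBall (0 : Rd d) 1 → expNegInvGlue (1 - ‖y‖ ^ 2) = 0 := by
    intro y hy
    rw [mem_closedBall_zero_iff, not_le] at hy
    exact expNegInvGlue.zero_of_nonpos (by nlinarith)
  have hψc : HasCompactSupport ψ₀ :=
    HasCompactSupport.intro (isCompact_closedBall 0 1) fun y hy => hz y hy
  have hηc : HasCompactSupport η₀ :=
    HasCompactSupport.intro (isCompact_closedBall 0 1) fun y hy => by simp [hη₀, hg, hz y hy]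
  have hlow : ∀ y : Rd d, ‖y‖ ≤ 1 / 2 → 2 * Real.exp (-(4 / 3)) ≤ η₀ y := by
    intro y hy
    have h1 : 3 / 4 ≤ 1 - ‖y‖ ^ 2 := by nlinarith [norm_nonneg y]
    have h2 : 1 - ‖y‖ ^ 2 ≤ 1 := by nlinarith [norm_nonneg y]
    set t := 1 - ‖y‖ ^ 2
    have h3 : 1 ≤ t⁻¹ := (one_le_inv₀ (by linarith)).2 h2
    have h4 : t⁻¹ ≤ 4 / 3 := by
      rw [inv_le_comm₀ (by linarith) (by norm_num)]; linarith
    have h5 : Real.exp (-(4 / 3)) ≤ expNegInvGlue t := by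
      rw [expNegInvGlue, if_neg (by linarith)]
      exact Real.exp_le_exp.2 (by linarith)
    have h6 := Real.exp_pos (-(4 / 3))
    simp only [hη₀, hg]
    nlinarith [one_le_pow₀ h3 (n := 2)]
  have hη0 : ∀ y, 0 ≤ η₀ y := fun y => by have := gpos (1 - ‖y‖ ^ 2); simp only [hη₀]; linarith
  have hle : ∀ y, ψ₀ y ≤ η₀ y := by
    intro y
    simp only [hψ₀, hη₀, hg]
    rcases le_or_gt (1 - ‖y‖ ^ 2) 0 with h | h
    · simp [expNegInvGlue.zero_of_nonpos h]
    · have h2 : 1 - ‖y‖ ^ 2 ≤ 1 := by nlinarith [norm_nonneg y]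
      have h3 := one_le_pow₀ ((one_le_inv₀ h).2 h2) (n := 2)
      nlinarith [expNegInvGlue.nonneg (1 - ‖y‖ ^ 2)]
  have hpd : ∀ j y, pd (stdVec j) ψ₀ y = -(y j * η₀ y) := by
    intro j y
    have h1 : HasFDerivAt (fun y : Rd d => 1 - ‖y‖ ^ 2) (-(2 • innerSL ℝ y)) y := by
      have := (hasStrictFDerivAt_norm_sq y).hasFDerivAt.const_sub (1 : ℝ)
      exact this
    have h2 := (hasDerivAt_expNegInvGlue (1 - ‖y‖ ^ 2)).comp_hasFDerivAt y h1
    have h3 : fderiv ℝ ψ₀ y = _ := h2.fderiv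
    rw [pd, h3]
    have h4 : inner ℝ y (stdVec j) = y j := by
      rw [stdVec, EuclideanSpace.inner_single_right]; simp
    simp only [hη₀, hg]
    simp [h4]
    ring
  have hint : Integrable η₀ := hηs.continuous.integrable_of_hasCompactSupport hηc
  have hZ : 0 < ∫ y, η₀ y := by
    rw [integral_pos_iff_support_of_nonneg hη0 hint]
    refine lt_of_lt_of_le (Metric.measure_ball_pos volume (0 : Rd d) (r := 1 / 2) (by norm_num))
      (measure_mono fun y hy => ?_)
    have h1 := hlow y (by rw [mem_ball_zero_iff] at hy; linarith)
    have h6 := Real.exp_pos (-(4 / 3))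
    exact ne_of_gt (by linarith)
  set Z := ∫ y, η₀ y with hZd
  have hi : 0 < Z⁻¹ := inv_pos.2 hZ
  refine ⟨fun y => Z⁻¹ * ψ₀ y, fun y => Z⁻¹ * η₀ y, ⟨contDiff_const.mul hψs, hψc.mul_left⟩,
    ⟨contDiff_const.mul hηs, hηc.mul_left⟩, fun y => mul_nonneg hi.le (expNegInvGlue.nonneg _),
    fun y => mul_le_mul_of_nonneg_left (hle y) hi.le, fun j y => ?_, ?_, fun y => ?_,
    Z⁻¹ * (2 * Real.exp (-(4 / 3))), by positivity, fun y hy =>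
      mul_le_mul_of_nonneg_left (hlow y hy) hi.le⟩
  · rw [pd_const_mul hψs]
    simp only [hpd]
    ring
  · rw [integral_const_mul, ← hZd, inv_mul_cancel₀ hZ.ne']
  · simp [hη₀]

/-- Differentiation of a dilated average in the dilation parameter. -/
theorem hasDerivAt_dilated_average {κ f : Rd d → ℝ} (hκ : IsTest κ) (hf : ContDiff ℝ ∞ f)
    (x : Rd d) (r : ℝ) :
    HasDerivAt (fun r : ℝ => ∫ y, κ y * f (x + r • y)) (∫ y, κ y * pd y f (x + r • y)) r := by
  have hc : Continuous (fun p : ℝ × Rd d => pd p.2 f (x + p.1 • p.2)) := by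
    have h1 : Continuous (fun p : ℝ × Rd d => fderiv ℝ f (x + p.1 • p.2)) :=
      (hf.continuous_fderiv (by simp)).comp (by fun_prop)
    exact h1.clm_apply continuous_snd
  have hcκ : Continuous (fun p : ℝ × Rd d => κ p.2 * pd p.2 f (x + p.1 • p.2)) :=
    (hκ.1.continuous.comp continuous_snd).mul hc
  obtain ⟨C, hC⟩ := ((isCompact_closedBall r 1).prod hκ.2.isCompact).exists_bound_of_continuousOn
    hcκ.continuousOn
  have hfr : ∀ s : ℝ, Continuous (fun y => κ y * f (x + s • y)) := fun s =>
    hκ.1.continuous.mul (hf.continuous.comp (by fun_prop))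
  refine (hasDerivAt_integral_of_dominated_loc_of_deriv_le (μ := volume)
    (F := fun r y => κ y * f (x + r • y)) (F' := fun r y => κ y * pd y f (x + r • y)) (x₀ := r)
    (bound := (tsupport κ).indicator fun _ => C) (s := Metric.closedBall r 1)
    (Metric.closedBall_mem_nhds r one_pos) (Eventually.of_forall fun s =>
      (hfr s).aestronglyMeasurable)
    ((hfr r).integrable_of_hasCompactSupport hκ.2.mul_right)
    (hcκ.comp (Continuous.prodMk_right r)).aestronglyMeasurable (ae_of_all _ fun y s hs => ?_)
    ((integrable_indicator_iff hκ.2.isCompact.isClosed.measurableSet).2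
      (integrableOn_const hκ.2.isCompact.measure_lt_top.ne)) (ae_of_all _ fun y s hs => ?_)).2
  · by_cases hy : y ∈ tsupport κ
    · rw [indicator_of_mem hy]
      exact hC (s, y) ⟨hs, hy⟩
    · rw [indicator_of_notMem hy, image_eq_zero_of_notMem_tsupport hy]
      simp
  · have h1 : HasDerivAt (fun s : ℝ => x + s • y) y s := by
      simpa using ((hasDerivAt_id s).smul_const y).const_add x
    exact ((contDiff_differentiableAt hf (x + s • y)).hasFDerivAt.comp_hasDerivAt s h1).const_mul _

theorem pd_comp_dilate {f : Rd d → ℝ} (hf : ContDiff ℝ ∞ f) (x : Rd d) (r : ℝ) (v : Rd d) :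
    pd v (fun y => f (x + r • y)) = fun y => r * pd v f (x + r • y) := by
  ext y
  have h1 : HasFDerivAt (fun y : Rd d => x + r • y) (r • ContinuousLinearMap.id ℝ (Rd d)) y := by
    exact ((hasFDerivAt_id y).const_smul r).const_add x
  have h2 := (contDiff_differentiableAt hf (x + r • y)).hasFDerivAt.comp y h1
  have h3 : fderiv ℝ (fun y => f (x + r • y)) y = _ := h2.fderiv
  rw [pd, h3]
  simp [pd]

theorem contDiff_comp_dilate {f : Rd d → ℝ} (hf : ContDiff ℝ ∞ f) (x : Rd d) (r : ℝ) :
    ContDiff ℝ ∞ (fun y => f (x + r • y)) :=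
  hf.comp (contDiff_const.add (contDiff_id.const_smul r))

/-- The radial average of `W` at scale `r` has derivative controlled by the Laplacian of `W`. -/
theorem hasDerivAt_radial_average {ψ η W : Rd d → ℝ} (hψ : IsTest ψ) (hη : IsTest η)
    (h : ∀ j y, pd (stdVec j) ψ y = -(y j * η y)) (hW : ContDiff ℝ ∞ W) (x : Rd d) (r : ℝ) :
    HasDerivAt (fun r : ℝ => ∫ y, η y * W (x + r • y))
      (r * ∫ y, ψ y * ∑ j, pd (stdVec j) (pd (stdVec j) W) (x + r • y)) r := by
  convert! hasDerivAt_dilated_average hη hW x r using 1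
  have hs : ∀ j, ContDiff ℝ ∞ (fun y => pd (stdVec j) W (x + r • y)) := fun j =>
    contDiff_comp_dilate (contDiff_pd hW _) x r
  have hs2 : ∀ j, ContDiff ℝ ∞ (fun y => pd (stdVec j) (pd (stdVec j) W) (x + r • y)) := fun j =>
    contDiff_comp_dilate (contDiff_pd (contDiff_pd hW _) _) x r
  -- The radial derivative `y · ∇W` weighted by `η` is `-∇ψ · ∇W`; integration by parts moves the
  -- derivative onto `∇W` and produces the Laplacian with a factor `r`.
  have h1 : ∀ y, η y * pd y W (x + r • y)
      = -∑ j, pd (stdVec j) ψ y * pd (stdVec j) W (x + r • y) := by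
    intro y
    rw [pd_eq_sum, Finset.mul_sum, ← Finset.sum_neg_distrib]
    refine Finset.sum_congr rfl fun j _ => ?_
    rw [h]; ring
  have hi : ∀ j, Integrable (fun y => pd (stdVec j) ψ y * pd (stdVec j) W (x + r • y)) := fun j =>
    ((hψ.pd _).1.continuous.mul (hs j).continuous).integrable_of_hasCompactSupport
      (hψ.pd _).2.mul_right
  have hi2 : ∀ j, Integrable (fun y => ψ y * pd (stdVec j) (pd (stdVec j) W) (x + r • y)) := fun j =>
    (hψ.1.continuous.mul (hs2 j).continuous).integrable_of_hasCompactSupport hψ.2.mul_right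
  simp only [h1, Finset.mul_sum]
  rw [integral_neg, integral_finsetSum _ fun j _ => hi j, integral_finsetSum _ fun j _ => hi2 j,
    ← Finset.sum_neg_distrib, Finset.mul_sum]
  refine Finset.sum_congr rfl fun j _ => ?_
  rw [pd_mul_compact (hs j) hψ.1 hψ.2, pd_comp_dilate (contDiff_pd hW _), neg_neg,
    ← integral_const_mul]
  exact integral_congr_ae (ae_of_all _ fun y => by ring)

theorem integrable_dilated {κ f : Rd d → ℝ} (hκ : IsTest κ) (hf : Continuous f) (x : Rd d) (r : ℝ) :
    Integrable (fun y => κ y * f (x + r • y)) :=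
  (hκ.1.continuous.mul (hf.comp (by fun_prop))).integrable_of_hasCompactSupport hκ.2.mul_right

theorem conv_even_eq {η W : Rd d → ℝ} (he : ∀ y, η (-y) = η y) (x : Rd d) :
    conv η W x = ∫ y, η y * W (x + y) := by
  rw [conv_eq_swap, ← integral_neg_eq_self]
  exact integral_congr_ae (ae_of_all _ fun y => by simp [he])

/-- Sub-mean-value inequality. -/
theorem le_mul_conv_of_laplacian_ge {ψ η W : Rd d → ℝ} (hψ : IsTest ψ) (hη : IsTest η)
    (h0 : ∀ y, 0 ≤ ψ y) (hle : ∀ y, ψ y ≤ η y)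
    (h : ∀ j y, pd (stdVec j) ψ y = -(y j * η y)) (h1 : ∫ y, η y = 1) (he : ∀ y, η (-y) = η y)
    (hW : ContDiff ℝ ∞ W) (hW0 : ∀ x, 0 ≤ W x) {C : ℝ} (hC : 0 ≤ C)
    (hL : ∀ x, -(C * W x) ≤ ∑ j, pd (stdVec j) (pd (stdVec j) W) x) (x : Rd d) :
    W x ≤ Real.exp (C / 2) * conv η W x := by
  set m : ℝ → ℝ := fun r => ∫ y, η y * W (x + r • y) with hm
  have hΔ : ContDiff ℝ ∞ (fun x => ∑ j, pd (stdVec j) (pd (stdVec j) W) x) :=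
    ContDiff.sum fun j _ => contDiff_pd (contDiff_pd hW _) _
  -- The hypotheses give `m' ≥ -C r m`, where `ψ ≤ η` and `W ≥ 0` compare the average over `ψ` with
  -- `m`. The exponential is the integrating factor; comparing `r = 0` with `r = 1` finishes.
  have hd : ∀ r, HasDerivAt (fun r => Real.exp (C * r ^ 2 / 2) * m r)
      (Real.exp (C * r ^ 2 / 2) * (C * r) * m r + Real.exp (C * r ^ 2 / 2) *
        (r * ∫ y, ψ y * ∑ j, pd (stdVec j) (pd (stdVec j) W) (x + r • y))) r := by
    intro r
    have e1 : HasDerivAt (fun r : ℝ => C * r ^ 2 / 2) (C * r) r := by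
      convert! ((hasDerivAt_pow 2 r).const_mul C).div_const 2 using 1
      simp; ring
    exact e1.exp.mul (hasDerivAt_radial_average hψ hη h hW x r)
  have hmono : MonotoneOn (fun r => Real.exp (C * r ^ 2 / 2) * m r) (Set.Ici 0) := by
    refine monotoneOn_of_deriv_nonneg (convex_Ici 0)
      (fun r _ => (hd r).continuousAt.continuousWithinAt)
      (fun r _ => (hd r).differentiableAt.differentiableWithinAt) fun r hr => ?_
    rw [interior_Ici, Set.mem_Ioi] at hr
    rw [(hd r).deriv]
    have e2 : -(C * m r) ≤ ∫ y, ψ y * ∑ j, pd (stdVec j) (pd (stdVec j) W) (x + r • y) := by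
      rw [hm, ← integral_const_mul, ← integral_neg]
      refine integral_mono ((integrable_dilated hη hW.continuous x r).const_mul C).neg
        (integrable_dilated hψ hΔ.continuous x r) fun y => ?_
      have := mul_le_mul_of_nonneg_left (hL (x + r • y)) (h0 y)
      have := mul_le_mul_of_nonneg_right (hle y) (mul_nonneg hC (hW0 (x + r • y)))
      simp only
      nlinarith
    have := mul_le_mul_of_nonneg_left e2 hr.le
    have e3 := Real.exp_pos (C * r ^ 2 / 2)
    have : 0 ≤ Real.exp (C * r ^ 2 / 2) * (C * r * m r +
      r * ∫ y, ψ y * ∑ j, pd (stdVec j) (pd (stdVec j) W) (x + r • y)) :=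
      mul_nonneg e3.le (by nlinarith)
    linarith
  have := hmono (Set.mem_Ici.2 le_rfl) (Set.mem_Ici.2 zero_le_one) zero_le_one
  simp only [hm] at this
  simp only [zero_smul, add_zero, one_smul, ne_eq, OfNat.ofNat_ne_zero, not_false_eq_true, zero_pow,
    mul_zero, zero_div, Real.exp_zero, one_mul, one_pow, mul_one] at this
  rw [integral_mul_const, h1, one_mul] at this
  rwa [conv_even_eq he]

/-- Super-mean-value inequality. -/
theorem average_le_of_laplacian_le {ψ η W : Rd d → ℝ} (hψ : IsTest ψ) (hη : IsTest η)
    (h0 : ∀ y, 0 ≤ ψ y) (hle : ∀ y, ψ y ≤ η y)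
    (h : ∀ j y, pd (stdVec j) ψ y = -(y j * η y)) (h1 : ∫ y, η y = 1)
    (hW : ContDiff ℝ ∞ W) (hW0 : ∀ x, 0 ≤ W x) {C : ℝ} (hC : 0 ≤ C)
    (hL : ∀ x, ∑ j, pd (stdVec j) (pd (stdVec j) W) x ≤ C * W x) (x : Rd d) {R : ℝ} (hR : 0 ≤ R) :
    Real.exp (-(C * R ^ 2 / 2)) * ∫ y, η y * W (x + R • y) ≤ W x := by
  set m : ℝ → ℝ := fun r => ∫ y, η y * W (x + r • y) with hm
  have hΔ : ContDiff ℝ ∞ (fun x => ∑ j, pd (stdVec j) (pd (stdVec j) W) x) :=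
    ContDiff.sum fun j _ => contDiff_pd (contDiff_pd hW _) _
  have hd : ∀ r, HasDerivAt (fun r => Real.exp (-(C * r ^ 2 / 2)) * m r)
      (Real.exp (-(C * r ^ 2 / 2)) * (-(C * r)) * m r + Real.exp (-(C * r ^ 2 / 2)) *
        (r * ∫ y, ψ y * ∑ j, pd (stdVec j) (pd (stdVec j) W) (x + r • y))) r := by
    intro r
    have e1 : HasDerivAt (fun r : ℝ => -(C * r ^ 2 / 2)) (-(C * r)) r := by
      convert! (((hasDerivAt_pow 2 r).const_mul C).div_const 2).neg using 1
      simp; ring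
    exact e1.exp.mul (hasDerivAt_radial_average hψ hη h hW x r)
  have hmono : AntitoneOn (fun r => Real.exp (-(C * r ^ 2 / 2)) * m r) (Set.Ici 0) := by
    refine antitoneOn_of_deriv_nonpos (convex_Ici 0)
      (fun r _ => (hd r).continuousAt.continuousWithinAt)
      (fun r _ => (hd r).differentiableAt.differentiableWithinAt) fun r hr => ?_
    rw [interior_Ici, Set.mem_Ioi] at hr
    rw [(hd r).deriv]
    have e2 : ∫ y, ψ y * ∑ j, pd (stdVec j) (pd (stdVec j) W) (x + r • y) ≤ C * m r := by
      rw [hm, ← integral_const_mul]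
      refine integral_mono (integrable_dilated hψ hΔ.continuous x r)
        ((integrable_dilated hη hW.continuous x r).const_mul C) fun y => ?_
      have := mul_le_mul_of_nonneg_left (hL (x + r • y)) (h0 y)
      have := mul_le_mul_of_nonneg_right (hle y) (mul_nonneg hC (hW0 (x + r • y)))
      simp only
      nlinarith
    have := mul_le_mul_of_nonneg_left e2 hr.le
    have e3 := Real.exp_pos (-(C * r ^ 2 / 2))
    have : Real.exp (-(C * r ^ 2 / 2)) * (-(C * r) * m r +
      r * ∫ y, ψ y * ∑ j, pd (stdVec j) (pd (stdVec j) W) (x + r • y)) ≤ 0 :=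
      mul_nonpos_of_nonneg_of_nonpos e3.le (by nlinarith)
    linarith
  have := hmono (Set.mem_Ici.2 le_rfl) (Set.mem_Ici.2 hR) hR
  simp only [hm] at this
  simp only [zero_smul, add_zero, ne_eq, OfNat.ofNat_ne_zero, not_false_eq_true, zero_pow,
    mul_zero, zero_div, neg_zero, Real.exp_zero, one_mul] at this
  rwa [integral_mul_const, h1, one_mul] at this

/-- Interior gradient bound. -/
theorem exists_gradient_bound (j : Fin d) : ∃ K : ℝ, 0 ≤ K ∧ ∀ W : Rd d → ℝ, ContDiff ℝ ∞ W →
    ∀ B S : ℝ, (∀ x, |W x| ≤ B) → (∀ x, |∑ l, pd (stdVec l) (pd (stdVec l) W) x| ≤ S) →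
      ∀ x, |pd (stdVec j) W x| ≤ K * (B + S) := by
  obtain ⟨ψ, η, hψ, hη, h0, hle, h, h1, he, -⟩ := exists_radial_kernel d
  set a := ∫ y, |pd (stdVec j) ψ y| with ha
  set b := ∫ y, |pd (stdVec j) η y| with hb
  have ha0 : 0 ≤ a := integral_nonneg fun _ => abs_nonneg _
  have hb0 : 0 ≤ b := integral_nonneg fun _ => abs_nonneg _
  refine ⟨a + b, by positivity, fun W hW B S hB hS x => ?_⟩
  have hS0 : 0 ≤ S := (abs_nonneg _).trans (hS 0)
  have hB0 : 0 ≤ B := (abs_nonneg _).trans (hB 0)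
  have hΔ : ContDiff ℝ ∞ (fun x => ∑ j, pd (stdVec j) (pd (stdVec j) W) x) :=
    ContDiff.sum fun j _ => contDiff_pd (contDiff_pd hW _) _
  have bound : ∀ (κ f : Rd d → ℝ) (T r : ℝ), IsTest κ → Continuous f → (∀ x, |f x| ≤ T) →
      |∫ y, κ y * f (x + r • y)| ≤ (∫ y, |κ y|) * T := by
    intro κ f T r hκ hf hT
    rw [← integral_mul_const]
    refine (abs_integral_le_integral_abs).trans (integral_mono (integrable_dilated hκ hf x r).abs
      ((hκ.1.continuous.integrable_of_hasCompactSupport hκ.2).abs.mul_const _) fun y => ?_)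
    simp only [abs_mul]
    exact mul_le_mul_of_nonneg_left (hT _) (abs_nonneg _)
  -- At `r = 0` this average is the derivative itself. At `r = 1` the derivative moves onto `η`,
  -- which bounds it by `b * B`; in between its derivative in `r` is the average of the Laplacian
  -- against `∂_j ψ`, bounded by `a * S`.
  set G : ℝ → ℝ := fun r => ∫ y, η y * pd (stdVec j) W (x + r • y) with hG
  have hcomm : ∀ z, ∑ l, pd (stdVec l) (pd (stdVec l) (pd (stdVec j) W)) z
      = pd (stdVec j) (fun x => ∑ l, pd (stdVec l) (pd (stdVec l) W) x) z := by
    intro z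
    rw [pd_sum _ fun l => contDiff_pd (contDiff_pd hW _) _]
    refine Finset.sum_congr rfl fun l _ => ?_
    rw [pd_comm hW, pd_comm (contDiff_pd hW _)]
  have hG' : ∀ r, HasDerivAt G
      (-∫ y, pd (stdVec j) ψ y * ∑ l, pd (stdVec l) (pd (stdVec l) W) (x + r • y)) r := by
    intro r
    convert! hasDerivAt_radial_average hψ hη h (contDiff_pd hW (stdVec j)) x r using 1
    simp only [hcomm]
    rw [pd_mul_compact (contDiff_comp_dilate hΔ x r) hψ.1 hψ.2, neg_neg, pd_comp_dilate hΔ,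
      ← integral_const_mul]
    exact integral_congr_ae (ae_of_all _ fun y => by ring)
  have h2 : |G 1 - G 0| ≤ a * S := by
    have := (convex_univ (𝕜 := ℝ) (E := ℝ)).norm_image_sub_le_of_norm_hasDerivWithin_le (C := a * S)
      (fun r _ => (hG' r).hasDerivWithinAt) (fun r _ => by
        rw [norm_neg, Real.norm_eq_abs]
        exact bound _ _ S r (hψ.pd _) hΔ.continuous hS) (Set.mem_univ 0) (Set.mem_univ 1)
    simpa using this
  have h3 : G 0 = pd (stdVec j) W x := by simp [hG, integral_mul_const, h1]
  have h4 : |G 1| ≤ b * B := by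
    have e1 : G 1 = -∫ y, pd (stdVec j) η y * W (x + (1 : ℝ) • y) := by
      rw [pd_mul_compact (contDiff_comp_dilate hW x 1) hη.1 hη.2, neg_neg, pd_comp_dilate hW]
      simp [hG]
    rw [e1, abs_neg]
    exact bound _ _ B 1 (hη.pd _) hW.continuous hB
  rw [← h3]
  have h5 : |G 0| ≤ |G 1 - G 0| + |G 1| := by
    have := abs_sub (G 1) (G 1 - G 0)
    rw [sub_sub_cancel] at this; linarith
  nlinarith [mul_nonneg ha0 hB0, mul_nonneg hb0 hS0]

end DefectModes

/-! ### Kato's inequality, local boundedness and the strong maximum principle. -/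

namespace DefectModes

variable {d : ℕ}

theorem abs_sqrt_add_sq_sub_le {δ : ℝ} (hδ : 0 < δ) (a b : ℝ) :
    |Real.sqrt (δ ^ 2 + a ^ 2) - Real.sqrt (δ ^ 2 + b ^ 2)| ≤ |a - b| := by
  have hA := Real.sq_sqrt (by positivity : 0 ≤ δ ^ 2 + a ^ 2)
  have hB := Real.sq_sqrt (by positivity : 0 ≤ δ ^ 2 + b ^ 2)
  have h1 := Real.sqrt_pos.2 (by positivity : 0 < δ ^ 2 + a ^ 2)
  have h2 := Real.sqrt_pos.2 (by positivity : 0 < δ ^ 2 + b ^ 2)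
  set A := Real.sqrt (δ ^ 2 + a ^ 2)
  set B := Real.sqrt (δ ^ 2 + b ^ 2)
  have h3 : |a| ≤ A := abs_le_of_sq_le_sq (by nlinarith) h1.le
  have h4 : |b| ≤ B := abs_le_of_sq_le_sq (by nlinarith) h2.le
  have h5 : |a * b| ≤ A * B := by rw [abs_mul]; gcongr
  have h6 : δ ^ 2 + a * b ≤ A * B := by
    refine le_of_sq_le_sq ?_ (by positivity)
    rw [mul_pow, hA, hB]
    nlinarith [sq_nonneg (a - b), sq_nonneg δ, mul_nonneg (sq_nonneg δ) (sq_nonneg (a - b))]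
  exact sq_le_sq.1 (by nlinarith)

theorem contDiff_sqrt_add_sq {δ : ℝ} (hδ : 0 < δ) {u : Rd d → ℝ} (hu : ContDiff ℝ ∞ u) :
    ContDiff ℝ ∞ (fun x => Real.sqrt (δ ^ 2 + u x ^ 2)) :=
  (contDiff_const.add (hu.pow 2)).sqrt fun x => by positivity

/-- Obtained by differentiating `h² = δ² + u²` rather than the square root; a second differentiation
gives Kato's inequality. -/
theorem sqrt_add_sq_mul_pd {δ : ℝ} (hδ : 0 < δ) {u : Rd d → ℝ} (hu : ContDiff ℝ ∞ u) (v : Rd d) :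
    (fun x => Real.sqrt (δ ^ 2 + u x ^ 2) * pd v (fun x => Real.sqrt (δ ^ 2 + u x ^ 2)) x)
      = fun x => u x * pd v u x := by
  set h := fun x => Real.sqrt (δ ^ 2 + u x ^ 2) with hh
  have hs := contDiff_sqrt_add_sq hδ hu
  have e1 : (fun x => h x * h x) = fun x => δ ^ 2 + u x * u x := by
    ext x; rw [hh]; simp only; rw [Real.mul_self_sqrt (by positivity)]; ring
  have e2 := congrArg (pd v) e1
  rw [pd_mul hs hs, pd_add contDiff_const (hu.mul hu), pd_mul hu hu] at e2
  ext x
  have := congrFun e2 x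
  have e3 : pd v (fun _ : Rd d => δ ^ 2) x = 0 := by simp [pd]
  rw [e3] at this
  linarith

/-- Since `|u|` is at most the regularized absolute value. Minimizing sequences can thus be made
positive without raising their Dirichlet energy. -/
theorem sq_pd_sqrt_le {δ : ℝ} (hδ : 0 < δ) {u : Rd d → ℝ} (hu : ContDiff ℝ ∞ u) (v x : Rd d) :
    pd v (fun x => Real.sqrt (δ ^ 2 + u x ^ 2)) x ^ 2 ≤ pd v u x ^ 2 := by
  have e := congrFun (sqrt_add_sq_mul_pd hδ hu v) x
  have hA := Real.sq_sqrt (by positivity : 0 ≤ δ ^ 2 + u x ^ 2)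
  have hp := Real.sqrt_pos.2 (by positivity : 0 < δ ^ 2 + u x ^ 2)
  set A := Real.sqrt (δ ^ 2 + u x ^ 2)
  set p := pd v (fun x => Real.sqrt (δ ^ 2 + u x ^ 2)) x
  have : A ^ 2 * p ^ 2 ≤ A ^ 2 * pd v u x ^ 2 := by
    rw [← mul_pow, e, mul_pow]
    exact mul_le_mul_of_nonneg_right (by rw [hA]; nlinarith) (sq_nonneg _)
  exact le_of_mul_le_mul_left this (by positivity)

/-- Kato's inequality for the regularized absolute value. -/
theorem laplacian_sqrt_ge {δ : ℝ} (hδ : 0 < δ) {u : Rd d → ℝ} (hu : ContDiff ℝ ∞ u) (x : Rd d) :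
    -|∑ j, pd (stdVec j) (pd (stdVec j) u) x|
      ≤ ∑ j, pd (stdVec j) (pd (stdVec j) fun x => Real.sqrt (δ ^ 2 + u x ^ 2)) x := by
  have hs := contDiff_sqrt_add_sq hδ hu
  -- Differentiating `h ∂h = u ∂u` once more gives `(∂h)² + h ∂²h = (∂u)² + u ∂²u`, and `(∂h)² ≤
  -- (∂u)²`.
  have e : ∀ j : Fin d, u x * pd (stdVec j) (pd (stdVec j) u) x ≤ Real.sqrt (δ ^ 2 + u x ^ 2) *
      pd (stdVec j) (pd (stdVec j) fun x => Real.sqrt (δ ^ 2 + u x ^ 2)) x := by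
    intro j
    have e1 := congrArg (pd (stdVec j)) (sqrt_add_sq_mul_pd hδ hu (stdVec j))
    rw [pd_mul hs (contDiff_pd hs _), pd_mul hu (contDiff_pd hu _)] at e1
    have e2 := congrFun e1 x
    have e3 := sq_pd_sqrt_le hδ hu (stdVec j) x
    nlinarith
  have e' := Finset.sum_le_sum fun j (_ : j ∈ Finset.univ) => e j
  rw [← Finset.mul_sum, ← Finset.mul_sum] at e'
  have hA := Real.sq_sqrt (by positivity : 0 ≤ δ ^ 2 + u x ^ 2)
  have hp := Real.sqrt_pos.2 (by positivity : 0 < δ ^ 2 + u x ^ 2)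
  set A := Real.sqrt (δ ^ 2 + u x ^ 2)
  set S := ∑ j, pd (stdVec j) (pd (stdVec j) u) x
  have h3 : |u x| ≤ A := abs_le_of_sq_le_sq (by nlinarith) hp.le
  have h4 : |u x * S| ≤ A * |S| := by rw [abs_mul]; gcongr
  have h5 := (abs_le.1 h4).1
  refine le_of_mul_le_mul_left ?_ hp
  linarith

theorem laplacian_conv {κ f : Rd d → ℝ} (hκ : IsTest κ) (hf : LocallyIntegrable f) (j : Fin d) :
    pd (stdVec j) (pd (stdVec j) (conv κ f)) = conv (pd (stdVec j) (pd (stdVec j) κ)) f := by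
  rw [pd_conv hκ hf, pd_conv (hκ.pd _) hf]

theorem laplacian_conv_eq {κ f : Rd d → ℝ} (hκ : IsTest κ) (hf : ContDiff ℝ ∞ f) (j : Fin d) :
    pd (stdVec j) (pd (stdVec j) (conv κ f)) = conv κ (pd (stdVec j) (pd (stdVec j) f)) := by
  rw [pd_conv_eq hκ (hasWeakPartial_of_contDiff hf j),
    pd_conv_eq hκ (hasWeakPartial_of_contDiff (contDiff_pd hf _) j)]

namespace PCell

variable {c : PCell d}

theorem L2.of_abs_le [IsFiniteMeasure c.μ] {u h : Rd d → ℝ} (hu : c.L2 u) (hp : c.Per h)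
    (hm : AEStronglyMeasurable h volume) {C : ℝ} (hle : ∀ᵐ x, |h x| ≤ |u x| + C) :
    c.L2 h := by
  refine ⟨hp, hm, ?_⟩
  have h1 : MemLp (fun x => |u x| + C) 2 c.μ := hu.2.2.abs.add (memLp_const C)
  refine h1.mono' hm.restrict ?_
  filter_upwards [ae_mu (c := c) hle] with x hx
  simpa using hx

/-- `G 0` need not vanish, so constants must be square integrable; hence the finite measure. -/
theorem L2.comp_lipschitz [IsFiniteMeasure c.μ] {u : Rd d → ℝ} (hu : c.L2 u) {G : ℝ → ℝ}
    (hG : ∀ a b, |G a - G b| ≤ |a - b|) : c.L2 (fun x => G (u x)) := by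
  have hc : Continuous G := by
    have : LipschitzWith 1 G := LipschitzWith.of_dist_le_mul fun a b => by
      simpa [Real.dist_eq] using hG a b
    exact this.continuous
  refine hu.of_abs_le (hu.1.comp G) (hc.comp_aestronglyMeasurable hu.2.1) (C := |G 0|)
    (ae_of_all _ fun x => ?_)
  have h1 := hG (u x) 0
  have h2 := abs_sub_abs_le_abs_sub (G (u x)) (G 0)
  rw [sub_zero] at h1
  linarith

theorem tendsto_comp_lipschitz {u : ℕ → Rd d → ℝ} {u₀ : Rd d → ℝ} {G : ℝ → ℝ}
    (hG : ∀ a b, |G a - G b| ≤ |a - b|)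
    (t : Tendsto (fun n => eLpNorm (u n - u₀) 2 c.μ) atTop (𝓝 0)) :
    Tendsto (fun n => eLpNorm ((fun x => G (u n x)) - fun x => G (u₀ x)) 2 c.μ) atTop (𝓝 0) :=
  tendsto_of_tendsto_of_tendsto_of_le_of_le tendsto_const_nhds t (fun _ => zero_le) fun n =>
    eLpNorm_mono fun x => by simpa [Real.norm_eq_abs] using hG (u n x) (u₀ x)

theorem tendsto_conv {f : ℕ → Rd d → ℝ} {f₀ : Rd d → ℝ} (hf : ∀ n, c.L2 (f n)) (hf₀ : c.L2 f₀)
    (t : Tendsto (fun n => eLpNorm (f n - f₀) 2 c.μ) atTop (𝓝 0)) {κ : Rd d → ℝ} (hκ : IsTest κ)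
    (x : Rd d) : Tendsto (fun n => DefectModes.conv κ (f n) x) atTop
      (𝓝 (DefectModes.conv κ f₀ x)) :=
  tendsto_integral_test hf hf₀ t (hκ.comp_sub x).1.continuous (hκ.comp_sub x).2

/-- Local boundedness of periodic solutions of `Δu = f` with `|f| ≤ C (|u| + 1)`. -/
theorem ae_bounded_of_equation [IsFiniteMeasure c.μ] {u f : Rd d → ℝ} (hu : c.L2 u) (hf : c.L2 f)
    (h : ∀ n x, ∑ j, DefectModes.pd (stdVec j) (DefectModes.pd (stdVec j) (DefectModes.moll n u)) x
      = DefectModes.moll n f x)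
    {C : ℝ} (hC0 : 0 ≤ C) (hC : ∀ᵐ x, |f x| ≤ C * (|u x| + 1)) : ∃ B, ∀ᵐ x, |u x| ≤ B := by
  set G : ℝ → ℝ := fun a => Real.sqrt (1 ^ 2 + a ^ 2) with hG
  have hGl : ∀ a b, |G a - G b| ≤ |a - b| := abs_sqrt_add_sq_sub_le one_pos
  have hAl : ∀ a b : ℝ, abs (abs a - abs b) ≤ abs (a - b) := abs_abs_sub_abs_le_abs_sub
  set H : Rd d → ℝ := fun x => G (u x) with hH
  have hH2 : c.L2 H := hu.comp_lipschitz hGl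
  have hG0 : ∀ a, 0 ≤ G a := fun a => Real.sqrt_nonneg _
  have hG1 : ∀ a, |a| ≤ G a := fun a => Real.abs_le_sqrt (by nlinarith)
  have hG2 : ∀ a, 1 ≤ G a := fun a => Real.one_le_sqrt.2 (by nlinarith [sq_nonneg a])
  obtain ⟨ψ, η, hψ, hη, h0, hle, hpd, h1, he, -⟩ := exists_radial_kernel d
  obtain ⟨B, hB0, hB⟩ := abs_conv_le_sqrt (c := c) hη
  -- Kato's inequality holds for the smooth `moll n u`; averaging it with the fixed kernel of index
  -- `k` moves the derivatives to the kernel, so that `n` can tend to infinity. The factor 2 comes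
  -- from `|u| + 1 ≤ 2 G(u)`.
  have key : ∀ k x, -(2 * C * DefectModes.moll k H x) ≤
      ∑ j, DefectModes.pd (stdVec j) (DefectModes.pd (stdVec j) (DefectModes.moll k H)) x := by
    intro k x
    set κ := mollKernel d k with hκd
    have hκ := isTest_mollKernel d k
    have hκ0 := mollKernel_nonneg (d := d) k
    have hu2 := fun n => (hu.moll n).comp_lipschitz hGl
    have hf2 := fun n => (hf.moll n).comp_lipschitz hAl
    have hfa : c.L2 (fun x => |f x|) := hf.comp_lipschitz hAl
    have t1 : Tendsto (fun n => ∑ j, DefectModes.pd (stdVec j) (DefectModes.pd (stdVec j)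
        (DefectModes.conv κ fun x => G (DefectModes.moll n u x))) x) atTop
        (𝓝 (∑ j, DefectModes.pd (stdVec j) (DefectModes.pd (stdVec j)
          (DefectModes.moll k H)) x)) := by
      refine tendsto_finsetSum _ fun j _ => ?_
      have e1 := fun n => laplacian_conv hκ (hu2 n).locallyIntegrable j
      have e2 := laplacian_conv hκ hH2.locallyIntegrable j
      rw [show DefectModes.moll k H = DefectModes.conv κ H from rfl, e2]
      exact (tendsto_conv hu2 hH2 (tendsto_comp_lipschitz hGl (tendsto_moll hu))
        ((hκ.pd _).pd _) x).congr fun n => (congrFun (e1 n) x).symm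
    have t2 : Tendsto (fun n => DefectModes.conv κ (fun x => |DefectModes.moll n f x|) x) atTop
        (𝓝 (DefectModes.conv κ (fun x => |f x|) x)) :=
      tendsto_conv hf2 hfa (tendsto_comp_lipschitz hAl (tendsto_moll hf)) hκ x
    have t3 : ∀ n, -DefectModes.conv κ (fun x => |DefectModes.moll n f x|) x ≤
        ∑ j, DefectModes.pd (stdVec j) (DefectModes.pd (stdVec j)
        (DefectModes.conv κ fun x => G (DefectModes.moll n u x))) x := by
      intro n
      have hs := contDiff_moll hu.locallyIntegrable n
      have hsq := contDiff_sqrt_add_sq one_pos hs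
      have hli : ∀ j, LocallyIntegrable (DefectModes.pd (stdVec j) (DefectModes.pd (stdVec j)
          fun x => G (DefectModes.moll n u x))) := fun j =>
        (contDiff_pd (contDiff_pd hsq _) _).continuous.locallyIntegrable
      have hli2 : LocallyIntegrable (fun x => ∑ j, DefectModes.pd (stdVec j)
          (DefectModes.pd (stdVec j) fun x => G (DefectModes.moll n u x)) x) :=
        (ContDiff.sum fun j _ => contDiff_pd (contDiff_pd hsq _) _).continuous.locallyIntegrable
      have e1 : ∀ j, DefectModes.pd (stdVec j) (DefectModes.pd (stdVec j)
        (DefectModes.conv κ fun x => G (DefectModes.moll n u x))) = _ := fun j =>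
          laplacian_conv_eq hκ hsq j
      simp only [e1]
      have e2 := congrFun (conv_sum Finset.univ hκ hli) x
      rw [← e2]
      have e3 := congrFun (conv_const_mul κ (fun x => |DefectModes.moll n f x|) (-1)) x
      simp only [neg_mul, one_mul] at e3
      rw [← e3]
      refine conv_mono hκ hκ0 (hf2 n).locallyIntegrable.neg hli2 (ae_of_all _ fun y => ?_) x
      have := laplacian_sqrt_ge one_pos hs y
      rwa [h] at this
    refine le_trans ?_ (le_of_tendsto_of_tendsto' t2.neg t1 t3)
    rw [neg_le_neg_iff, DefectModes.moll, ← hκd,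
      ← congrFun (conv_const_mul κ H (2 * C)) x]
    refine conv_mono hκ hκ0 hfa.locallyIntegrable (hH2.const_mul _).locallyIntegrable ?_ x
    filter_upwards [hC] with y hy
    have := hG1 (u y)
    have := hG2 (u y)
    simp only [hH]
    nlinarith
  -- The sub-mean-value inequality bounds `moll k H` by an average, and the average by the `L²` norm
  -- of `H`, uniformly in `k`.
  have fin : ∀ k x, DefectModes.moll k H x
      ≤ Real.exp (2 * C / 2) * (B * Real.sqrt (∫ y, H y ^ 2 ∂c.μ)) := by
    intro k x
    have hpos : ∀ x, 0 ≤ DefectModes.moll k H x := fun x =>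
      integral_nonneg fun y => mul_nonneg (mollKernel_nonneg _ _) (hG0 _)
    refine (le_mul_conv_of_laplacian_ge hψ hη h0 hle hpd h1 he
      (contDiff_moll hH2.locallyIntegrable k) hpos (by positivity) (key k) x).trans ?_
    refine mul_le_mul_of_nonneg_left ?_ (Real.exp_pos _).le
    refine (le_abs_self _).trans ((hB _ (hH2.moll k) x).trans ?_)
    exact mul_le_mul_of_nonneg_left (Real.sqrt_le_sqrt (integral_moll_sq_le hH2 k)) hB0
  refine ⟨Real.exp (2 * C / 2) * (B * Real.sqrt (∫ y, H y ^ 2 ∂c.μ)), ?_⟩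
  filter_upwards [ae_tendsto_moll hH2.locallyIntegrable] with x hx
  exact (hG1 _).trans (le_of_tendsto' hx fun k => fin k x)

theorem moll_nonneg {v : Rd d → ℝ} (h : ∀ᵐ x, 0 ≤ v x) (n : ℕ) (x : Rd d) :
    0 ≤ DefectModes.moll n v x := by
  refine integral_nonneg_of_ae ?_
  filter_upwards [h] with y hy using mul_nonneg (mollKernel_nonneg _ _) hy

/-- A strong maximum principle. -/
theorem ae_pos_of_equation [IsFiniteMeasure c.μ] (hD : Bornology.IsBounded c.D)
    {v f : Rd d → ℝ} (hv : c.L2 v) (hf : c.L2 f)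
    (h : ∀ n x, ∑ j, DefectModes.pd (stdVec j) (DefectModes.pd (stdVec j) (DefectModes.moll n v)) x
      = DefectModes.moll n f x)
    {C : ℝ} (hC0 : 0 ≤ C) (hC : ∀ᵐ x, f x ≤ C * v x) (h0 : ∀ᵐ x, 0 ≤ v x)
    (hpos : 0 < ∫ x, v x ∂c.μ) : ∃ a, 0 < a ∧ ∀ᵐ x, a ≤ v x := by
  obtain ⟨ψ, η, hψ, hη, hψ0, hle, hpd, h1, -, κ₀, hκ₀, hκ⟩ := exists_radial_kernel d
  obtain ⟨ρ, hρ⟩ := hD.subset_ball 0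
  -- Large enough that `‖z - x‖ / R ≤ 1 / 2` for all `x`, `z` in the domain, where `η` is at least
  -- `κ₀`. A single average about `x` then sees the whole domain.
  set R : ℝ := 4 * (|ρ| + 1) with hR
  have hR0 : 0 < R := by positivity
  set I := ∫ x, v x ∂c.μ with hI
  set r : ℝ := |(R ^ Module.finrank ℝ (Rd d))⁻¹| with hr
  have hr0 : 0 < r := by positivity
  have tI : Tendsto (fun n => ∫ x, DefectModes.moll n v x ∂c.μ) atTop (𝓝 I) := by
    have := tendsto_integral_mul_of_tendsto (g := fun _ _ => (1 : ℝ)) (g₀ := fun _ => 1)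
      (fun n => (hv.moll n).2.2) (fun _ => memLp_const (μ := c.μ) 1) hv.2.2 (memLp_const 1)
      (tendsto_moll hv) (by simp)
    simpa using this
  have low : ∀ n x, x ∈ c.D → Real.exp (-(C * R ^ 2 / 2)) * (r * (κ₀ * ∫ x, DefectModes.moll n v x ∂c.μ))
      ≤ DefectModes.moll n v x := by
    intro n x hx
    set W := DefectModes.moll n v with hW
    have hWs := contDiff_moll hv.locallyIntegrable n
    have hW0 : ∀ x, 0 ≤ W x := moll_nonneg h0 n
    have hL : ∀ x, ∑ j, DefectModes.pd (stdVec j) (DefectModes.pd (stdVec j) W) x ≤ C * W x := by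
      intro x
      rw [h, hW, DefectModes.moll, DefectModes.moll, ← congrFun (conv_const_mul _ v C) x]
      exact conv_mono (isTest_mollKernel d n) (mollKernel_nonneg n) hf.locallyIntegrable
        (hv.const_mul C).locallyIntegrable hC x
    refine le_trans ?_ (average_le_of_laplacian_le hψ hη hψ0 hle hpd h1 hWs hW0 hC0 hL x hR0.le)
    refine mul_le_mul_of_nonneg_left ?_ (Real.exp_pos _).le
    have e1 : ∫ y, η y * W (x + R • y) = r * ∫ z, η (R⁻¹ • z) * W (x + z) := by
      rw [← smul_eq_mul, hr, ← Measure.integral_comp_smul]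
      refine integral_congr_ae (ae_of_all _ fun y => ?_)
      simp only
      rw [smul_smul, inv_mul_cancel₀ hR0.ne', one_smul]
    have e2 : ∫ z, η (R⁻¹ • z) * W (x + z) = ∫ z, η (R⁻¹ • (z - x)) * W z := by
      rw [← integral_add_left_eq_self (μ := volume) (fun z => η (R⁻¹ • (z - x)) * W z) x]
      simp
    rw [e1, e2]
    refine mul_le_mul_of_nonneg_left ?_ hr0.le
    have hcs : HasCompactSupport (fun z => η (R⁻¹ • (z - x))) := by
      have := hη.2.comp_homeomorph ((Homeomorph.subRight x).trans
        (Homeomorph.smulOfNeZero R⁻¹ (inv_pos.2 hR0).ne'))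
      exact this
    have hi : Integrable (fun z => η (R⁻¹ • (z - x)) * W z) :=
      ((hη.1.continuous.comp (by fun_prop)).mul hWs.continuous).integrable_of_hasCompactSupport
        hcs.mul_right
    have hn : ∀ z, 0 ≤ η (R⁻¹ • (z - x)) * W z := fun z =>
      mul_nonneg ((hψ0 _).trans (hle _)) (hW0 z)
    rw [← integral_const_mul]
    refine le_trans ?_ (setIntegral_le_integral (s := c.D) hi (ae_of_all _ hn))
    refine integral_mono_ae (((hv.moll n).2.2.integrable (by norm_num)).const_mul κ₀) hi.integrableOn ?_
    filter_upwards [ae_restrict_mem₀ c.fund.nullMeasurableSet] with z hz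
    refine mul_le_mul_of_nonneg_right (hκ _ ?_) (hW0 z)
    have a1 := mem_ball_zero_iff.1 (hρ hz)
    have a2 := mem_ball_zero_iff.1 (hρ hx)
    have a3 := norm_sub_le z x
    have a4 := le_abs_self ρ
    rw [norm_smul, norm_inv, Real.norm_of_nonneg hR0.le, inv_mul_le_iff₀ hR0]
    linarith
  refine ⟨Real.exp (-(C * R ^ 2 / 2)) * (r * (κ₀ * I)), by positivity, ?_⟩
  refine ae_of_ae_mu (c := c) (fun γ => ?_) ?_
  · filter_upwards [hv.1 γ] with x hx hy
    rwa [hx] at hy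
  · filter_upwards [ae_mu (c := c) (ae_tendsto_moll hv.locallyIntegrable),
      ae_restrict_mem₀ c.fund.nullMeasurableSet] with x hx hxD
    exact le_of_tendsto_of_tendsto' (((tI.const_mul κ₀).const_mul r).const_mul _) hx
      fun n => low n x hxD

end PCell

/-- The interior gradient bound applies to each mollification with constants independent of `n`, and
passes to the almost everywhere limit. -/
theorem ae_bounded_weakPartial {u f g : Rd d → ℝ} {j : Fin d} (hg : HasWeakPartial j u g)
    (h : ∀ n x, ∑ j, pd (stdVec j) (pd (stdVec j) (moll n u)) x = moll n f x)
    {B S : ℝ} (hB : ∀ᵐ x, |u x| ≤ B) (hS : ∀ᵐ x, |f x| ≤ S) : ∃ K, ∀ᵐ x, |g x| ≤ K := by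
  obtain ⟨K, hK0, hK⟩ := exists_gradient_bound j
  refine ⟨K * (B + S), ?_⟩
  filter_upwards [ae_tendsto_moll hg.2.1] with x hx
  refine le_of_tendsto' hx.abs fun n => ?_
  rw [← pd_moll hg n]
  exact hK _ (contDiff_moll hg.1 n) B S (abs_moll_le hB n)
    (fun x => by rw [h]; exact abs_moll_le hS n x) x

end DefectModes

/-! ### Quadratic forms with bounded potential and their minimizing sequences. -/

namespace DefectModes

namespace PCell

variable {d : ℕ} {c : PCell d} {m : ℕ}

theorem foldr_pd_lin {φ ψ : Rd d → ℝ} (hφ : ContDiff ℝ ∞ φ) (hψ : ContDiff ℝ ∞ ψ) (s t : ℝ)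
    (vs : List (Rd d)) : ContDiff ℝ ∞ (vs.foldr DefectModes.pd φ) ∧
      vs.foldr DefectModes.pd (fun x => s * φ x + t * ψ x)
        = fun x => s * vs.foldr DefectModes.pd φ x + t * vs.foldr DefectModes.pd ψ x := by
  induction vs generalizing φ ψ with
  | nil => exact ⟨hφ, rfl⟩
  | cons a l ih =>
    refine ⟨contDiff_pd (ih hφ hψ).1 a, ?_⟩
    simp only [List.foldr_cons]
    rw [(ih hφ hψ).2, pd_add (contDiff_const.mul (ih hφ hψ).1) (contDiff_const.mul (ih hψ hφ).1),
      pd_const_mul (ih hφ hψ).1, pd_const_mul (ih hψ hφ).1]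

theorem Sm.lin {φ ψ : Rd d → ℝ} (hφ : c.Sm φ) (hψ : c.Sm ψ) (s t : ℝ) :
    c.Sm (fun x => s * φ x + t * ψ x) := by
  refine ⟨(contDiff_const.mul hφ.1).add (contDiff_const.mul hψ.1),
    fun γ x => by simp only [hφ.2.1 γ x, hψ.2.1 γ x], fun vs => ?_⟩
  rw [(foldr_pd_lin hφ.1 hψ.1 s t vs).2]
  exact ((hφ.2.2 vs).const_mul s).add ((hψ.2.2 vs).const_mul t)

theorem Sm.const_mul {φ : Rd d → ℝ} (hφ : c.Sm φ) (s : ℝ) : c.Sm (fun x => s * φ x) := by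
  simpa using hφ.lin hφ s 0

/-- A bounded measurable invariant potential. -/
def Pot (c : PCell d) (P : Rd d → ℝ) (K : ℝ) : Prop :=
  c.Per P ∧ AEStronglyMeasurable P volume ∧ ∀ᵐ x, |P x| ≤ K

theorem Pot.mul {P : Rd d → ℝ} {K : ℝ} (hP : c.Pot P K) {f : Rd d → ℝ} (hf : c.L2 f) :
    c.L2 (fun x => P x * f x) := hf.bdd_mul hP.1 hP.2.1 hP.2.2

theorem Pot.sub_const {P : Rd d → ℝ} {K : ℝ} (hP : c.Pot P K) (a : ℝ) :
    c.Pot (fun x => P x - a) (K + |a|) :=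
  ⟨hP.1.comp (fun t => t - a), hP.2.1.sub aestronglyMeasurable_const, by
    filter_upwards [hP.2.2] with x hx
    exact (abs_sub _ _).trans (by linarith)⟩

theorem Pot.nonneg {P : Rd d → ℝ} {K : ℝ} (hP : c.Pot P K) : 0 ≤ K := by
  obtain ⟨x, hx⟩ := hP.2.2.exists
  exact (abs_nonneg _).trans hx

/-- The bilinear form of `-∑ ∂_b² + P` on smooth functions. -/
noncomputable def form (c : PCell d) (b : Fin m → Rd d) (P φ ψ : Rd d → ℝ) : ℝ :=
  ∑ i, ∫ x, DefectModes.pd (b i) φ x * DefectModes.pd (b i) ψ x ∂c.μ + ∫ x, P x * φ x * ψ x ∂c.μ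

variable {b : Fin m → Rd d} {P : Rd d → ℝ} {K : ℝ}

theorem form_comm (φ ψ : Rd d → ℝ) : c.form b P φ ψ = c.form b P ψ φ := by
  simp only [form, mul_comm, mul_left_comm]

theorem form_lin (hP : c.Pot P K) {φ ψ θ : Rd d → ℝ} (hφ : c.Sm φ) (hψ : c.Sm ψ) (hθ : c.Sm θ)
    (s t : ℝ) : c.form b P (fun x => s * φ x + t * ψ x) θ
      = s * c.form b P φ θ + t * c.form b P ψ θ := by
  have h1 : ∀ i, ∫ x, DefectModes.pd (b i) (fun x => s * φ x + t * ψ x) x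
      * DefectModes.pd (b i) θ x ∂c.μ = s * ∫ x, DefectModes.pd (b i) φ x * DefectModes.pd (b i) θ x ∂c.μ
        + t * ∫ x, DefectModes.pd (b i) ψ x * DefectModes.pd (b i) θ x ∂c.μ := by
    intro i
    rw [pd_add (contDiff_const.mul hφ.1) (contDiff_const.mul hψ.1), pd_const_mul hφ.1,
      pd_const_mul hψ.1, ← integral_const_mul, ← integral_const_mul, ← integral_add
        (((hφ.pd _).l2.integrable_mul (hθ.pd _).l2).const_mul s)
        (((hψ.pd _).l2.integrable_mul (hθ.pd _).l2).const_mul t)]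
    exact integral_congr_ae (ae_of_all _ fun x => by ring)
  have h2 : ∫ x, P x * (s * φ x + t * ψ x) * θ x ∂c.μ
      = s * ∫ x, P x * φ x * θ x ∂c.μ + t * ∫ x, P x * ψ x * θ x ∂c.μ := by
    rw [← integral_const_mul, ← integral_const_mul, ← integral_add
        (((hP.mul hφ.l2).integrable_mul hθ.l2).const_mul s)
        (((hP.mul hψ.l2).integrable_mul hθ.l2).const_mul t)]
    exact integral_congr_ae (ae_of_all _ fun x => by ring)
  simp only [form, h1, h2, Finset.sum_add_distrib, ← Finset.mul_sum]
  ring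

/-- Cauchy-Schwarz for a nonnegative form. -/
theorem sq_form_le (hP : c.Pot P K) (h0 : ∀ φ, c.Sm φ → 0 ≤ c.form b P φ φ) {φ ψ : Rd d → ℝ}
    (hφ : c.Sm φ) (hψ : c.Sm ψ) :
    c.form b P φ ψ ^ 2 ≤ c.form b P φ φ * c.form b P ψ ψ := by
  have key : ∀ t : ℝ, 0 ≤ c.form b P ψ ψ * (t * t) + (2 * c.form b P φ ψ) * t + c.form b P φ φ := by
    intro t
    have h1 := h0 _ (hφ.lin hψ 1 t)
    rw [form_lin hP hφ hψ (hφ.lin hψ 1 t), form_comm φ, form_comm ψ, form_lin hP hφ hψ hφ,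
      form_lin hP hφ hψ hψ, form_comm ψ φ] at h1
    linarith
  have := discrim_le_zero key
  rw [discrim] at this
  nlinarith

theorem form_eq_integral (hP : c.Pot P K) {φ ψ : Rd d → ℝ} (hφ : c.Sm φ) (hψ : c.Sm ψ) :
    c.form b P φ ψ = ∫ x, φ x * (P x * ψ x
      - ∑ i, DefectModes.pd (b i) (DefectModes.pd (b i) ψ) x) ∂c.μ := by
  have h1 : ∀ i, Integrable (fun x => φ x * DefectModes.pd (b i) (DefectModes.pd (b i) ψ) x) c.μ :=
    fun i => hφ.l2.integrable_mul ((hψ.pd _).pd _).l2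
  have h2 : Integrable (fun x => φ x * (P x * ψ x)) c.μ := hφ.l2.integrable_mul (hP.mul hψ.l2)
  simp only [mul_sub, Finset.mul_sum]
  rw [integral_sub h2 (integrable_finsetSum _ fun i _ => h1 i), integral_finsetSum _ fun i _ => h1 i,
    form]
  simp only [hφ.integral_pd_mul (hψ.pd _), Finset.sum_neg_distrib]
  rw [neg_add_eq_sub]
  congr 1
  exact integral_congr_ae (ae_of_all _ fun x => by ring)

/-- Weak limits of minimizing sequences of a nonnegative form are in its kernel. -/
theorem weak_equation_of_minimizing (hP : c.Pot P K) (h0 : ∀ φ, c.Sm φ → 0 ≤ c.form b P φ φ)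
    {φ : ℕ → Rd d → ℝ} (hφ : ∀ n, c.Sm (φ n))
    (t : Tendsto (fun n => c.form b P (φ n) (φ n)) atTop (𝓝 0)) {v : Rd d → ℝ}
    (hv : ∀ g, MemLp g 2 c.μ → Tendsto (fun n => ∫ x, φ n x * g x ∂c.μ) atTop
      (𝓝 (∫ x, v x * g x ∂c.μ))) {ψ : Rd d → ℝ} (hψ : c.Sm ψ) :
    ∫ x, v x * (P x * ψ x - ∑ i, DefectModes.pd (b i) (DefectModes.pd (b i) ψ) x) ∂c.μ = 0 := by
  have hg : c.L2 (fun x => P x * ψ x - ∑ i, DefectModes.pd (b i) (DefectModes.pd (b i) ψ) x) :=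
    (hP.mul hψ.l2).sub (L2.sum _ fun i => ((hψ.pd _).pd _).l2)
  have h1 := hv _ hg.2.2
  simp only [← form_eq_integral hP (hφ _) hψ] at h1
  -- Cauchy-Schwarz for the nonnegative form: its square is at most the product of the two energies,
  -- one of which tends to zero.
  have h2 : Tendsto (fun n => c.form b P (φ n) ψ) atTop (𝓝 0) := by
    have h3 : Tendsto (fun n => Real.sqrt (c.form b P (φ n) (φ n) * c.form b P ψ ψ)) atTop (𝓝 0) := by
      have := (t.mul_const (c.form b P ψ ψ)).sqrt
      simpa using this
    exact squeeze_zero_norm (fun n => Real.abs_le_sqrt (sq_form_le hP h0 (hφ n) hψ)) h3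
  exact tendsto_nhds_unique h1 h2

/-- The quadratic form of `-∑ ∂_b² + P` evaluated through weak partial derivatives. -/
noncomputable def wform (c : PCell d) (b : Fin m → Rd d) (P u : Rd d → ℝ) (g : Fin d → Rd d → ℝ) : ℝ :=
  ∑ i, ∫ x, (∑ j, b i j * g j x) ^ 2 ∂c.μ + ∫ x, P x * u x ^ 2 ∂c.μ

/-- Mollification commutes with weak derivatives, so inequalities known for smooth functions extend
to all of `H¹`. -/
theorem tendsto_form_moll (hP : c.Pot P K) {u : Rd d → ℝ} {g : Fin d → Rd d → ℝ} (hu : c.L2 u)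
    (hg : ∀ j, HasWeakPartial j u (g j) ∧ c.L2 (g j)) :
    Tendsto (fun n => c.form b P (DefectModes.moll n u) (DefectModes.moll n u)) atTop
      (𝓝 (c.wform b P u g)) := by
  have hG : ∀ i, c.L2 (fun x => ∑ j, b i j * g j x) := fun i =>
    L2.sum _ fun j => (hg j).2.const_mul _
  have h1 : ∀ i n, DefectModes.pd (b i) (DefectModes.moll n u)
      = DefectModes.moll n (fun x => ∑ j, b i j * g j x) := by
    intro i n
    ext x
    rw [pd_eq_sum, DefectModes.moll, DefectModes.moll,
      conv_sum _ (isTest_mollKernel d n) fun j => ((hg j).2.const_mul _).locallyIntegrable]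
    refine Finset.sum_congr rfl fun j _ => ?_
    rw [conv_const_mul, pd_conv_eq (isTest_mollKernel d n) (hg j).1]
  refine Tendsto.add (tendsto_finsetSum _ fun i _ => ?_) ?_
  · simp only [h1, ← sq]
    exact tendsto_integral_sq (fun n => (hG i).moll n) (hG i) (tendsto_moll (hG i))
  · have h2 : Tendsto (fun n => eLpNorm ((fun x => P x * DefectModes.moll n u x) - fun x => P x * u x)
        2 c.μ) atTop (𝓝 0) := by
      have h3 : ∀ n, eLpNorm ((fun x => P x * DefectModes.moll n u x) - fun x => P x * u x) 2 c.μ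
          ≤ ENNReal.ofReal K * eLpNorm (DefectModes.moll n u - u) 2 c.μ := by
        intro n
        refine eLpNorm_le_mul_eLpNorm_of_ae_le_mul ?_ 2
        filter_upwards [ae_mu (c := c) hP.2.2] with x hx
        simp only [Pi.sub_apply, ← mul_sub, norm_mul, Real.norm_eq_abs]
        exact mul_le_mul_of_nonneg_right hx (abs_nonneg _)
      have h4 := ENNReal.Tendsto.const_mul (a := ENNReal.ofReal K) (tendsto_moll hu) (Or.inr (by simp))
      rw [mul_zero] at h4
      exact tendsto_of_tendsto_of_tendsto_of_le_of_le tendsto_const_nhds h4 (fun _ => zero_le) h3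
    have := tendsto_integral_mul_of_tendsto (fun n => (hP.mul (hu.moll n)).2.2)
      (fun n => (hu.moll n).2.2) (hP.mul hu).2.2 hu.2.2 h2 (tendsto_moll hu)
    simpa only [sq, mul_assoc] using! this

theorem wform_nonneg (hP : c.Pot P K) (h0 : ∀ φ, c.Sm φ → 0 ≤ c.form b P φ φ) {u : Rd d → ℝ}
    {g : Fin d → Rd d → ℝ} (hu : c.L2 u) (hg : ∀ j, HasWeakPartial j u (g j) ∧ c.L2 (g j)) :
    0 ≤ c.wform b P u g :=
  ge_of_tendsto' (tendsto_form_moll hP hu hg) fun n => h0 _ (hu.sm_moll n)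

theorem form_sub_const (hP : c.Pot P K) {φ : Rd d → ℝ} (hφ : c.Sm φ) (a : ℝ) :
    c.form b (fun x => P x - a) φ φ = c.form b P φ φ - a * ∫ x, φ x ^ 2 ∂c.μ := by
  have h1 : Integrable (fun x => P x * φ x * φ x) c.μ := (hP.mul hφ.l2).integrable_mul hφ.l2
  have h2 : Integrable (fun x => φ x ^ 2) c.μ := hφ.l2.2.2.integrable_sq
  rw [form, form, ← integral_const_mul, add_sub_assoc, ← integral_sub h1 (h2.const_mul a)]
  congr 1
  exact integral_congr_ae (ae_of_all _ fun x => by ring)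

/-- Gårding's inequality from `P ≥ -K`: bounds on the form and the `L²` norm give a bound on the
gradient. -/
theorem form_ge (hP : c.Pot P K) {φ : Rd d → ℝ} (hφ : c.Sm φ) :
    ∑ i, ∫ x, DefectModes.pd (b i) φ x ^ 2 ∂c.μ ≤ c.form b P φ φ + K * ∫ x, φ x ^ 2 ∂c.μ := by
  have h1 : Integrable (fun x => P x * φ x * φ x) c.μ := (hP.mul hφ.l2).integrable_mul hφ.l2
  have h2 : Integrable (fun x => φ x ^ 2) c.μ := hφ.l2.2.2.integrable_sq
  have h3 : 0 ≤ ∫ x, (P x * φ x * φ x + K * φ x ^ 2) ∂c.μ := by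
    refine integral_nonneg_of_ae ?_
    filter_upwards [ae_mu (c := c) hP.2.2] with x hx
    have := (abs_le.1 hx).1
    have := sq_nonneg (φ x)
    simp only [Pi.zero_apply]
    nlinarith
  rw [integral_add h1 (h2.const_mul K), integral_const_mul] at h3
  simp only [form, ← sq]
  linarith

/-- The infimum of the form on normalized smooth functions. -/
theorem exists_inf (hP : c.Pot P K) (hne : ∃ φ, c.Sm φ ∧ ∫ x, φ x ^ 2 ∂c.μ = 1) :
    ∃ l : ℝ, -K ≤ l ∧ (∀ φ, c.Sm φ → l * ∫ x, φ x ^ 2 ∂c.μ ≤ c.form b P φ φ) ∧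
      ∃ φ : ℕ → Rd d → ℝ, (∀ n, c.Sm (φ n)) ∧ (∀ n, ∫ x, φ n x ^ 2 ∂c.μ = 1) ∧
        Tendsto (fun n => c.form b P (φ n) (φ n)) atTop (𝓝 l) := by
  set S : Set ℝ := {e | ∃ φ, c.Sm φ ∧ ∫ x, φ x ^ 2 ∂c.μ = 1 ∧ c.form b P φ φ = e} with hS
  have hSne : S.Nonempty := by
    obtain ⟨φ, h1, h2⟩ := hne
    exact ⟨_, φ, h1, h2, rfl⟩
  have hlow : ∀ e ∈ S, -K ≤ e := by
    rintro _ ⟨φ, h1, h2, rfl⟩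
    have := form_ge (b := b) hP h1
    have h3 : 0 ≤ ∑ i, ∫ x, DefectModes.pd (b i) φ x ^ 2 ∂c.μ :=
      Finset.sum_nonneg fun i _ => integral_nonneg fun x => sq_nonneg _
    rw [h2] at this
    linarith
  have hbdd : BddBelow S := ⟨-K, hlow⟩
  obtain ⟨s, -, hs, hsS⟩ := exists_seq_tendsto_sInf hSne hbdd
  choose φ h1 h2 h3 using hsS
  refine ⟨sInf S, le_csInf hSne hlow, fun φ hφ => ?_, φ, h1, h2, by simpa only [h3] using hs⟩
  have hn : 0 ≤ ∫ x, φ x ^ 2 ∂c.μ := integral_nonneg fun x => sq_nonneg _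
  -- A function of zero norm cannot be normalized; for it the claim reduces to nonnegativity of the
  -- gradient terms.
  rcases hn.eq_or_lt with h | h
  · rw [← h, mul_zero]
    have := form_ge (b := b) hP hφ
    rw [← h, mul_zero, add_zero] at this
    exact le_trans (Finset.sum_nonneg fun i _ => integral_nonneg fun x => sq_nonneg _) this
  · set a := ∫ x, φ x ^ 2 ∂c.μ with ha
    set s := (Real.sqrt a)⁻¹ with hsd
    have hs2 : s ^ 2 = a⁻¹ := by rw [hsd, inv_pow, Real.sq_sqrt h.le]
    have e0 : (fun x => s * φ x) = fun x => s * φ x + 0 * φ x := by ext x; ring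
    have e1 : c.form b P (fun x => s * φ x) (fun x => s * φ x) = a⁻¹ * c.form b P φ φ := by
      have hsφ := hφ.const_mul s
      conv_lhs => enter [4]; rw [e0]
      rw [form_lin hP hφ hφ hsφ, form_comm φ, e0, form_lin hP hφ hφ hφ, ← hs2]
      ring
    have e2 : c.form b P (fun x => s * φ x) (fun x => s * φ x) ∈ S := by
      refine ⟨_, hφ.const_mul s, ?_, rfl⟩
      simp only [mul_pow]
      rw [integral_const_mul, hs2, ← ha, inv_mul_cancel₀ h.ne']
    have e3 := csInf_le hbdd e2
    rw [e1] at e3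
    rwa [le_inv_mul_iff₀ h, mul_comm] at e3

theorem tendsto_test_of_weak {u : ℕ → Rd d → ℝ} {v : Rd d → ℝ} (hu : ∀ n, c.L2 (u n)) (hv : c.L2 v)
    (t : ∀ g, MemLp g 2 c.μ → Tendsto (fun n => ∫ x, u n x * g x ∂c.μ) atTop
      (𝓝 (∫ x, v x * g x ∂c.μ))) {ψ : Rd d → ℝ} (hψ : Continuous ψ) (hc : HasCompactSupport ψ) :
    Tendsto (fun n => ∫ x, ψ x * u n x) atTop (𝓝 (∫ x, ψ x * v x)) := by
  obtain ⟨Ψ, hΨ, h⟩ := exists_periodization (c := c) hψ hc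
  rw [h v hv]
  simp only [fun n => h (u n) (hu n)]
  exact t Ψ hΨ

end PCell

end DefectModes

/-! ### The periodic ground state. -/

namespace DefectModes

namespace PCell

variable {d : ℕ} {c : PCell d}

theorem exists_bound_of_perE (hD : Bornology.IsBounded c.D) {φ : Rd d → ℝ} (hφ : Continuous φ)
    (hp : c.PerE φ) : ∃ C, ∀ x, |φ x| ≤ C := by
  obtain ⟨C, hC⟩ := hD.isCompact_closure.exists_bound_of_continuousOn hφ.continuousOn
  have h1 : ∀ᵐ x, |φ x| ≤ C := by
    refine ae_of_ae_mu (c := c) (fun γ => ae_of_all _ fun x hx => by rwa [hp γ x] at hx) ?_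
    filter_upwards [ae_restrict_mem₀ c.fund.nullMeasurableSet] with x hx
    exact hC x (subset_closure hx)
  refine ⟨C, fun x => ?_⟩
  have h2 : IsClosed {x | |φ x| ≤ C} := isClosed_le hφ.abs continuous_const
  have h3 := (Measure.dense_of_ae h1).closure_eq
  rw [h2.closure_eq] at h3
  exact (Set.ext_iff.1 h3 x).2 trivial

/-- On a bounded domain an invariant smooth function and all its derivatives are bounded, so square
integrability is automatic. -/
theorem Sm.of_contDiff [IsFiniteMeasure c.μ] (hD : Bornology.IsBounded c.D) {φ : Rd d → ℝ}
    (hφ : ContDiff ℝ ∞ φ) (hp : c.PerE φ) : c.Sm φ := by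
  refine ⟨hφ, hp, fun vs => ?_⟩
  have h : ContDiff ℝ ∞ (vs.foldr DefectModes.pd φ) ∧ c.PerE (vs.foldr DefectModes.pd φ) := by
    induction vs with
    | nil => exact ⟨hφ, hp⟩
    | cons a l ih => exact ⟨contDiff_pd ih.1 a, ih.2.pd a⟩
  obtain ⟨C, hC⟩ := exists_bound_of_perE hD h.1.continuous h.2
  exact ⟨h.2.per, h.1.continuous.aestronglyMeasurable,
    MemLp.of_bound h.1.continuous.aestronglyMeasurable C (ae_of_all _ hC)⟩

theorem integral_mul_conv_eq [IsFiniteMeasure c.μ] (hD : Bornology.IsBounded c.D) {κ f g : Rd d → ℝ}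
    (hκ : IsTest κ) (hf : Continuous f) (hg : Continuous g) (hfp : c.PerE f) (hgp : c.PerE g) :
    ∫ x, f x * DefectModes.conv κ g x ∂c.μ = ∫ t, κ t * ∫ x, f x * g (x - t) ∂c.μ := by
  obtain ⟨A, hA⟩ := exists_bound_of_perE hD hf hfp
  obtain ⟨B, hB⟩ := exists_bound_of_perE hD hg hgp
  have hi : Integrable (fun p : Rd d × Rd d => f p.1 * (κ p.2 * g (p.1 - p.2))) (c.μ.prod volume) := by
    have h1 : Integrable (fun p : Rd d × Rd d => κ p.2) (c.μ.prod volume) :=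
      (hκ.1.continuous.integrable_of_hasCompactSupport hκ.2).comp_snd c.μ
    refine (h1.bdd_mul (c := A * B) (f := fun p : Rd d × Rd d => f p.1 * g (p.1 - p.2)) ?_ ?_).congr
      (ae_of_all _ fun p => by ring)
    · exact ((hf.comp continuous_fst).mul (hg.comp (continuous_fst.sub continuous_snd))).aestronglyMeasurable
    · refine ae_of_all _ fun p => ?_
      rw [Real.norm_eq_abs, abs_mul]
      exact mul_le_mul (hA _) (hB _) (abs_nonneg _) ((abs_nonneg _).trans (hA p.1))
  have h2 : ∀ x, f x * DefectModes.conv κ g x = ∫ t, f x * (κ t * g (x - t)) := fun x => by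
    rw [conv_eq_swap, integral_const_mul]
  simp only [h2]
  rw [integral_integral_swap hi]
  refine integral_congr_ae (ae_of_all _ fun t => ?_)
  simp only
  rw [← integral_const_mul]
  exact integral_congr_ae (ae_of_all _ fun x => by ring)

/-- Convolution with an even kernel is self-adjoint. Fubini and translation invariance prove it for
smooth functions, and mollification extends it to `L²`. -/
theorem integral_mul_conv_symm [IsFiniteMeasure c.μ] (hD : Bornology.IsBounded c.D) {κ : Rd d → ℝ}
    (hκ : IsTest κ) (he : ∀ y, κ (-y) = κ y) {f g : Rd d → ℝ} (hf : c.L2 f) (hg : c.Sm g) :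
    ∫ x, f x * DefectModes.conv κ g x ∂c.μ = ∫ x, DefectModes.conv κ f x * g x ∂c.μ := by
  have key : ∀ f, c.Sm f →
      ∫ x, f x * DefectModes.conv κ g x ∂c.μ = ∫ x, DefectModes.conv κ f x * g x ∂c.μ := by
    intro f hf
    simp only [mul_comm (DefectModes.conv κ f _)]
    rw [integral_mul_conv_eq hD hκ hf.1.continuous hg.1.continuous hf.2.1 hg.2.1,
      integral_mul_conv_eq hD hκ hg.1.continuous hf.1.continuous hg.2.1 hf.2.1,
      ← integral_neg_eq_self]
    refine integral_congr_ae (ae_of_all _ fun t => ?_)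
    simp only [he]
    congr 1
    have := integral_shift (c := c) (F := fun x => g x * f (x - t))
      (fun γ x => by simp only [add_sub_assoc, hf.2.1 γ, hg.2.1 γ]) (-t)
    rw [← this]
    refine integral_congr_ae (ae_of_all _ fun x => ?_)
    simp [mul_comm]
  have t := tendsto_moll hf
  have h1 := tendsto_integral_mul_of_tendsto (g := fun _ => DefectModes.conv κ g)
    (g₀ := DefectModes.conv κ g) (fun n => (hf.moll n).2.2) (fun _ => (hg.l2.conv hκ).2.2) hf.2.2
    (hg.l2.conv hκ).2.2 t (by simp)
  have t2 : Tendsto (fun n => eLpNorm (DefectModes.conv κ (DefectModes.moll n f)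
      - DefectModes.conv κ f) 2 c.μ) atTop (𝓝 0) := by
    have h3 : ∀ n, eLpNorm (DefectModes.conv κ (DefectModes.moll n f) - DefectModes.conv κ f) 2 c.μ
        ≤ (∫⁻ t, ‖κ t‖ₑ) * eLpNorm (DefectModes.moll n f - f) 2 c.μ := fun n => by
      have e := conv_sub hκ (hf.moll n).locallyIntegrable hf.locallyIntegrable
      have := eLpNorm_conv_le hκ ((hf.moll n).sub hf)
      rw [e] at this
      exact this
    have hfin : (∫⁻ t, ‖κ t‖ₑ) ≠ ⊤ :=
      (hκ.1.continuous.integrable_of_hasCompactSupport hκ.2).hasFiniteIntegral.ne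
    have h4 := ENNReal.Tendsto.const_mul (a := ∫⁻ t, ‖κ t‖ₑ) t (Or.inr hfin)
    rw [mul_zero] at h4
    exact tendsto_of_tendsto_of_tendsto_of_le_of_le tendsto_const_nhds h4 (fun _ => zero_le) h3
  have h2 := tendsto_integral_mul_of_tendsto (g := fun _ => g)
    (g₀ := g) (fun n => ((hf.moll n).conv hκ).2.2) (fun _ => hg.l2.2.2) (hf.conv hκ).2.2
    hg.l2.2.2 t2 (by simp)
  refine tendsto_nhds_unique h1 (h2.congr fun n => (key _ (hf.sm_moll n)).symm)

/-- A weak equation against smooth invariant functions gives the mollified equation. -/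
theorem moll_equation_of_sm [IsFiniteMeasure c.μ] (hD : Bornology.IsBounded c.D) {u f : Rd d → ℝ}
    (hu : c.L2 u) (hf : c.L2 f)
    (h : ∀ ψ, c.Sm ψ → ∫ x, u x * ∑ j, DefectModes.pd (stdVec j) (DefectModes.pd (stdVec j) ψ) x ∂c.μ
      = ∫ x, f x * ψ x ∂c.μ) (n : ℕ) (x : Rd d) :
    ∑ j, DefectModes.pd (stdVec j) (DefectModes.pd (stdVec j) (DefectModes.moll n u)) x
      = DefectModes.moll n f x := by
  have hκ := isTest_mollKernel d n
  have hus := hu.sm_moll n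
  have hfs := hf.sm_moll n
  have hpp := fun j : Fin d => ((hus.pd (stdVec j)).pd (stdVec j))
  set r : Rd d → ℝ := fun x => ∑ j, DefectModes.pd (stdVec j)
    (DefectModes.pd (stdVec j) (DefectModes.moll n u)) x - DefectModes.moll n f x with hr
  have hrs : c.Sm r := by
    refine Sm.of_contDiff hD ((ContDiff.sum fun j _ => (hpp j).1).sub hfs.1) fun γ x => ?_
    simp only [hr, fun j => (hpp j).2.1 γ x, hfs.2.1 γ x]
  have key : ∀ θ, c.Sm θ → ∫ x, r x * θ x ∂c.μ = 0 := by
    intro θ hθ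
    have h1 := h _ (hθ.l2.sm_moll n)
    have e1 : ∀ j, DefectModes.pd (stdVec j) (DefectModes.pd (stdVec j) (DefectModes.moll n θ))
        = DefectModes.moll n (DefectModes.pd (stdVec j) (DefectModes.pd (stdVec j) θ)) :=
      fun j => laplacian_conv_eq hκ hθ.1 j
    have hθ2 := fun j => (hθ.pd (stdVec j)).pd (stdVec j)
    have e2 : ∀ j, ∫ x, u x * DefectModes.moll n (DefectModes.pd (stdVec j)
        (DefectModes.pd (stdVec j) θ)) x ∂c.μ
        = ∫ x, DefectModes.pd (stdVec j) (DefectModes.pd (stdVec j) (DefectModes.moll n u)) x * θ x ∂c.μ := by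
      intro j
      rw [DefectModes.moll, integral_mul_conv_symm hD hκ (moll_neg_eq n) hu (hθ2 j),
        (hus.pd _).integral_pd_mul hθ, hus.integral_pd_mul (hθ.pd _), neg_neg]
      rfl
    rw [DefectModes.moll, integral_mul_conv_symm hD hκ (moll_neg_eq n) hf hθ] at h1
    have e3 : ∫ x, u x * ∑ j, DefectModes.pd (stdVec j) (DefectModes.pd (stdVec j)
        (DefectModes.moll n θ)) x ∂c.μ = ∫ x, (∑ j, DefectModes.pd (stdVec j)
          (DefectModes.pd (stdVec j) (DefectModes.moll n u)) x) * θ x ∂c.μ := by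
      simp only [e1, Finset.mul_sum, Finset.sum_mul]
      rw [integral_finsetSum _ fun j _ => hu.integrable_mul ((hθ2 j).l2.moll n),
        integral_finsetSum _ fun j _ => (hpp j).l2.integrable_mul hθ.l2]
      exact Finset.sum_congr rfl fun j _ => e2 j
    have i1 : Integrable (fun x => (∑ j, DefectModes.pd (stdVec j)
          (DefectModes.pd (stdVec j) (DefectModes.moll n u)) x) * θ x) c.μ :=
      (L2.sum _ fun j => (hpp j).l2).integrable_mul hθ.l2
    have i2 : Integrable (fun x => DefectModes.moll n f x * θ x) c.μ := hfs.l2.integrable_mul hθ.l2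
    simp only [hr, sub_mul]
    rw [integral_sub i1 i2, ← e3]
    exact sub_eq_zero.2 h1
  -- The residual of the mollified equation is itself an admissible test function; tested against
  -- itself it must vanish.
  have h2 := key r hrs
  have h3 : (fun x => r x * r x) =ᵐ[c.μ] 0 :=
    (integral_eq_zero_iff_of_nonneg (fun x => mul_self_nonneg _) (hrs.l2.integrable_mul hrs.l2)).1 h2
  have h4 : r =ᵐ[volume] fun _ => 0 := by
    refine hrs.2.1.per.ae_eq L2.zero.1 ?_
    filter_upwards [h3] with x hx using mul_self_eq_zero.1 hx
  have h5 : r = fun _ => 0 := by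
    exact Measure.eq_of_ae_eq h4 hrs.1.continuous continuous_const
  exact sub_eq_zero.1 (congrFun h5 x)

end PCell

theorem isBounded_cellIco : Bornology.IsBounded (lattice d).D := by
  refine (isBounded_iff_forall_norm_le).2 ⟨Real.sqrt d, fun x hx => ?_⟩
  rw [EuclideanSpace.norm_eq]
  refine Real.sqrt_le_sqrt ?_
  calc ∑ i, ‖x i‖ ^ 2 ≤ ∑ i : Fin d, (1 : ℝ) := Finset.sum_le_sum fun i _ => by
        have h : x i ∈ Set.Ico (0 : ℝ) 1 := hx i
        rw [Real.norm_of_nonneg h.1]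
        nlinarith [h.1, h.2]
    _ = d := by simp

theorem lattice_sm {φ : Rd d → ℝ} (hφ : ContDiff ℝ ∞ φ) (hp : (lattice d).PerE φ) :
    (lattice d).Sm φ := PCell.Sm.of_contDiff isBounded_cellIco hφ hp

/-- Existence of a nonnegative ground state of a periodic Schrödinger operator. -/
theorem exists_principal {V : Rd d → ℝ} {K : ℝ} (hV : (lattice d).Pot V K) :
    ∃ (l : ℝ) (v : Rd d → ℝ), (lattice d).L2 v ∧ (∀ᵐ x, 0 ≤ v x) ∧ 0 < ∫ x, v x ∂(lattice d).μ ∧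
      (∀ n x, ∑ j, pd (stdVec j) (pd (stdVec j) (moll n v)) x = moll n (fun x => (V x - l) * v x) x) ∧
      ∀ φ, (lattice d).Sm φ → 0 ≤ (lattice d).form stdVec (fun x => V x - l) φ φ := by
  have hone : (lattice d).Sm (fun _ => 1) := lattice_sm contDiff_const fun _ _ => rfl
  obtain ⟨l, hl, hinf, φ, hφ, hφ1, t⟩ := PCell.exists_inf (b := stdVec) hV
    ⟨fun _ => 1, hone, by simp⟩
  have hP := hV.sub_const l
  set P : Rd d → ℝ := fun x => V x - l with hPd
  have h0 : ∀ φ, (lattice d).Sm φ → 0 ≤ (lattice d).form stdVec P φ φ := fun φ hφ => by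
    rw [PCell.form_sub_const hV hφ]
    linarith [hinf φ hφ]
  -- Replacing `φ n` by `√(δ n² + φ n²)` with `δ n → 0` keeps the sequence smooth and minimizing and
  -- makes it positive.
  set δ : ℕ → ℝ := fun n => 1 / ((n : ℝ) + 1) with hδ
  have hδ0 : ∀ n, 0 < δ n := fun n => by positivity
  have hδ1 : ∀ n, δ n ≤ 1 := fun n => by
    rw [hδ]; simp only; rw [div_le_one (by positivity)]; linarith [(Nat.cast_nonneg n : (0 : ℝ) ≤ n)]
  have hδt : Tendsto (fun n => δ n ^ 2) atTop (𝓝 0) := by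
    have := (tendsto_one_div_add_atTop_nhds_zero_nat (𝕜 := ℝ)).pow 2
    simpa only [ne_eq, OfNat.ofNat_ne_zero, not_false_eq_true, zero_pow] using this
  set h : ℕ → Rd d → ℝ := fun n x => Real.sqrt (δ n ^ 2 + φ n x ^ 2) with hh
  have hs : ∀ n, (lattice d).Sm (h n) := fun n =>
    lattice_sm (contDiff_sqrt_add_sq (hδ0 n) (hφ n).1) fun γ x => by
      simp only [hh, (hφ n).2.1 γ x]
  have hsq : ∀ n x, h n x ^ 2 = δ n ^ 2 + φ n x ^ 2 := fun n x => Real.sq_sqrt (by positivity)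
  have hint : ∀ n, ∫ x, h n x ^ 2 ∂(lattice d).μ = δ n ^ 2 + 1 := by
    intro n
    simp only [hsq]
    rw [integral_add (integrable_const _) (hφ n).l2.2.2.integrable_sq, hφ1]
    simp
  have hform : ∀ n, (lattice d).form stdVec P (h n) (h n)
      ≤ (lattice d).form stdVec P (φ n) (φ n) + δ n ^ 2 * (K + |l|) := by
    intro n
    have e1 : ∀ j : Fin d, ∫ x, pd (stdVec j) (h n) x * pd (stdVec j) (h n) x ∂(lattice d).μ
        ≤ ∫ x, pd (stdVec j) (φ n) x * pd (stdVec j) (φ n) x ∂(lattice d).μ := fun j =>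
      integral_mono (((hs n).pd _).l2.integrable_mul ((hs n).pd _).l2)
        (((hφ n).pd _).l2.integrable_mul ((hφ n).pd _).l2) fun x => by
          have := sq_pd_sqrt_le (hδ0 n) (hφ n).1 (stdVec j) x
          simpa only [← sq] using this
    have hPi : Integrable P (lattice d).μ := by
      have := (hP.mul hone.l2).2.2.integrable (by norm_num)
      simpa using this
    have i1 : Integrable (fun x => P x * φ n x * φ n x) (lattice d).μ :=
      (hP.mul (hφ n).l2).integrable_mul (hφ n).l2
    have e2 : ∫ x, P x * h n x * h n x ∂(lattice d).μ
        = δ n ^ 2 * ∫ x, P x ∂(lattice d).μ + ∫ x, P x * φ n x * φ n x ∂(lattice d).μ := by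
      rw [← integral_const_mul, ← integral_add (hPi.const_mul _) i1]
      refine integral_congr_ae (ae_of_all _ fun x => ?_)
      have := hsq n x
      simp only
      rw [mul_assoc, ← sq, this]; ring
    have e3 : ∫ x, P x ∂(lattice d).μ ≤ K + |l| := by
      have := integral_mono_ae hPi (integrable_const (μ := (lattice d).μ) (K + |l|)) (by
        filter_upwards [PCell.ae_mu (c := lattice d) hP.2.2] with x hx using (abs_le.1 hx).2)
      simpa using this
    simp only [PCell.form]
    rw [e2]
    have := Finset.sum_le_sum fun j (_ : j ∈ Finset.univ) => e1 j
    have := mul_le_mul_of_nonneg_left e3 (sq_nonneg (δ n))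
    linarith
  have tφ : Tendsto (fun n => (lattice d).form stdVec P (φ n) (φ n)) atTop (𝓝 0) := by
    have := t.sub_const l
    rw [sub_self] at this
    refine this.congr fun n => ?_
    rw [PCell.form_sub_const hV (hφ n), hφ1, mul_one]
  have th : Tendsto (fun n => (lattice d).form stdVec P (h n) (h n)) atTop (𝓝 0) := by
    have := tφ.add (hδt.mul_const (K + |l|))
    rw [zero_mul, add_zero] at this
    exact squeeze_zero (fun n => h0 _ (hs n)) hform this
  have hle2 : ∀ n, ∫ x, h n x ^ 2 ∂(lattice d).μ ≤ 2 := fun n => by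
    rw [hint]; nlinarith [hδ0 n, hδ1 n]
  obtain ⟨v, hv, s, hsm, hw⟩ := PCell.exists_weak_subseq (fun n => (hs n).l2) hle2
  have hv0μ : ∀ᵐ x ∂(lattice d).μ, 0 ≤ v x := by
    -- Testing the weak limit with its own negative part: nonnegativity of the sequence forces `∫ v
    -- min(v, 0) ≤ 0`, while the integrand is nonnegative.
    have hg : MemLp (fun x => min (v x) 0) 2 (lattice d).μ := by
      refine MemLp.of_le hv.2.2 (hv.2.2.1.inf aestronglyMeasurable_const) (ae_of_all _ fun x => ?_)
      simp only [Real.norm_eq_abs]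
      rcases le_total (v x) 0 with h | h
      · rw [min_eq_left h]
      · rw [min_eq_right h]; simp
    have e1 : ∫ x, v x * min (v x) 0 ∂(lattice d).μ ≤ 0 :=
      le_of_tendsto' (hw _ hg) fun n => integral_nonpos fun x =>
        mul_nonpos_of_nonneg_of_nonpos (Real.sqrt_nonneg _) (min_le_right _ _)
    have e2 : ∀ x, 0 ≤ v x * min (v x) 0 := fun x => by
      rcases le_total (v x) 0 with h | h
      · rw [min_eq_left h]; exact mul_self_nonneg _
      · rw [min_eq_right h]; simp
    have e3 := (integral_eq_zero_iff_of_nonneg e2 (hv.2.2.integrable_mul hg)).1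
      (le_antisymm e1 (integral_nonneg e2))
    filter_upwards [e3] with x hx
    by_contra hneg
    push Not at hneg
    rw [Pi.zero_apply, min_eq_left hneg.le] at hx
    exact hneg.ne (mul_self_eq_zero.1 hx)
  have hv0 : ∀ᵐ x, 0 ≤ v x := by
    refine PCell.ae_of_ae_mu (c := lattice d) (fun γ => ?_) hv0μ
    filter_upwards [hv.1 γ] with x hx hy
    rwa [hx] at hy
  have hvi : Integrable v (lattice d).μ := hv.2.2.integrable (by norm_num)
  refine ⟨l, v, hv, hv0, ?_, ?_, h0⟩
  · refine (integral_nonneg_of_ae hv0μ).lt_of_ne fun hz => ?_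
    have hvz : v =ᵐ[(lattice d).μ] 0 := (integral_eq_zero_iff_of_nonneg_ae hv0μ hvi).1 hz.symm
    have hvz' : v =ᵐ[volume] fun _ => 0 := hv.1.ae_eq PCell.L2.zero.1 hvz
    -- On the cell the constant potential one is square integrable, so it acts compactly. If the
    -- weak limit vanished, the norms would tend to zero, although they are at least one.
    have tt : Tendsto (fun n => ∫ x, (1 : ℝ) * h (s n) x ^ 2 ∂(lattice d).μ) atTop (𝓝 0) := by
      obtain ⟨C, hC⟩ := th.bddAbove_range
      have hgr : ∀ n, ∑ j, ∫ x, pd (stdVec j) (h (s n)) x ^ 2 ∂(lattice d).μ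
          ≤ max 2 (C + (K + |l|) * 2) := by
        intro n
        refine (PCell.form_ge (b := stdVec) hP (hs (s n))).trans (le_max_of_le_right ?_)
        have := mul_le_mul_of_nonneg_left (hle2 (s n)) hP.nonneg
        have := hC ⟨s n, rfl⟩
        simp only at this
        linarith
      refine PCell.tendsto_integral_potential (c := lattice d) (B := 1)
        (g := fun n j => pd (stdVec j) (h (s n))) (C := max 2 (C + (K + |l|) * 2))
        (fun n => (hs (s n)).l2)
        (fun n j => ⟨hasWeakPartial_of_contDiff (hs (s n)).1 j, ((hs (s n)).pd _).l2⟩)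
        (fun n => (hle2 _).trans (le_max_left _ _)) hgr
        hone.l2 (ae_of_all _ fun x => by simp) fun ψ hψ hc => ?_
      have := PCell.tendsto_test_of_weak (fun n => (hs (s n)).l2) hv hw hψ hc
      rwa [integral_congr_ae (g := fun _ => 0) (by
        filter_upwards [hvz'] with x hx; rw [hx, mul_zero]), integral_zero] at this
    have := ge_of_tendsto' tt (b := 1) fun n => by
      simp only [one_mul]; rw [hint]; nlinarith [sq_nonneg (δ (s n))]
    linarith
  · refine PCell.moll_equation_of_sm isBounded_cellIco hv (hP.mul hv) fun ψ hψ => ?_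
    have e := PCell.weak_equation_of_minimizing hP h0 (fun n => hs (s n))
      (th.comp hsm.tendsto_atTop) hw hψ
    have i1 : Integrable (fun x => v x * (P x * ψ x)) (lattice d).μ :=
      hv.integrable_mul (hP.mul hψ.l2)
    have i2 : Integrable (fun x => v x * ∑ j, pd (stdVec j) (pd (stdVec j) ψ) x) (lattice d).μ :=
      hv.integrable_mul (PCell.L2.sum _ fun j => ((hψ.pd _).pd _).l2)
    simp only [mul_sub] at e
    rw [integral_sub i1 i2, sub_eq_zero] at e
    rw [← e]
    exact integral_congr_ae (ae_of_all _ fun x => by simp only [hPd]; ring)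

end DefectModes

/-! ### Weak form of the Laplace and Bloch equations. -/

namespace DefectModes

variable {d : ℕ}

theorem HasWeakPartial.im {j : Fin d} {f g : Rd d → ℂ} (h : HasWeakPartial j f g) :
    HasWeakPartial j (fun x => (f x).im) (fun x => (g x).im) := by
  simpa using (h.const_mul (-Complex.I)).re

/-- `Δ u = f` in the sense of distributions. -/
def WeakLaplace (u f : Rd d → ℝ) : Prop :=
  ∀ ψ, IsTest ψ → ∫ x, (∑ j, pd (stdVec j) (pd (stdVec j) ψ) x) * u x = ∫ x, ψ x * f x

theorem integrable_test_mul {f ψ : Rd d → ℝ} (hf : LocallyIntegrable f) (hψ : IsTest ψ) :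
    Integrable (fun x => ψ x * f x) := integrable_smul_test hf hψ.1.continuous hψ.2

theorem HasWeakPartial.test_test {j : Fin d} {u g k ψ : Rd d → ℝ} (h1 : HasWeakPartial j u g)
    (h2 : HasWeakPartial j g k) (hψ : IsTest ψ) :
    ∫ x, DefectModes.pd (stdVec j) (DefectModes.pd (stdVec j) ψ) x * u x = ∫ x, ψ x * k x := by
  rw [h1.test (hψ.pd _).1 (hψ.pd _).2, h2.test hψ.1 hψ.2, neg_neg]

theorem weakLaplace_of_partials {u f : Rd d → ℝ} {g k : Fin d → Rd d → ℝ}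
    (h1 : ∀ j, HasWeakPartial j u (g j)) (h2 : ∀ j, HasWeakPartial j (g j) (k j))
    (hu : LocallyIntegrable u) (h : f =ᵐ[volume] fun x => ∑ j, k j x) : WeakLaplace u f := by
  intro ψ hψ
  rw [integral_congr_ae (f := fun x => ψ x * f x) (g := fun x => ∑ j, ψ x * k j x) (by
    filter_upwards [h] with x hx; rw [hx, Finset.mul_sum])]
  simp only [Finset.sum_mul]
  rw [integral_finsetSum _ fun j _ => integrable_test_mul (h2 j).2.1 hψ,
    integral_finsetSum _ fun j _ => integrable_test_mul hu ((hψ.pd _).pd _)]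
  exact Finset.sum_congr rfl fun j _ => (h1 j).test_test (h2 j) hψ

theorem WeakLaplace.moll {u f : Rd d → ℝ} (h : WeakLaplace u f) (hu : LocallyIntegrable u)
    (n : ℕ) (x : Rd d) : ∑ j, DefectModes.pd (stdVec j)
      (DefectModes.pd (stdVec j) (DefectModes.moll n u)) x = DefectModes.moll n f x :=
  PCell.moll_equation_of_test hu h n x

theorem regularity_laplace {c : PCell d} {u f : Rd d → ℝ} (hu : c.L2 u) (hf : c.L2 f)
    (h : ∀ n x, ∑ j, pd (stdVec j) (pd (stdVec j) (moll n u)) x = moll n f x) :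
    ∃ (g : Fin d → Rd d → ℝ) (k : Fin d → Fin d → Rd d → ℝ),
      (∀ j, HasWeakPartial j u (g j) ∧ c.L2 (g j)) ∧
      (∀ j l, HasWeakPartial l (g j) (k j l) ∧ c.L2 (k j l)) ∧
      f =ᵐ[volume] fun x => ∑ j, k j j x := by
  obtain ⟨g, k, h1, h2, h3⟩ := PCell.regularity (c := c) (b := stdVec)
    (C := fun j i => if i = j then 1 else 0) (fun j => by simp) hu hf h
  refine ⟨g, k, h1, h2, h3.trans (ae_of_all _ fun x => ?_)⟩
  simp [stdVec_apply]

theorem PCell.L2.of_perE {c : PCell d} {f : Rd d → ℝ} (hp : c.PerE f) (h : MemLp f 2 c.μ) :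
    c.L2 f := by
  obtain ⟨g, h1, h2, h3⟩ := c.rep f h.1
  have h4 := PCell.Per.ae_eq (PCell.PerE.per h1) (PCell.PerE.per hp) h2
  exact ⟨hp.per, h3.congr h4, h⟩

/-- Functions with square integrable weak derivatives up to order two, in real form. -/
theorem memH2Per_of {u : Rd d → ℝ} {g : Fin d → Rd d → ℝ} {k : Fin d → Fin d → Rd d → ℝ}
    (hp : LatticePeriodic u) (hu : (lattice d).L2 u)
    (h1 : ∀ j, HasWeakPartial j u (g j) ∧ (lattice d).L2 (g j))
    (h2 : ∀ j l, HasWeakPartial l (g j) (k j l) ∧ (lattice d).L2 (k j l)) : MemH2Per u := by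
  refine ⟨hp, ?_⟩
  rw [← lattice_mu]
  exact ⟨hu.2.2, fun j => ⟨g j, (h1 j).1, (h1 j).2.2.2, fun l =>
    ⟨k j l, (h2 j l).1, (h2 j l).2.2.2⟩⟩⟩

theorem memH2Per_ofReal_of {u : Rd d → ℝ} {g : Fin d → Rd d → ℝ} {k : Fin d → Fin d → Rd d → ℝ}
    (hp : LatticePeriodic u) (hu : (lattice d).L2 u)
    (h1 : ∀ j, HasWeakPartial j u (g j) ∧ (lattice d).L2 (g j))
    (h2 : ∀ j l, HasWeakPartial l (g j) (k j l) ∧ (lattice d).L2 (k j l)) :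
    MemH2Per (fun x => (u x : ℂ)) := by
  refine ⟨fun j x => by simp only [hp j x], ?_⟩
  rw [← lattice_mu]
  exact ⟨hu.2.2.ofReal, fun j => ⟨_, (h1 j).1.ofReal, (h1 j).2.2.2.ofReal, fun l =>
    ⟨_, (h2 j l).1.ofReal, (h2 j l).2.2.2.ofReal⟩⟩⟩

/-- The Bloch eigenvalue equation in expanded form. -/
def BlochEq (V : Rd d → ℝ) (k : Rd d) (E : ℝ) (p : Rd d → ℂ) : Prop :=
  ∃ G G₂ : Fin d → Rd d → ℂ, (∀ j, HasWeakPartial j p (G j) ∧ HasWeakPartial j (G j) (G₂ j)) ∧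
    ∀ᵐ x, ∑ j, (G₂ j x + 4 * Real.pi * Complex.I * (k j : ℂ) * G j x
      - 4 * Real.pi ^ 2 * (k j : ℂ) ^ 2 * p x) = ((V x : ℂ) - E) * p x

theorem SolvesBloch.blochEq {V : Rd d → ℝ} {k : Rd d} {E : ℝ} {p : Rd d → ℂ}
    (h : SolvesBloch V k E p) : BlochEq V k E p := by
  obtain ⟨⟨-, -, h1⟩, h2⟩ := h
  choose g hg hg2 using h1
  choose k' hk _ using fun j => (hg2 j).2 j
  refine ⟨g, k', fun j => ⟨hg j, hk j⟩, ?_⟩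
  have e1 : ∀ j, blochPartial k j p =ᵐ[volume]
      fun x => g j x + 2 * (Real.pi : ℂ) * Complex.I * (k j : ℂ) * p x := fun j => by
    filter_upwards [(hg j).weakPartial_eq] with x hx
    simp only [blochPartial, hx]
  have e2 : ∀ j, weakPartial j (blochPartial k j p) =ᵐ[volume]
      fun x => k' j x + 2 * (Real.pi : ℂ) * Complex.I * (k j : ℂ) * g j x := fun j =>
    (((hk j).add ((hg j).const_mul _)).congr (e1 j).symm (ae_eq_refl _)).weakPartial_eq
  filter_upwards [h2, eventually_countable_forall.2 e1, eventually_countable_forall.2 e2]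
    with x h3 h4 h5
  have h6 : ∀ j, blochPartial k j (blochPartial k j p) x = k' j x + 4 * Real.pi * Complex.I *
      (k j : ℂ) * g j x - 4 * Real.pi ^ 2 * (k j : ℂ) ^ 2 * p x := fun j => by
    change weakPartial j (blochPartial k j p) x
      + 2 * (Real.pi : ℂ) * Complex.I * (k j : ℂ) * blochPartial k j p x = _
    rw [h4, h5]
    linear_combination (4 * (Real.pi : ℂ) ^ 2 * (k j : ℂ) ^ 2 * p x) * Complex.I_sq
  rw [Finset.sum_congr rfl fun j _ => h6 j] at h3
  linear_combination -h3

theorem BlochEq.const_mul {V : Rd d → ℝ} {k : Rd d} {E : ℝ} {p : Rd d → ℂ} (h : BlochEq V k E p)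
    (z : ℂ) : BlochEq V k E (fun x => z * p x) := by
  obtain ⟨G, G₂, h1, h2⟩ := h
  refine ⟨fun j x => z * G j x, fun j x => z * G₂ j x,
    fun j => ⟨(h1 j).1.const_mul z, (h1 j).2.const_mul z⟩, ?_⟩
  filter_upwards [h2] with x hx
  rw [show ((V x : ℂ) - E) * (z * p x) = z * (((V x : ℂ) - E) * p x) by ring, ← hx, Finset.mul_sum]
  exact Finset.sum_congr rfl fun j _ => by ring

/-- Real part of the weak Bloch equation. -/
theorem BlochEq.weak_re {V : Rd d → ℝ} {k : Rd d} {E : ℝ} {p : Rd d → ℂ} (h : BlochEq V k E p)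
    (hp : LocallyIntegrable p) {ψ : Rd d → ℝ} (hψ : IsTest ψ) :
    (∫ x, (∑ j, DefectModes.pd (stdVec j) (DefectModes.pd (stdVec j) ψ) x) * (p x).re)
      + 4 * Real.pi * (∫ x, DefectModes.pd k ψ x * (p x).im)
      - 4 * Real.pi ^ 2 * ‖k‖ ^ 2 * (∫ x, ψ x * (p x).re)
      = ∫ x, ψ x * ((V x - E) * (p x).re) := by
  obtain ⟨G, G₂, h1, h2⟩ := h
  have hlr : LocallyIntegrable (fun x => (p x).re) := by
    exact hp.mono (Complex.continuous_re.comp_aestronglyMeasurable hp.aestronglyMeasurable)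
      (ae_of_all _ fun x => by simpa using Complex.abs_re_le_norm (p x))
  have hli : LocallyIntegrable (fun x => (p x).im) := by
    exact hp.mono (Complex.continuous_im.comp_aestronglyMeasurable hp.aestronglyMeasurable)
      (ae_of_all _ fun x => by simpa using Complex.abs_im_le_norm (p x))
  have e1 : ∫ x, ψ x * ((V x - E) * (p x).re) = ∫ x, ∑ j, (ψ x * (G₂ j x).re
      - 4 * Real.pi * k j * (ψ x * (G j x).im) - 4 * Real.pi ^ 2 * k j ^ 2 * (ψ x * (p x).re)) := by
    refine integral_congr_ae ?_
    filter_upwards [h2] with x hx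
    have h3 := congrArg Complex.re hx
    have h4 : (((V x : ℂ) - E) * p x).re = (V x - E) * (p x).re := by
      rw [← Complex.ofReal_sub, Complex.re_ofReal_mul]
    rw [h4, Complex.re_sum] at h3
    rw [← h3, Finset.mul_sum]
    refine Finset.sum_congr rfl fun j _ => ?_
    have h5 : 4 * (Real.pi : ℂ) * Complex.I * (k j : ℂ) * G j x
        = ((4 * Real.pi * k j : ℝ) : ℂ) * (Complex.I * G j x) := by push_cast; ring
    have h6 : 4 * (Real.pi : ℂ) ^ 2 * (k j : ℂ) ^ 2 * p x
        = ((4 * Real.pi ^ 2 * k j ^ 2 : ℝ) : ℂ) * p x := by push_cast; ring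
    rw [h5, h6, Complex.sub_re, Complex.add_re, Complex.re_ofReal_mul, Complex.re_ofReal_mul,
      Complex.I_mul_re]
    ring
  have i1 : ∀ j, Integrable (fun x => ψ x * (G₂ j x).re) := fun j =>
    integrable_test_mul (h1 j).2.re.2.1 hψ
  have i2 : ∀ j, Integrable (fun x => 4 * Real.pi * k j * (ψ x * (G j x).im)) := fun j =>
    (integrable_test_mul (h1 j).1.im.2.1 hψ).const_mul _
  have i3 : ∀ j, Integrable (fun x => 4 * Real.pi ^ 2 * k j ^ 2 * (ψ x * (p x).re)) := fun j =>
    (integrable_test_mul hlr hψ).const_mul _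
  have i12 : ∀ j, Integrable (fun x => ψ x * (G₂ j x).re - 4 * Real.pi * k j * (ψ x * (G j x).im)) :=
    fun j => (i1 j).sub (i2 j)
  have i123 : ∀ j, Integrable (fun x => ψ x * (G₂ j x).re - 4 * Real.pi * k j * (ψ x * (G j x).im)
      - 4 * Real.pi ^ 2 * k j ^ 2 * (ψ x * (p x).re)) := fun j => (i12 j).sub (i3 j)
  rw [e1, integral_finsetSum _ fun j _ => i123 j]
  have e2 : ∀ j, ∫ x, (ψ x * (G₂ j x).re - 4 * Real.pi * k j * (ψ x * (G j x).im)
      - 4 * Real.pi ^ 2 * k j ^ 2 * (ψ x * (p x).re))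
      = (∫ x, DefectModes.pd (stdVec j) (DefectModes.pd (stdVec j) ψ) x * (p x).re)
        + 4 * Real.pi * (k j * ∫ x, DefectModes.pd (stdVec j) ψ x * (p x).im)
        - 4 * Real.pi ^ 2 * k j ^ 2 * ∫ x, ψ x * (p x).re := by
    intro j
    rw [integral_sub (i12 j) (i3 j), integral_sub (i1 j) (i2 j), integral_const_mul,
      integral_const_mul, (h1 j).1.re.test_test (h1 j).2.re hψ, (h1 j).1.im.test hψ.1 hψ.2]
    ring
  rw [Finset.sum_congr rfl fun j _ => e2 j, Finset.sum_sub_distrib, Finset.sum_add_distrib,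
    ← Finset.mul_sum, ← Finset.sum_mul, ← Finset.mul_sum, EuclideanSpace.real_norm_sq_eq]
  congr 2
  · simp only [Finset.sum_mul]
    rw [integral_finsetSum _ fun j _ => integrable_test_mul hlr ((hψ.pd _).pd _)]
  · congr 1
    rw [← Finset.sum_congr rfl fun j _ => integral_const_mul (k j) _, ← integral_finsetSum _ fun j _ =>
      (integrable_test_mul hli (hψ.pd _)).const_mul _]
    refine integral_congr_ae (ae_of_all _ fun x => ?_)
    simp only
    rw [pd_eq_sum, Finset.sum_mul]
    exact Finset.sum_congr rfl fun j _ => by ring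

/-- Imaginary part of the weak Bloch equation. -/
theorem BlochEq.weak_im {V : Rd d → ℝ} {k : Rd d} {E : ℝ} {p : Rd d → ℂ} (h : BlochEq V k E p)
    (hp : LocallyIntegrable p) {ψ : Rd d → ℝ} (hψ : IsTest ψ) :
    (∫ x, (∑ j, DefectModes.pd (stdVec j) (DefectModes.pd (stdVec j) ψ) x) * (p x).im)
      - 4 * Real.pi * (∫ x, DefectModes.pd k ψ x * (p x).re)
      - 4 * Real.pi ^ 2 * ‖k‖ ^ 2 * (∫ x, ψ x * (p x).im)
      = ∫ x, ψ x * ((V x - E) * (p x).im) := by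
  have hl : LocallyIntegrable (fun x => -Complex.I * p x) := by
    exact hp.smul (-Complex.I)
  -- Multiplication by `-i` makes `Im p` the real part and `-Re p` the imaginary part.
  have := (h.const_mul (-Complex.I)).weak_re hl hψ
  simp only [neg_mul, Complex.neg_re, Complex.neg_im, Complex.I_mul_re, Complex.I_mul_im, neg_neg,
    mul_neg, integral_neg] at this
  linarith

end DefectModes

/-! ### Identification of the band edge state with the periodic ground state. -/

namespace DefectModes

variable {d : ℕ}

theorem exists_ae_bound_of_memLp_top {V : Rd d → ℝ} (hV : MemLp V ⊤ (volume : Measure (Rd d))) :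
    ∃ K : ℝ, ∀ᵐ x, |V x| ≤ K := by
  refine ⟨(eLpNormEssSup V volume).toReal, ?_⟩
  have hfin : eLpNormEssSup V volume ≠ ⊤ := by
    have := hV.2
    rw [eLpNorm_exponent_top] at this
    exact this.ne
  filter_upwards [ae_le_eLpNormEssSup (f := V) (μ := volume)] with x hx
  have := ENNReal.toReal_mono hfin hx
  simpa using this

theorem LatticePeriodic.pot {V : Rd d → ℝ} (hp : LatticePeriodic V) (hV : MemLp V ⊤ (volume : Measure (Rd d))) :
    ∃ K, (lattice d).Pot V K := by
  obtain ⟨K, hK⟩ := exists_ae_bound_of_memLp_top hV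
  exact ⟨K, (LatticePeriodic.perE hp).per, hV.1, hK⟩

theorem MemH2Per.l2_re {p : Rd d → ℂ} (h : MemH2Per p) : (lattice d).L2 (fun x => (p x).re) := by
  refine PCell.L2.of_perE (fun γ x => by rw [LatticePeriodic.perE h.1 γ x]) ?_
  rw [lattice_mu]
  exact h.2.1.re

theorem MemH2Per.l2_im {p : Rd d → ℂ} (h : MemH2Per p) : (lattice d).L2 (fun x => (p x).im) := by
  refine PCell.L2.of_perE (fun γ x => by rw [LatticePeriodic.perE h.1 γ x]) ?_
  rw [lattice_mu]
  exact h.2.1.im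

theorem locallyIntegrable_of_re_im {p : Rd d → ℂ} (h1 : LocallyIntegrable (fun x => (p x).re))
    (h2 : LocallyIntegrable (fun x => (p x).im)) : LocallyIntegrable p := by
  have h : ∀ u : Rd d → ℝ, LocallyIntegrable u → LocallyIntegrable (fun x => (u x : ℂ)) :=
    fun u hu => hu.mono (Complex.continuous_ofReal.comp_aestronglyMeasurable hu.aestronglyMeasurable)
      (ae_of_all _ fun x => by simp)
  have h3 := (h _ h1).add ((h _ h2).smul Complex.I)
  convert! h3 using 1
  ext x
  simp only [Pi.add_apply, Pi.smul_apply, smul_eq_mul]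
  rw [mul_comm, Complex.re_add_im]

theorem pd_zero_vec (ψ : Rd d → ℝ) (x : Rd d) : pd 0 ψ x = 0 := by simp [pd]

/-- At zero quasimomentum the coupling term disappears, so real and imaginary parts solve the
equation separately. -/
theorem SolvesBloch.weakLaplace {V : Rd d → ℝ} {E : ℝ} {p : Rd d → ℂ} (h : SolvesBloch V 0 E p) :
    WeakLaplace (fun x => (p x).re) (fun x => (V x - E) * (p x).re) ∧
      WeakLaplace (fun x => (p x).im) (fun x => (V x - E) * (p x).im) := by
  have hl := locallyIntegrable_of_re_im h.1.l2_re.locallyIntegrable h.1.l2_im.locallyIntegrable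
  constructor
  · intro ψ hψ
    simpa [pd_zero_vec] using h.blochEq.weak_re hl hψ
  · intro ψ hψ
    simpa [pd_zero_vec] using h.blochEq.weak_im hl hψ

theorem wform_eq_of_partials {c : PCell d} {P : Rd d → ℝ} {K : ℝ} (hP : c.Pot P K)
    {u : Rd d → ℝ} {g : Fin d → Rd d → ℝ} {k : Fin d → Fin d → Rd d → ℝ} (hu : c.L2 u)
    (h1 : ∀ j, HasWeakPartial j u (g j) ∧ c.L2 (g j))
    (h2 : ∀ j l, HasWeakPartial l (g j) (k j l) ∧ c.L2 (k j l)) :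
    c.wform stdVec P u g = ∫ x, u x * (P x * u x - ∑ j, k j j x) ∂c.μ := by
  have e1 : ∀ j, ∫ x, (∑ l, (stdVec j : Rd d) l * g l x) ^ 2 ∂c.μ = -∫ x, u x * k j j x ∂c.μ := by
    intro j
    rw [← PCell.integral_weak_mul (h1 j).1 (h2 j j).1 hu (h1 j).2 (h1 j).2 (h2 j j).2]
    refine integral_congr_ae (ae_of_all _ fun x => ?_)
    simp only [stdVec_apply, ite_mul, one_mul, zero_mul, Finset.sum_ite_eq', Finset.mem_univ, if_true]
    ring
  have i1 : Integrable (fun x => u x * (P x * u x)) c.μ := hu.integrable_mul (hP.mul hu)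
  have i2 : ∀ j, Integrable (fun x => u x * k j j x) c.μ := fun j => hu.integrable_mul (h2 j j).2
  simp only [PCell.wform, e1, mul_sub, Finset.mul_sum]
  rw [integral_sub i1 (integrable_finsetSum _ fun j _ => i2 j), integral_finsetSum _ fun j _ => i2 j,
    Finset.sum_neg_distrib, neg_add_eq_sub]
  congr 1
  exact integral_congr_ae (ae_of_all _ fun x => by ring)

/-- Regularity allows integration by parts, and the form of `-Δ + V - l` at an eigenfunction is `(E
- l) ∫ u²`; nonnegativity of the form gives the claim. -/
theorem le_of_weakLaplace {V : Rd d → ℝ} {K l E : ℝ} (hV : (lattice d).Pot V K)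
    (h0 : ∀ φ, (lattice d).Sm φ → 0 ≤ (lattice d).form stdVec (fun x => V x - l) φ φ)
    {u : Rd d → ℝ} (hu : (lattice d).L2 u) (h : WeakLaplace u (fun x => (V x - E) * u x))
    (hne : ¬ (u =ᵐ[volume] 0)) : l ≤ E := by
  have hf := (hV.sub_const E).mul hu
  obtain ⟨g, k, h1, h2, h3⟩ := regularity_laplace hu hf (h.moll hu.locallyIntegrable)
  have h4 := PCell.wform_nonneg (hV.sub_const l) h0 hu h1
  rw [wform_eq_of_partials (hV.sub_const l) hu h1 h2] at h4
  have h5 : ∫ x, u x * ((V x - l) * u x - ∑ j, k j j x) ∂(lattice d).μ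
      = (E - l) * ∫ x, u x ^ 2 ∂(lattice d).μ := by
    rw [← integral_const_mul]
    refine integral_congr_ae ?_
    filter_upwards [PCell.ae_mu (c := lattice d) h3] with x hx
    rw [← hx]; ring
  rw [h5] at h4
  have h6 : 0 < ∫ x, u x ^ 2 ∂(lattice d).μ := by
    refine (integral_nonneg fun x => sq_nonneg _).lt_of_ne fun hz => hne ?_
    have h7 := (integral_eq_zero_iff_of_nonneg (fun x => sq_nonneg _) hu.2.2.integrable_sq).1 hz.symm
    refine hu.1.ae_eq PCell.L2.zero.1 ?_
    filter_upwards [h7] with x hx using pow_eq_zero_iff two_ne_zero |>.1 hx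
  by_contra hlt
  push Not at hlt
  nlinarith

theorem blochPartial_zero (j : Fin d) (p : Rd d → ℂ) : blochPartial 0 j p = weakPartial j p := by
  ext x
  simp [blochPartial]

theorem weakPartial_weakPartial_eq {𝕜 : Type*} [RCLike 𝕜] {j : Fin d} {u g k : Rd d → 𝕜}
    (h1 : HasWeakPartial j u g) (h2 : HasWeakPartial j g k) :
    weakPartial j (weakPartial j u) =ᵐ[volume] k :=
  (h2.congr h1.weakPartial_eq.symm (ae_eq_refl _)).weakPartial_eq

theorem solvesBloch_zero_of {V : Rd d → ℝ} {E : ℝ} {u : Rd d → ℝ} {g : Fin d → Rd d → ℝ}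
    {k : Fin d → Fin d → Rd d → ℝ} (hp : LatticePeriodic u) (hu : (lattice d).L2 u)
    (h1 : ∀ j, HasWeakPartial j u (g j) ∧ (lattice d).L2 (g j))
    (h2 : ∀ j l, HasWeakPartial l (g j) (k j l) ∧ (lattice d).L2 (k j l))
    (h3 : (fun x => (V x - E) * u x) =ᵐ[volume] fun x => ∑ j, k j j x) :
    SolvesBloch V 0 E (fun x => (u x : ℂ)) := by
  refine ⟨memH2Per_ofReal_of hp hu h1 h2, ?_⟩
  simp only [blochPartial_zero]
  filter_upwards [h3, eventually_countable_forall.2 fun j =>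
    weakPartial_weakPartial_eq (h1 j).1.ofReal (h2 j j).1.ofReal] with x hx hk
  simp only [hk]
  have := congrArg (fun t : ℝ => (t : ℂ)) hx
  push_cast at this
  linear_combination this

/-- The band edge state is bounded away from zero, has a bounded gradient, and `-Δ + V - E` is
nonnegative. -/
theorem bandEdge_facts {V w : Rd d → ℝ} {K : ℝ} (hV : (lattice d).Pot V K)
    (hw : IsSimpleBandEdgeState V w) :
    (lattice d).L2 w ∧ ∫ x, w x ^ 2 ∂(lattice d).μ = 1 ∧
    WeakLaplace w (fun x => (V x - bandE0 V 0) * w x) ∧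
    (∃ s a : ℝ, s ^ 2 = 1 ∧ 0 < a ∧ ∀ᵐ x, a ≤ s * w x) ∧
    (∃ B, ∀ᵐ x, |w x| ≤ B) ∧
    (∃ (g : Fin d → Rd d → ℝ) (k : Fin d → Fin d → Rd d → ℝ) (B : ℝ),
      (∀ j, HasWeakPartial j w (g j) ∧ (lattice d).L2 (g j)) ∧
      (∀ j l, HasWeakPartial l (g j) (k j l) ∧ (lattice d).L2 (k j l)) ∧
      ((fun x => (V x - bandE0 V 0) * w x) =ᵐ[volume] fun x => ∑ j, k j j x) ∧
      ∀ j, ∀ᵐ x, |g j x| ≤ B) := by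
  obtain ⟨hwb, hw1, hsimple⟩ := hw
  have hwl : (lattice d).L2 w := by simpa using hwb.1.l2_re
  have hww : WeakLaplace w (fun x => (V x - bandE0 V 0) * w x) := by
    simpa using hwb.weakLaplace.1
  have hw1' : ∫ x, w x ^ 2 ∂(lattice d).μ = 1 := by rw [lattice_mu]; exact hw1
  obtain ⟨l, v, hv, hv0, hvi, hveq, h0⟩ := exists_principal hV
  obtain ⟨v', hvp, hvv, hv2⟩ := hv.exists_rep
  have hveq' : ∀ n x, ∑ j, pd (stdVec j) (pd (stdVec j) (moll n v')) x
      = moll n (fun x => (V x - l) * v' x) x := by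
    intro n x
    have e1 : moll n v' = moll n v := conv_congr hvv
    have e2 : moll n (fun x => (V x - l) * v' x) = moll n (fun x => (V x - l) * v x) :=
      conv_congr (by filter_upwards [hvv] with x hx; rw [hx])
    rw [e1, e2]
    exact hveq n x
  have hv0' : ∀ᵐ x, 0 ≤ v' x := by filter_upwards [hv0, hvv] with x h1 h2; rwa [h2]
  have hvi' : 0 < ∫ x, v' x ∂(lattice d).μ := by
    rwa [integral_congr_ae (PCell.ae_mu (c := lattice d) hvv)]
  have hfl : (lattice d).L2 (fun x => (V x - l) * v' x) := (hV.sub_const l).mul hv2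
  obtain ⟨g, k, h1, h2, h3⟩ := regularity_laplace hv2 hfl hveq'
  have hvne : ¬ (fun x => (v' x : ℂ)) =ᵐ[volume] 0 := by
    intro hz
    have : ∫ x, v' x ∂(lattice d).μ = 0 := by
      rw [integral_congr_ae (g := fun _ => 0), integral_zero]
      filter_upwards [PCell.ae_mu (c := lattice d) hz] with x hx
      exact Complex.ofReal_eq_zero.1 hx
    linarith
  have hvs : SolvesBloch V 0 l (fun x => (v' x : ℂ)) :=
    solvesBloch_zero_of (PerE.latticePeriodic hvp) hv2 h1 h2 h3
  -- The real or the imaginary part of a complex eigenfunction is a nonzero real one with the same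
  -- eigenvalue.
  have hlow : ∀ E' ∈ {E : ℝ | ∃ p : Rd d → ℂ, SolvesBloch V 0 E p ∧ ¬ (p =ᵐ[volume] 0)}, l ≤ E' := by
    rintro E' ⟨p, hp, hpne⟩
    by_cases hre : (fun x => (p x).re) =ᵐ[volume] 0
    · by_cases him : (fun x => (p x).im) =ᵐ[volume] 0
      · exfalso
        apply hpne
        filter_upwards [hre, him] with x e1 e2
        exact Complex.ext e1 e2
      · exact le_of_weakLaplace hV h0 hp.1.l2_im hp.weakLaplace.2 him
    · exact le_of_weakLaplace hV h0 hp.1.l2_re hp.weakLaplace.1 hre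
  -- The infimum in `bandE0` is attained by the ground state just constructed, so its set is
  -- nonempty and bounded below.
  have hE : bandE0 V 0 = l := by
    refine le_antisymm (csInf_le ⟨l, hlow⟩ ⟨_, hvs, hvne⟩) (le_csInf ⟨_, _, hvs, hvne⟩ hlow)
  rw [hE] at hsimple hww ⊢
  -- Simplicity makes the positive ground state a multiple of `w`. Both functions are real, so the
  -- real part of the factor suffices; its sign is the sign of `w`.
  obtain ⟨z, hz⟩ := hsimple _ hvs
  have hz' : ∀ᵐ x, v' x = z.re * w x := by
    filter_upwards [hz] with x hx
    have := congrArg Complex.re hx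
    simpa using this
  have hfv : ∀ᵐ x, (V x - l) * v' x ≤ (K + |l|) * v' x := by
    filter_upwards [(hV.sub_const l).2.2, hv0'] with x e1 e2
    exact mul_le_mul_of_nonneg_right (abs_le.1 e1).2 e2
  obtain ⟨a, ha, hav⟩ := PCell.ae_pos_of_equation isBounded_cellIco hv2 hfl hveq'
    (hV.sub_const l).nonneg hfv hv0' hvi'
  have hzne : z.re ≠ 0 := by
    intro h
    obtain ⟨x, e1, e2⟩ := (hz'.and hav).exists
    rw [h, zero_mul] at e1
    linarith
  have hfw : (lattice d).L2 (fun x => (V x - l) * w x) := (hV.sub_const l).mul hwl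
  have hwm := hww.moll hwl.locallyIntegrable
  obtain ⟨gw, kw, g1, g2, g3⟩ := regularity_laplace hwl hfw hwm
  have hbw : ∀ᵐ x, |(V x - l) * w x| ≤ (K + |l|) * |w x| := by
    filter_upwards [(hV.sub_const l).2.2] with x hx
    rw [abs_mul]
    exact mul_le_mul_of_nonneg_right hx (abs_nonneg _)
  obtain ⟨B, hB⟩ := PCell.ae_bounded_of_equation hwl hfw hwm (hV.sub_const l).nonneg (by
    filter_upwards [hbw] with x hx
    have := (hV.sub_const l).nonneg
    nlinarith)
  choose Bg hBg using fun j => ae_bounded_weakPartial (g1 j).1 hwm hB (S := (K + |l|) * B) (by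
    filter_upwards [hbw, hB] with x hx hx2
    exact hx.trans (mul_le_mul_of_nonneg_left hx2 (hV.sub_const l).nonneg))
  refine ⟨hwl, hw1', hww, ⟨SignType.sign z.re, a / |z.re|, ?_, div_pos ha (abs_pos.2 hzne), ?_⟩,
    ⟨B, hB⟩, gw, kw, ∑ j, |Bg j|, g1, g2, g3, fun j => ?_⟩
  · rcases hzne.lt_or_gt with h | h <;> simp [h]
  · filter_upwards [hz', hav] with x e1 e2
    rw [div_le_iff₀ (abs_pos.2 hzne)]
    have : (SignType.sign z.re : ℝ) * |z.re| = z.re := sign_mul_abs _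
    calc a ≤ v' x := e2
      _ = _ := by rw [e1]; linear_combination -(w x) * this
  · filter_upwards [hBg j] with x hx
    exact hx.trans ((le_abs_self _).trans
      (Finset.single_le_sum (f := fun j => |Bg j|) (fun i _ => abs_nonneg _) (Finset.mem_univ j)))

end DefectModes

/-! ### Difference quotients in the quasimomentum. -/

namespace DefectModes

variable {d : ℕ}

theorem convex_brillouin : Convex ℝ (brillouin d) := by
  have : brillouin d = ⋂ j, (fun x : Rd d => x j) ⁻¹' Set.Icc (-1 / 2 : ℝ) (1 / 2) := by
    ext x; simp [brillouin]
  rw [this]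
  exact convex_iInter fun j => (convex_Icc _ _).is_linear_preimage
    ⟨fun x y => rfl, fun a x => rfl⟩

theorem ball_subset_brillouin : Metric.ball (0 : Rd d) (1 / 2) ⊆ brillouin d := by
  intro k hk j
  rw [mem_ball_zero_iff] at hk
  have h1 := (PiLp.norm_apply_le k j).trans hk.le
  rw [Real.norm_eq_abs, abs_le] at h1
  exact ⟨by linarith [h1.1], h1.2⟩

theorem neg_mem_brillouin {k : Rd d} (h : k ∈ brillouin d) : -k ∈ brillouin d := fun j => by
  have := h j
  simp only [PiLp.neg_apply]
  exact ⟨by linarith [this.2], by linarith [this.1]⟩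

theorem zero_mem_brillouin : (0 : Rd d) ∈ brillouin d :=
  ball_subset_brillouin (Metric.mem_ball_self (by norm_num))

theorem brillouin_mem_nhds {k : Rd d} (hk : k ∈ Metric.ball (0 : Rd d) (1 / 2)) :
    brillouin d ∈ 𝓝 k :=
  Filter.mem_of_superset (Metric.isOpen_ball.mem_nhds hk) ball_subset_brillouin

theorem uniqueDiffOn_brillouin : UniqueDiffOn ℝ (brillouin d) :=
  uniqueDiffOn_convex convex_brillouin ⟨0, mem_interior_iff_mem_nhds.2
    (brillouin_mem_nhds (Metric.mem_ball_self (by norm_num)))⟩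

/-- First and second difference bounds for a function with bounded derivatives on the Brillouin
zone. -/
theorem difference_bounds {f : Rd d → ℂ} {M : ℝ} (hf : ContDiffOn ℝ 3 f (brillouin d))
    (hM : ∀ n : ℕ, n ≤ 3 → ∀ k ∈ brillouin d, ‖iteratedFDerivWithin ℝ n f (brillouin d) k‖ ≤ M)
    {k : Rd d} (hk : k ∈ brillouin d) :
    ‖f k - f 0‖ ≤ M * ‖k‖ ∧ ‖f k + f (-k) - 2 * f 0‖ ≤ 2 * M * ‖k‖ ^ 2 := by
  have hu := uniqueDiffOn_brillouin (d := d)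
  have hd := hf.differentiableOn (by simp)
  constructor
  · have := convex_brillouin.norm_image_sub_le_of_norm_fderivWithin_le (C := M) hd
      (fun x hx => by rw [← norm_iteratedFDerivWithin_one f (hu x hx)]; exact hM 1 (by norm_num) x hx)
      zero_mem_brillouin hk
    simpa using this
  · have hd1 := hf.differentiableOn_iteratedFDerivWithin (m := 1) (by norm_num) hu
    have hlip : ∀ x ∈ brillouin d, ∀ y ∈ brillouin d,
        ‖fderivWithin ℝ f (brillouin d) x - fderivWithin ℝ f (brillouin d) y‖ ≤ M * ‖x - y‖ := by
      intro x hx y hy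
      have h1 := convex_brillouin.norm_image_sub_le_of_norm_fderivWithin_le (C := M) hd1
        (fun x hx => by rw [norm_fderivWithin_iteratedFDerivWithin]; exact hM 2 (by norm_num) x hx)
        hy hx
      rwa [← dist_eq_norm, dist_iteratedFDerivWithin_one _ _ (hu x hx) (hu y hy), dist_eq_norm] at h1
    set s := brillouin d ∩ Metric.closedBall 0 ‖k‖ with hs
    have hsc : Convex ℝ s := convex_brillouin.inter (convex_closedBall 0 _)
    have hM0 : 0 ≤ M := (norm_nonneg _).trans (hM 1 (by norm_num) k hk)
    have hneg : ∀ x : Rd d, HasFDerivWithinAt (fun x : Rd d => -x)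
      (-ContinuousLinearMap.id ℝ (Rd d)) s x := fun x => (hasFDerivWithinAt_id x s).neg
    -- The derivative of the even part is `Df(x) - Df(-x)`, of size at most `2M‖x‖` because `Df` is
    -- Lipschitz. On the intersection with the ball of radius `‖k‖` this is at most `2M‖k‖`.
    have hder : ∀ x ∈ s, HasFDerivWithinAt (fun x => f x + f (-x))
        (fderivWithin ℝ f (brillouin d) x + (fderivWithin ℝ f (brillouin d) (-x)).comp
          (-ContinuousLinearMap.id ℝ (Rd d))) s x := by
      intro x hx
      have h1 := (hd x hx.1).hasFDerivWithinAt.mono (inter_subset_left : s ⊆ brillouin d)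
      have h2 := (hd (-x) (neg_mem_brillouin hx.1)).hasFDerivWithinAt.comp x (hneg x)
        (fun y hy => neg_mem_brillouin hy.1)
      exact h1.add h2
    have hb : ∀ x ∈ s, ‖fderivWithin ℝ f (brillouin d) x + (fderivWithin ℝ f (brillouin d) (-x)).comp
          (-ContinuousLinearMap.id ℝ (Rd d))‖ ≤ 2 * M * ‖k‖ := by
      intro x hx
      rw [ContinuousLinearMap.comp_neg, ContinuousLinearMap.comp_id, ← sub_eq_add_neg]
      refine (hlip x hx.1 (-x) (neg_mem_brillouin hx.1)).trans ?_
      have h1 : ‖x‖ ≤ ‖k‖ := mem_closedBall_zero_iff.1 hx.2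
      have h2 : ‖x - -x‖ ≤ 2 * ‖k‖ := by
        rw [sub_neg_eq_add]
        exact (norm_add_le x x).trans (by linarith)
      nlinarith
    have := hsc.norm_image_sub_le_of_norm_hasFDerivWithin_le hder hb
      ⟨zero_mem_brillouin, by simp⟩ ⟨hk, by simp⟩
    simp only [neg_zero, sub_zero] at this
    calc ‖f k + f (-k) - 2 * f 0‖ = ‖f k + f (-k) - (f 0 + f 0)‖ := by rw [two_mul]
      _ ≤ 2 * M * ‖k‖ * ‖k‖ := this
      _ = _ := by ring

/-- Second order expansion at a critical point along a line. -/
theorem tendsto_second_order {E : Rd d → ℝ} (hE : ContDiffOn ℝ 3 E (brillouin d))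
    (h0 : fderiv ℝ E 0 = 0) (ξ : Rd d) :
    Tendsto (fun t : ℝ => (E (t • ξ) - E 0) / t ^ 2) (𝓝[≠] 0)
      (𝓝 (iteratedFDeriv ℝ 2 E 0 ![ξ, ξ] / 2)) := by
  have hb0 : (0 : Rd d) ∈ Metric.ball (0 : Rd d) (1 / 2) := Metric.mem_ball_self (by norm_num)
  have hEat : ∀ k ∈ Metric.ball (0 : Rd d) (1 / 2), ContDiffAt ℝ 3 E k := fun k hk =>
    hE.contDiffAt (brillouin_mem_nhds hk)
  set A := iteratedFDeriv ℝ 2 E 0 ![ξ, ξ] with hA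
  have hD : DifferentiableAt ℝ (fderiv ℝ E) 0 :=
    ((hEat 0 hb0).fderiv_right (m := 2) (by norm_num)).differentiableAt (by norm_num)
  have hA2 : A = fderiv ℝ (fderiv ℝ E) 0 ξ ξ := by
    rw [hA, iteratedFDeriv_two_apply]; simp
  have h1 : HasDerivAt (fun t : ℝ => fderiv ℝ E (t • ξ) ξ) A 0 := by
    have e1 : HasDerivAt (fun t : ℝ => t • ξ) ξ 0 := by
      simpa using (hasDerivAt_id (0 : ℝ)).smul_const ξ
    have e2 : HasFDerivAt (fderiv ℝ E) (fderiv ℝ (fderiv ℝ E) 0) ((0 : ℝ) • ξ) := by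
      rw [zero_smul]; exact hD.hasFDerivAt
    have e3 := e2.comp_hasDerivAt (0 : ℝ) e1
    rw [hA2]
    exact e3.clm_apply (hasDerivAt_const (0 : ℝ) ξ) |>.congr_deriv (by simp)
  rw [hasDerivAt_iff_isLittleO] at h1
  rw [Metric.tendsto_nhdsWithin_nhds]
  intro ε hε
  have h2 := h1.def (half_pos hε)
  simp only [zero_smul, h0, sub_zero, smul_eq_mul] at h2
  obtain ⟨δ, hδ, hδ2⟩ := Metric.eventually_nhds_iff.1 h2
  refine ⟨min δ (1 / (2 * (‖ξ‖ + 1))), by positivity, fun t ht htd => ?_⟩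
  have ht0 : t ≠ 0 := ht
  rw [Real.dist_eq, sub_zero, lt_min_iff] at htd
  have hball : ∀ s : ℝ, |s| ≤ |t| → s • ξ ∈ Metric.ball (0 : Rd d) (1 / 2) := by
    intro s hs
    rw [mem_ball_zero_iff, norm_smul, Real.norm_eq_abs]
    have h3 : |t| * (2 * (‖ξ‖ + 1)) < 1 := by
      have := htd.2
      rwa [lt_div_iff₀ (by positivity)] at this
    nlinarith [norm_nonneg ξ, abs_nonneg s, mul_le_mul_of_nonneg_right hs (norm_nonneg ξ),
      abs_pos.2 ht0]
  -- The mean value inequality is applied to `E(sξ) - A s² / 2`, whose derivative is `o(s)` because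
  -- the gradient vanishes at zero.
  have hder : ∀ s ∈ Set.Icc (-|t|) |t|, HasDerivWithinAt (fun s : ℝ => E (s • ξ) - A / 2 * s ^ 2)
      (fderiv ℝ E (s • ξ) ξ - s * A) (Set.Icc (-|t|) |t|) s := by
    intro s hs
    have e1 : HasDerivAt (fun t : ℝ => t • ξ) ξ s := by
      simpa using (hasDerivAt_id s).smul_const ξ
    have e2 := ((hEat _ (hball s (abs_le.2 hs))).differentiableAt (by norm_num)).hasFDerivAt.comp_hasDerivAt s e1
    have e3 := (hasDerivAt_pow 2 s).const_mul (A / 2)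
    refine ((e2.sub e3).congr_deriv ?_).hasDerivWithinAt
    simp; ring
  have hbound : ∀ s ∈ Set.Icc (-|t|) |t|, ‖fderiv ℝ E (s • ξ) ξ - s * A‖ ≤ ε / 2 * |t| := by
    intro s hs
    have hs' := abs_le.2 hs
    have := hδ2 (y := s) (by rw [Real.dist_eq, sub_zero]; exact lt_of_le_of_lt hs' htd.1)
    simp only [zero_apply, sub_zero] at this
    refine this.trans ?_
    rw [Real.norm_eq_abs]
    exact mul_le_mul_of_nonneg_left hs' (by linarith)
  have h3 := (convex_Icc (-|t|) |t|).norm_image_sub_le_of_norm_hasDerivWithin_le hder hbound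
    (x := 0) (y := t) ⟨by simp, abs_nonneg t⟩ ⟨neg_abs_le t, le_abs_self t⟩
  simp only [zero_smul, sub_zero, ne_eq, OfNat.ofNat_ne_zero, not_false_eq_true, zero_pow, mul_zero,
    Real.norm_eq_abs] at h3
  rw [Real.dist_eq]
  have e4 : (E (t • ξ) - E 0) / t ^ 2 - A / 2 = (E (t • ξ) - A / 2 * t ^ 2 - E 0) / t ^ 2 := by
    field_simp; ring
  rw [e4, abs_div, abs_of_pos (by positivity : 0 < t ^ 2), div_lt_iff₀ (by positivity)]
  rw [mul_assoc, ← sq, sq_abs] at h3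
  nlinarith [sq_pos_of_ne_zero ht0]

end DefectModes

/-! ### First and second order expansion of the Bloch eigenfunctions. -/

namespace DefectModes

variable {d : ℕ}

noncomputable def lap (ψ : Rd d → ℝ) : Rd d → ℝ := fun x => ∑ j, pd (stdVec j) (pd (stdVec j) ψ) x

theorem IsTest.lap {ψ : Rd d → ℝ} (h : IsTest ψ) : IsTest (lap ψ) :=
  ⟨ContDiff.sum fun j _ => ((h.pd _).pd _).1, by
    refine HasCompactSupport.intro h.2.isCompact fun x hx => ?_
    refine Finset.sum_eq_zero fun j _ => ?_
    have h1 : tsupport (DefectModes.pd (stdVec j) (DefectModes.pd (stdVec j) ψ)) ⊆ tsupport ψ :=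
      (tsupport_fderiv_apply_subset ℝ (stdVec j)).trans (tsupport_fderiv_apply_subset ℝ (stdVec j))
    exact image_eq_zero_of_notMem_tsupport fun h => hx (h1 h)⟩

theorem integral_test_lin {ψ f g : Rd d → ℝ} (hψ : IsTest ψ) (hf : LocallyIntegrable f)
    (hg : LocallyIntegrable g) (s t : ℝ) :
    ∫ x, ψ x * (s * f x + t * g x) = s * (∫ x, ψ x * f x) + t * ∫ x, ψ x * g x := by
  rw [← integral_const_mul, ← integral_const_mul, ← integral_add
    ((integrable_test_mul hf hψ).const_mul s) ((integrable_test_mul hg hψ).const_mul t)]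
  exact integral_congr_ae (ae_of_all _ fun x => by ring)

theorem PCell.L2.lin {c : PCell d} {f g : Rd d → ℝ} (hf : c.L2 f) (hg : c.L2 g) (s t : ℝ) :
    c.L2 (fun x => s * f x + t * g x) := (hf.const_mul s).add (hg.const_mul t)

/-- The bounded potential is moved onto the periodized test function, which stays square integrable.
-/
theorem PCell.tendsto_test_pot {c : PCell d} {u : ℕ → Rd d → ℝ} {v P : Rd d → ℝ} {K : ℝ}
    (hP : c.Pot P K) (hu : ∀ n, c.L2 (u n)) (hv : c.L2 v)
    (t : ∀ g, MemLp g 2 c.μ → Tendsto (fun n => ∫ x, u n x * g x ∂c.μ) atTop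
      (𝓝 (∫ x, v x * g x ∂c.μ))) {ψ : Rd d → ℝ} (hψ : IsTest ψ) :
    Tendsto (fun n => ∫ x, ψ x * (P x * u n x)) atTop (𝓝 (∫ x, ψ x * (P x * v x))) := by
  obtain ⟨Ψ, hΨ, h⟩ := PCell.exists_periodization (c := c) hψ.1.continuous hψ.2
  have h1 : MemLp (fun x => P x * Ψ x) 2 c.μ := by
    refine (hΨ.const_mul K).of_le_mul (c := 1) (hP.2.1.restrict.mul hΨ.1) ?_
    filter_upwards [PCell.ae_mu (c := c) hP.2.2] with x hx
    rw [one_mul, norm_mul, norm_mul, Real.norm_eq_abs, Real.norm_eq_abs K]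
    exact mul_le_mul_of_nonneg_right (hx.trans (le_abs_self K)) (norm_nonneg _)
  have h2 := t _ h1
  rw [h _ (hP.mul hv)]
  simp only [fun n => h _ (hP.mul (hu n))]
  have e : ∀ f : Rd d → ℝ, ∫ x, P x * f x * Ψ x ∂c.μ = ∫ x, f x * (P x * Ψ x) ∂c.μ := fun f =>
    integral_congr_ae (ae_of_all _ fun x => by ring)
  simpa only [e] using h2

/-- Odd difference of the weak equations at `±tξ`. `L`, `G`, `I`, `W` stand for the integrals of a
Bloch function against `Δψ`, `∂_ξ ψ`, `ψ` and `(V - E_0(0)) ψ`; the energy differences are kept as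
second order quotients. -/
theorem bloch_algebra_first {t p r L L' G G' I I' W W' e e₁ e₂ : ℝ} (ht : t ≠ 0)
    (h1 : L - 4 * p * (t * G) - 4 * p ^ 2 * (t * r) ^ 2 * I = W + (e - e₁) * I)
    (h2 : L' - 4 * p * (-t * G') - 4 * p ^ 2 * (t * r) ^ 2 * I' = W' + (e - e₂) * I') :
    1 / (2 * t) * L + -(1 / (2 * t)) * L' - 2 * p * (G + G')
      - 4 * p ^ 2 * (t * r) ^ 2 * (1 / (2 * t) * I + -(1 / (2 * t)) * I')
      = 1 / (2 * t) * W + -(1 / (2 * t)) * W' - t / 2 * ((e₁ - e) / t ^ 2 * I)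
        + t / 2 * ((e₂ - e) / t ^ 2 * I') := by
  field_simp
  linear_combination h1 - h2

/-- Second symmetric difference of the equations at `tξ`, `-tξ` and `0`, in the same notation. -/
theorem bloch_algebra_second {t p r L L' L₀ G G' I I' W W' W₀ e e₁ e₂ : ℝ} (ht : t ≠ 0)
    (h0 : L₀ = W₀)
    (h1 : L + 4 * p * (t * G) - 4 * p ^ 2 * (t * r) ^ 2 * I = W + (e - e₁) * I)
    (h2 : L' + 4 * p * (-t * G') - 4 * p ^ 2 * (t * r) ^ 2 * I' = W' + (e - e₂) * I') :
    1 / t ^ 2 * (1 * L + 1 * L') + -(2 / t ^ 2) * L₀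
      + 8 * p * (1 / (2 * t) * G + -(1 / (2 * t)) * G') - 4 * p ^ 2 * r ^ 2 * (I + I')
      = 1 / t ^ 2 * (1 * W + 1 * W') + -(2 / t ^ 2) * W₀
        - ((e₁ - e) / t ^ 2 * I + (e₂ - e) / t ^ 2 * I') := by
  field_simp
  linear_combination 2 * h1 + 2 * h2 - 4 * h0

/-- First and second order expansion of the Bloch eigenfunctions in the quasimomentum, in weak
form. -/
theorem exists_bloch_expansion {V w : Rd d → ℝ} {K : ℝ} (hV : (lattice d).Pot V K)
    (hband : BandRegular V) (hw : IsSimpleBandEdgeState V w) (hgrad : fderiv ℝ (bandE0 V) 0 = 0)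
    (ξ : Rd d) : ∃ Y S : Rd d → ℝ, (lattice d).L2 Y ∧ (lattice d).L2 S ∧
      (∀ ψ, IsTest ψ → (∫ x, lap ψ x * Y x) - 4 * Real.pi * (∫ x, pd ξ ψ x * w x)
        = ∫ x, ψ x * ((V x - bandE0 V 0) * Y x)) ∧
      ∀ ψ, IsTest ψ → (∫ x, lap ψ x * S x) + 8 * Real.pi * (∫ x, pd ξ ψ x * Y x)
        - 8 * Real.pi ^ 2 * ‖ξ‖ ^ 2 * (∫ x, ψ x * w x)
        = (∫ x, ψ x * ((V x - bandE0 V 0) * S x))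
          - iteratedFDeriv ℝ 2 (bandE0 V) 0 ![ξ, ξ] * ∫ x, ψ x * w x := by
  obtain ⟨hEr, p, hp, M, hM2, hMp⟩ := hband
  obtain ⟨hwl, hw1, hww, -, -, -⟩ := bandEdge_facts hV hw
  set E := bandE0 V with hEd
  rw [← lattice_mu] at hM2 hMp
  obtain ⟨z, hz⟩ := hw.2.2 _ (hp 0 zero_mem_brillouin).1
  have hz0 : z ≠ 0 := by
    rintro rfl
    have h1 := (hp 0 zero_mem_brillouin).2
    rw [integral_congr_ae (g := fun _ => 0) (by
      filter_upwards [ae_restrict_of_ae hz] with x hx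
      rw [hx]; simp)] at h1
    simp at h1
  -- Dividing by the constant relating `p 0` to `w` makes the family start exactly at `w`.
  set P : Rd d → Rd d → ℂ := fun k x => z⁻¹ * p k x with hPd
  have hPb : ∀ k ∈ brillouin d, BlochEq V k (E k) (P k) := fun k hk =>
    (hp k hk).1.blochEq.const_mul z⁻¹
  have hPa : ∀ k ∈ brillouin d, (lattice d).L2 (fun x => (P k x).re) := fun k hk => by
    have := ((hp k hk).1.1.l2_re).lin (hp k hk).1.1.l2_im z⁻¹.re (-z⁻¹.im)
    convert! this using 2 with x
    simp only [hPd, Complex.mul_re]; ring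
  have hPi : ∀ k ∈ brillouin d, (lattice d).L2 (fun x => (P k x).im) := fun k hk => by
    have := ((hp k hk).1.1.l2_im).lin (hp k hk).1.1.l2_re z⁻¹.re z⁻¹.im
    convert! this using 2 with x
  have hP0 : ∀ᵐ x ∂(lattice d).μ, P 0 x = w x := by
    filter_upwards [PCell.ae_mu (c := lattice d) hz] with x hx
    simp only [hPd, hx]
    rw [← mul_assoc, inv_mul_cancel₀ hz0, one_mul]
  set N : Rd d → ℝ := fun x => ‖z⁻¹‖ * M x with hN
  have hN2 : MemLp N 2 (lattice d).μ := hM2.const_mul _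
  have hdiff : ∀ᵐ x ∂(lattice d).μ, ∀ k ∈ brillouin d, ‖P k x - w x‖ ≤ N x * ‖k‖ ∧
      ‖P k x + P (-k) x - 2 * w x‖ ≤ 2 * N x * ‖k‖ ^ 2 := by
    filter_upwards [hMp, hP0] with x hx h0 k hk
    obtain ⟨h1, h2⟩ := difference_bounds hx.1 hx.2 hk
    rw [← h0]
    simp only [hPd, hN]
    constructor
    · rw [← mul_sub, norm_mul, mul_assoc]
      exact mul_le_mul_of_nonneg_left h1 (norm_nonneg _)
    · rw [show z⁻¹ * p k x + z⁻¹ * p (-k) x - 2 * (z⁻¹ * p 0 x)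
        = z⁻¹ * (p k x + p (-k) x - 2 * p 0 x) by ring, norm_mul]
      calc _ ≤ ‖z⁻¹‖ * (2 * M x * ‖k‖ ^ 2) := mul_le_mul_of_nonneg_left h2 (norm_nonneg _)
        _ = _ := by ring
  -- The prefactor keeps `t n • ξ` inside the ball of radius one half, where the derivative bounds
  -- hold.
  set t : ℕ → ℝ := fun n => (1 / (2 * (‖ξ‖ + 1))) * (1 / ((n : ℝ) + 1)) with ht
  have ht0 : ∀ n, 0 < t n := fun n => by positivity
  have htt : Tendsto t atTop (𝓝 0) := by
    have := (tendsto_one_div_add_atTop_nhds_zero_nat (𝕜 := ℝ)).const_mul (1 / (2 * (‖ξ‖ + 1)))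
    rwa [mul_zero] at this
  have hmem : ∀ n, t n • ξ ∈ brillouin d := fun n => by
    refine ball_subset_brillouin ?_
    rw [mem_ball_zero_iff, norm_smul, Real.norm_of_nonneg (ht0 n).le]
    have h1 : (1 : ℝ) / ((n : ℝ) + 1) ≤ 1 := by
      rw [div_le_one (by positivity)]; linarith [(Nat.cast_nonneg n : (0 : ℝ) ≤ n)]
    have h2 : t n ≤ 1 / (2 * (‖ξ‖ + 1)) := mul_le_of_le_one_right (by positivity) h1
    calc t n * ‖ξ‖ ≤ 1 / (2 * (‖ξ‖ + 1)) * ‖ξ‖ := mul_le_mul_of_nonneg_right h2 (norm_nonneg _)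
      _ < 1 / 2 := by
        rw [div_mul_eq_mul_div, one_mul, div_lt_div_iff₀ (by positivity) (by norm_num)]
        linarith
  have hmem' : ∀ n, -(t n • ξ) ∈ brillouin d := fun n => neg_mem_brillouin (hmem n)
  set a : ℕ → Rd d → ℝ := fun n x => (P (t n • ξ) x).re with had
  set a' : ℕ → Rd d → ℝ := fun n x => (P (-(t n • ξ)) x).re with had'
  set b : ℕ → Rd d → ℝ := fun n x => (P (t n • ξ) x).im with hbd
  set b' : ℕ → Rd d → ℝ := fun n x => (P (-(t n • ξ)) x).im with hbd'
  have ha : ∀ n, (lattice d).L2 (a n) := fun n => hPa _ (hmem n)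
  have ha' : ∀ n, (lattice d).L2 (a' n) := fun n => hPa _ (hmem' n)
  have hb : ∀ n, (lattice d).L2 (b n) := fun n => hPi _ (hmem n)
  have hb' : ∀ n, (lattice d).L2 (b' n) := fun n => hPi _ (hmem' n)
  have hnorm : ∀ n, ‖t n • ξ‖ = t n * ‖ξ‖ := fun n => by
    rw [norm_smul, Real.norm_of_nonneg (ht0 n).le]
  have hab : ∀ᵐ x ∂(lattice d).μ, ∀ n, |a n x - w x| ≤ N x * (t n * ‖ξ‖) ∧
      |a' n x - w x| ≤ N x * (t n * ‖ξ‖) ∧ |b n x| ≤ N x * (t n * ‖ξ‖) ∧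
      |b' n x| ≤ N x * (t n * ‖ξ‖) ∧ |a n x + a' n x - 2 * w x| ≤ 2 * N x * (t n * ‖ξ‖) ^ 2 := by
    filter_upwards [hdiff] with x hx n
    have h1 := (hx _ (hmem n)).1
    have h2 := (hx _ (hmem' n)).1
    have h3 := (hx _ (hmem n)).2
    rw [norm_neg] at h2
    rw [hnorm] at h1 h2 h3
    have e1 := (Complex.abs_re_le_norm _).trans h1
    have e2 := (Complex.abs_re_le_norm _).trans h2
    have e3 := (Complex.abs_im_le_norm _).trans h1
    have e4 := (Complex.abs_im_le_norm _).trans h2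
    have e5 := (Complex.abs_re_le_norm _).trans h3
    simp only [Complex.sub_re, Complex.sub_im, Complex.add_re, Complex.ofReal_re, Complex.ofReal_im,
      sub_zero, Complex.mul_re, Complex.re_ofNat, Complex.im_ofNat, zero_mul] at e1 e2 e3 e4 e5
    exact ⟨e1, e2, e3, e4, e5⟩
  -- The odd first difference of imaginary parts and the second difference of real parts. The Bloch
  -- equation couples real and imaginary parts only through its first order term, so these two form
  -- a closed system in the limit.
  set y : ℕ → Rd d → ℝ := fun n x => 1 / (2 * t n) * b n x + -(1 / (2 * t n)) * b' n x with hyd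
  set s₁ : ℕ → Rd d → ℝ := fun n x => 1 * a n x + 1 * a' n x with hs1
  set S : ℕ → Rd d → ℝ := fun n x => 1 / t n ^ 2 * s₁ n x + -(2 / t n ^ 2) * w x with hSd
  have hy : ∀ n, (lattice d).L2 (y n) := fun n => (hb n).lin (hb' n) _ _
  have hs1l : ∀ n, (lattice d).L2 (s₁ n) := fun n => (ha n).lin (ha' n) _ _
  have hS : ∀ n, (lattice d).L2 (S n) := fun n => (hs1l n).lin hwl _ _
  set C : ℝ := ∫ x, N x ^ 2 ∂(lattice d).μ with hC
  have hNi : Integrable (fun x => N x ^ 2) (lattice d).μ := hN2.integrable_sq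
  have hybd : ∀ n, ∫ x, y n x ^ 2 ∂(lattice d).μ ≤ ‖ξ‖ ^ 2 * C := by
    intro n
    rw [hC, ← integral_const_mul]
    refine integral_mono_ae (hy n).2.2.integrable_sq (hNi.const_mul _) ?_
    filter_upwards [hab] with x hx
    obtain ⟨-, -, h3, h4, -⟩ := hx n
    have h5 : |y n x| ≤ ‖ξ‖ * N x := by
      have e : y n x = (b n x - b' n x) / (2 * t n) := by simp only [hyd]; ring
      rw [e, abs_div, abs_of_pos (mul_pos two_pos (ht0 n)), div_le_iff₀ (mul_pos two_pos (ht0 n))]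
      have := abs_sub (b n x) (b' n x)
      nlinarith
    rw [← mul_pow]
    exact sq_le_sq' (by linarith [(abs_le.1 h5).1]) (abs_le.1 h5).2
  have hSbd : ∀ n, ∫ x, S n x ^ 2 ∂(lattice d).μ ≤ (2 * ‖ξ‖ ^ 2) ^ 2 * C := by
    intro n
    rw [hC, ← integral_const_mul]
    refine integral_mono_ae (hS n).2.2.integrable_sq (hNi.const_mul _) ?_
    filter_upwards [hab] with x hx
    obtain ⟨-, -, -, -, h3⟩ := hx n
    have h5 : |S n x| ≤ 2 * ‖ξ‖ ^ 2 * N x := by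
      have e : S n x = (a n x + a' n x - 2 * w x) / t n ^ 2 := by simp only [hSd, hs1]; ring
      have h6 : 0 < t n ^ 2 := pow_pos (ht0 n) 2
      rw [e, abs_div, abs_of_pos h6, div_le_iff₀ h6]
      nlinarith
    rw [← mul_pow]
    exact sq_le_sq' (by linarith [(abs_le.1 h5).1]) (abs_le.1 h5).2
  -- The second subsequence is extracted from the first, so both weak limits hold along the
  -- composite.
  obtain ⟨Y, hY, σ₁, hσ₁, hYw⟩ := PCell.exists_weak_subseq hy hybd
  obtain ⟨S₀, hS₀, σ₂, hσ₂, hSw⟩ := PCell.exists_weak_subseq (fun n => hS (σ₁ n))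
    (fun n => hSbd (σ₁ n))
  set σ : ℕ → ℕ := fun n => σ₁ (σ₂ n) with hσ
  have hσt : Tendsto σ atTop atTop := (hσ₁.comp hσ₂).tendsto_atTop
  have hYw' : ∀ g, MemLp g 2 (lattice d).μ → Tendsto (fun n => ∫ x, y (σ n) x * g x ∂(lattice d).μ)
      atTop (𝓝 (∫ x, Y x * g x ∂(lattice d).μ)) := fun g hg =>
    (hYw g hg).comp hσ₂.tendsto_atTop
  have tσ : Tendsto (fun n => t (σ n)) atTop (𝓝 0) := htt.comp hσt
  have hEσ : Tendsto (fun n => (E (t (σ n) • ξ) - E 0) / t (σ n) ^ 2) atTop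
      (𝓝 (iteratedFDeriv ℝ 2 E 0 ![ξ, ξ] / 2)) :=
    (tendsto_second_order hEr hgrad ξ).comp (tendsto_nhdsWithin_iff.2
      ⟨tσ, Eventually.of_forall fun n => (ht0 _).ne'⟩)
  have hEσ' : Tendsto (fun n => (E (-(t (σ n) • ξ)) - E 0) / t (σ n) ^ 2) atTop
      (𝓝 (iteratedFDeriv ℝ 2 E 0 ![ξ, ξ] / 2)) := by
    have := (tendsto_second_order hEr hgrad ξ).comp (f := fun n => -t (σ n)) (x := atTop)
      (tendsto_nhdsWithin_iff.2 ⟨by simpa using tσ.neg, Eventually.of_forall fun n =>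
        (neg_ne_zero.2 (ht0 _).ne')⟩)
    simpa [Function.comp_def] using this
  have strong : ∀ f : ℕ → Rd d → ℝ, (∀ n, (lattice d).L2 (f n)) → ∀ f₀, (lattice d).L2 f₀ →
      (∀ᵐ x ∂(lattice d).μ, ∀ n, |f n x - f₀ x| ≤ N x * (t n * ‖ξ‖)) → ∀ ψ, IsTest ψ →
      Tendsto (fun n => ∫ x, ψ x * f (σ n) x) atTop (𝓝 (∫ x, ψ x * f₀ x)) := by
    intro f hf f₀ hf₀ hle ψ hψ
    refine PCell.tendsto_integral_test (fun n => hf (σ n)) hf₀ ?_ hψ.1.continuous hψ.2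
    have h1 : ∀ n, eLpNorm (f (σ n) - f₀) 2 (lattice d).μ
        ≤ ENNReal.ofReal (t (σ n) * ‖ξ‖) * eLpNorm N 2 (lattice d).μ := fun n => by
      refine eLpNorm_le_mul_eLpNorm_of_ae_le_mul ?_ 2
      filter_upwards [hle] with x hx
      refine (hx (σ n)).trans ?_
      rw [mul_comm]
      exact mul_le_mul_of_nonneg_left (le_abs_self _) (mul_nonneg (ht0 _).le (norm_nonneg _))
    have h2 : Tendsto (fun n => ENNReal.ofReal (t (σ n) * ‖ξ‖) * eLpNorm N 2 (lattice d).μ)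
        atTop (𝓝 0) := by
      have h3 := ENNReal.tendsto_ofReal (tσ.mul_const ‖ξ‖)
      rw [zero_mul, ENNReal.ofReal_zero] at h3
      have h4 := ENNReal.Tendsto.mul_const (b := eLpNorm N 2 (lattice d).μ) h3 (Or.inr hN2.2.ne)
      rwa [zero_mul] at h4
    exact tendsto_of_tendsto_of_tendsto_of_le_of_le tendsto_const_nhds h2 (fun _ => zero_le) h1
  have ta : ∀ ψ, IsTest ψ → Tendsto (fun n => ∫ x, ψ x * a (σ n) x) atTop (𝓝 (∫ x, ψ x * w x)) :=
    strong a ha w hwl (by filter_upwards [hab] with x hx n using (hx n).1)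
  have ta' : ∀ ψ, IsTest ψ → Tendsto (fun n => ∫ x, ψ x * a' (σ n) x) atTop (𝓝 (∫ x, ψ x * w x)) :=
    strong a' ha' w hwl (by filter_upwards [hab] with x hx n using (hx n).2.1)
  have tb : ∀ ψ, IsTest ψ → Tendsto (fun n => ∫ x, ψ x * b (σ n) x) atTop (𝓝 0) := fun ψ hψ => by
    simpa using strong b hb _ PCell.L2.zero
      (by filter_upwards [hab] with x hx n; simpa using (hx n).2.2.1) ψ hψ
  have tb' : ∀ ψ, IsTest ψ → Tendsto (fun n => ∫ x, ψ x * b' (σ n) x) atTop (𝓝 0) := fun ψ hψ => by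
    simpa using strong b' hb' _ PCell.L2.zero
      (by filter_upwards [hab] with x hx n; simpa using (hx n).2.2.2.1) ψ hψ
  have tY : ∀ ψ, IsTest ψ → Tendsto (fun n => ∫ x, ψ x * y (σ n) x) atTop (𝓝 (∫ x, ψ x * Y x)) :=
    fun ψ hψ => PCell.tendsto_test_of_weak (fun n => hy (σ n)) hY hYw' hψ.1.continuous hψ.2
  have tS : ∀ ψ, IsTest ψ → Tendsto (fun n => ∫ x, ψ x * S (σ n) x) atTop (𝓝 (∫ x, ψ x * S₀ x)) :=
    fun ψ hψ => PCell.tendsto_test_of_weak (fun n => hS (σ n)) hS₀ hSw hψ.1.continuous hψ.2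
  have hVE := hV.sub_const (E 0)
  have tYV : ∀ ψ, IsTest ψ → Tendsto (fun n => ∫ x, ψ x * ((V x - E 0) * y (σ n) x)) atTop
      (𝓝 (∫ x, ψ x * ((V x - E 0) * Y x))) :=
    fun ψ hψ => PCell.tendsto_test_pot hVE (fun n => hy (σ n)) hY hYw' hψ
  have tSV : ∀ ψ, IsTest ψ → Tendsto (fun n => ∫ x, ψ x * ((V x - E 0) * S (σ n) x)) atTop
      (𝓝 (∫ x, ψ x * ((V x - E 0) * S₀ x))) :=
    fun ψ hψ => PCell.tendsto_test_pot hVE (fun n => hS (σ n)) hS₀ hSw hψ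
  have hloc : ∀ k ∈ brillouin d, LocallyIntegrable (P k) := fun k hk =>
    locallyIntegrable_of_re_im (hPa k hk).locallyIntegrable (hPi k hk).locallyIntegrable
  have hsplit : ∀ (ψ f : Rd d → ℝ) (e : ℝ), IsTest ψ → (lattice d).L2 f →
      ∫ x, ψ x * ((V x - e) * f x) = (∫ x, ψ x * ((V x - E 0) * f x)) + (E 0 - e) * ∫ x, ψ x * f x := by
    intro ψ f e hψ hf
    have := integral_test_lin hψ (hVE.mul hf).locallyIntegrable hf.locallyIntegrable 1 (E 0 - e)
    rw [one_mul] at this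
    rw [← this]
    exact integral_congr_ae (ae_of_all _ fun x => by ring)
  have hVlin : ∀ (ψ f g : Rd d → ℝ) (α β : ℝ), IsTest ψ → (lattice d).L2 f → (lattice d).L2 g →
      ∫ x, ψ x * ((V x - E 0) * (α * f x + β * g x))
        = α * (∫ x, ψ x * ((V x - E 0) * f x)) + β * ∫ x, ψ x * ((V x - E 0) * g x) := by
    intro ψ f g α β hψ hf hg
    rw [← integral_test_lin hψ (hVE.mul hf).locallyIntegrable (hVE.mul hg).locallyIntegrable]
    exact integral_congr_ae (ae_of_all _ fun x => by ring)
  have hpdt : ∀ (ψ f : Rd d → ℝ) (r : ℝ), ∫ x, pd (r • ξ) ψ x * f x = r * ∫ x, pd ξ ψ x * f x := by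
    intro ψ f r
    rw [← integral_const_mul]
    exact integral_congr_ae (ae_of_all _ fun x => by simp [pd]; ring)
  have hpdt' : ∀ (ψ f : Rd d → ℝ) (r : ℝ),
      ∫ x, pd (-(r • ξ)) ψ x * f x = -r * ∫ x, pd ξ ψ x * f x := by
    intro ψ f r
    rw [← hpdt, neg_smul]
  refine ⟨Y, S₀, hY, hS₀, fun ψ hψ => ?_, fun ψ hψ => ?_⟩
  -- The energy terms carry a factor `t n` and the integrals of the imaginary parts tend to zero, so
  -- they leave no trace in the first order equation.
  · have e1 : ∀ n, (∫ x, lap ψ x * y n x) - 2 * Real.pi * ((∫ x, pd ξ ψ x * a n x)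
        + ∫ x, pd ξ ψ x * a' n x) - 4 * Real.pi ^ 2 * (t n * ‖ξ‖) ^ 2 * (∫ x, ψ x * y n x)
        = (∫ x, ψ x * ((V x - E 0) * y n x))
          - t n / 2 * ((E (t n • ξ) - E 0) / t n ^ 2 * (∫ x, ψ x * b n x))
          + t n / 2 * ((E (-(t n • ξ)) - E 0) / t n ^ 2 * (∫ x, ψ x * b' n x)) := by
      intro n
      have h1 := (hPb _ (hmem n)).weak_im (hloc _ (hmem n)) hψ
      have h2 := (hPb _ (hmem' n)).weak_im (hloc _ (hmem' n)) hψ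
      rw [hsplit _ _ _ hψ (hPi _ (hmem n)), hnorm, hpdt] at h1
      rw [hsplit _ _ _ hψ (hPi _ (hmem' n)), norm_neg, hnorm, hpdt'] at h2
      simp only [hyd]
      rw [integral_test_lin hψ.lap (hb n).locallyIntegrable (hb' n).locallyIntegrable,
        integral_test_lin hψ (hb n).locallyIntegrable (hb' n).locallyIntegrable,
        hVlin _ _ _ _ _ hψ (hb n) (hb' n)]
      change (∫ x, lap ψ x * b n x) - 4 * Real.pi * (t n * (∫ x, pd ξ ψ x * a n x))
        - 4 * Real.pi ^ 2 * (t n * ‖ξ‖) ^ 2 * (∫ x, ψ x * b n x)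
        = (∫ x, ψ x * ((V x - E 0) * b n x)) + (E 0 - E (t n • ξ)) * (∫ x, ψ x * b n x) at h1
      change (∫ x, lap ψ x * b' n x) - 4 * Real.pi * (-t n * (∫ x, pd ξ ψ x * a' n x))
        - 4 * Real.pi ^ 2 * (t n * ‖ξ‖) ^ 2 * (∫ x, ψ x * b' n x)
        = (∫ x, ψ x * ((V x - E 0) * b' n x)) + (E 0 - E (-(t n • ξ))) * (∫ x, ψ x * b' n x) at h2
      exact bloch_algebra_first (ht0 n).ne' h1 h2
    have l1 := (((tY _ hψ.lap).sub (((ta _ (hψ.pd ξ)).add (ta' _ (hψ.pd ξ))).const_mul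
      (2 * Real.pi))).sub ((((tσ.mul_const ‖ξ‖).pow 2).const_mul (4 * Real.pi ^ 2)).mul (tY _ hψ)))
    have l2 := ((tYV _ hψ).sub ((tσ.div_const 2).mul (hEσ.mul (tb _ hψ)))).add
      ((tσ.div_const 2).mul (hEσ'.mul (tb' _ hψ)))
    have := tendsto_nhds_unique l1 (l2.congr fun n => (e1 (σ n)).symm)
    simp only [zero_mul, zero_div, mul_zero, sub_zero, add_zero, ne_eq, OfNat.ofNat_ne_zero,
      not_false_eq_true, zero_pow] at this
    linarith
  · have h0 : ∫ x, lap ψ x * w x = ∫ x, ψ x * ((V x - E 0) * w x) := hww ψ hψ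
    -- Each of the two energy quotients tends to half the second derivative of the band, and the
    -- real parts tend to `w`.
    have e1 : ∀ n, (∫ x, lap ψ x * S n x) + 8 * Real.pi * (∫ x, pd ξ ψ x * y n x)
        - 4 * Real.pi ^ 2 * ‖ξ‖ ^ 2 * ((∫ x, ψ x * a n x) + ∫ x, ψ x * a' n x)
        = (∫ x, ψ x * ((V x - E 0) * S n x))
          - ((E (t n • ξ) - E 0) / t n ^ 2 * (∫ x, ψ x * a n x)
          + (E (-(t n • ξ)) - E 0) / t n ^ 2 * (∫ x, ψ x * a' n x)) := by
      intro n
      have h1 := (hPb _ (hmem n)).weak_re (hloc _ (hmem n)) hψ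
      have h2 := (hPb _ (hmem' n)).weak_re (hloc _ (hmem' n)) hψ
      rw [hsplit _ _ _ hψ (hPa _ (hmem n)), hnorm, hpdt] at h1
      rw [hsplit _ _ _ hψ (hPa _ (hmem' n)), norm_neg, hnorm, hpdt'] at h2
      simp only [hyd, hSd]
      rw [integral_test_lin hψ.lap (hs1l n).locallyIntegrable hwl.locallyIntegrable,
        integral_test_lin (hψ.pd ξ) (hb n).locallyIntegrable (hb' n).locallyIntegrable,
        hVlin _ _ _ _ _ hψ (hs1l n) hwl]
      simp only [hs1]
      rw [integral_test_lin hψ.lap (ha n).locallyIntegrable (ha' n).locallyIntegrable,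
        hVlin _ _ _ _ _ hψ (ha n) (ha' n)]
      change (∫ x, lap ψ x * a n x) + 4 * Real.pi * (t n * (∫ x, pd ξ ψ x * b n x))
        - 4 * Real.pi ^ 2 * (t n * ‖ξ‖) ^ 2 * (∫ x, ψ x * a n x)
        = (∫ x, ψ x * ((V x - E 0) * a n x)) + (E 0 - E (t n • ξ)) * (∫ x, ψ x * a n x) at h1
      change (∫ x, lap ψ x * a' n x) + 4 * Real.pi * (-t n * (∫ x, pd ξ ψ x * b' n x))
        - 4 * Real.pi ^ 2 * (t n * ‖ξ‖) ^ 2 * (∫ x, ψ x * a' n x)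
        = (∫ x, ψ x * ((V x - E 0) * a' n x)) + (E 0 - E (-(t n • ξ))) * (∫ x, ψ x * a' n x) at h2
      exact bloch_algebra_second (ht0 n).ne' h0 h1 h2
    have l1 := ((tS _ hψ.lap).add ((tY _ (hψ.pd ξ)).const_mul (8 * Real.pi))).sub
      (((ta _ hψ).add (ta' _ hψ)).const_mul (4 * Real.pi ^ 2 * ‖ξ‖ ^ 2))
    have l2 := (tSV _ hψ).sub ((hEσ.mul (ta _ hψ)).add (hEσ'.mul (ta' _ hψ)))
    have := tendsto_nhds_unique l1 (l2.congr fun n => (e1 (σ n)).symm)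
    linarith

end DefectModes

/-! ### Correctors and the Hessian of the band. -/

namespace DefectModes

variable {d : ℕ}

theorem WeakLaplace.lin {u v f g : Rd d → ℝ} (hu : WeakLaplace u f) (hv : WeakLaplace v g)
    (lu : LocallyIntegrable u) (lv : LocallyIntegrable v) (lf : LocallyIntegrable f)
    (lg : LocallyIntegrable g) (s t : ℝ) :
    WeakLaplace (fun x => s * u x + t * v x) (fun x => s * f x + t * g x) := by
  intro ψ hψ
  have h1 := integral_test_lin hψ.lap lu lv s t
  have h2 : ∫ x, DefectModes.lap ψ x * u x = ∫ x, ψ x * f x := hu ψ hψ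
  have h3 : ∫ x, DefectModes.lap ψ x * v x = ∫ x, ψ x * g x := hv ψ hψ
  rw [h2, h3, ← integral_test_lin hψ lf lg] at h1
  exact h1

theorem WeakLaplace.congr {u v f g : Rd d → ℝ} (h : WeakLaplace u f) (h1 : u =ᵐ[volume] v)
    (h2 : f =ᵐ[volume] g) : WeakLaplace v g := by
  intro ψ hψ
  have := h ψ hψ
  rw [integral_congr_ae (f := fun x => ψ x * f x) (g := fun x => ψ x * g x)
    (by filter_upwards [h2] with x hx; rw [hx])] at this
  rw [← this]
  exact integral_congr_ae (by filter_upwards [h1] with x hx; rw [hx])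

/-- Green's identity on the period cell. -/
theorem green_identity {c : PCell d} {u v : Rd d → ℝ} {g g' : Fin d → Rd d → ℝ}
    {k k' : Fin d → Fin d → Rd d → ℝ} (hu : c.L2 u) (hv : c.L2 v)
    (h1 : ∀ j, HasWeakPartial j u (g j) ∧ c.L2 (g j))
    (h2 : ∀ j l, HasWeakPartial l (g j) (k j l) ∧ c.L2 (k j l))
    (h1' : ∀ j, HasWeakPartial j v (g' j) ∧ c.L2 (g' j))
    (h2' : ∀ j l, HasWeakPartial l (g' j) (k' j l) ∧ c.L2 (k' j l)) :
    ∫ x, u x * ∑ j, k' j j x ∂c.μ = ∫ x, v x * ∑ j, k j j x ∂c.μ := by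
  simp only [Finset.mul_sum]
  rw [integral_finsetSum _ fun j _ => hu.integrable_mul (h2' j j).2,
    integral_finsetSum _ fun j _ => hv.integrable_mul (h2 j j).2]
  refine Finset.sum_congr rfl fun j _ => ?_
  have e1 := PCell.integral_weak_mul (c := c) (h1 j).1 (h2' j j).1 hu (h1 j).2 (h1' j).2 (h2' j j).2
  have e2 := PCell.integral_weak_mul (c := c) (h1' j).1 (h2 j j).1 hv (h1' j).2 (h1 j).2 (h2 j j).2
  have e3 : ∫ x, g j x * g' j x ∂c.μ = ∫ x, g' j x * g j x ∂c.μ :=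
    integral_congr_ae (ae_of_all _ fun x => mul_comm _ _)
  linarith

theorem integral_pd_test {f ψ : Rd d → ℝ} {g : Fin d → Rd d → ℝ} (h : ∀ j, HasWeakPartial j f (g j))
    (hf : LocallyIntegrable f) (hψ : IsTest ψ) (ξ : Rd d) :
    ∫ x, pd ξ ψ x * f x = -∫ x, ψ x * ∑ j, ξ j * g j x := by
  have e1 : ∫ x, pd ξ ψ x * f x = ∫ x, ∑ j, ξ j * (pd (stdVec j) ψ x * f x) :=
    integral_congr_ae (ae_of_all _ fun x => by
      simp only
      rw [pd_eq_sum, Finset.sum_mul]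
      exact Finset.sum_congr rfl fun j _ => by ring)
  have e2 : ∫ x, ψ x * ∑ j, ξ j * g j x = ∫ x, ∑ j, ξ j * (ψ x * g j x) :=
    integral_congr_ae (ae_of_all _ fun x => by
      simp only
      rw [Finset.mul_sum]
      exact Finset.sum_congr rfl fun j _ => by ring)
  rw [e1, e2, integral_finsetSum _ fun j _ => (integrable_test_mul hf (hψ.pd _)).const_mul _,
    integral_finsetSum _ fun j _ => (integrable_test_mul (h j).2.1 hψ).const_mul _,
    ← Finset.sum_neg_distrib]
  refine Finset.sum_congr rfl fun j _ => ?_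
  rw [integral_const_mul, integral_const_mul, (h j).test hψ.1 hψ.2]
  ring

/-- The corrector equation has a solution. -/
theorem exists_solvesLstar {V w : Rd d → ℝ} {K : ℝ} (hV : (lattice d).Pot V K)
    (hband : BandRegular V) (hw : IsSimpleBandEdgeState V w) (hgrad : fderiv ℝ (bandE0 V) 0 = 0)
    (j : Fin d) : ∃ U, SolvesLstar V w (weakPartial j w) U := by
  obtain ⟨hwl, hw1, hww, -, -, gw, kw, B, g1, g2, g3, gB⟩ := bandEdge_facts hV hw
  obtain ⟨Y, -, hY, -, hYe, -⟩ := exists_bloch_expansion hV hband hw hgrad (stdVec j)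
  set E := bandE0 V 0 with hE
  have hVE := hV.sub_const E
  have hYL : WeakLaplace Y (fun x => (V x - E) * Y x + -(4 * Real.pi) * gw j x) := by
    intro ψ hψ
    have h1 := hYe ψ hψ
    rw [integral_pd_test (fun l => (g1 l).1) hwl.locallyIntegrable hψ] at h1
    simp only [stdVec_apply, ite_mul, one_mul, zero_mul, Finset.sum_ite_eq', Finset.mem_univ,
      if_true] at h1
    have h2 := integral_test_lin hψ (hVE.mul hY).locallyIntegrable (g1 j).2.locallyIntegrable 1
      (-(4 * Real.pi))
    simp only [one_mul] at h2
    rw [h2]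
    change (∫ x, lap ψ x * Y x) = _
    linarith
  -- The first order equation says `L_* Y = 4π ∂_j w`. Dividing by `4π` and subtracting `q w`, which
  -- `L_*` annihilates, enforces orthogonality to `w`.
  set q : ℝ := (∫ x, w x * Y x ∂(lattice d).μ) / (4 * Real.pi) with hq
  have hpi := Real.pi_pos
  set U₀ : Rd d → ℝ := fun x => 1 / (4 * Real.pi) * Y x + -q * w x with hU0
  have hU0l : (lattice d).L2 U₀ := hY.lin hwl _ _
  have hU0L : WeakLaplace U₀ (fun x => (V x - E) * U₀ x - gw j x) := by
    refine (hYL.lin hww hY.locallyIntegrable hwl.locallyIntegrable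
      ((hVE.mul hY).add ((g1 j).2.const_mul _)).locallyIntegrable
      (hVE.mul hwl).locallyIntegrable (1 / (4 * Real.pi)) (-q)).congr (ae_eq_refl _) ?_
    refine ae_of_all _ fun x => ?_
    simp only [hU0]
    field_simp
    ring
  obtain ⟨U, hUp, hUU, hUl⟩ := hU0l.exists_rep
  have hUL : WeakLaplace U (fun x => (V x - E) * U x - gw j x) :=
    hU0L.congr hUU.symm (by filter_upwards [hUU] with x hx; rw [hx])
  obtain ⟨g, k, u1, u2, u3⟩ := regularity_laplace hUl ((hVE.mul hUl).sub (g1 j).2)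
    (hUL.moll hUl.locallyIntegrable)
  refine ⟨U, memH2Per_of (PerE.latticePeriodic hUp) hUl u1 u2, ?_, ?_⟩
  · filter_upwards [u3, (g1 j).1.weakPartial_eq, eventually_countable_forall.2 fun l =>
      weakPartial_weakPartial_eq (u1 l).1 (u2 l l).1] with x e1 e2 e3
    simp only [weakLaplacian, e3]
    rw [← e1, e2]
    ring
  · change ∫ x, w x * U x ∂(cellMeasure d) = 0
    rw [← lattice_mu, integral_congr_ae (g := fun x => 1 / (4 * Real.pi) * (w x * Y x) + -q * w x ^ 2)
      (by filter_upwards [PCell.ae_mu (c := lattice d) hUU] with x hx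
          rw [hx, hU0]; ring),
      integral_add ((hwl.integrable_mul hY).const_mul _) (hwl.2.2.integrable_sq.const_mul _),
      integral_const_mul, integral_const_mul, hw1, hq]
    ring

/-- Correctors and their gradients are bounded. -/
theorem SolvesLstar.facts {V w g U : Rd d → ℝ} {K B : ℝ} (hV : (lattice d).Pot V K)
    (hg : (lattice d).L2 g) (hB : ∀ᵐ x, |g x| ≤ B) (h : SolvesLstar V w g U) :
    (lattice d).L2 U ∧ WeakLaplace U (fun x => (V x - bandE0 V 0) * U x - g x) ∧
    (∃ B', ∀ᵐ x, |U x| ≤ B') ∧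
    ∃ (gU : Fin d → Rd d → ℝ) (kU : Fin d → Fin d → Rd d → ℝ) (B' : ℝ),
      (∀ j, HasWeakPartial j U (gU j) ∧ (lattice d).L2 (gU j)) ∧
      (∀ j l, HasWeakPartial l (gU j) (kU j l) ∧ (lattice d).L2 (kU j l)) ∧
      ((fun x => (V x - bandE0 V 0) * U x - g x) =ᵐ[volume] fun x => ∑ j, kU j j x) ∧
      ∀ j, ∀ᵐ x, |gU j x| ≤ B' := by
  obtain ⟨⟨hp, hU2, hpart⟩, heq, -⟩ := h
  set E := bandE0 V 0 with hE
  have hVE := hV.sub_const E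
  rw [← lattice_mu] at hU2
  have hUl : (lattice d).L2 U := PCell.L2.of_perE (LatticePeriodic.perE hp) hU2
  choose g1 hg1 hg2 using hpart
  choose k1 hk1 _ using fun j => (hg2 j).2 j
  have hUL : WeakLaplace U (fun x => (V x - E) * U x - g x) := by
    refine weakLaplace_of_partials hg1 hk1 hUl.locallyIntegrable ?_
    filter_upwards [heq, eventually_countable_forall.2 fun l =>
      weakPartial_weakPartial_eq (hg1 l) (hk1 l)] with x e1 e2
    simp only [weakLaplacian, e2] at e1
    linarith
  have hm := hUL.moll hUl.locallyIntegrable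
  have hf := (hVE.mul hUl).sub hg
  obtain ⟨gU, kU, u1, u2, u3⟩ := regularity_laplace hUl hf hm
  set C : ℝ := (K + |E|) + |B| with hC
  have hK0 := hVE.nonneg
  have hfb : ∀ᵐ x, |(V x - E) * U x - g x| ≤ C * (|U x| + 1) := by
    filter_upwards [hVE.2.2, hB] with x e1 e2
    have h1 : |(V x - E) * U x| ≤ (K + |E|) * |U x| := by
      rw [abs_mul]; exact mul_le_mul_of_nonneg_right e1 (abs_nonneg _)
    have h2 := abs_sub ((V x - E) * U x) (g x)
    have h3 := le_abs_self B
    have h4 := abs_nonneg (U x)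
    have h5 := abs_nonneg B
    nlinarith
  obtain ⟨B1, hB1⟩ := PCell.ae_bounded_of_equation hUl hf hm (by positivity) hfb
  choose Bg hBg using fun j => ae_bounded_weakPartial (u1 j).1 hm hB1 (S := C * (B1 + 1)) (by
    filter_upwards [hfb, hB1] with x e1 e2
    refine e1.trans (mul_le_mul_of_nonneg_left (by linarith) (by positivity)))
  refine ⟨hUl, hUL, ⟨B1, hB1⟩, gU, kU, ∑ j, |Bg j|, u1, u2, u3, fun j => ?_⟩
  filter_upwards [hBg j] with x hx
  exact hx.trans ((le_abs_self _).trans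
    (Finset.single_le_sum (f := fun j => |Bg j|) (fun i _ => abs_nonneg _) (Finset.mem_univ j)))

/-- The Hessian of the lowest band in terms of the correctors. -/
theorem hessian_eq {V w : Rd d → ℝ} {K : ℝ} (hV : (lattice d).Pot V K)
    (hband : BandRegular V) (hw : IsSimpleBandEdgeState V w) (hgrad : fderiv ℝ (bandE0 V) 0 = 0)
    {gw : Fin d → Rd d → ℝ} {B : ℝ} (g1 : ∀ j, HasWeakPartial j w (gw j) ∧ (lattice d).L2 (gw j))
    (gB : ∀ j, ∀ᵐ x, |gw j x| ≤ B)
    {U : Fin d → Rd d → ℝ} (hU : ∀ j, SolvesLstar V w (gw j) (U j)) (ξ : Rd d) :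
    iteratedFDeriv ℝ 2 (bandE0 V) 0 ![ξ, ξ] = 8 * Real.pi ^ 2 * ‖ξ‖ ^ 2
      - 32 * Real.pi ^ 2 * ∫ x, (∑ j, ξ j * U j x) * (∑ j, ξ j * gw j x) ∂(lattice d).μ := by
  obtain ⟨hwl, hw1, hww, -, -, -⟩ := bandEdge_facts hV hw
  obtain ⟨Y, S, hY, hS, hYe, hSe⟩ := exists_bloch_expansion hV hband hw hgrad ξ
  set E := bandE0 V 0 with hE
  set D := iteratedFDeriv ℝ 2 (bandE0 V) 0 ![ξ, ξ] with hD
  have hVE := hV.sub_const E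
  set gξ : Rd d → ℝ := fun x => ∑ j, ξ j * gw j x with hgξ
  have hgξl : (lattice d).L2 gξ := PCell.L2.sum _ fun j => (g1 j).2.const_mul _
  obtain ⟨-, kw, w1, w2, w3⟩ : ∃ (_ : True) (kw : Fin d → Fin d → Rd d → ℝ),
      (∀ j, HasWeakPartial j w (gw j) ∧ (lattice d).L2 (gw j)) ∧
      (∀ j l, HasWeakPartial l (gw j) (kw j l) ∧ (lattice d).L2 (kw j l)) ∧
      (fun x => (V x - E) * w x) =ᵐ[volume] fun x => ∑ j, kw j j x := by
    obtain ⟨g, k, a1, a2, a3⟩ := regularity_laplace hwl (hVE.mul hwl)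
      (hww.moll hwl.locallyIntegrable)
    exact ⟨trivial, k, g1, fun j l => ⟨(a2 j l).1.congr ((a1 j).1.unique (g1 j).1) (ae_eq_refl _),
      (a2 j l).2⟩, a3⟩
  have hfY : (lattice d).L2 (fun x => (V x - E) * Y x + -(4 * Real.pi) * gξ x) :=
    (hVE.mul hY).add (hgξl.const_mul _)
  have hYL : WeakLaplace Y (fun x => (V x - E) * Y x + -(4 * Real.pi) * gξ x) := by
    intro ψ hψ
    have h1 := hYe ψ hψ
    rw [integral_pd_test (fun l => (g1 l).1) hwl.locallyIntegrable hψ] at h1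
    have h2 := integral_test_lin hψ (hVE.mul hY).locallyIntegrable hgξl.locallyIntegrable 1
      (-(4 * Real.pi))
    simp only [one_mul] at h2
    rw [h2]
    change (∫ x, lap ψ x * Y x) = _
    linarith
  obtain ⟨gY, kY, y1, y2, y3⟩ := regularity_laplace hY hfY (hYL.moll hY.locallyIntegrable)
  set yξ : Rd d → ℝ := fun x => ∑ j, ξ j * gY j x with hyξ
  have hyξl : (lattice d).L2 yξ := PCell.L2.sum _ fun j => (y1 j).2.const_mul _
  set q : ℝ := 8 * Real.pi ^ 2 * ‖ξ‖ ^ 2 - D with hq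
  have hr : (lattice d).L2 (fun x => 8 * Real.pi * yξ x + q * w x) := hyξl.lin hwl _ _
  have hfS : (lattice d).L2 (fun x => (V x - E) * S x + (8 * Real.pi * yξ x + q * w x)) :=
    (hVE.mul hS).add hr
  have hSL : WeakLaplace S (fun x => (V x - E) * S x + (8 * Real.pi * yξ x + q * w x)) := by
    intro ψ hψ
    have h1 := hSe ψ hψ
    rw [integral_pd_test (fun l => (y1 l).1) hY.locallyIntegrable hψ] at h1
    have h2 := integral_test_lin hψ (hVE.mul hS).locallyIntegrable hr.locallyIntegrable 1 1
    simp only [one_mul] at h2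
    rw [h2, integral_test_lin hψ hyξl.locallyIntegrable hwl.locallyIntegrable]
    change (∫ x, lap ψ x * S x) = _
    rw [hq]
    linarith
  obtain ⟨gS, kS, s1, s2, s3⟩ := regularity_laplace hS hfS (hSL.moll hS.locallyIntegrable)
  -- Solvability of the second order equation: paired with `w`, the potential terms cancel and `8π ∫
  -- (∂_ξ Y) w + 8π²|ξ|² - D = 0` remains.
  have e1 := green_identity hwl hS w1 w2 s1 s2
  have e2 : ∫ x, w x * ∑ j, kS j j x ∂(lattice d).μ
      = (∫ x, S x * ∑ j, kw j j x ∂(lattice d).μ)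
        + (8 * Real.pi * (∫ x, yξ x * w x ∂(lattice d).μ) + q * 1) := by
    rw [← hw1, ← integral_const_mul, ← integral_const_mul,
      ← integral_add ((hyξl.integrable_mul hwl).const_mul _) (hwl.2.2.integrable_sq.const_mul _),
      ← integral_add]
    · refine integral_congr_ae ?_
      filter_upwards [PCell.ae_mu (c := lattice d) s3, PCell.ae_mu (c := lattice d) w3] with x a1 a2
      rw [← a1, ← a2]; ring
    · exact hS.integrable_mul (PCell.L2.sum _ fun j => (w2 j j).2)
    · exact ((hyξl.integrable_mul hwl).const_mul _).add (hwl.2.2.integrable_sq.const_mul _)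
  have e3 : ∫ x, yξ x * w x ∂(lattice d).μ = -∫ x, Y x * gξ x ∂(lattice d).μ := by
    have a1 : ∀ j, Integrable (fun x => ξ j * (gY j x * w x)) (lattice d).μ := fun j =>
      ((y1 j).2.integrable_mul hwl).const_mul _
    have a2 : ∀ j, Integrable (fun x => ξ j * (Y x * gw j x)) (lattice d).μ := fun j =>
      (hY.integrable_mul (g1 j).2).const_mul _
    have a3 : ∫ x, yξ x * w x ∂(lattice d).μ = ∫ x, ∑ j, ξ j * (gY j x * w x) ∂(lattice d).μ :=
      integral_congr_ae (ae_of_all _ fun x => by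
        simp only [hyξ, Finset.sum_mul]; exact Finset.sum_congr rfl fun j _ => by ring)
    have a4 : ∫ x, Y x * gξ x ∂(lattice d).μ = ∫ x, ∑ j, ξ j * (Y x * gw j x) ∂(lattice d).μ :=
      integral_congr_ae (ae_of_all _ fun x => by
        simp only [hgξ, Finset.mul_sum]; exact Finset.sum_congr rfl fun j _ => by ring)
    rw [a3, a4, integral_finsetSum _ fun j _ => a1 j, integral_finsetSum _ fun j _ => a2 j,
      ← Finset.sum_neg_distrib]
    refine Finset.sum_congr rfl fun j _ => ?_
    rw [integral_const_mul, integral_const_mul,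
      PCell.integral_weak_mul (y1 j).1 (g1 j).1 hY (y1 j).2 hwl (g1 j).2]
    ring
  set Uξ : Rd d → ℝ := fun x => ∑ j, ξ j * U j x with hUξ
  have hf := fun j => (hU j).facts hV (g1 j).2 (gB j)
  choose hUl hUL hUb gU kU BU u1 u2 u3 uB using hf
  -- Green's identity between `L_* U_j = ∂_j w` and `L_* Y = 4π ∂_ξ w`. It holds whatever multiple
  -- of `w` is contained in `Y`.
  have e4 : ∀ j, ∫ x, Y x * gw j x ∂(lattice d).μ = 4 * Real.pi * ∫ x, U j x * gξ x ∂(lattice d).μ := by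
    intro j
    have a1 := green_identity (hUl j) hY (u1 j) (u2 j) y1 y2
    have i1 : Integrable (fun x => Y x * ((V x - E) * U j x)) (lattice d).μ :=
      hY.integrable_mul (hVE.mul (hUl j))
    have i2 : Integrable (fun x => Y x * gw j x) (lattice d).μ := hY.integrable_mul (g1 j).2
    have i3 : Integrable (fun x => 4 * Real.pi * (U j x * gξ x)) (lattice d).μ :=
      ((hUl j).integrable_mul hgξl).const_mul _
    have a2 : ∫ x, U j x * ∑ i, kY i i x ∂(lattice d).μ
        = (∫ x, Y x * ((V x - E) * U j x) ∂(lattice d).μ)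
          - 4 * Real.pi * ∫ x, U j x * gξ x ∂(lattice d).μ := by
      rw [← integral_const_mul, ← integral_sub i1 i3]
      refine integral_congr_ae ?_
      filter_upwards [PCell.ae_mu (c := lattice d) y3] with x b1
      rw [← b1]; ring
    have a3 : ∫ x, Y x * ∑ i, kU j i i x ∂(lattice d).μ
        = (∫ x, Y x * ((V x - E) * U j x) ∂(lattice d).μ) - ∫ x, Y x * gw j x ∂(lattice d).μ := by
      rw [← integral_sub i1 i2]
      refine integral_congr_ae ?_
      filter_upwards [PCell.ae_mu (c := lattice d) (u3 j)] with x b1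
      rw [← b1]; ring
    linarith
  have e5 : ∫ x, Y x * gξ x ∂(lattice d).μ = 4 * Real.pi * ∫ x, Uξ x * gξ x ∂(lattice d).μ := by
    have a1 : ∫ x, Y x * gξ x ∂(lattice d).μ = ∑ j, ξ j * ∫ x, Y x * gw j x ∂(lattice d).μ := by
      simp only [← integral_const_mul]
      rw [← integral_finsetSum _ fun j _ => (hY.integrable_mul (g1 j).2).const_mul _]
      refine integral_congr_ae (ae_of_all _ fun x => ?_)
      simp only [hgξ, Finset.mul_sum]
      exact Finset.sum_congr rfl fun j _ => by ring
    have a2 : ∫ x, Uξ x * gξ x ∂(lattice d).μ = ∑ j, ξ j * ∫ x, U j x * gξ x ∂(lattice d).μ := by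
      simp only [← integral_const_mul]
      rw [← integral_finsetSum _ fun j _ => ((hUl j).integrable_mul hgξl).const_mul _]
      refine integral_congr_ae (ae_of_all _ fun x => ?_)
      simp only [hUξ, Finset.sum_mul]
      exact Finset.sum_congr rfl fun j _ => by ring
    rw [a1, a2, Finset.mul_sum]
    refine Finset.sum_congr rfl fun j _ => ?_
    rw [e4]; ring
  rw [e3, e5] at e2
  rw [hq] at e2
  linarith

end DefectModes

/-! ### Ground states on `ℝ^d` by the direct method. -/

namespace DefectModes

variable {d : ℕ}

theorem IsTest.sm_whole {ψ : Rd d → ℝ} (hψ : IsTest ψ) : (whole d).Sm ψ := by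
  have h : ∀ vs : List (Rd d), IsTest (vs.foldr DefectModes.pd ψ) := fun vs => by
    induction vs with
    | nil => exact hψ
    | cons a l ih => exact ih.pd a
  refine ⟨hψ.1, fun γ x => ?_, fun vs => whole_l2
    ((h vs).1.continuous.memLp_of_hasCompactSupport (h vs).2)⟩
  obtain ⟨γ, hγ⟩ := γ
  have : γ = 0 := by simpa [whole] using hγ
  simp [this]

/-- Coordinate vectors are combinations of the frame `b`, so the form controls the full gradient. -/
theorem integral_sq_pd_le {m : ℕ} {b : Fin m → Rd d} {C : Fin d → Fin m → ℝ}
    (hC : ∀ j, stdVec j = ∑ i, C j i • b i) {c : PCell d} {φ : Rd d → ℝ} (hφ : c.Sm φ) :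
    ∑ j, ∫ x, pd (stdVec j) φ x ^ 2 ∂c.μ
      ≤ (∑ j, ∑ i, C j i ^ 2) * ∑ i, ∫ x, pd (b i) φ x ^ 2 ∂c.μ := by
  have hi : ∀ v, Integrable (fun x => pd v φ x ^ 2) c.μ := fun v => (hφ.pd v).l2.2.2.integrable_sq
  rw [Finset.sum_mul]
  refine Finset.sum_le_sum fun j _ => ?_
  rw [← integral_finsetSum _ fun i _ => hi _, ← integral_const_mul]
  refine integral_mono (hi _) ((integrable_finsetSum _ fun i _ => hi _).const_mul _) fun x => ?_
  have h : pd (stdVec j) φ x = ∑ i, C j i * pd (b i) φ x := by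
    rw [pd, hC j, map_sum]
    simp [pd]
  simp only [h]
  exact Finset.sum_mul_sq_le_sq_mul_sq _ _ _

/-- Existence of a ground state below the essential spectrum for `-∑ ∂_b² + W + Q` on `ℝ^d`, with
`Q` square integrable and bounded. -/
theorem exists_ground_state {m : ℕ} {b : Fin m → Rd d} {C : Fin d → Fin m → ℝ}
    (hC : ∀ j, stdVec j = ∑ i, C j i • b i) {W Q : Rd d → ℝ} {K B : ℝ}
    (hW : (whole d).Pot W K) (hQ : MemLp Q 2 volume) (hB : ∀ᵐ x, |Q x| ≤ B)
    (h0 : ∀ φ, (whole d).Sm φ → 0 ≤ (whole d).form b W φ φ)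
    {u : Rd d → ℝ} {g : Fin d → Rd d → ℝ} (hu : (whole d).L2 u)
    (hg : ∀ j, HasWeakPartial j u (g j) ∧ (whole d).L2 (g j))
    (hneg : (whole d).wform b (fun x => W x + Q x) u g < 0) :
    ∃ (l : ℝ) (v : Rd d → ℝ) (gv : Fin d → Rd d → ℝ) (k : Fin d → Fin d → Rd d → ℝ),
      l < 0 ∧ (whole d).L2 v ∧ ¬ v =ᵐ[volume] 0 ∧
      (∀ j, HasWeakPartial j v (gv j) ∧ (whole d).L2 (gv j)) ∧
      (∀ i j, HasWeakPartial j (gv i) (k i j) ∧ (whole d).L2 (k i j)) ∧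
      (fun x => (W x + Q x - l) * v x) =ᵐ[volume]
        (fun x => ∑ i, ∑ p, ∑ q, b i p * b i q * k p q x) ∧
      ∀ (u : Rd d → ℝ) (g : Fin d → Rd d → ℝ), (whole d).L2 u →
        (∀ j, HasWeakPartial j u (g j) ∧ (whole d).L2 (g j)) →
        l * ∫ x, u x ^ 2 ≤ (whole d).wform b (fun x => W x + Q x) u g := by
  have hP : (whole d).Pot (fun x => W x + Q x) (K + B) := by
    refine ⟨whole_per _, hW.2.1.add hQ.1, ?_⟩
    filter_upwards [hW.2.2, hB] with x h1 h2
    exact (abs_add_le _ _).trans (add_le_add h1 h2)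
  set P : Rd d → ℝ := fun x => W x + Q x with hPd
  -- A sufficiently fine mollification of the trial function still has negative energy, which makes
  -- the infimum over smooth functions negative.
  obtain ⟨N, hN⟩ := ((PCell.tendsto_form_moll hP hu hg).eventually (gt_mem_nhds hneg)).exists
  have hφ₀ := hu.sm_moll N
  set φ₀ := moll N u
  have hpos : 0 < ∫ x, φ₀ x ^ 2 ∂(whole d).μ := by
    refine (integral_nonneg fun x => sq_nonneg _).lt_of_ne fun h => ?_
    have h1 := PCell.form_ge (b := b) hP hφ₀
    rw [← h, mul_zero, add_zero] at h1
    have h2 : 0 ≤ ∑ i, ∫ x, pd (b i) φ₀ x ^ 2 ∂(whole d).μ :=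
      Finset.sum_nonneg fun i _ => integral_nonneg fun x => sq_nonneg _
    linarith
  obtain ⟨l, -, hinf, φ, hφ, hφ1, t⟩ := PCell.exists_inf (b := b) hP
    ⟨fun x => (Real.sqrt (∫ x, φ₀ x ^ 2 ∂(whole d).μ))⁻¹ * φ₀ x, hφ₀.const_mul _, by
      simp only [mul_pow]
      rw [integral_const_mul, inv_pow, Real.sq_sqrt hpos.le, inv_mul_cancel₀ hpos.ne']⟩
  have hl : l < 0 := by
    by_contra h
    push Not at h
    have := hinf _ hφ₀
    have := mul_nonneg h hpos.le
    linarith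
  have hPl := hP.sub_const l
  have h0l : ∀ φ, (whole d).Sm φ → 0 ≤ (whole d).form b (fun x => P x - l) φ φ := fun φ hφ => by
    rw [PCell.form_sub_const hP hφ]
    linarith [hinf φ hφ]
  have tφ : Tendsto (fun n => (whole d).form b (fun x => P x - l) (φ n) (φ n)) atTop (𝓝 0) := by
    have := t.sub_const l
    rw [sub_self] at this
    refine this.congr fun n => ?_
    rw [PCell.form_sub_const hP (hφ n), hφ1, mul_one]
  obtain ⟨v, hv, s, hs, hw⟩ := PCell.exists_weak_subseq (fun n => (hφ n).l2) (fun n => (hφ1 n).le)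
  -- If the weak limit were zero, the `Q` part of the energy would tend to zero by compactness. The
  -- rest is nonnegative by `h0`, contradicting `l < 0`.
  have hv0 : ¬ v =ᵐ[volume] 0 := by
    intro hvz
    obtain ⟨M, hM⟩ := t.bddAbove_range
    have hgr : ∀ n, ∑ j, ∫ x, pd (stdVec j) (φ (s n)) x ^ 2 ∂(whole d).μ
        ≤ max 1 ((∑ j, ∑ i, C j i ^ 2) * (M + (K + B))) := fun n => by
      refine (integral_sq_pd_le hC (hφ _)).trans (le_max_of_le_right ?_)
      refine mul_le_mul_of_nonneg_left ?_
        (Finset.sum_nonneg fun j _ => Finset.sum_nonneg fun i _ => sq_nonneg _)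
      refine (PCell.form_ge hP (hφ _)).trans ?_
      rw [hφ1, mul_one]
      have := hM ⟨s n, rfl⟩
      simp only at this
      linarith
    have tt : Tendsto (fun n => ∫ x, Q x * φ (s n) x ^ 2 ∂(whole d).μ) atTop (𝓝 0) := by
      refine PCell.tendsto_integral_potential (c := whole d) (B := B)
        (g := fun n j => pd (stdVec j) (φ (s n)))
        (fun n => (hφ (s n)).l2)
        (fun n j => ⟨hasWeakPartial_of_contDiff (hφ (s n)).1 j, ((hφ (s n)).pd _).l2⟩)
        (fun n => (hφ1 _).le.trans (le_max_left _ _)) hgr (whole_l2 hQ) hB fun ψ hψ hc => ?_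
      have := PCell.tendsto_test_of_weak (fun n => (hφ (s n)).l2) hv hw hψ hc
      rwa [integral_congr_ae (g := fun _ => 0) (by
        filter_upwards [hvz] with x hx; rw [hx, Pi.zero_apply, mul_zero]), integral_zero] at this
    have h1 := (t.comp hs.tendsto_atTop).sub tt
    have h2 : ∀ n, 0 ≤ (whole d).form b P (φ (s n)) (φ (s n))
        - ∫ x, Q x * φ (s n) x ^ 2 ∂(whole d).μ := fun n => by
      refine (h0 _ (hφ (s n))).trans_eq ?_
      have hQL : (whole d).L2 (fun x => Q x * φ (s n) x) :=
        (hφ (s n)).l2.bdd_mul (whole_per _) hQ.1 hB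
      have i1 : Integrable (fun x => W x * φ (s n) x * φ (s n) x) (whole d).μ :=
        (hW.mul (hφ (s n)).l2).integrable_mul (hφ (s n)).l2
      have i2 : Integrable (fun x => Q x * φ (s n) x ^ 2) (whole d).μ := by
        simpa only [sq, mul_assoc] using! hQL.integrable_mul (hφ (s n)).l2
      rw [PCell.form, PCell.form, add_sub_assoc]
      congr 1
      rw [eq_sub_iff_add_eq, ← integral_add i1 i2]
      exact integral_congr_ae (ae_of_all _ fun x => by simp only [hPd]; ring)
    have := ge_of_tendsto' h1 h2
    linarith
  have hf : (whole d).L2 (fun x => (P x - l) * v x) := hPl.mul hv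
  have hweak : ∀ ψ, IsTest ψ →
      ∫ x, (∑ i, pd (b i) (pd (b i) ψ) x) * v x = ∫ x, ψ x * ((P x - l) * v x) := by
    intro ψ hψ
    have hψs := hψ.sm_whole
    have e := PCell.weak_equation_of_minimizing hPl h0l (fun n => hφ (s n))
      (tφ.comp hs.tendsto_atTop) hw hψs
    have i1 : Integrable (fun x => v x * ((P x - l) * ψ x)) (whole d).μ :=
      hv.integrable_mul (hPl.mul hψs.l2)
    have i2 : Integrable (fun x => v x * ∑ i, pd (b i) (pd (b i) ψ) x) (whole d).μ :=
      hv.integrable_mul (PCell.L2.sum _ fun i => ((hψs.pd _).pd _).l2)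
    simp only [mul_sub] at e
    rw [integral_sub i1 i2, sub_eq_zero, whole_mu] at e
    simp only [mul_comm _ (v _)]
    rw [← e]
    exact integral_congr_ae (ae_of_all _ fun x => by ring)
  obtain ⟨gv, k, h1, h2, h3⟩ := PCell.regularity hC hv hf
    (PCell.moll_equation_of_test hv.locallyIntegrable hweak)
  refine ⟨l, v, gv, k, hl, hv, hv0, h1, h2, h3, fun u g hu hg => ?_⟩
  have e1 := PCell.tendsto_form_moll (b := b) hP hu hg
  have e2 := (PCell.tendsto_integral_sq (fun n => hu.moll n) hu (PCell.tendsto_moll hu)).const_mul l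
  rw [whole_mu] at e2
  refine le_of_tendsto_of_tendsto' e2 e1 fun n => ?_
  have := hinf _ (hu.sm_moll n)
  rwa [whole_mu] at this

end DefectModes

/-! ### Weak divergence, product and reciprocal rules, dilations. -/

namespace DefectModes

variable {d : ℕ}

theorem tendsto_integral_mul_moll {h F : Rd d → ℝ} {C : ℝ} (hh : Integrable h)
    (hF : LocallyIntegrable F) (hC : ∀ᵐ x, |F x| ≤ C) :
    Tendsto (fun n => ∫ x, h x * moll n F x) atTop (𝓝 (∫ x, h x * F x)) := by
  refine tendsto_integral_of_dominated_convergence (fun x => ‖h x‖ * C)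
    (fun n => hh.1.mul (contDiff_moll hF n).continuous.aestronglyMeasurable) (hh.norm.mul_const _)
    (fun n => ae_of_all _ fun x => ?_) ?_
  · rw [norm_mul]
    exact mul_le_mul_of_nonneg_left (abs_moll_le hC n x) (norm_nonneg _)
  · filter_upwards [ae_tendsto_moll hF] with x hx using hx.const_mul _

/-- The vector field `F` has weak divergence `f`. -/
def WeakDiv (F : Fin d → Rd d → ℝ) (f : Rd d → ℝ) : Prop :=
  (∀ j, LocallyIntegrable (F j)) ∧ LocallyIntegrable f ∧
    ∀ φ, IsTest φ → ∑ j, ∫ x, pd (stdVec j) φ x * F j x = -∫ x, φ x * f x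

theorem sum_pd_moll {F : Fin d → Rd d → ℝ} {f : Rd d → ℝ} (h : WeakDiv F f) (n : ℕ) (x : Rd d) :
    ∑ j, pd (stdVec j) (moll n (F j)) x = moll n f x := by
  have hκ := isTest_mollKernel d n
  have h1 := h.2.2 _ (hκ.comp_sub x)
  simp only [pd_comp_sub, neg_mul, integral_neg, Finset.sum_neg_distrib, neg_inj] at h1
  rw [moll, conv, ← h1]
  refine Finset.sum_congr rfl fun j _ => ?_
  rw [moll, pd_conv hκ (h.1 j)]
  rfl

/-- Product rule for bounded vector fields with bounded divergence. -/
theorem WeakDiv.mul {F : Fin d → Rd d → ℝ} {f : Rd d → ℝ} (h : WeakDiv F f) {C : ℝ}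
    (hF : ∀ j, ∀ᵐ x, |F j x| ≤ C) (hf : ∀ᵐ x, |f x| ≤ C) {u : Rd d → ℝ} {g : Fin d → Rd d → ℝ}
    (hu : ∀ j, HasWeakPartial j u (g j)) (hu0 : LocallyIntegrable u) :
    WeakDiv (fun j x => F j x * u x) (fun x => f x * u x + ∑ j, F j x * g j x) := by
  have hm : ∀ {a b : Rd d → ℝ}, LocallyIntegrable a → (∀ᵐ x, |a x| ≤ C) → LocallyIntegrable b →
      LocallyIntegrable (fun x => a x * b x) := fun ha hC hb => by
    rw [locallyIntegrable_iff] at hb ⊢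
    exact fun k hk => (hb k hk).bdd_mul ha.aestronglyMeasurable.restrict (ae_restrict_of_ae hC)
  have hs : LocallyIntegrable (fun x => ∑ j, F j x * g j x) := by
    have : LocallyIntegrable (∑ j, fun x => F j x * g j x) :=
      Finset.sum_induction _ (fun f : Rd d → ℝ => LocallyIntegrable f) (fun a b ha hb => ha.add hb)
        (integrable_zero _ _ _).locallyIntegrable fun j _ => hm (h.1 j) (hF j) (hu j).2.1
    simpa only [Finset.sum_fn] using this
  refine ⟨fun j => hm (h.1 j) (hF j) hu0, (hm h.2.1 hf hu0).add hs, fun φ hφ => ?_⟩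
  have i1 : ∀ j, Integrable (fun x => pd (stdVec j) φ x * u x) := fun j =>
    integrable_smul_test hu0 (contDiff_pd hφ.1 _).continuous (hasCompactSupport_pd hφ.2 _)
  have i2 : Integrable (fun x => φ x * u x) := integrable_smul_test hu0 hφ.1.continuous hφ.2
  have i3 : ∀ j, Integrable (fun x => φ x * g j x) := fun j =>
    integrable_smul_test (hu j).2.1 hφ.1.continuous hφ.2
  have hb : ∀ {a b : Rd d → ℝ}, Integrable a → LocallyIntegrable b → (∀ᵐ x, |b x| ≤ C) →
      Integrable (fun x => a x * b x) := fun ha hb hC => by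
    simpa only [mul_comm] using! ha.bdd_mul hb.aestronglyMeasurable hC
  -- Only the field is mollified: `φ * moll n (F j)` is then a legitimate test function for `u`, and
  -- the bounds on the field and its divergence allow the limit.
  have key : ∀ n, ∑ j, ∫ x, pd (stdVec j) φ x * u x * moll n (F j) x
      = -(∫ x, φ x * u x * moll n f x) - ∑ j, ∫ x, φ x * g j x * moll n (F j) x := by
    intro n
    have hbm : ∀ {a b : Rd d → ℝ}, Integrable a → LocallyIntegrable b → (∀ᵐ x, |b x| ≤ C) →
        Integrable (fun x => a x * moll n b x) := fun ha hb' hC =>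
      hb ha (contDiff_moll hb' n).continuous.locallyIntegrable (ae_of_all _ (abs_moll_le hC n))
    have e : ∀ j, ∫ x, (pd (stdVec j) φ x * moll n (F j) x
        + φ x * pd (stdVec j) (moll n (F j)) x) * u x = -∫ x, φ x * moll n (F j) x * g j x := by
      intro j
      have := (hu j).test (hφ.1.mul (contDiff_moll (h.1 j) n)) hφ.2.mul_right
      rwa [pd_mul hφ.1 (contDiff_moll (h.1 j) n)] at this
    have i4 : ∀ j, Integrable (fun x => φ x * pd (stdVec j) (moll n (F j)) x * u x) := fun j =>
      integrable_smul_test hu0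
        (hφ.1.continuous.mul (contDiff_pd (contDiff_moll (h.1 j) n) _).continuous) hφ.2.mul_right
    have e2 : ∀ j, ∫ x, pd (stdVec j) φ x * u x * moll n (F j) x
        = -(∫ x, φ x * pd (stdVec j) (moll n (F j)) x * u x)
          - ∫ x, φ x * g j x * moll n (F j) x := by
      intro j
      have e3 := e j
      have e4 : ∀ x, (pd (stdVec j) φ x * moll n (F j) x + φ x * pd (stdVec j) (moll n (F j)) x) * u x
        = pd (stdVec j) φ x * u x * moll n (F j) x
          + φ x * pd (stdVec j) (moll n (F j)) x * u x := fun x => by ring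
      simp only [e4] at e3
      rw [integral_add (hbm (i1 j) (h.1 j) (hF j)) (i4 j)] at e3
      have e5 : ∫ x, φ x * moll n (F j) x * g j x = ∫ x, φ x * g j x * moll n (F j) x :=
        integral_congr_ae (ae_of_all _ fun x => by ring)
      linarith
    simp only [e2, Finset.sum_sub_distrib, Finset.sum_neg_distrib]
    rw [← integral_finsetSum _ fun j _ => i4 j]
    congr 2
    refine integral_congr_ae (ae_of_all _ fun x => ?_)
    simp only
    rw [← sum_pd_moll h n x, ← Finset.sum_mul, ← Finset.mul_sum]
    ring
  have t1 := tendsto_finsetSum Finset.univ fun j _ =>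
    tendsto_integral_mul_moll (i1 j) (h.1 j) (hF j)
  have t2 := (tendsto_integral_mul_moll i2 h.2.1 hf).neg.sub
    (tendsto_finsetSum Finset.univ fun j _ => tendsto_integral_mul_moll (i3 j) (h.1 j) (hF j))
  have e := tendsto_nhds_unique (t1.congr key) t2
  have e6 : ∫ x, φ x * (f x * u x + ∑ j, F j x * g j x)
      = (∫ x, φ x * u x * f x) + ∑ j, ∫ x, φ x * g j x * F j x := by
    rw [← integral_finsetSum _ fun j _ => hb (i3 j) (h.1 j) (hF j), ← integral_add (hb i2 h.2.1 hf)
      (integrable_finsetSum _ fun j _ => hb (i3 j) (h.1 j) (hF j))]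
    refine integral_congr_ae (ae_of_all _ fun x => ?_)
    simp only [mul_add, Finset.mul_sum]
    congr 1
    · ring
    · exact Finset.sum_congr rfl fun j _ => by ring
  rw [e6, neg_add, ← sub_eq_add_neg, ← e]
  exact Finset.sum_congr rfl fun j _ => integral_congr_ae (ae_of_all _ fun x => by ring)

/-- A partial derivative is the divergence of a field with one nonzero component, so the product
rule for divergences contains the one for partial derivatives. -/
theorem HasWeakPartial.weakDiv {j : Fin d} {f g : Rd d → ℝ} (h : HasWeakPartial j f g) :
    WeakDiv (fun i x => if i = j then f x else 0) g := by
  refine ⟨fun i => ?_, h.2.1, fun φ hφ => ?_⟩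
  · by_cases hi : i = j
    · simpa only [hi, if_true] using h.1
    · simpa only [hi, if_false] using! (HasWeakPartial.zero (d := d) (𝕜 := ℝ) j).1
  · rw [Finset.sum_eq_single j (fun i _ hi => by simp [hi]) (fun hj => absurd (Finset.mem_univ _) hj)]
    simpa using h.test hφ.1 hφ.2

/-- Product rule with one factor having a bounded weak derivative. -/
theorem HasWeakPartial.mul {j : Fin d} {f g : Rd d → ℝ} (h : HasWeakPartial j f g) {C : ℝ}
    (hf : ∀ᵐ x, |f x| ≤ C) (hg : ∀ᵐ x, |g x| ≤ C) {u : Rd d → ℝ} {gu : Fin d → Rd d → ℝ}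
    (hu : ∀ i, HasWeakPartial i u (gu i)) :
    HasWeakPartial j (fun x => f x * u x) (fun x => g x * u x + f x * gu j x) := by
  have hC : 0 ≤ C := by
    obtain ⟨x, hx⟩ := hf.exists
    exact (abs_nonneg _).trans hx
  have h1 := h.weakDiv.mul (C := C) (fun i => by
    filter_upwards [hf] with x hx
    split_ifs
    · exact hx
    · simpa using hC) hg hu (hu j).1
  refine ⟨by simpa using h1.1 j, by simpa using h1.2.1, fun φ hφ hc => ?_⟩
  have h2 := h1.2.2 φ ⟨hφ, hc⟩
  rw [Finset.sum_eq_single j (fun i _ hi => by simp [hi])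
    (fun hj => absurd (Finset.mem_univ _) hj)] at h2
  simpa [pd] using h2

/-- The divergence of an integrable field integrates to zero. -/
theorem WeakDiv.integral_eq_zero {F : Fin d → Rd d → ℝ} {f : Rd d → ℝ} (h : WeakDiv F f)
    (hF : ∀ j, Integrable (F j)) (hf : Integrable f) : ∫ x, f x = 0 := by
  set η : Rd d → ℝ := ⇑(bump d 0)
  have hηs : ContDiff ℝ ∞ η := (bump d 0).contDiff
  have hηc : HasCompactSupport η := (bump d 0).hasCompactSupport
  -- The cutoffs `η(t n • x)` tend to one, while their gradients are of size `t n` and vanish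
  -- against the integrable field.
  set t : ℕ → ℝ := fun n => 1 / ((n : ℝ) + 1) with ht
  have ht0 : Tendsto t atTop (𝓝 0) := tendsto_one_div_add_atTop_nhds_zero_nat
  have htp : ∀ n, 0 < t n := fun n => by positivity
  have hT : ∀ n, IsTest (fun x => η (t n • x)) := fun n =>
    ⟨hηs.comp (contDiff_const_smul (t n)), hηc.comp_smul (htp n).ne'⟩
  have hpd : ∀ n (j : Fin d) x, pd (stdVec j) (fun x => η (t n • x)) x
      = t n * pd (stdVec j) η (t n • x) := fun n j x => by
    have h1 : HasFDerivAt (fun x : Rd d => η (t n • x))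
        ((fderiv ℝ η (t n • x)).comp (t n • ContinuousLinearMap.id ℝ (Rd d))) x :=
      (contDiff_differentiableAt hηs _).hasFDerivAt.comp x ((hasFDerivAt_id x).const_smul (t n))
    rw [pd, h1.fderiv]
    simp [pd]
  have hbd : ∀ j : Fin d, ∃ B, ∀ x, |pd (stdVec j) η x| ≤ B := fun j => by
    obtain ⟨B, hB⟩ := (contDiff_pd hηs (stdVec j)).continuous.bounded_above_of_compact_support
      (hasCompactSupport_pd hηc _)
    exact ⟨B, hB⟩
  choose B hB using hbd
  have t1 : Tendsto (fun n => ∫ x, η (t n • x) * f x) atTop (𝓝 (∫ x, f x)) := by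
    refine tendsto_integral_of_dominated_convergence (fun x => ‖f x‖)
      (fun n => (hT n).1.continuous.aestronglyMeasurable.mul hf.1) hf.norm
      (fun n => ae_of_all _ fun x => ?_) (ae_of_all _ fun x => ?_)
    · rw [norm_mul, Real.norm_of_nonneg (bump d 0).nonneg]
      exact mul_le_of_le_one_left (norm_nonneg _) (bump d 0).le_one
    · have h1 : Tendsto (fun n => η (t n • x)) atTop (𝓝 (η ((0 : ℝ) • x))) :=
        (hηs.continuous.tendsto _).comp (ht0.smul_const x)
      have h2 : η ((0 : ℝ) • x) = 1 := by
        rw [zero_smul]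
        exact (bump d 0).one_of_mem_closedBall (by simp [(bump d 0).rIn_pos.le])
      rw [h2] at h1
      simpa using h1.mul_const (f x)
  have t2 : ∀ j, Tendsto (fun n => ∫ x, pd (stdVec j) (fun x => η (t n • x)) x * F j x) atTop
      (𝓝 0) := fun j => by
    have h1 : Tendsto (fun n => t n * (B j * ∫ x, ‖F j x‖)) atTop (𝓝 0) := by
      simpa using ht0.mul_const (B j * ∫ x, ‖F j x‖)
    refine squeeze_zero_norm (fun n => ?_) h1
    rw [← integral_const_mul, ← integral_const_mul]
    refine (norm_integral_le_integral_norm _).trans (integral_mono_of_nonneg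
      (ae_of_all _ fun x => norm_nonneg _) (((hF j).norm.const_mul _).const_mul _)
      (ae_of_all _ fun x => ?_))
    simp only [hpd, norm_mul, Real.norm_of_nonneg (htp n).le, mul_assoc]
    exact mul_le_mul_of_nonneg_left (mul_le_mul_of_nonneg_right (hB j _) (norm_nonneg _)) (htp n).le
  have t3 := tendsto_finsetSum Finset.univ fun j _ => t2 j
  simp only [fun n => h.2.2 _ (hT n)] at t3
  have := tendsto_nhds_unique t3 t1.neg
  simpa using this

theorem pd_inv {f : Rd d → ℝ} (hf : ContDiff ℝ ∞ f) (h0 : ∀ x, f x ≠ 0) (v : Rd d) :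
    ContDiff ℝ ∞ (fun x => (f x)⁻¹) ∧ pd v (fun x => (f x)⁻¹) = fun x => -(pd v f x) * ((f x)⁻¹) ^ 2 := by
  have hi : ContDiff ℝ ∞ (fun x => (f x)⁻¹) := hf.inv h0
  refine ⟨hi, ?_⟩
  have h1 := pd_mul hi hf v
  have h2 : (fun x => (f x)⁻¹ * f x) = fun _ => 1 := by ext x; exact inv_mul_cancel₀ (h0 x)
  ext x
  have h3 := congrFun h1 x
  rw [h2] at h3
  simp only [pd, fderiv_fun_const, Pi.zero_apply, _root_.zero_apply] at h3
  have := h0 x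
  simp only [pd]
  field_simp at h3 ⊢
  linarith

/-- Weak derivatives of the reciprocal of a positive function with bounded weak derivatives. -/
theorem HasWeakPartial.inv {j : Fin d} {f g : Rd d → ℝ} (h : HasWeakPartial j f g) {a C : ℝ}
    (ha : 0 < a) (hf : ∀ᵐ x, a ≤ f x) (hg : ∀ᵐ x, |g x| ≤ C) :
    HasWeakPartial j (fun x => (f x)⁻¹) (fun x => -(g x) * ((f x)⁻¹) ^ 2) := by
  have hC : 0 ≤ C := by
    obtain ⟨x, hx⟩ := hg.exists
    exact (abs_nonneg _).trans hx
  -- Mollification preserves the lower bound, so the reciprocals are smooth and uniformly bounded.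
  have hlow : ∀ n x, a ≤ moll n f x := fun n x => by
    have := conv_mono (isTest_mollKernel d n) (mollKernel_nonneg n)
      (continuous_const (y := a)).locallyIntegrable h.1 hf x
    rwa [conv_const, integral_mollKernel, one_mul] at this
  have hb1 : ∀ {y : ℝ}, a ≤ y → |y⁻¹| ≤ a⁻¹ := fun hy => by
    rw [abs_of_pos (inv_pos.2 (ha.trans_le hy))]
    exact inv_anti₀ ha hy
  have hb2 : ∀ {y z : ℝ}, a ≤ y → |z| ≤ C → |-z * y⁻¹ ^ 2| ≤ C * a⁻¹ ^ 2 := fun hy hz => by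
    rw [abs_mul, abs_neg, abs_pow]
    exact mul_le_mul hz (pow_le_pow_left₀ (abs_nonneg _) (hb1 hy) 2) (by positivity) hC
  have m1 : AEStronglyMeasurable (fun x => (f x)⁻¹) volume :=
    (h.1.aestronglyMeasurable.aemeasurable.inv).aestronglyMeasurable
  have m2 : AEStronglyMeasurable (fun x => -(g x) * ((f x)⁻¹) ^ 2) volume :=
    (h.2.1.aestronglyMeasurable.neg).mul (m1.pow 2)
  have hloc : ∀ {u : Rd d → ℝ} {K : ℝ}, AEStronglyMeasurable u volume → (∀ᵐ x, |u x| ≤ K) →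
      LocallyIntegrable u := fun {u K} hu hK =>
    (memLp_top_of_bound hu K hK).locallyIntegrable le_top
  refine ⟨hloc m1 (hf.mono fun x hx => hb1 hx), hloc m2 (by
    filter_upwards [hf, hg] with x h1 h2 using hb2 h1 h2), fun φ hφ hc => ?_⟩
  have hφi : ∀ {ψ : Rd d → ℝ}, Continuous ψ → HasCompactSupport ψ → Integrable ψ := fun h1 h2 =>
    h1.integrable_of_hasCompactSupport h2
  have gen : ∀ {ψ : Rd d → ℝ} {u : ℕ → Rd d → ℝ} {u₀ : Rd d → ℝ} {K : ℝ}, Integrable ψ →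
      (∀ n, Continuous (u n)) → (∀ n x, |u n x| ≤ K) →
      (∀ᵐ x, Tendsto (fun n => u n x) atTop (𝓝 (u₀ x))) →
      Tendsto (fun n => ∫ x, ψ x * u n x) atTop (𝓝 (∫ x, ψ x * u₀ x)) := by
    intro ψ u u₀ K hψ hu hK ht
    refine tendsto_integral_of_dominated_convergence (fun x => ‖ψ x‖ * K)
      (fun n => hψ.1.mul (hu n).aestronglyMeasurable) (hψ.norm.mul_const _)
      (fun n => ae_of_all _ fun x => ?_) (ht.mono fun x hx => hx.const_mul _)
    rw [norm_mul]
    exact mul_le_mul_of_nonneg_left (hK n x) (norm_nonneg _)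
  have hp := fun n => pd_inv (contDiff_moll h.1 n) (fun x => (ha.trans_le (hlow n x)).ne') (stdVec j)
  have ht : ∀ᵐ x, Tendsto (fun n => (moll n f x)⁻¹) atTop (𝓝 (f x)⁻¹) := by
    filter_upwards [ae_tendsto_moll h.1, hf] with x h1 h2 using h1.inv₀ (ha.trans_le h2).ne'
  have t1 := gen (hφi (contDiff_pd hφ (stdVec j)).continuous (hasCompactSupport_pd hc (stdVec j)))
    (fun n => (hp n).1.continuous) (fun n x => hb1 (hlow n x)) ht
  have t2 := gen (hφi hφ.continuous hc) (u := fun n x => -(moll n g x) * ((moll n f x)⁻¹) ^ 2)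
    (fun n => ((contDiff_moll h.2.1 n).continuous.neg.mul ((hp n).1.continuous.pow 2)))
    (fun n x => hb2 (hlow n x) (abs_moll_le hg n x)) (by
      filter_upwards [ae_tendsto_moll h.2.1, ht] with x h1 h2 using h1.neg.mul (h2.pow 2))
  refine tendsto_nhds_unique t1 (t2.neg.congr fun n => ?_)
  rw [pd_mul_compact (hp n).1 hφ hc, (hp n).2, pd_moll h]

theorem HasWeakPartial.comp_smul {j : Fin d} {f g : Rd d → ℝ} (h : HasWeakPartial j f g)
    (hf : LocallyIntegrable f) (hg : LocallyIntegrable g) {ε : ℝ}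
    (hε : ε ≠ 0) : HasWeakPartial j (fun x => f (ε • x)) (fun x => ε * g (ε • x)) := by
  have hloc : ∀ {u : Rd d → ℝ}, LocallyIntegrable u → LocallyIntegrable (fun x => u (ε • x)) := by
    intro u hu
    rw [locallyIntegrable_iff] at hu ⊢
    intro k hk
    have h1 := hu (ε • k) (hk.smul ε)
    rw [← integrable_indicator_iff (hk.smul ε).measurableSet] at h1
    have h2 := h1.comp_smul hε
    rw [← integrable_indicator_iff hk.measurableSet]
    refine h2.congr (ae_of_all _ fun x => ?_)
    have h3 : ε • x ∈ ε • k ↔ x ∈ k := Set.smul_mem_smul_set_iff₀ hε _ _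
    beta_reduce
    by_cases hx : x ∈ k
    · rw [indicator_of_mem (h3.2 hx), indicator_of_mem hx]
    · rw [indicator_of_notMem (h3.not.2 hx), indicator_of_notMem hx]
  refine ⟨hloc hf, by simpa only [smul_eq_mul] using! (hloc hg).smul ε, fun φ hφ hc => ?_⟩
  have h1 := h.test (φ := fun x => φ (ε⁻¹ • x)) (hφ.comp (contDiff_const_smul ε⁻¹))
    (hc.comp_smul (inv_ne_zero hε))
  have h2 : ∀ x, pd (stdVec j) (fun x => φ (ε⁻¹ • x)) x = ε⁻¹ * pd (stdVec j) φ (ε⁻¹ • x) := by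
    intro x
    have h1 : HasFDerivAt (fun x : Rd d => φ (ε⁻¹ • x))
        ((fderiv ℝ φ (ε⁻¹ • x)).comp (ε⁻¹ • ContinuousLinearMap.id ℝ (Rd d))) x :=
      (contDiff_differentiableAt hφ _).hasFDerivAt.comp x ((hasFDerivAt_id x).const_smul ε⁻¹)
    rw [pd, h1.fderiv]
    simp [pd]
  simp only [h2] at h1
  have e : ∀ x : Rd d, ε⁻¹ • ε • x = x := fun x => inv_smul_smul₀ hε x
  have e1 := Measure.integral_comp_smul volume
    (fun x : Rd d => ε⁻¹ * pd (stdVec j) φ (ε⁻¹ • x) * f x) ε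
  have e2 := Measure.integral_comp_smul volume (fun x : Rd d => φ (ε⁻¹ • x) * g x) ε
  simp only [e] at e1 e2
  rw [h1, smul_neg, ← e2] at e1
  have e3 : ∫ x, (fderiv ℝ φ x (stdVec j)) • f (ε • x)
      = ε * ∫ x, ε⁻¹ * pd (stdVec j) φ x * f (ε • x) := by
    rw [← integral_const_mul]
    refine integral_congr_ae (ae_of_all _ fun x => ?_)
    simp only [pd, smul_eq_mul]
    field_simp
  rw [e3, e1, mul_neg, ← integral_const_mul]
  congr 1
  exact integral_congr_ae (ae_of_all _ fun x => by simp only [smul_eq_mul]; ring)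

end DefectModes

/-! ### Averaging of rapidly oscillating periodic functions. -/

namespace DefectModes

variable {d : ℕ}

/-- Continuity of the translation action on `L¹`; it provides the error estimate in the averaging
below. -/
theorem tendsto_integral_abs_shift_sub {f : Rd d → ℝ} (hf : Integrable f) :
    Tendsto (fun t => ∫ x, |f (t + x) - f x|) (𝓝 0) (𝓝 0) := by
  have : Fact ((1 : ℝ≥0∞) ≠ ⊤) := ⟨by simp⟩
  have hF := memLp_one_iff_integrable.2 hf
  have h1 : Continuous fun t : Rd d => DomAddAct.mk t +ᵥ hF.toLp f := by
    exact continuous_vadd.comp ((DomAddAct.continuous_mk).prodMk continuous_const)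
  have h2 : Tendsto (fun t : Rd d => ‖(DomAddAct.mk t +ᵥ hF.toLp f) - hF.toLp f‖) (𝓝 0) (𝓝 0) := by
    have h3 : DomAddAct.mk (0 : Rd d) +ᵥ hF.toLp f = hF.toLp f := by
      rw [DomAddAct.mk_vadd_toLp]
      congr 1
      ext x
      simp
    have := ((h1.tendsto 0).sub_const (hF.toLp f)).norm
    rwa [h3, sub_self, norm_zero] at this
  refine h2.congr fun t => ?_
  rw [DomAddAct.mk_vadd_toLp, ← MemLp.toLp_sub, L1.norm_eq_integral_norm]
  refine integral_congr_ae ?_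
  filter_upwards [MemLp.coeFn_toLp ((hF.comp_measurePreserving
    (measurePreserving_vadd t volume)).sub hF)] with x hx
  exact congrArg norm hx

namespace PCell

variable {c : PCell d}

theorem Pot.mul_pot {g h : Rd d → ℝ} {K L : ℝ} (hg : c.Pot g K) (hh : c.Pot h L) :
    c.Pot (fun x => g x * h x) (K * L) :=
  ⟨hg.1.comp₂ hh.1 (· * ·), hg.2.1.mul hh.2.1, by
    filter_upwards [hg.2.2, hh.2.2] with x h1 h2
    rw [abs_mul]
    exact mul_le_mul h1 h2 (abs_nonneg _) hg.nonneg⟩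

end PCell

theorem quasiMeasurePreserving_smul_vol {ε : ℝ} (hε : ε ≠ 0) :
    Measure.QuasiMeasurePreserving (fun y : Rd d => ε • y) volume volume :=
  ⟨measurable_const_smul ε, by
    rw [Measure.map_addHaar_smul _ hε]
    exact Measure.smul_absolutelyContinuous⟩

/-- Averaging of a rapidly oscillating periodic function. -/
theorem tendsto_integral_oscillating {f g : Rd d → ℝ} {K : ℝ} (hf : Integrable f)
    (hg : (lattice d).Pot g K) :
    Tendsto (fun ε : ℝ => ∫ y, f y * g (ε⁻¹ • y)) (𝓝[>] 0)
      (𝓝 ((∫ y, f y) * ∫ x, g x ∂(lattice d).μ)) := by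
  obtain ⟨g', hp, he, hm⟩ := hg.1.exists_rep hg.2.1
  have hK : ∀ᵐ x, |g' x| ≤ K := by filter_upwards [hg.2.2, he] with x h1 h2; rwa [h2]
  have hK0 := hg.nonneg
  have e1 : ∫ x, g x ∂(lattice d).μ = ∫ x, g' x ∂(lattice d).μ :=
    integral_congr_ae (PCell.ae_mu (c := lattice d) (he.mono fun x hx => hx.symm))
  rw [e1]
  obtain ⟨R, hR⟩ := isBounded_iff_forall_norm_le.1 (isBounded_cellIco (d := d))
  rw [Metric.tendsto_nhds]
  intro η hη
  have h1 := (tendsto_integral_abs_shift_sub hf).eventually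
    (gt_mem_nhds (show 0 < η / (2 * (K + 1)) by positivity))
  obtain ⟨δ, hδ, hδ1⟩ := Metric.eventually_nhds_iff.1 h1
  have h2 : ∀ᶠ ε : ℝ in 𝓝[>] 0, ε < δ / (|R| + 1) :=
    mem_nhdsWithin_of_mem_nhds (gt_mem_nhds (by positivity))
  filter_upwards [h2, self_mem_nhdsWithin] with ε h3 (hε : 0 < ε)
  have q1 := quasiMeasurePreserving_smul_vol (d := d) (inv_ne_zero hε.ne')
  have e2 : ∫ y, f y * g (ε⁻¹ • y) = ∫ y, f y * g' (ε⁻¹ • y) :=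
    integral_congr_ae (by filter_upwards [q1.ae he] with y hy; rw [hy])
  have q2 : ∀ t : Rd d, Measure.QuasiMeasurePreserving (fun y : Rd d => ε⁻¹ • y + t) volume volume :=
    fun t => (measurePreserving_add_right volume t).quasiMeasurePreserving.comp q1
  have q3 : Measure.QuasiMeasurePreserving (fun z : Rd d × Rd d => ε⁻¹ • z.1 + z.2)
      ((volume : Measure (Rd d)).prod (lattice d).μ) volume :=
    QuasiMeasurePreserving.prod_of_left
      ((measurable_fst.const_smul ε⁻¹).add measurable_snd) (ae_of_all _ q2)
  have hpi : Integrable (fun z : Rd d × Rd d => f z.1 * g' (ε⁻¹ • z.1 + z.2))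
      ((volume : Measure (Rd d)).prod (lattice d).μ) := by
    have := (hf.comp_fst (lattice d).μ).bdd_mul (hm.comp_quasiMeasurePreserving q3) (q3.ae hK)
    simpa only [mul_comm] using! this
  -- Averaging over all shifts `t` of the cell yields the product of the two integrals exactly, by
  -- Fubini.
  have e3 : ∫ t, (∫ y, f y * g' (ε⁻¹ • y + t)) ∂(lattice d).μ
      = (∫ y, f y) * ∫ x, g' x ∂(lattice d).μ := by
    rw [integral_integral_swap (f := fun t y => f y * g' (ε⁻¹ • y + t)) hpi.swap,
      ← integral_mul_const]
    refine integral_congr_ae (ae_of_all _ fun y => ?_)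
    simp only
    rw [integral_const_mul]
    congr 1
    have := PCell.integral_shift hp (-(ε⁻¹ • y))
    rw [← this]
    exact integral_congr_ae (ae_of_all _ fun t => by simp only [sub_neg_eq_add, add_comm])
  -- A shift of the periodic factor by `t` equals a shift of `f` by `ε • t`, so every shifted
  -- integral is close to the unshifted one.
  have e4 : ∀ t : Rd d, ∫ y, f y * g' (ε⁻¹ • y) = ∫ y, f (ε • t + y) * g' (ε⁻¹ • y + t) := by
    intro t
    rw [← integral_add_left_eq_self _ (ε • t)]
    simp only [smul_add, inv_smul_smul₀ hε.ne', add_comm t]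
  have e5 : ∀ t : Rd d, ‖ε • t‖ < δ → |(∫ y, f y * g' (ε⁻¹ • y))
      - ∫ y, f y * g' (ε⁻¹ • y + t)| ≤ K * (η / (2 * (K + 1))) := by
    intro t ht
    have hmb := hm.comp_quasiMeasurePreserving (q2 t)
    have i1 : Integrable (fun y => f (ε • t + y) * g' (ε⁻¹ • y + t)) := by
      simpa only [mul_comm] using! (hf.comp_add_left (ε • t)).bdd_mul hmb ((q2 t).ae hK)
    have i2 : Integrable (fun y => f y * g' (ε⁻¹ • y + t)) := by
      simpa only [mul_comm] using! hf.bdd_mul hmb ((q2 t).ae hK)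
    rw [e4 t, ← integral_sub i1 i2]
    refine (abs_integral_le_integral_abs).trans (le_trans ?_ (mul_le_mul_of_nonneg_left
      (hδ1 (y := ε • t) (by simpa using ht)).le hK0))
    rw [← integral_const_mul]
    refine integral_mono_of_nonneg (ae_of_all _ fun y => abs_nonneg _)
      (((hf.comp_add_left (ε • t)).sub hf).abs.const_mul K) ?_
    filter_upwards [(q2 t).ae hK] with y hy
    rw [← sub_mul, abs_mul, mul_comm]
    exact mul_le_mul_of_nonneg_right hy (abs_nonneg _)
  rw [e2, ← e3, Real.dist_eq]
  have e6 : (∫ y, f y * g' (ε⁻¹ • y)) - ∫ t, (∫ y, f y * g' (ε⁻¹ • y + t)) ∂(lattice d).μ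
      = ∫ t, ((∫ y, f y * g' (ε⁻¹ • y)) - ∫ y, f y * g' (ε⁻¹ • y + t)) ∂(lattice d).μ := by
    rw [integral_sub (integrable_const _) hpi.integral_prod_right]
    simp
  have e7 : ∀ᵐ t ∂(lattice d).μ, ‖(∫ y, f y * g' (ε⁻¹ • y))
      - ∫ y, f y * g' (ε⁻¹ • y + t)‖ ≤ K * (η / (2 * (K + 1))) := by
    refine (ae_restrict_mem₀ (lattice d).fund.nullMeasurableSet).mono fun t ht => e5 t ?_
    rw [norm_smul, Real.norm_of_nonneg hε.le]
    rw [lt_div_iff₀ (by positivity)] at h3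
    refine lt_of_le_of_lt (mul_le_mul_of_nonneg_left ?_ hε.le) h3
    exact (hR t ht).trans ((le_abs_self R).trans (by linarith))
  have e8 := norm_integral_le_of_norm_le_const e7
  rw [← e6, Real.norm_eq_abs, probReal_univ, mul_one] at e8
  refine lt_of_le_of_lt e8 ?_
  rw [mul_div_assoc', div_lt_iff₀ (by positivity)]
  nlinarith

/-- Two-scale limit of the integral of a square. -/
theorem tendsto_two_scale {ι : Type*} [Fintype ι] {p q : Rd d → ℝ} {B L : ℝ}
    (hp : (whole d).Pot p B) (hq : (lattice d).Pot q L)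
    {f g : ι → Rd d → ℝ} {K : ι → ℝ} (hf : ∀ i, MemLp (f i) 2 volume)
    (hg : ∀ i, (lattice d).Pot (g i) (K i)) {a : ι → ℝ → ℝ} {a₀ : ι → ℝ}
    (ha : ∀ i, Tendsto (a i) (𝓝[>] 0) (𝓝 (a₀ i))) :
    Tendsto (fun ε : ℝ => ∫ y, p y * q (ε⁻¹ • y) * (∑ i, a i ε * (f i y * g i (ε⁻¹ • y))) ^ 2)
      (𝓝[>] 0) (𝓝 (∑ i, ∑ j, a₀ i * a₀ j *
        ((∫ y, p y * (f i y * f j y)) * ∫ x, q x * (g i x * g j x) ∂(lattice d).μ))) := by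
  have hff : ∀ i j, Integrable (fun y => p y * (f i y * f j y)) := fun i j =>
    ((hf i).integrable_mul (hf j)).bdd_mul hp.2.1 hp.2.2
  have hgg : ∀ i j, (lattice d).Pot (fun x => q x * (g i x * g j x)) (L * (K i * K j)) :=
    fun i j => hq.mul_pot ((hg i).mul_pot (hg j))
  have t := tendsto_finsetSum Finset.univ fun i _ => tendsto_finsetSum Finset.univ fun j _ =>
    ((ha i).mul (ha j)).mul (tendsto_integral_oscillating (hff i j) (hgg i j))
  refine t.congr' ?_
  filter_upwards [self_mem_nhdsWithin] with ε (hε : 0 < ε)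
  have q1 := quasiMeasurePreserving_smul_vol (d := d) (inv_ne_zero hε.ne')
  have hi : ∀ i j, Integrable (fun y => p y * (f i y * f j y) *
      (q (ε⁻¹ • y) * (g i (ε⁻¹ • y) * g j (ε⁻¹ • y)))) := fun i j => by
    have := (hff i j).bdd_mul ((hgg i j).2.1.comp_quasiMeasurePreserving q1) (q1.ae (hgg i j).2.2)
    simpa only [mul_comm] using! this
  simp only [← integral_const_mul]
  rw [Finset.sum_congr rfl fun i _ => (integral_finsetSum _ fun j _ => (hi i j).const_mul _).symm,
    ← integral_finsetSum _ fun i _ => integrable_finsetSum _ fun j _ => (hi i j).const_mul _]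
  refine integral_congr_ae (ae_of_all _ fun y => ?_)
  simp only
  rw [sq, Finset.sum_mul_sum, Finset.mul_sum]
  simp only [Finset.mul_sum]
  exact Finset.sum_congr rfl fun i _ => Finset.sum_congr rfl fun j _ => by ring

end DefectModes

/-! ### The ground state substitution. -/

namespace DefectModes

variable {d : ℕ}

/-- A zero-free periodic solution `w` of `Δ w = P w` with `w`, `1 / w`, `∇ w` and `P w` bounded. -/
structure Edge (P w : Rd d → ℝ) (gw : Fin d → Rd d → ℝ) (K B : ℝ) : Prop where
  pot : (lattice d).Pot P K
  l2 : (lattice d).L2 w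
  one : ∫ x, w x ^ 2 ∂(lattice d).μ = 1
  wp : ∀ j, HasWeakPartial j w (gw j)
  gl2 : ∀ j, (lattice d).L2 (gw j)
  div : WeakDiv gw (fun x => P x * w x)
  bw : ∀ᵐ x, |w x| ≤ B
  bg : ∀ j, ∀ᵐ x, |gw j x| ≤ B
  bf : ∀ᵐ x, |P x * w x| ≤ B
  ne : ∀ᵐ x, w x ≠ 0
  inv : ∀ j, HasWeakPartial j (fun x => (w x)⁻¹) (fun x => -(gw j x) * ((w x)⁻¹) ^ 2)
  binv : ∀ᵐ x, |(w x)⁻¹| ≤ B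
  bginv : ∀ j, ∀ᵐ x, |-(gw j x) * ((w x)⁻¹) ^ 2| ≤ B

theorem exists_edge {V w : Rd d → ℝ} {K : ℝ} (hV : (lattice d).Pot V K)
    (hw : IsSimpleBandEdgeState V w) :
    ∃ K B, Edge (fun x => V x - bandE0 V 0) w (fun j => weakPartial j w) K B := by
  obtain ⟨hl, h1, hL, ⟨s, a, hs, ha, hsa⟩, ⟨B₁, hB₁⟩, g, k, B₂, hg, -, -, hB₂⟩ := bandEdge_facts hV hw
  have hP := hV.sub_const (bandE0 V 0)
  have hB₁0 : 0 ≤ B₁ := by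
    obtain ⟨x, hx⟩ := hB₁.exists
    exact (abs_nonneg _).trans hx
  have wp : ∀ j, HasWeakPartial j w (weakPartial j w) := fun j => (hg j).1.spec
  have he : ∀ j, g j =ᵐ[volume] weakPartial j w := fun j => (hg j).1.unique (wp j)
  have bg : ∀ j, ∀ᵐ x, |weakPartial j w x| ≤ B₂ := fun j => by
    filter_upwards [hB₂ j, he j] with x h1 h2
    rwa [← h2]
  have hs0 : s ≠ 0 := fun h => by simp [h] at hs
  have hsi : ∀ y : ℝ, s * (s * y)⁻¹ = y⁻¹ := fun y => by
    rw [mul_inv, ← mul_assoc, mul_inv_cancel₀ hs0, one_mul]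
  have hs1 : |s| = 1 := by
    rw [← sq_abs] at hs
    nlinarith [abs_nonneg s]
  have habs : ∀ᵐ x, a ≤ |w x| := hsa.mono fun x hx => by
    calc a ≤ |s * w x| := hx.trans (le_abs_self _)
      _ = |w x| := by rw [abs_mul, hs1, one_mul]
  have bi : ∀ᵐ x, |(w x)⁻¹| ≤ a⁻¹ := habs.mono fun x hx => by
    rw [abs_inv]
    exact inv_anti₀ ha hx
  have inv : ∀ j, HasWeakPartial j (fun x => (w x)⁻¹)
      (fun x => -(weakPartial j w x) * ((w x)⁻¹) ^ 2) := fun j => by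
    -- The reciprocal rule needs a positive function, so it is applied to `s * w`; the sign is
    -- removed by `hsi`.
    have h2 := (((wp j).const_mul s).inv (C := B₂) ha hsa (by
      filter_upwards [bg j] with x hx
      rwa [abs_mul, hs1, one_mul])).const_mul s
    refine h2.congr (ae_of_all _ fun x => hsi _) (ae_of_all _ fun x => ?_)
    simp only
    rw [← hsi (w x)]
    ring
  refine ⟨_, max (max B₁ B₂) (max ((K + |bandE0 V 0|) * B₁) (max a⁻¹ (B₂ * a⁻¹ ^ 2))),
    hP, hl, h1, wp, fun j => (hg j).2.congr (he j), ⟨fun j => (wp j).2.1,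
      (hP.mul hl).locallyIntegrable, fun φ hφ => ?_⟩, ?_, fun j => ?_, ?_, ?_, inv, ?_, fun j => ?_⟩
  · rw [← hL φ hφ]
    simp only [Finset.sum_mul]
    rw [integral_finsetSum _ fun j _ => integrable_test_mul hl.locallyIntegrable
      ((hφ.pd _).pd _), ← Finset.sum_neg_distrib]
    refine Finset.sum_congr rfl fun j _ => ?_
    rw [(wp j).test (hφ.pd _).1 (hφ.pd _).2, neg_neg]
  · filter_upwards [hB₁] with x hx
    exact hx.trans ((le_max_left _ _).trans (le_max_left _ _))
  · filter_upwards [bg j] with x hx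
    exact hx.trans ((le_max_right _ _).trans (le_max_left _ _))
  · filter_upwards [hB₁, hP.2.2] with x h2 h3
    rw [abs_mul]
    exact (mul_le_mul h3 h2 (abs_nonneg _) hP.nonneg).trans
      ((le_max_left _ _).trans (le_max_right _ _))
  · filter_upwards [habs] with x hx h0
    rw [h0, abs_zero] at hx
    linarith
  · filter_upwards [bi] with x hx
    exact hx.trans ((le_max_left _ _).trans ((le_max_right _ _).trans (le_max_right _ _)))
  · filter_upwards [bg j, bi] with x h2 h3
    refine le_trans ?_ ((le_max_right _ _).trans ((le_max_right _ _).trans (le_max_right _ _)))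
    rw [abs_mul, abs_neg, abs_pow]
    exact mul_le_mul h2 (pow_le_pow_left₀ (abs_nonneg _) h3 2) (by positivity)
      ((abs_nonneg _).trans h2)

theorem sum_stdVec_mul (i : Fin d) (g : Fin d → ℝ) : ∑ j, (stdVec i : Rd d) j * g j = g i := by
  simp [stdVec_apply]

/-- Integrate by parts between `h` and `φ h`; only square integrability of `h` and its gradient is
available, so the square lies merely in `W^{1,1}`. -/
theorem HasWeakPartial.sq {h : Rd d → ℝ} {G : Fin d → Rd d → ℝ} (hh : (whole d).L2 h)
    (hG : ∀ j, HasWeakPartial j h (G j) ∧ (whole d).L2 (G j)) (j : Fin d) :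
    HasWeakPartial j (fun x => h x ^ 2) (fun x => h x * (2 * G j x)) := by
  have li : ∀ {u v : Rd d → ℝ}, (whole d).L2 u → (whole d).L2 v →
      Integrable (fun x => u x * v x) := fun hu hv => by
    simpa only [whole_mu] using hu.integrable_mul hv
  refine ⟨by simpa only [_root_.sq] using (li hh hh).locallyIntegrable,
    (li hh ((hG j).2.const_mul 2)).locallyIntegrable, fun φ hφ hc => ?_⟩
  obtain ⟨C, hC⟩ := hφ.continuous.bounded_above_of_compact_support hc
  obtain ⟨C', hC'⟩ := (contDiff_pd hφ (stdVec j)).continuous.bounded_above_of_compact_support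
    (hasCompactSupport_pd hc (stdVec j))
  have hm := (hasWeakPartial_of_contDiff hφ j).mul (C := max C C')
    (ae_of_all _ fun x => (hC x).trans (le_max_left _ _))
    (ae_of_all _ fun x => (hC' x).trans (le_max_right _ _)) (fun i => (hG i).1)
  have l2 : ∀ {ψ u : Rd d → ℝ} {C : ℝ}, Continuous ψ → (∀ x, |ψ x| ≤ C) → (whole d).L2 u →
      (whole d).L2 (fun x => ψ x * u x) := fun h1 h2 hu =>
    hu.bdd_mul (whole_per _) h1.aestronglyMeasurable (ae_of_all _ h2)
  have l2φ := l2 hφ.continuous hC hh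
  have l2p := l2 (contDiff_pd hφ (stdVec j)).continuous hC' hh
  have l2g := l2 hφ.continuous hC (hG j).2
  have e := PCell.integral_weak_mul (hG j).1 hm hh (hG j).2 l2φ (l2p.add l2g)
  rw [whole_mu] at e
  have i1 := li hh l2p
  have i2 := li hh l2g
  simp only [mul_add] at e
  rw [integral_add i1 i2] at e
  have e1 : ∫ x, G j x * (φ x * h x) = ∫ x, h x * (φ x * G j x) :=
    integral_congr_ae (ae_of_all _ fun x => by ring)
  have e2 : ∫ x, φ x • (h x * (2 * G j x)) = 2 * ∫ x, h x * (φ x * G j x) := by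
    rw [← integral_const_mul]
    exact integral_congr_ae (ae_of_all _ fun x => by simp only [smul_eq_mul]; ring)
  have e3 : ∫ x, (fderiv ℝ φ x (stdVec j)) • h x ^ 2 = ∫ x, h x * (pd (stdVec j) φ x * h x) :=
    integral_congr_ae (ae_of_all _ fun x => by simp only [smul_eq_mul, pd]; ring)
  rw [e2, e3]
  linarith

theorem WeakDiv.integral_cell_eq_zero {F : Fin d → Rd d → ℝ} {f : Rd d → ℝ} (h : WeakDiv F f)
    (hF : ∀ j, (lattice d).L2 (F j)) (hf : (lattice d).L2 f) : ∫ x, f x ∂(lattice d).μ = 0 := by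
  have hone : (lattice d).Sm (fun _ => 1) := lattice_sm contDiff_const fun _ _ => rfl
  have h1 : ∀ n, ∫ x, moll n f x * 1 ∂(lattice d).μ = 0 := fun n => by
    have e : ∀ j, ∫ x, pd (stdVec j) (moll n (F j)) x * 1 ∂(lattice d).μ = 0 := fun j => by
      rw [((hF j).sm_moll n).integral_pd_mul hone]
      simp [pd]
    simp only [← sum_pd_moll h n, Finset.sum_mul]
    rw [integral_finsetSum _ fun j _ => (((hF j).sm_moll n).pd _).l2.integrable_mul hone.l2]
    exact Finset.sum_eq_zero fun j _ => e j
  have t := tendsto_integral_mul_of_tendsto (fun n => (hf.moll n).2.2) (fun _ => hone.l2.2.2) hf.2.2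
    hone.l2.2.2 (PCell.tendsto_moll hf) (by simp)
  simp only [h1] at t
  simpa using (tendsto_nhds_unique t tendsto_const_nhds)

namespace Edge

variable {P w : Rd d → ℝ} {gw : Fin d → Rd d → ℝ} {K B : ℝ}

theorem wPot (h : Edge P w gw K B) : (lattice d).Pot w B := ⟨h.l2.1, h.l2.2.1, h.bw⟩

theorem gPot (h : Edge P w gw K B) (j : Fin d) : (lattice d).Pot (gw j) B :=
  ⟨(h.gl2 j).1, (h.gl2 j).2.1, h.bg j⟩

theorem invPot (h : Edge P w gw K B) : (lattice d).Pot (fun x => (w x)⁻¹) B :=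
  ⟨h.l2.1.comp (·⁻¹), h.l2.2.1.aemeasurable.inv.aestronglyMeasurable, h.binv⟩

theorem hasWeakPartial_mul (h : Edge P w gw K B) {u : Rd d → ℝ} {g : Fin d → Rd d → ℝ}
    (hu : ∀ j, HasWeakPartial j u (g j)) (j : Fin d) :
    HasWeakPartial j (fun x => w x * u x) (fun x => gw j x * u x + w x * g j x) :=
  (h.wp j).mul h.bw (h.bg j) hu

theorem l2_mul (h : Edge P w gw K B) {c : PCell d} (hw : c.Per w) (hg : ∀ j, c.Per (gw j))
    {u : Rd d → ℝ} {g : Fin d → Rd d → ℝ} (hu : c.L2 u) (hgu : ∀ j, c.L2 (g j)) :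
    c.L2 (fun x => w x * u x) ∧ ∀ j, c.L2 (fun x => gw j x * u x + w x * g j x) :=
  ⟨hu.bdd_mul hw h.l2.2.1 h.bw, fun j =>
    (hu.bdd_mul (hg j) (h.gl2 j).2.1 (h.bg j)).add ((hgu j).bdd_mul hw h.l2.2.1 h.bw)⟩

/-- The ground state substitution `u = w v`. -/
theorem wform_eq (h : Edge P w gw K B) {c : PCell d} (hP : c.Pot P K) (hw : c.Per w)
    (hg : ∀ j, c.Per (gw j)) {v : Rd d → ℝ} {G : Fin d → Rd d → ℝ} (hv : c.L2 v)
    (hG : ∀ j, c.L2 (G j))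
    (hz : ∫ x, (P x * w x * (w x * v x ^ 2)
      + ∑ j, gw j x * (gw j x * v x ^ 2 + w x * (v x * (2 * G j x)))) ∂c.μ = 0) :
    c.wform stdVec P (fun x => w x * v x) (fun j x => gw j x * v x + w x * G j x)
      = ∑ j, ∫ x, (w x * G j x) ^ 2 ∂c.μ := by
  obtain ⟨l1, l2⟩ := h.l2_mul hw hg hv hG
  have l3 : ∀ j, c.L2 (fun x => w x * G j x) := fun j => (hG j).bdd_mul hw h.l2.2.1 h.bw
  have i1 : Integrable (fun x => P x * (w x * v x) ^ 2) c.μ := by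
    simpa only [_root_.sq, mul_assoc] using! (hP.mul l1).integrable_mul l1
  have i2 : ∀ j, Integrable (fun x => (gw j x * v x + w x * G j x) ^ 2) c.μ :=
    fun j => (l2 j).2.2.integrable_sq
  have i3 : ∀ j, Integrable (fun x => (w x * G j x) ^ 2) c.μ := fun j => (l3 j).2.2.integrable_sq
  rw [PCell.wform]
  simp only [sum_stdVec_mul]
  have i4 : Integrable (fun x => ∑ j, (gw j x * v x + w x * G j x) ^ 2 + P x * (w x * v x) ^ 2) c.μ :=
    (integrable_finsetSum _ fun j _ => i2 j).add i1
  rw [← sub_eq_zero, ← hz, ← integral_finsetSum _ fun j _ => i2 j,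
    ← integral_finsetSum _ fun j _ => i3 j, ← integral_add (integrable_finsetSum _ fun j _ => i2 j) i1,
    ← integral_sub i4
      (integrable_finsetSum _ fun j _ => i3 j)]
  -- The difference of the two energy densities is the divergence of the field `w v² ∇w`, whose
  -- integral vanishes by `hz`.
  refine integral_congr_ae (ae_of_all _ fun x => ?_)
  simp only
  rw [add_sub_right_comm, ← Finset.sum_sub_distrib, add_comm]
  congr 1
  · ring
  · exact Finset.sum_congr rfl fun j _ => by ring

/-- On `ℝ^d` the field `w v² ∇w` and its divergence are integrable, so the divergence integrates to
zero. -/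
theorem wform_whole (h : Edge P w gw K B) {v : Rd d → ℝ} {G : Fin d → Rd d → ℝ}
    (hv : (whole d).L2 v) (hG : ∀ j, HasWeakPartial j v (G j) ∧ (whole d).L2 (G j)) :
    (whole d).wform stdVec P (fun x => w x * v x) (fun j x => gw j x * v x + w x * G j x)
      = ∑ j, ∫ x, (w x * G j x) ^ 2 := by
  have hP : (whole d).Pot P K := ⟨whole_per _, h.pot.2.1, h.pot.2.2⟩
  obtain ⟨l1, l2⟩ := h.l2_mul (whole_per _) (fun _ => whole_per _) hv fun j => (hG j).2
  have i0 := l1.integrable_mul hv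
  rw [whole_mu] at i0
  have i0' : Integrable (fun x => w x * v x ^ 2) := i0.congr (ae_of_all _ fun x => by ring)
  have hdiv := h.div.mul h.bg h.bf (h.hasWeakPartial_mul (HasWeakPartial.sq hv hG))
    i0'.locallyIntegrable
  have l3 : ∀ j, (whole d).L2 (fun x => gw j x * v x) := fun j =>
    hv.bdd_mul (whole_per _) (h.gl2 j).2.1 (h.bg j)
  have e := hdiv.integral_eq_zero (fun j => ?_) ?_
  · rw [h.wform_eq hP (whole_per _) (fun _ => whole_per _) hv (fun j => (hG j).2)
      (by rw [whole_mu]; exact e), whole_mu]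
  · have := (l3 j).integrable_mul l1
    rw [whole_mu] at this
    exact this.congr (ae_of_all _ fun x => by ring)
  · have i1 := (hP.mul l1).integrable_mul l1
    have i2 : ∀ j, Integrable (fun x => gw j x * (gw j x * v x ^ 2 + w x * (v x * (2 * G j x))))
        (whole d).μ := fun j =>
      ((l3 j).integrable_mul ((l3 j).add (((hG j).2.bdd_mul (whole_per _) h.l2.2.1 h.bw).const_mul 2))).congr
        (ae_of_all _ fun x => by ring)
    have := i1.add (integrable_finsetSum Finset.univ fun j _ => i2 j)
    rw [whole_mu] at this
    exact this.congr (ae_of_all _ fun x => by simp only [Pi.add_apply]; ring)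

/-- On the cell the boundary terms cancel by periodicity; boundedness of `v` and its gradient makes
the field and its divergence square integrable. -/
theorem wform_cell (h : Edge P w gw K B) {v : Rd d → ℝ} {G : Fin d → Rd d → ℝ} {C : ℝ}
    (hv : (lattice d).Pot v C) (hG : ∀ j, HasWeakPartial j v (G j) ∧ (lattice d).Pot (G j) C) :
    (lattice d).wform stdVec P (fun x => w x * v x) (fun j x => gw j x * v x + w x * G j x)
      = ∑ j, ∫ x, (w x * G j x) ^ 2 ∂(lattice d).μ := by
  have hl2 : ∀ {u : Rd d → ℝ} {L : ℝ}, (lattice d).Pot u L → (lattice d).L2 u := fun hu => by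
    have hone : (lattice d).Sm (fun _ => 1) := lattice_sm contDiff_const fun _ _ => rfl
    simpa using hu.mul hone.l2
  have hsq : ∀ j, HasWeakPartial j (fun x => v x ^ 2) (fun x => v x * (2 * G j x)) := fun j => by
    refine ((hG j).1.mul hv.2.2 (hG j).2.2.2 fun i => (hG i).1).congr
      (ae_of_all _ fun x => by ring) (ae_of_all _ fun x => by ring)
  have p2 : ∀ j, (lattice d).Pot (fun x => v x * (2 * G j x)) (C * (2 * C)) := fun j => by
    refine hv.mul_pot ⟨(hG j).2.1.comp (2 * ·), (hG j).2.2.1.const_mul 2, ?_⟩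
    filter_upwards [(hG j).2.2.2] with x hx
    rw [abs_mul, abs_two]
    linarith
  have pv2 : (lattice d).Pot (fun x => v x ^ 2) (C * C) := by
    simpa only [_root_.sq] using hv.mul_pot hv
  obtain ⟨l1, l2⟩ := h.l2_mul h.l2.1 (fun j => (h.gl2 j).1) (hl2 pv2) fun j => hl2 (p2 j)
  have hdiv := h.div.mul h.bg h.bf (h.hasWeakPartial_mul hsq) l1.locallyIntegrable
  refine h.wform_eq h.pot h.l2.1 (fun j => (h.gl2 j).1) (hl2 hv) (fun j => hl2 (hG j).2)
    (hdiv.integral_cell_eq_zero (fun j => (h.gPot j).mul l1) ?_)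
  refine PCell.L2.add ?_ (PCell.L2.sum _ fun j => (h.gPot j).mul (l2 j))
  simpa only [mul_assoc] using h.pot.mul (h.wPot.mul l1)

/-- The periodic operator is nonnegative on `ℝ^d`. -/
theorem form_nonneg (h : Edge P w gw K B) {φ : Rd d → ℝ} (hφ : (whole d).Sm φ) :
    0 ≤ (whole d).form stdVec P φ φ := by
  have hp := fun j => hasWeakPartial_of_contDiff hφ.1 j
  -- The function to substitute is `v = φ / w`; its energy is a sum of squares.
  have hv := fun j => (h.inv j).mul h.binv (h.bginv j) hp
  have hwp := h.hasWeakPartial_mul hv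
  have l1 : (whole d).L2 (fun x => (w x)⁻¹ * φ x) := hφ.l2.bdd_mul (whole_per _) h.invPot.2.1 h.binv
  have l2 : ∀ j, (whole d).L2 (fun x => -(gw j x) * ((w x)⁻¹) ^ 2 * φ x
      + (w x)⁻¹ * pd (stdVec j) φ x) := fun j =>
    (hφ.l2.bdd_mul (whole_per _) ((h.gl2 j).2.1.neg.mul (h.invPot.2.1.pow 2)) (h.bginv j)).add
      ((hφ.pd _).l2.bdd_mul (whole_per _) h.invPot.2.1 h.binv)
  have e := h.wform_whole l1 fun j => ⟨hv j, l2 j⟩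
  have e1 : (fun x => w x * ((w x)⁻¹ * φ x)) =ᵐ[volume] φ := by
    filter_upwards [h.ne] with x hx using mul_inv_cancel_left₀ hx _
  have e2 := fun j => ((hwp j).congr e1 (ae_eq_refl _)).unique (hp j)
  have e3 : (whole d).form stdVec P φ φ = (whole d).wform stdVec P
      (fun x => w x * ((w x)⁻¹ * φ x)) (fun j x => gw j x * ((w x)⁻¹ * φ x)
        + w x * (-(gw j x) * ((w x)⁻¹) ^ 2 * φ x + (w x)⁻¹ * pd (stdVec j) φ x)) := by
    rw [PCell.form, PCell.wform]
    simp only [sum_stdVec_mul, whole_mu]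
    congr 1
    · refine Finset.sum_congr rfl fun j _ => integral_congr_ae ?_
      filter_upwards [e2 j] with x hx
      rw [hx]
      ring
    · refine integral_congr_ae ?_
      filter_upwards [e1] with x hx
      rw [hx]
      ring
  rw [e3, e]
  exact Finset.sum_nonneg fun j _ => integral_nonneg fun x => sq_nonneg _

end Edge

end DefectModes

/-! ### Oscillating trial functions and the limit of their Rayleigh quotients. -/

namespace DefectModes

variable {d : ℕ}

theorem memLp_comp_smul {f : Rd d → ℝ} (hf : MemLp f 2 volume) {ε : ℝ} (hε : ε ≠ 0) :
    MemLp (fun x => f (ε • x)) 2 volume :=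
  (memLp_two_iff_integrable_sq
    (hf.1.comp_quasiMeasurePreserving (quasiMeasurePreserving_smul_vol hε))).2
    (hf.integrable_sq.comp_smul hε)

theorem integral_two_scale {ι : Type*} [Fintype ι] (p q : Rd d → ℝ) (a : ι → ℝ)
    (f g : ι → Rd d → ℝ) {ε : ℝ} (hε : 0 < ε) :
    ∫ y, p y * q (ε⁻¹ • y) * (∑ i, a i * (f i y * g i (ε⁻¹ • y))) ^ 2
      = ε ^ d * ∫ x, p (ε • x) * q x * (∑ i, a i * (f i (ε • x) * g i x)) ^ 2 := by
  have h := Measure.integral_comp_smul volume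
    (fun y : Rd d => p y * q (ε⁻¹ • y) * (∑ i, a i * (f i y * g i (ε⁻¹ • y))) ^ 2) ε
  simp only [inv_smul_smul₀ hε.ne', finrank_euclideanSpace, Fintype.card_fin, smul_eq_mul] at h
  rw [h, abs_of_pos (by positivity), mul_inv_cancel_left₀ (by positivity)]

/-- An `H²` profile `F` with its weak derivatives. -/
structure Profile (F : Rd d → ℝ) (gF : Fin d → Rd d → ℝ) (kF : Fin d → Fin d → Rd d → ℝ) : Prop where
  l2 : MemLp F 2 volume
  wp : ∀ j, HasWeakPartial j F (gF j)
  gl2 : ∀ j, MemLp (gF j) 2 volume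
  wp2 : ∀ j i, HasWeakPartial i (gF j) (kF j i)
  kl2 : ∀ j i, MemLp (kF j i) 2 volume

/-- Bounded periodic correctors `χ` with bounded weak derivatives `θ`. -/
structure Corrector (χ : Fin d → Rd d → ℝ) (θ : Fin d → Fin d → Rd d → ℝ) (C : ℝ) : Prop where
  pot : ∀ j, (lattice d).Pot (χ j) C
  wp : ∀ j i, HasWeakPartial i (χ j) (θ j i)
  gpot : ∀ j i, (lattice d).Pot (θ j i) C

/-- The oscillating profile `F(εx) + ε ∑ (∂_j F)(εx) χ_j(x)`. -/
noncomputable def osc (F : Rd d → ℝ) (gF χ : Fin d → Rd d → ℝ) (ε : ℝ) : Rd d → ℝ :=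
  -- `none` indexes the leading term and `some j` the correctors, so that the profile is a single
  -- family of products as `tendsto_two_scale` requires.
  fun x => ∑ s : Option (Fin d), (s.elim 1 fun _ => ε) *
    ((s.elim F gF) (ε • x) * (s.elim (fun _ => 1) χ) x)

/-- `ε⁻¹` times the `i`-th derivative of the oscillating profile. -/
noncomputable def oscGrad (gF χ : Fin d → Rd d → ℝ) (kF θ : Fin d → Fin d → Rd d → ℝ) (i : Fin d)
    (ε : ℝ) : Rd d → ℝ :=
  -- The left summands, where `χ_j` or nothing but the slow argument is differentiated once, survive
  -- as `ε → 0`; the right ones carry second derivatives of the profile and a factor `ε`.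
  fun x => ∑ s : Fin d ⊕ Fin d, (s.elim (fun _ => 1) fun _ => ε) *
    ((s.elim gF fun j => kF j i) (ε • x) *
      (s.elim (fun j x => (if i = j then 1 else 0) + θ j i x) χ) x)

theorem osc_eq (F : Rd d → ℝ) (gF χ : Fin d → Rd d → ℝ) (ε : ℝ) (x : Rd d) :
    osc F gF χ ε x = F (ε • x) + ∑ j, ε * (gF j (ε • x) * χ j x) := by
  simp [osc, Fintype.sum_option]

variable {F : Rd d → ℝ} {gF χ : Fin d → Rd d → ℝ} {kF θ : Fin d → Fin d → Rd d → ℝ} {C : ℝ}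

theorem osc_hasWeakPartial (hF : Profile F gF kF) (hχ : Corrector χ θ C) {ε : ℝ} (hε : ε ≠ 0)
    (i : Fin d) : HasWeakPartial i (osc F gF χ ε) (fun x => ε * oscGrad gF χ kF θ i ε x) := by
  have hl : ∀ {f : Rd d → ℝ}, MemLp f 2 volume → LocallyIntegrable f := fun hf =>
    hf.locallyIntegrable (by norm_num)
  have h1 := (hF.wp i).comp_smul (hl hF.l2) (hl (hF.gl2 i)) hε
  have h2 : ∀ j, HasWeakPartial i (fun x => ε * (χ j x * gF j (ε • x)))
      (fun x => ε * (θ j i x * gF j (ε • x) + χ j x * (ε * kF j i (ε • x)))) := fun j =>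
    ((hχ.wp j i).mul (hχ.pot j).2.2 (hχ.gpot j i).2.2 fun l =>
      (hF.wp2 j l).comp_smul (hl (hF.gl2 j)) (hl (hF.kl2 j l)) hε).const_mul ε
  refine (h1.add (HasWeakPartial.sum Finset.univ h2)).congr (ae_of_all _ fun x => ?_)
    (ae_of_all _ fun x => ?_)
  · simp only [osc_eq, mul_comm (gF _ _)]
  · simp only [oscGrad, Fintype.sum_sum_type, Sum.elim_inl, Sum.elim_inr, mul_add,
      Finset.sum_add_distrib, one_mul, mul_ite, mul_one, mul_zero,
      Finset.sum_ite_eq, Finset.mem_univ, if_true, Finset.mul_sum, add_assoc]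
    congr 2
    · exact Finset.sum_congr rfl fun j _ => by ring
    · exact Finset.sum_congr rfl fun j _ => by ring

theorem l2_bdd {c : PCell d} {f g : Rd d → ℝ} {L : ℝ} (hf : MemLp f 2 volume) (hg : c.Pot g L) :
    MemLp (fun x => f x * g x) 2 volume := by
  simpa only [mul_comm] using
    L2_whole_iff.1 ((whole_l2 hf).bdd_mul (whole_per _) hg.2.1 hg.2.2)

theorem lattice_pot_one (d : ℕ) : (lattice d).Pot (fun _ => 1) 1 :=
  ⟨fun _ => ae_of_all _ fun _ => rfl, aestronglyMeasurable_const, ae_of_all _ fun _ => by simp⟩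

theorem option_pot (hχ : Corrector χ θ C) (s : Option (Fin d)) :
    (lattice d).Pot (s.elim (fun _ => 1) χ) (s.elim 1 fun _ => C) := by
  cases s with
  | none => exact lattice_pot_one d
  | some j => exact hχ.pot j

theorem sum_pot (hχ : Corrector χ θ C) (i : Fin d) (s : Fin d ⊕ Fin d) :
    (lattice d).Pot (s.elim (fun j x => (if i = j then 1 else 0) + θ j i x) χ)
      (s.elim (fun _ => C + 1) fun _ => C) := by
  cases s with
  | inl j =>
    refine ⟨(hχ.gpot j i).1.comp ((if i = j then 1 else 0) + ·),
      aestronglyMeasurable_const.add (hχ.gpot j i).2.1, ?_⟩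
    filter_upwards [(hχ.gpot j i).2.2] with x hx
    refine (abs_add_le _ _).trans ?_
    have : |(if i = j then (1 : ℝ) else 0)| ≤ 1 := by split_ifs <;> simp
    simp only [Sum.elim_inl]
    linarith
  | inr j => exact hχ.pot j

theorem option_l2 (hF : Profile F gF kF) (s : Option (Fin d)) :
    MemLp (s.elim F gF) 2 volume := by
  cases s with
  | none => exact hF.l2
  | some j => exact hF.gl2 j

theorem sum_l2 (hF : Profile F gF kF) (i : Fin d) (s : Fin d ⊕ Fin d) :
    MemLp (s.elim gF fun j => kF j i) 2 volume := by
  cases s with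
  | inl j => exact hF.gl2 j
  | inr j => exact hF.kl2 j i

theorem osc_l2 (hF : Profile F gF kF) (hχ : Corrector χ θ C) {ε : ℝ} (hε : ε ≠ 0) :
    (whole d).L2 (osc F gF χ ε) ∧ ∀ i, (whole d).L2 (oscGrad gF χ kF θ i ε) :=
  ⟨whole_l2 (memLp_finsetSum _ fun s _ =>
      (l2_bdd (memLp_comp_smul (option_l2 hF s) hε) (option_pot hχ s)).const_mul _),
    fun i => whole_l2 (memLp_finsetSum _ fun s _ =>
      (l2_bdd (memLp_comp_smul (sum_l2 hF i s) hε) (sum_pot hχ i s)).const_mul _)⟩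

/-- The homogenized matrix generated by the correctors `χ` with gradients `θ`. -/
noncomputable def hom (w : Rd d → ℝ) (θ : Fin d → Fin d → Rd d → ℝ) (j l : Fin d) : ℝ :=
  ∑ i, ∫ x, w x ^ 2 * (((if i = j then 1 else 0) + θ j i x) * ((if i = l then 1 else 0) + θ l i x))
    ∂(lattice d).μ

namespace Edge

variable {P w Q : Rd d → ℝ} {gw : Fin d → Rd d → ℝ} {K B M : ℝ}

theorem sqPot (h : Edge P w gw K B) : (lattice d).Pot (fun x => w x ^ 2) (B * B) := by
  simpa only [sq] using h.wPot.mul_pot h.wPot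

/-- Only the leading index survives, and its oscillating factor averages to `∫ w² = 1`. -/
theorem tendsto_osc (h : Edge P w gw K B) {p : Rd d → ℝ} {L : ℝ} (hp : (whole d).Pot p L)
    (hF : Profile F gF kF) (hχ : Corrector χ θ C) :
    Tendsto (fun ε : ℝ => ε ^ d * ∫ x, p (ε • x) * (w x * osc F gF χ ε x) ^ 2) (𝓝[>] 0)
      (𝓝 (∫ y, p y * F y ^ 2)) := by
  have ha : ∀ s : Option (Fin d), Tendsto (fun ε : ℝ => (s.elim 1 fun _ => ε : ℝ)) (𝓝[>] 0)
      (𝓝 (s.elim 1 fun _ => 0)) := fun s => by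
    cases s with
    | none => exact tendsto_const_nhds
    | some j => exact tendsto_nhdsWithin_of_tendsto_nhds tendsto_id
  have t := tendsto_two_scale hp h.sqPot (option_l2 hF) (option_pot hχ) ha
  have e : (∫ y, p y * (F y * F y)) * ∫ x, w x ^ 2 * 1 ∂(lattice d).μ = ∫ y, p y * F y ^ 2 := by
    simp only [mul_one, h.one]
    simp only [sq]
  simp only [Fintype.sum_option (f := fun s : Option (Fin d) => _), Option.elim_none,
    Option.elim_some, mul_zero, zero_mul, Finset.sum_const_zero, add_zero, one_mul] at t
  rw [e] at t
  refine t.congr' ?_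
  filter_upwards [self_mem_nhdsWithin] with ε (hε : 0 < ε)
  have e2 := integral_two_scale p (fun x => w x ^ 2) (fun s : Option (Fin d) => s.elim 1 fun _ => ε)
    (fun s : Option (Fin d) => s.elim F gF) (fun s : Option (Fin d) => s.elim (fun _ => 1) χ) hε
  simp only [Fintype.sum_option, Option.elim_none, Option.elim_some, one_mul] at e2
  rw [e2]
  congr 1
  refine integral_congr_ae (ae_of_all _ fun x => ?_)
  simp only [osc_eq]
  ring

theorem tendsto_oscGrad (h : Edge P w gw K B) (hF : Profile F gF kF) (hχ : Corrector χ θ C)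
    (i : Fin d) :
    Tendsto (fun ε : ℝ => ε ^ d * ∫ x, (w x * oscGrad gF χ kF θ i ε x) ^ 2) (𝓝[>] 0)
      (𝓝 (∑ j, ∑ l, (∫ y, gF j y * gF l y) * ∫ x, w x ^ 2 * (((if i = j then 1 else 0) + θ j i x) *
        ((if i = l then 1 else 0) + θ l i x)) ∂(lattice d).μ)) := by
  have ha : ∀ s : Fin d ⊕ Fin d, Tendsto (fun ε : ℝ => (s.elim (fun _ => 1) fun _ => ε : ℝ))
      (𝓝[>] 0) (𝓝 (s.elim (fun _ => 1) fun _ => 0)) := fun s => by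
    cases s with
    | inl j => exact tendsto_const_nhds
    | inr j => exact tendsto_nhdsWithin_of_tendsto_nhds tendsto_id
  have hone : (whole d).Pot (fun _ => 1) 1 :=
    ⟨whole_per _, aestronglyMeasurable_const, ae_of_all _ fun _ => by simp⟩
  have t := tendsto_two_scale hone h.sqPot (sum_l2 hF i) (sum_pot hχ i) ha
  simp only [Fintype.sum_sum_type (f := fun s : Fin d ⊕ Fin d => _), Sum.elim_inl,
    Sum.elim_inr, mul_zero, zero_mul, Finset.sum_const_zero, add_zero, one_mul] at t
  refine t.congr' ?_
  filter_upwards [self_mem_nhdsWithin] with ε (hε : 0 < ε)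
  have e2 := integral_two_scale (fun _ => 1) (fun x => w x ^ 2)
    (fun s : Fin d ⊕ Fin d => s.elim (fun _ => 1) fun _ => ε)
    (fun s : Fin d ⊕ Fin d => s.elim gF fun j => kF j i)
    (fun s : Fin d ⊕ Fin d => s.elim (fun j x => (if i = j then 1 else 0) + θ j i x) χ) hε
  simp only [one_mul, Fintype.sum_sum_type, Sum.elim_inl, Sum.elim_inr] at e2
  rw [e2]
  congr 1
  refine integral_congr_ae (ae_of_all _ fun x => ?_)
  simp only [oscGrad, Fintype.sum_sum_type, Sum.elim_inl, Sum.elim_inr, one_mul]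
  ring

end Edge

theorem wform_add_pot {c : PCell d} {m : ℕ} {b : Fin m → Rd d} {P Q u : Rd d → ℝ} {g : Fin d → Rd d → ℝ}
    {K L : ℝ} (hP : c.Pot P K) (hQ : c.Pot Q L) (hu : c.L2 u) :
    c.wform b (fun x => P x + Q x) u g = c.wform b P u g + ∫ x, Q x * u x ^ 2 ∂c.μ := by
  have i1 : ∀ {R : Rd d → ℝ} {L : ℝ}, c.Pot R L → Integrable (fun x => R x * u x ^ 2) c.μ :=
    fun hR => by simpa only [sq, mul_assoc] using! (hR.mul hu).integrable_mul hu
  simp only [PCell.wform, add_mul]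
  rw [integral_add (i1 hP) (i1 hQ), add_assoc]

theorem memH1_of_ae {u v : Rd d → ℝ} {g : Fin d → Rd d → ℝ} (huv : v =ᵐ[volume] u)
    (hv : (whole d).L2 v) (hg : ∀ j, HasWeakPartial j v (g j) ∧ (whole d).L2 (g j)) : MemH1 u :=
  ⟨(L2_whole_iff.1 hv).ae_eq huv, fun j =>
    ⟨g j, (hg j).1.congr huv (ae_eq_refl _), L2_whole_iff.1 (hg j).2⟩⟩

theorem whole_pot_scaled {Q : Rd d → ℝ} {M : ℝ} (hQ : (whole d).Pot Q M) {ε : ℝ} (hε : ε ≠ 0) :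
    (whole d).Pot (fun x => ε ^ 2 * Q (ε • x)) (ε ^ 2 * M) := by
  have q := quasiMeasurePreserving_smul_vol (d := d) hε
  refine ⟨whole_per _, (hQ.2.1.comp_quasiMeasurePreserving q).const_mul _, ?_⟩
  filter_upwards [q.ae hQ.2.2] with x hx
  rw [abs_mul, abs_of_nonneg (sq_nonneg ε)]
  exact mul_le_mul_of_nonneg_left hx (sq_nonneg ε)

/-- `rayleigh` is defined with the chosen `weakPartial`; here it is expressed through any weak
derivatives and any representative of the function. -/
theorem rayleigh_eq {V Q u v : Rd d → ℝ} {g : Fin d → Rd d → ℝ} {K M ε : ℝ} (hε : ε ≠ 0)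
    (hV : (whole d).Pot (fun x => V x - bandE0 V 0) K) (hQ : (whole d).Pot Q M)
    (huv : v =ᵐ[volume] u) (hv : (whole d).L2 v)
    (hg : ∀ j, HasWeakPartial j v (g j) ∧ (whole d).L2 (g j)) :
    rayleigh V Q ε u = (whole d).wform stdVec
      (fun x => (V x - bandE0 V 0) + ε ^ 2 * Q (ε • x)) v g / ∫ x, v x ^ 2 := by
  have e := fun j => ((hg j).1.congr huv (ae_eq_refl _)).weakPartial_eq
  rw [wform_add_pot hV (whole_pot_scaled hQ hε) hv]
  have i1 : ∀ j, Integrable (fun x => g j x ^ 2) := fun j => (L2_whole_iff.1 (hg j).2).integrable_sq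
  have i2 : ∀ {R : Rd d → ℝ} {L : ℝ}, (whole d).Pot R L → Integrable (fun x => R x * v x ^ 2) :=
    fun hR => by simpa only [sq, mul_assoc, whole_mu] using! (hR.mul hv).integrable_mul hv
  simp only [PCell.wform, sum_stdVec_mul, whole_mu]
  have i3 : Integrable (fun x => ∑ j, g j x ^ 2) := integrable_finsetSum _ fun j _ => i1 j
  have i4 : Integrable (fun x => ∑ j, g j x ^ 2 + (V x - bandE0 V 0) * v x ^ 2) := i3.add (i2 hV)
  rw [← integral_finsetSum _ fun j _ => i1 j, ← integral_add i3 (i2 hV),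
    ← integral_add i4 (i2 (whole_pot_scaled hQ hε)), rayleigh]
  congr 1
  · refine integral_congr_ae ?_
    filter_upwards [huv, eventually_countable_forall.2 e] with x h1 h2
    simp only [h2, h1]
    ring
  · refine integral_congr_ae ?_
    filter_upwards [huv] with x h1
    rw [h1]

/-- The limit of the rescaled Rayleigh quotient along oscillating trial functions. -/
theorem tendsto_rayleigh {V Q w : Rd d → ℝ} {gw : Fin d → Rd d → ℝ} {K B M : ℝ}
    (h : Edge (fun x => V x - bandE0 V 0) w gw K B) (hQ : (whole d).Pot Q M)
    (hF : Profile F gF kF) (hχ : Corrector χ θ C) (hn : ∫ y, F y ^ 2 ≠ 0) {u : ℝ → Rd d → ℝ}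
    (hu : ∀ ε, 0 < ε → (fun x => w x * osc F gF χ ε x) =ᵐ[volume] u ε) :
    (∀ ε, 0 < ε → MemH1 (u ε)) ∧
    Tendsto (fun ε : ℝ => (ε ^ 2)⁻¹ * rayleigh V Q ε (u ε)) (𝓝[>] 0)
      (𝓝 (((∑ j, ∑ l, (∫ y, gF j y * gF l y) * hom w θ j l) + ∫ y, Q y * F y ^ 2)
        / ∫ y, F y ^ 2)) := by
  have hPw : (whole d).Pot (fun x => V x - bandE0 V 0) K := ⟨whole_per _, h.pot.2.1, h.pot.2.2⟩
  have hone : (whole d).Pot (fun _ => 1) 1 :=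
    ⟨whole_per _, aestronglyMeasurable_const, ae_of_all _ fun _ => by simp⟩
  have hG : ∀ ε, 0 < ε → ∀ j, HasWeakPartial j (osc F gF χ ε)
      (fun x => ε * oscGrad gF χ kF θ j ε x) ∧
      (whole d).L2 (fun x => ε * oscGrad gF χ kF θ j ε x) := fun ε hε j =>
    ⟨osc_hasWeakPartial hF hχ hε.ne' j, ((osc_l2 hF hχ hε.ne').2 j).const_mul ε⟩
  have hl := fun ε (hε : 0 < ε) => h.l2_mul (whole_per _) (fun _ => whole_per _)
    (osc_l2 hF hχ hε.ne').1 fun j => (hG ε hε j).2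
  have hwp := fun ε (hε : 0 < ε) j =>
    h.hasWeakPartial_mul (fun j => (hG ε hε j).1) j
  refine ⟨fun ε hε => memH1_of_ae (hu ε hε) (hl ε hε).1 fun j => ⟨hwp ε hε j, (hl ε hε).2 j⟩, ?_⟩
  have t1 := h.tendsto_osc hone hF hχ
  have t2 := h.tendsto_osc hQ hF hχ
  have t3 := tendsto_finsetSum Finset.univ fun i _ => h.tendsto_oscGrad hF hχ i
  simp only [one_mul] at t1
  -- The volume factor `ε ^ d` of the rescaling cancels in this quotient, and both energy terms
  -- carry a factor `ε ^ 2`, from the gradient and from the scaled potential.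
  have t := (t3.add t2).div t1 hn
  have e : ∑ i, ∑ j, ∑ l, (∫ y, gF j y * gF l y) * ∫ x, w x ^ 2 * (((if i = j then 1 else 0) + θ j i x) *
        ((if i = l then 1 else 0) + θ l i x)) ∂(lattice d).μ
      = ∑ j, ∑ l, (∫ y, gF j y * gF l y) * hom w θ j l := by
    rw [Finset.sum_comm]
    refine Finset.sum_congr rfl fun j _ => ?_
    rw [Finset.sum_comm]
    refine Finset.sum_congr rfl fun l _ => ?_
    rw [hom, Finset.mul_sum]
  rw [e] at t
  refine t.congr' ?_
  filter_upwards [self_mem_nhdsWithin] with ε (hε : 0 < ε)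
  have hε2 : ε ^ 2 ≠ 0 := by positivity
  have hεd : ε ^ d ≠ 0 := by positivity
  rw [rayleigh_eq hε.ne' hPw hQ (hu ε hε) (hl ε hε).1 fun j => ⟨hwp ε hε j, (hl ε hε).2 j⟩,
    wform_add_pot hPw (whole_pot_scaled hQ hε.ne') (hl ε hε).1,
    h.wform_whole (osc_l2 hF hχ hε.ne').1 (hG ε hε), whole_mu]
  have e1 : ∀ i, ∫ x, (w x * (ε * oscGrad gF χ kF θ i ε x)) ^ 2
      = ε ^ 2 * ∫ x, (w x * oscGrad gF χ kF θ i ε x) ^ 2 := fun i => by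
    rw [← integral_const_mul]
    exact integral_congr_ae (ae_of_all _ fun x => by ring)
  have e2 : ∫ x, ε ^ 2 * Q (ε • x) * (w x * osc F gF χ ε x) ^ 2
      = ε ^ 2 * ∫ x, Q (ε • x) * (w x * osc F gF χ ε x) ^ 2 := by
    rw [← integral_const_mul]
    exact integral_congr_ae (ae_of_all _ fun x => by ring)
  simp only [e1, e2, Pi.div_apply, ← Finset.mul_sum, ← mul_add]
  rw [mul_div_mul_left _ _ hεd, mul_div_assoc, inv_mul_cancel_left₀ hε2]

end DefectModes

/-! ### The homogenized matrix is the inverse effective mass matrix. -/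

namespace DefectModes

variable {d : ℕ}

theorem PCell.Pot.l2 {f : Rd d → ℝ} {L : ℝ} (h : (lattice d).Pot f L) : (lattice d).L2 f := by
  have hone : (lattice d).Sm (fun _ => 1) := lattice_sm contDiff_const fun _ _ => rfl
  simpa using h.mul hone.l2

theorem PCell.Pot.const_mul {c : PCell d} {f : Rd d → ℝ} {L : ℝ} (h : c.Pot f L) (a : ℝ) :
    c.Pot (fun x => a * f x) (|a| * L) :=
  ⟨h.1.comp (a * ·), h.2.1.const_mul a, by
    filter_upwards [h.2.2] with x hx
    rw [abs_mul]
    exact mul_le_mul_of_nonneg_left hx (abs_nonneg a)⟩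

theorem PCell.Pot.add {c : PCell d} {f g : Rd d → ℝ} {L L' : ℝ} (h : c.Pot f L) (h' : c.Pot g L') :
    c.Pot (fun x => f x + g x) (L + L') :=
  ⟨h.1.comp₂ h'.1 (· + ·), h.2.1.add h'.2.1, by
    filter_upwards [h.2.2, h'.2.2] with x h1 h2 using (abs_add_le _ _).trans (add_le_add h1 h2)⟩

theorem PCell.Pot.mono {c : PCell d} {f : Rd d → ℝ} {L L' : ℝ} (h : c.Pot f L) (hL : L ≤ L') :
    c.Pot f L' := ⟨h.1, h.2.1, h.2.2.mono fun _ hx => hx.trans hL⟩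

theorem PCell.Pot.sum {c : PCell d} {ι : Type*} (s : Finset ι) {f : ι → Rd d → ℝ} {L : ι → ℝ}
    (h : ∀ i, c.Pot (f i) (L i)) : c.Pot (fun x => ∑ i ∈ s, f i x) (∑ i ∈ s, L i) := by
  classical
  induction s using Finset.induction_on with
  | empty => exact ⟨fun _ => ae_of_all _ fun _ => rfl, aestronglyMeasurable_const, by simp⟩
  | insert a s ha ih =>
    simp only [Finset.sum_insert ha]
    exact (h a).add ih

namespace Edge

variable {P w : Rd d → ℝ} {gw : Fin d → Rd d → ℝ} {K B : ℝ}

/-- The substitution `w χ = 2U` on the cell turns `∫ w² |∇χ|²` into the form of `2U`, which is `4 ∫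
U L_* U`. The second identity integrates `w² Θ_i = 2 (w ∂_i U - U ∂_i w)` by parts. -/
theorem corrector_energy (h : Edge P w gw K B) {U g χ : Rd d → ℝ} {gU Θ : Fin d → Rd d → ℝ}
    {kU : Fin d → Fin d → Rd d → ℝ} {C : ℝ} (hU : (lattice d).L2 U)
    (h1 : ∀ j, HasWeakPartial j U (gU j) ∧ (lattice d).L2 (gU j))
    (h2 : ∀ j l, HasWeakPartial l (gU j) (kU j l) ∧ (lattice d).L2 (kU j l))
    (h3 : (fun x => P x * U x - g x) =ᵐ[volume] fun x => ∑ j, kU j j x)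
    (hχ : (lattice d).Pot χ C) (hΘ : ∀ j, HasWeakPartial j χ (Θ j) ∧ (lattice d).Pot (Θ j) C)
    (he : (fun x => w x * χ x) =ᵐ[volume] fun x => 2 * U x) :
    (∑ i, ∫ x, (w x * Θ i x) ^ 2 ∂(lattice d).μ = 4 * ∫ x, U x * g x ∂(lattice d).μ) ∧
      ∀ i, ∫ x, w x ^ 2 * Θ i x ∂(lattice d).μ = -4 * ∫ x, U x * gw i x ∂(lattice d).μ := by
  have e1 := fun j => ((h.hasWeakPartial_mul (fun i => (hΘ i).1) j).congr he (ae_eq_refl _)).unique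
    ((h1 j).1.const_mul 2)
  have ae := fun {p : Rd d → Prop} (hp : ∀ᵐ x, p x) => PCell.ae_mu (c := lattice d) hp
  constructor
  · rw [← h.wform_cell hχ hΘ]
    have e2 : (lattice d).wform stdVec P (fun x => w x * χ x)
        (fun j x => gw j x * χ x + w x * Θ j x) = 4 * (lattice d).wform stdVec P U gU := by
      simp only [PCell.wform, sum_stdVec_mul]
      simp only [mul_add, Finset.mul_sum, ← integral_const_mul]
      congr 1
      · refine Finset.sum_congr rfl fun j _ => integral_congr_ae ?_
        filter_upwards [ae (e1 j)] with x hx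
        linear_combination (gw j x * χ x + w x * Θ j x + 2 * gU j x) * hx
      · refine integral_congr_ae ?_
        filter_upwards [ae he] with x hx
        rw [hx]
        ring
    rw [e2, wform_eq_of_partials h.pot hU h1 h2]
    congr 1
    refine integral_congr_ae ?_
    filter_upwards [ae h3] with x hx
    rw [← hx]
    ring
  · intro i
    have e3 := PCell.integral_weak_mul (h1 i).1 (h.wp i) hU (h1 i).2 h.l2 (h.gl2 i)
    have i1 : Integrable (fun x => gU i x * w x) (lattice d).μ := (h1 i).2.integrable_mul h.l2
    have i2 : Integrable (fun x => U x * gw i x) (lattice d).μ := hU.integrable_mul (h.gl2 i)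
    have e4 : ∫ x, w x ^ 2 * Θ i x ∂(lattice d).μ
        = ∫ x, (2 * (gU i x * w x) - 2 * (U x * gw i x)) ∂(lattice d).μ := by
      refine integral_congr_ae ?_
      filter_upwards [ae (e1 i), ae he] with x hx hx'
      linear_combination w x * hx - gw i x * hx'
    rw [e4, integral_sub (i1.const_mul 2) (i2.const_mul 2), integral_const_mul, integral_const_mul, e3]
    ring

/-- The quadratic form of the homogenized matrix. -/
theorem hom_quad (h : Edge P w gw K B) {θ : Fin d → Fin d → Rd d → ℝ} {C : ℝ}
    (hθ : ∀ j i, (lattice d).Pot (θ j i) C) (ξ : Fin d → ℝ) :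
    ∑ j, ∑ l, ξ j * ξ l * hom w θ j l = ∑ i, ξ i ^ 2
      + 2 * (∑ i, ξ i * ∫ x, w x ^ 2 * ∑ j, ξ j * θ j i x ∂(lattice d).μ)
      + ∑ i, ∫ x, (w x * ∑ j, ξ j * θ j i x) ^ 2 ∂(lattice d).μ := by
  have hΘ : ∀ i, (lattice d).Pot (fun x => ∑ j, ξ j * θ j i x) (∑ j, |ξ j| * C) := fun i =>
    PCell.Pot.sum _ fun j => (hθ j i).const_mul _
  have hδ : ∀ i j, (lattice d).Pot (fun x => (if i = j then 1 else 0) + θ j i x)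
      (|if i = j then (1 : ℝ) else 0| * 1 + C) := fun i j => by
    simpa using ((lattice_pot_one d).const_mul (if i = j then 1 else 0)).add (hθ j i)
  have hsq : (lattice d).Pot (fun x => w x ^ 2) (B * B) := h.sqPot
  have hint : ∀ {f : Rd d → ℝ} {L : ℝ}, (lattice d).Pot f L → Integrable f (lattice d).μ :=
    fun hf => hf.l2.2.2.integrable (by norm_num)
  have e1 : ∑ j, ∑ l, ξ j * ξ l * hom w θ j l
      = ∑ i, ∫ x, w x ^ 2 * (ξ i + ∑ j, ξ j * θ j i x) ^ 2 ∂(lattice d).μ := by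
    have e2 : ∀ i, ∫ x, w x ^ 2 * (ξ i + ∑ j, ξ j * θ j i x) ^ 2 ∂(lattice d).μ
        = ∑ j, ∑ l, ξ j * ξ l * ∫ x, w x ^ 2 * (((if i = j then 1 else 0) + θ j i x)
          * ((if i = l then 1 else 0) + θ l i x)) ∂(lattice d).μ := by
      intro i
      have i1 : ∀ j l, Integrable (fun x => ξ j * ξ l * (w x ^ 2 * (((if i = j then 1 else 0) + θ j i x)
          * ((if i = l then 1 else 0) + θ l i x)))) (lattice d).μ := fun j l =>
        (hint (hsq.mul_pot ((hδ i j).mul_pot (hδ i l)))).const_mul _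
      simp only [← integral_const_mul]
      rw [Finset.sum_congr rfl fun j _ => (integral_finsetSum _ fun l _ => i1 j l).symm,
        ← integral_finsetSum _ fun j _ => integrable_finsetSum _ fun l _ => i1 j l]
      refine integral_congr_ae (ae_of_all _ fun x => ?_)
      have e3 : ξ i + ∑ j, ξ j * θ j i x = ∑ j, ξ j * ((if i = j then 1 else 0) + θ j i x) := by
        simp [mul_add, Finset.sum_add_distrib]
      simp only
      rw [e3, sq (∑ j, _), Finset.sum_mul_sum, Finset.mul_sum]
      simp only [Finset.mul_sum]
      exact Finset.sum_congr rfl fun j _ => Finset.sum_congr rfl fun l _ => by ring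
    simp only [e2, hom, Finset.mul_sum]
    symm
    rw [Finset.sum_comm]
    exact Finset.sum_congr rfl fun j _ => Finset.sum_comm
  rw [e1, Finset.mul_sum, ← Finset.sum_add_distrib, ← Finset.sum_add_distrib]
  refine Finset.sum_congr rfl fun i _ => ?_
  have i1 : Integrable (fun x => ξ i ^ 2 * w x ^ 2) (lattice d).μ := (hint hsq).const_mul _
  have i2 : Integrable (fun x => 2 * ξ i * (w x ^ 2 * ∑ j, ξ j * θ j i x)) (lattice d).μ :=
    (hint (hsq.mul_pot (hΘ i))).const_mul _
  have i3 : Integrable (fun x => (w x * ∑ j, ξ j * θ j i x) ^ 2) (lattice d).μ :=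
    (h.wPot.mul_pot (hΘ i)).l2.2.2.integrable_sq
  have i4 : Integrable (fun x => ξ i ^ 2 * w x ^ 2 + 2 * ξ i * (w x ^ 2 * ∑ j, ξ j * θ j i x))
    (lattice d).μ := i1.add i2
  have e4 : ξ i ^ 2 + 2 * (ξ i * ∫ x, w x ^ 2 * ∑ j, ξ j * θ j i x ∂(lattice d).μ)
      = (∫ x, ξ i ^ 2 * w x ^ 2 ∂(lattice d).μ)
        + ∫ x, 2 * ξ i * (w x ^ 2 * ∑ j, ξ j * θ j i x) ∂(lattice d).μ := by
    rw [integral_const_mul, integral_const_mul, h.one]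
    ring
  rw [e4, ← integral_add i1 i2, ← integral_add i4 i3]
  exact integral_congr_ae (ae_of_all _ fun x => by ring)

end Edge

theorem effMass_quad (V : Rd d → ℝ) (ξ : Fin d → ℝ) :
    ∑ j, ∑ l, ξ j * ξ l * effMass V j l = 1 / (8 * Real.pi ^ 2) *
      iteratedFDeriv ℝ 2 (bandE0 V) 0 ![∑ j, ξ j • stdVec j, ∑ j, ξ j • stdVec j] := by
  simp only [effMass, Matrix.of_apply, iteratedFDeriv_two_apply, Matrix.cons_val_zero,
    Matrix.cons_val_one, map_sum, map_smul, _root_.sum_apply,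
    _root_.smul_apply, smul_eq_mul, Finset.mul_sum]
  rw [Finset.sum_comm]
  exact Finset.sum_congr rfl fun j _ => Finset.sum_congr rfl fun l _ => by ring

/-- All mollifications have vanishing gradient, hence are constant, and they converge almost
everywhere. -/
theorem ae_const_of_weakPartial_zero {u : Rd d → ℝ} (hu : LocallyIntegrable u)
    (h : ∀ j, HasWeakPartial j u (fun _ => 0)) : ∃ c, u =ᵐ[volume] fun _ => c := by
  have h1 : ∀ n x, moll n u x = moll n u 0 := fun n x => by
    refine is_const_of_fderiv_eq_zero (𝕜 := ℝ) ((contDiff_moll hu n).differentiable (by simp))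
      (fun y => ?_) x 0
    ext v
    have := pd_eq_sum (moll n u) v y
    simp only [fun j => pd_moll (h j) n] at this
    rw [← pd, this]
    simp [moll, conv]
  obtain ⟨x₀, hx₀⟩ := (ae_tendsto_moll hu).exists
  refine ⟨u x₀, ?_⟩
  filter_upwards [ae_tendsto_moll hu] with x hx
  simp only [h1 _ x] at hx
  simp only [h1 _ x₀] at hx₀
  exact tendsto_nhds_unique hx hx₀

theorem WeakLaplace.unique {c : PCell d} {u f g : Rd d → ℝ} (hu : LocallyIntegrable u)
    (hf : c.L2 f) (hg : c.L2 g) (h : WeakLaplace u f) (h' : WeakLaplace u g) : f =ᵐ[volume] g :=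
  PCell.moll_sub_tendsto hf hg fun n => by
    ext x
    rw [← h.moll hu n x, h'.moll hu n x]

/-- The correctors `2 U_j / w`: their homogenized matrix is the inverse effective mass matrix. -/
theorem exists_corrector {V w : Rd d → ℝ} {K K' B : ℝ} (hV : (lattice d).Pot V K)
    (hband : BandRegular V) (hw : IsSimpleBandEdgeState V w) (hgrad : fderiv ℝ (bandE0 V) 0 = 0)
    {U : Fin d → Rd d → ℝ} (hU : ∀ j, SolvesLstar V w (weakPartial j w) (U j))
    (h : Edge (fun x => V x - bandE0 V 0) w (fun j => weakPartial j w) K' B) :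
    ∃ (χ : Fin d → Rd d → ℝ) (θ : Fin d → Fin d → Rd d → ℝ) (C : ℝ), Corrector χ θ C ∧
      (∀ j, (fun x => w x * χ j x) =ᵐ[volume] fun x => 2 * U j x) ∧
      (∀ ξ : Fin d → ℝ, ∑ j, ∑ l, ξ j * ξ l * hom w θ j l = ∑ j, ∑ l, ξ j * ξ l * effMass V j l) ∧
      (∀ ξ : Fin d → ℝ, ∑ j, ξ j ^ 2 - ∑ j, ∑ l, ξ j * ξ l * effMass V j l
        = ∑ i, ∫ x, (w x * ∑ j, ξ j * θ j i x) ^ 2 ∂(lattice d).μ) ∧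
      ∀ j, ∑ i, ∫ x, (w x * θ j i x) ^ 2 ∂(lattice d).μ = 0 → weakPartial j w =ᵐ[volume] 0 := by
  choose l1 lap bU gU kU bgU h1 h2 h3 h4 using
    fun j => SolvesLstar.facts hV (h.gl2 j) (h.bg j) (hU j)
  choose bU hbU using bU
  have ginv : ∀ i, (lattice d).Pot (fun x => -(weakPartial i w x) * ((w x)⁻¹) ^ 2) B := fun i =>
    ⟨(h.gl2 i).1.comp₂ h.l2.1 (fun s t => -s * (t⁻¹) ^ 2),
      (h.gl2 i).2.1.neg.mul (h.invPot.2.1.pow 2), h.bginv i⟩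
  have pU : ∀ j, (lattice d).Pot (U j) (bU j) := fun j => ⟨(l1 j).1, (l1 j).2.1, hbU j⟩
  have pgU : ∀ j i, (lattice d).Pot (gU j i) (bgU j) := fun j i =>
    ⟨(h1 j i).2.1, (h1 j i).2.2.1, h4 j i⟩
  set χ : Fin d → Rd d → ℝ := fun j x => 2 * ((w x)⁻¹ * U j x) with hχ
  set θ : Fin d → Fin d → Rd d → ℝ := fun j i x =>
    2 * (-(weakPartial i w x) * ((w x)⁻¹) ^ 2 * U j x + (w x)⁻¹ * gU j i x)
  have pχ : ∀ j, (lattice d).Pot (χ j) (|2| * (B * bU j)) := fun j =>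
    (h.invPot.mul_pot (pU j)).const_mul 2
  have pθ : ∀ j i, (lattice d).Pot (θ j i) (|2| * (B * bU j + B * bgU j)) := fun j i =>
    (((ginv i).mul_pot (pU j)).add (h.invPot.mul_pot (pgU j i))).const_mul 2
  set C : ℝ := ∑ j, (|2| * (B * bU j) + |2| * (B * bU j + B * bgU j)) with hC
  have hCj : ∀ j, |2| * (B * bU j) + |2| * (B * bU j + B * bgU j) ≤ C := fun j =>
    Finset.single_le_sum (f := fun j => |2| * (B * bU j) + |2| * (B * bU j + B * bgU j))
      (fun j _ => add_nonneg (pχ j).nonneg (pθ j j).nonneg) (Finset.mem_univ j)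
  have hcor : Corrector χ θ C := ⟨fun j => (pχ j).mono ?_, fun j i =>
    ((h.inv i).mul h.binv (h.bginv i) fun l => (h1 j l).1).const_mul 2, fun j i => (pθ j i).mono ?_⟩
  rotate_left
  · linarith [hCj j, (pθ j j).nonneg]
  · linarith [hCj j, (pχ j).nonneg]
  have hwχ : ∀ j, (fun x => w x * χ j x) =ᵐ[volume] fun x => 2 * U j x := fun j => by
    filter_upwards [h.ne] with x hx
    simp only [hχ]
    field_simp
  -- The corrector equation is linear, so the energy identities hold for every combination `∑ ξ_j
  -- U_j`, which gives the full quadratic form.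
  have key := fun ξ : Fin d → ℝ => h.corrector_energy (U := fun x => ∑ j, ξ j * U j x)
    (g := fun x => ∑ j, ξ j * weakPartial j w x) (χ := fun x => ∑ j, ξ j * χ j x)
    (gU := fun i x => ∑ j, ξ j * gU j i x) (Θ := fun i x => ∑ j, ξ j * θ j i x)
    (kU := fun i l x => ∑ j, ξ j * kU j i l x) (C := ∑ j, |ξ j| * C)
    (PCell.L2.sum _ fun j => (l1 j).const_mul _)
    (fun i => ⟨HasWeakPartial.sum _ fun j => (h1 j i).1.const_mul _,
      PCell.L2.sum _ fun j => (h1 j i).2.const_mul _⟩)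
    (fun i l => ⟨HasWeakPartial.sum _ fun j => (h2 j i l).1.const_mul _,
      PCell.L2.sum _ fun j => (h2 j i l).2.const_mul _⟩)
    (by
      filter_upwards [eventually_countable_forall.2 h3] with x hx
      rw [Finset.sum_comm]
      simp only [← Finset.mul_sum, ← hx]
      rw [Finset.mul_sum, ← Finset.sum_sub_distrib]
      exact Finset.sum_congr rfl fun j _ => by ring)
    (PCell.Pot.sum _ fun j => (hcor.pot j).const_mul _)
    (fun i => ⟨HasWeakPartial.sum _ fun j => (hcor.wp j i).const_mul _,
      PCell.Pot.sum _ fun j => (hcor.gpot j i).const_mul _⟩)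
    (by
      filter_upwards [eventually_countable_forall.2 hwχ] with x hx
      rw [Finset.mul_sum, Finset.mul_sum]
      exact Finset.sum_congr rfl fun j _ => by linear_combination ξ j * hx j)
  have hI : ∀ ξ : Fin d → ℝ, ∑ j, ∑ l, ξ j * ξ l * effMass V j l = ∑ j, ξ j ^ 2
      - 4 * ∫ x, (∑ j, ξ j * U j x) * (∑ j, ξ j * weakPartial j w x) ∂(lattice d).μ := by
    intro ξ
    have hc : ∀ i, (∑ j, ξ j • (stdVec j : Rd d)) i = ξ i := fun i => by
      simp [stdVec_apply]
    rw [effMass_quad, hessian_eq hV hband hw hgrad (fun j => ⟨h.wp j, h.gl2 j⟩) h.bg hU,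
      EuclideanSpace.norm_sq_eq]
    simp only [hc, Real.norm_eq_abs, sq_abs]
    have := Real.pi_ne_zero
    field_simp
    ring
  have hcross : ∀ ξ : Fin d → ℝ, ∑ i, ξ i * ∫ x, w x ^ 2 * ∑ j, ξ j * θ j i x ∂(lattice d).μ
      = -4 * ∫ x, (∑ j, ξ j * U j x) * (∑ j, ξ j * weakPartial j w x) ∂(lattice d).μ := by
    intro ξ
    have i1 : ∀ i, Integrable (fun x => ξ i * ((∑ j, ξ j * U j x) * weakPartial i w x))
        (lattice d).μ := fun i =>
      ((PCell.L2.sum Finset.univ fun j => (l1 j).const_mul (ξ j)).integrable_mul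
        (h.gl2 i)).const_mul (ξ i)
    simp only [(key ξ).2]
    rw [Finset.sum_congr rfl fun i _ => mul_left_comm (ξ i) (-4) _, ← Finset.mul_sum]
    congr 1
    simp only [← integral_const_mul]
    rw [← integral_finsetSum _ fun i _ => i1 i]
    refine integral_congr_ae (ae_of_all _ fun x => ?_)
    simp only [Finset.mul_sum]
    exact Finset.sum_congr rfl fun i _ => mul_left_comm _ _ _
  -- With `I = ∫ U_ξ ∂_ξ w`, the quadratic form of `hom` is `|ξ|² - 8I + 4I`, that of the effective
  -- mass is `|ξ|² - 4I`, and the defect is `4I`.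
  refine ⟨χ, θ, C, hcor, hwχ, fun ξ => ?_, fun ξ => ?_, fun j hj => ?_⟩
  · rw [h.hom_quad hcor.gpot, hcross, (key ξ).1, hI]
    ring
  · rw [(key ξ).1, hI]
    ring
  · have hz : ∀ i, θ j i =ᵐ[volume] fun _ => 0 := fun i => by
      have l := (h.wPot.mul_pot (hcor.gpot j i)).l2
      have h5 := (Finset.sum_eq_zero_iff_of_nonneg fun i _ => integral_nonneg fun x =>
        sq_nonneg (w x * θ j i x)).1 hj i (Finset.mem_univ i)
      have h6 := (integral_eq_zero_iff_of_nonneg (fun x => sq_nonneg _) l.2.2.integrable_sq).1 h5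
      refine (hcor.gpot j i).1.ae_eq PCell.L2.zero.1 ?_
      filter_upwards [h6, PCell.ae_mu (c := lattice d) h.ne] with x hx hx'
      exact (mul_eq_zero.1 (pow_eq_zero_iff (two_ne_zero) |>.1 hx)).resolve_left hx'
    -- A constant corrector means that `U_j` is a multiple of `w`, so `L_*` annihilates it, and its
    -- right-hand side `∂_j w` must vanish.
    obtain ⟨c, hc⟩ := ae_const_of_weakPartial_zero (hcor.pot j).l2.locallyIntegrable fun i =>
      (hcor.wp j i).congr (ae_eq_refl _) (hz i)
    have hUc : (fun x => (c / 2) * w x + 0 * w x) =ᵐ[volume] U j := by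
      filter_upwards [hwχ j, hc] with x h5 h6
      rw [h6] at h5
      linarith
    have hwl := (bandEdge_facts hV hw).2.2.1
    have hP := hV.sub_const (bandE0 V 0)
    have lf := (hP.mul h.l2).locallyIntegrable
    have h7 := (hwl.lin hwl h.l2.locallyIntegrable h.l2.locallyIntegrable lf lf (c / 2) 0).congr hUc
      (g := fun x => (V x - bandE0 V 0) * U j x) (by
        filter_upwards [hUc] with x hx
        rw [← hx]
        ring)
    have h8 := WeakLaplace.unique (l1 j).locallyIntegrable ((hP.mul (l1 j)).sub (h.gl2 j))
      (hP.mul (l1 j)) (lap j) h7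
    filter_upwards [h8] with x hx
    simp only [Pi.zero_apply]
    linarith

end DefectModes

/-! ### The homogenized operator and ground states below the band edge. -/

namespace DefectModes

variable {d : ℕ}

theorem MemH2.exists_profile {F : Rd d → ℝ} (hF : MemH2 F) :
    ∃ gF kF, Profile F gF kF := by
  choose g h1 h2 using hF.2
  choose k h3 h4 using fun j => (h2 j).2
  exact ⟨g, k, hF.1, h1, fun j => (h2 j).1, h3, h4⟩

theorem Profile.memH2 {F : Rd d → ℝ} {gF kF} (h : Profile F gF kF) : MemH2 F :=
  ⟨h.l2, fun j => ⟨gF j, h.wp j, h.gl2 j, fun i => ⟨kF j i, h.wp2 j i, h.kl2 j i⟩⟩⟩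

theorem Profile.homOp_ae {F : Rd d → ℝ} {gF kF} (h : Profile F gF kF) (A : Matrix (Fin d) (Fin d) ℝ)
    (Q : Rd d → ℝ) : homOp A Q F =ᵐ[volume] fun x => -(∑ j, ∑ l, A j l * kF l j x) + Q x * F x := by
  have e : ∀ j l, weakPartial j (fun y => A j l * weakPartial l F y) =ᵐ[volume]
      fun x => A j l * kF l j x := fun j l =>
    (((h.wp2 l j).const_mul (A j l)).congr (by
      filter_upwards [(h.wp l).weakPartial_eq] with x hx
      rw [hx]) (ae_eq_refl _)).weakPartial_eq
  filter_upwards [eventually_countable_forall.2 fun j => eventually_countable_forall.2 (e j)] with x hx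
  simp only [homOp, hx]

theorem integrable_pot_sq {P F : Rd d → ℝ} {M : ℝ} (hP : (whole d).Pot P M) (hF : MemLp F 2 volume) :
    Integrable (fun x => P x * F x ^ 2) := by
  simpa only [sq, mul_assoc, whole_mu] using! (hP.mul (whole_l2 hF)).integrable_mul (whole_l2 hF)

/-- The energy identity for an eigenfunction of `L_{A,Q}`. -/
theorem Profile.energy {F Q : Rd d → ℝ} {gF kF} (h : Profile F gF kF) {A : Matrix (Fin d) (Fin d) ℝ}
    {e M : ℝ} (hQ : (whole d).Pot Q M) (hF : IsHomEigenpair A Q e F) :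
    (∑ j, ∑ l, (∫ y, gF j y * gF l y) * A j l) + ∫ y, Q y * F y ^ 2 = e * ∫ y, F y ^ 2 := by
  have e1 : ∀ j l, ∫ y, gF j y * gF l y = -∫ y, F y * kF l j y := fun j l => by
    have := PCell.integral_weak_mul (h.wp j) (h.wp2 l j) (whole_l2 h.l2) (whole_l2 (h.gl2 j))
      (whole_l2 (h.gl2 l)) (whole_l2 (h.kl2 l j))
    rwa [whole_mu] at this
  have i1 : ∀ j l, Integrable (fun y => A j l * (F y * kF l j y)) := fun j l =>
    (h.l2.integrable_mul (h.kl2 l j)).const_mul _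
  have e2 : ∑ j, ∑ l, (∫ y, gF j y * gF l y) * A j l
      = ∫ y, -(∑ j, ∑ l, A j l * (F y * kF l j y)) := by
    rw [integral_neg, integral_finsetSum _ fun j _ => integrable_finsetSum _ fun l _ => i1 j l]
    simp only [e1, ← Finset.sum_neg_distrib]
    refine Finset.sum_congr rfl fun j _ => ?_
    rw [integral_finsetSum _ fun l _ => i1 j l, ← Finset.sum_neg_distrib]
    exact Finset.sum_congr rfl fun l _ => by rw [integral_const_mul]; ring
  have i2 : Integrable (fun y => -(∑ j, ∑ l, A j l * (F y * kF l j y))) :=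
    (integrable_finsetSum _ fun j _ => integrable_finsetSum _ fun l _ => i1 j l).neg
  rw [e2, ← integral_add i2 (integrable_pot_sq hQ h.l2), ← integral_const_mul]
  refine integral_congr_ae ?_
  filter_upwards [hF.2.2, h.homOp_ae A Q] with x h1 h2
  rw [h2] at h1
  simp only [mul_left_comm _ (F x), ← Finset.mul_sum]
  linear_combination F x * h1

theorem integral_sq_pos {F : Rd d → ℝ} (hF : MemLp F 2 volume) (h0 : ¬ F =ᵐ[volume] 0) :
    0 < ∫ y, F y ^ 2 := by
  refine (integral_nonneg fun y => sq_nonneg _).lt_of_ne fun h => h0 ?_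
  filter_upwards [(integral_eq_zero_iff_of_nonneg (fun y => sq_nonneg _) hF.integrable_sq).1 h.symm]
    with x hx
  exact pow_eq_zero_iff two_ne_zero |>.1 hx

theorem sum_sum_stdVec (k : Fin d → Fin d → ℝ) :
    ∑ i, ∑ p, ∑ q, (stdVec i : Rd d) p * (stdVec i : Rd d) q * k p q = ∑ i, k i i := by
  refine Finset.sum_congr rfl fun i _ => ?_
  simp only [mul_assoc, ← Finset.mul_sum, sum_stdVec_mul]

/-- A trial function with energy below the band edge produces a ground state. -/
theorem exists_isGroundState {V Q w u : Rd d → ℝ} {gw : Fin d → Rd d → ℝ} {K B M ε : ℝ}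
    (h : Edge (fun x => V x - bandE0 V 0) w gw K B) (hQ : (whole d).Pot Q M)
    (hQ2 : MemLp Q 2 volume) (hε : ε ≠ 0) (hu : MemH1 u) (hneg : rayleigh V Q ε u < 0) :
    ∃ m ψ, m < bandE0 V 0 ∧ IsGroundState V Q ε m ψ := by
  have hP : (whole d).Pot (fun x => V x - bandE0 V 0) K := ⟨whole_per _, h.pot.2.1, h.pot.2.2⟩
  have hQε := whole_pot_scaled hQ hε
  have hray : ∀ {v : Rd d → ℝ} {g : Fin d → Rd d → ℝ}, MemLp v 2 volume →
      (∀ j, HasWeakPartial j v (g j) ∧ (whole d).L2 (g j)) → rayleigh V Q ε v = (whole d).wform stdVec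
        (fun x => (V x - bandE0 V 0) + ε ^ 2 * Q (ε • x)) v g / ∫ x, v x ^ 2 := fun hv hg =>
    rayleigh_eq hε hP hQ (ae_eq_refl _) (whole_l2 hv) hg
  have hex : ∀ {v : Rd d → ℝ}, MemH1 v → ∃ g : Fin d → Rd d → ℝ,
      ∀ j, HasWeakPartial j v (g j) ∧ (whole d).L2 (g j) := fun hv => by
    choose g h1 h2 using hv.2
    exact ⟨g, fun j => ⟨h1 j, whole_l2 (h2 j)⟩⟩
  obtain ⟨g, hg⟩ := hex hu
  rw [hray hu.1 hg] at hneg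
  have hneg' : (whole d).wform stdVec (fun x => (V x - bandE0 V 0) + ε ^ 2 * Q (ε • x)) u g < 0 := by
    by_contra h'
    exact absurd (div_nonneg (not_lt.1 h') (integral_nonneg fun x => sq_nonneg (u x))) (not_le.2 hneg)
  -- The frame is the standard basis and the nonnegative part is `V - E_0(0)`, so a negative level
  -- is an energy below the band edge.
  obtain ⟨l, v, gv, k, hl, hv, hv0, h1, h2, h3, h4⟩ := exists_ground_state
    (C := fun j i => if i = j then 1 else 0) (fun j => by simp) hP
    ((memLp_comp_smul hQ2 hε).const_mul (ε ^ 2)) hQε.2.2 (fun φ hφ => h.form_nonneg hφ)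
    (whole_l2 hu.1) hg hneg'
  have hprof : Profile v gv k := ⟨L2_whole_iff.1 hv, fun j => (h1 j).1, fun j => L2_whole_iff.1 (h1 j).2,
    fun j i => (h2 j i).1, fun j i => L2_whole_iff.1 (h2 j i).2⟩
  refine ⟨bandE0 V 0 + l, v, by linarith, hprof.memH2, hv0, ?_, fun v' hv' hv'0 => ?_⟩
  · filter_upwards [h3, eventually_countable_forall.2 fun j =>
      weakPartial_weakPartial_eq (h1 j).1 (h2 j j).1] with x e1 e2
    rw [sum_sum_stdVec fun p q => k p q x] at e1
    simp only [weakLaplacian, e2, ← e1]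
    ring
  · obtain ⟨g', hg'⟩ := hex hv'
    rw [hray hv'.1 hg']
    have := h4 v' g' (whole_l2 hv'.1) hg'
    rw [← le_div_iff₀ (integral_sq_pos hv'.1 hv'0)] at this
    linarith

theorem dotProduct_quad (A : Matrix (Fin d) (Fin d) ℝ) (ξ : Fin d → ℝ) :
    star ξ ⬝ᵥ A.mulVec ξ = ∑ j, ∑ l, ξ j * ξ l * A j l := by
  simp only [dotProduct, Matrix.mulVec, Finset.mul_sum, Pi.star_apply, star_trivial]
  exact Finset.sum_congr rfl fun j _ => Finset.sum_congr rfl fun l _ => by ring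

theorem Profile.sum_integral {F : Rd d → ℝ} {gF kF} (h : Profile F gF kF)
    (A : Matrix (Fin d) (Fin d) ℝ) :
    Integrable (fun y => ∑ j, ∑ l, gF j y * gF l y * A j l) ∧
    ∑ j, ∑ l, (∫ y, gF j y * gF l y) * A j l = ∫ y, ∑ j, ∑ l, gF j y * gF l y * A j l := by
  have i1 : ∀ j l, Integrable (fun y => gF j y * gF l y * A j l) := fun j l =>
    ((h.gl2 j).integrable_mul (h.gl2 l)).mul_const _
  refine ⟨integrable_finsetSum _ fun j _ => integrable_finsetSum _ fun l _ => i1 j l, ?_⟩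
  rw [integral_finsetSum _ fun j _ => integrable_finsetSum _ fun l _ => i1 j l]
  refine Finset.sum_congr rfl fun j _ => ?_
  rw [integral_finsetSum _ fun l _ => i1 j l]
  exact Finset.sum_congr rfl fun l _ => (integral_mul_const _ _).symm

/-- A square integrable function with vanishing derivative in some direction is zero. -/
theorem ae_zero_of_directional {F : Rd d → ℝ} {gF : Fin d → Rd d → ℝ} (hF : MemLp F 2 volume)
    (hg : ∀ j, HasWeakPartial j F (gF j)) {ν : Rd d} (hν : ν ≠ 0)
    (h : ∀ᵐ x, ∑ j, ν j * gF j x = 0) : F =ᵐ[volume] 0 := by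
  have hw := whole_l2 hF
  refine PCell.moll_sub_tendsto hw PCell.L2.zero fun n => ?_
  have hφ := hw.sm_moll n
  set φ := moll n F with hφd
  have h1 : ∀ x, pd ν φ x = 0 := fun x => by
    rw [pd_eq_sum]
    simp only [hφd, fun j => pd_moll (hg j) n]
    have e : (∑ j, ν j * moll n (gF j) x) = moll n (fun x => ∑ j, ν j * gF j x) x := by
      rw [moll, conv_sum _ (isTest_mollKernel d n) fun j => by
        simpa only [smul_eq_mul] using! (hg j).2.1.smul (ν j)]
      exact Finset.sum_congr rfl fun j _ => by rw [conv_const_mul]; rfl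
    rw [e, moll, conv_congr (g := fun _ => 0) h]
    simp [conv]
  -- The mollification has zero derivative along `ν`, so it is constant on every line in that
  -- direction.
  have h2 : ∀ (x : Rd d) (t : ℝ), φ (x + t • ν) = φ x := fun x t => by
    have hd : ∀ s : ℝ, HasDerivAt (fun s : ℝ => φ (x + s • ν)) 0 s := fun s => by
      have h3 := (contDiff_differentiableAt hφ.1 (x + s • ν)).hasFDerivAt.comp_hasDerivAt s
        (((hasDerivAt_id s).smul_const ν).const_add x)
      have h4 := h1 (x + s • ν)
      simp only [pd] at h4
      simpa only [id_eq, one_smul, h4] using! h3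
    have := is_const_of_deriv_eq_zero (fun s => (hd s).differentiableAt) (fun s => (hd s).deriv) t 0
    simpa using this
  have hi : Integrable (fun x => φ x ^ 2) := by
    simpa only [whole_mu] using hφ.l2.2.2.integrable_sq
  have h3 : ∀ᵐ x, φ x ^ 2 = 0 := by
    refine ae_eq_zero_of_integral_contDiff_smul_eq_zero hi.locallyIntegrable fun ψ hψ hc => ?_
    obtain ⟨C, hC⟩ := hψ.continuous.bounded_above_of_compact_support hc
    -- By this invariance the test function can be pushed to infinity along `ν` without changing the
    -- integral, which therefore vanishes by dominated convergence.
    have h4 : ∀ m : ℕ, ∫ x, ψ x • φ x ^ 2 = ∫ x, ψ (x + (m : ℝ) • ν) * φ x ^ 2 := fun m => by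
      rw [← integral_add_right_eq_self _ ((m : ℝ) • ν)]
      simp only [h2, smul_eq_mul]
    have t : Tendsto (fun m : ℕ => ∫ x, ψ (x + (m : ℝ) • ν) * φ x ^ 2) atTop
        (𝓝 (∫ x : Rd d, (0 : ℝ))) := by
      refine tendsto_integral_of_dominated_convergence (fun x => C * φ x ^ 2) (fun m =>
        ((hψ.continuous.comp (continuous_add_const _)).mul
          (hφ.1.continuous.pow 2)).aestronglyMeasurable) (hi.const_mul C)
        (fun m => ae_of_all _ fun x => ?_) (ae_of_all _ fun x => ?_)
      · rw [norm_mul, Real.norm_of_nonneg (sq_nonneg _)]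
        exact mul_le_mul_of_nonneg_right (hC _) (sq_nonneg _)
      · obtain ⟨R, hR⟩ := hc.isCompact.isBounded.subset_closedBall 0
        obtain ⟨N, hN⟩ := exists_nat_gt ((R + ‖x‖) / ‖ν‖)
        refine tendsto_const_nhds.congr' ?_
        filter_upwards [eventually_ge_atTop N] with m hm
        rw [image_eq_zero_of_notMem_tsupport (f := ψ) fun hmem => ?_, zero_mul]
        have h5 := mem_closedBall_zero_iff.1 (hR hmem)
        have h6 : (R + ‖x‖) / ‖ν‖ < m := hN.trans_le (by exact_mod_cast hm)
        rw [div_lt_iff₀ (norm_pos_iff.2 hν)] at h6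
        have h7 : ‖(m : ℝ) • ν‖ ≤ ‖x + (m : ℝ) • ν‖ + ‖x‖ := by
          simpa using norm_sub_le (x + (m : ℝ) • ν) x
        rw [norm_smul, Real.norm_natCast] at h7
        linarith
    rw [integral_zero] at t
    refine tendsto_nhds_unique tendsto_const_nhds (t.congr fun m => (h4 m).symm)
  have h4 : φ = fun _ => 0 := Measure.eq_of_ae_eq (μ := volume)
    (h3.mono fun x hx => pow_eq_zero_iff two_ne_zero |>.1 hx) hφ.1.continuous continuous_const
  rw [h4]
  ext x
  simp [moll, conv]

/-- A nonzero positive semidefinite form is positive on gradients. -/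
theorem Profile.quad_pos {F : Rd d → ℝ} {gF kF} (h : Profile F gF kF) (h0 : ¬ F =ᵐ[volume] 0)
    {X : Matrix (Fin d) (Fin d) ℝ} (hX : X.PosSemidef) {i : Fin d} (hi : X i i ≠ 0) :
    0 < ∑ j, ∑ l, (∫ y, gF j y * gF l y) * X j l := by
  obtain ⟨i1, e⟩ := h.sum_integral X
  rw [e]
  have hn : ∀ ξ : Fin d → ℝ, 0 ≤ ∑ j, ∑ l, ξ j * ξ l * X j l := fun ξ => by
    rw [← dotProduct_quad]
    exact hX.dotProduct_mulVec_nonneg ξ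
  refine (integral_nonneg fun y => hn _).lt_of_ne fun hz => h0 ?_
  have h1 := (integral_eq_zero_iff_of_nonneg (fun y => hn _) i1).1 hz.symm
  -- For a positive semidefinite matrix a null vector of the form lies in the kernel; row `i` then
  -- annihilates the gradient, and this row is a nonzero direction because `X i i ≠ 0`.
  refine ae_zero_of_directional h.l2 h.wp (ν := WithLp.toLp 2 (X i)) (fun h2 => hi ?_) ?_
  · exact congrFun (congrArg WithLp.ofLp h2) i
  · filter_upwards [h1] with x hx
    rw [Pi.zero_apply, ← dotProduct_quad, hX.dotProduct_mulVec_zero_iff] at hx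
    exact congrFun hx i

/-- Below a negative value of the energy of `L_{A,Q}` there is an eigenvalue. -/
theorem exists_hom_eigenvalue {A : Matrix (Fin d) (Fin d) ℝ} (hA : A.PosDef) {Q F : Rd d → ℝ} {M s : ℝ}
    (hQ : (whole d).Pot Q M) (hQ2 : MemLp Q 2 volume) {gF kF} (h : Profile F gF kF)
    (h0 : ¬ F =ᵐ[volume] 0) (hs : s ≤ 0)
    (hlt : (∑ j, ∑ l, (∫ y, gF j y * gF l y) * A j l) + ∫ y, Q y * F y ^ 2 < s * ∫ y, F y ^ 2) :
    ∃ l v, l < s ∧ IsHomEigenpair A Q l v := by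
  -- The rows of `S` form a frame in which `∇ · A∇` is a sum of squares of directional derivatives.
  -- As `A` is invertible, so is `S`, and `S⁻¹` expresses the coordinate vectors in that frame.
  obtain ⟨S, hS⟩ : ∃ S : Matrix (Fin d) (Fin d) ℝ, A = star S * S := by
    open scoped MatrixOrder in
    exact CStarAlgebra.nonneg_iff_eq_star_mul_self.1 hA.posSemidef.nonneg
  have hSA : ∀ p q, A p q = ∑ i, S i p * S i q := fun p q => by
    rw [hS, Matrix.mul_apply]
    simp [Matrix.star_apply]
  have hSu : IsUnit S.det := by
    have h1 := (Matrix.isUnit_iff_isUnit_det _).1 hA.isUnit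
    rw [hS, Matrix.det_mul] at h1
    exact isUnit_of_mul_isUnit_right h1
  have hpot0 : (whole d).Pot (fun _ => 0) 0 :=
    ⟨whole_per _, aestronglyMeasurable_const, ae_of_all _ fun _ => by simp⟩
  have hwf : (whole d).wform (fun i => WithLp.toLp 2 (S i)) (fun x => 0 + Q x) F gF
      = (∑ j, ∑ l, (∫ y, gF j y * gF l y) * A j l) + ∫ y, Q y * F y ^ 2 := by
    have i1 : ∀ i, Integrable (fun x => (∑ j, S i j * gF j x) ^ 2) := fun i =>
      (memLp_finsetSum _ fun j _ => (h.gl2 j).const_mul (S i j)).integrable_sq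
    rw [(h.sum_integral A).2, PCell.wform, whole_mu, ← integral_finsetSum _ fun i _ => i1 i]
    simp only [zero_add]
    congr 1
    refine integral_congr_ae (ae_of_all _ fun x => ?_)
    simp only [hSA, sq, Finset.sum_mul_sum]
    simp only [Finset.mul_sum]
    rw [Finset.sum_comm]
    refine Finset.sum_congr rfl fun j _ => ?_
    rw [Finset.sum_comm]
    exact Finset.sum_congr rfl fun l _ => Finset.sum_congr rfl fun i _ => by ring
  have hpos := integral_sq_pos h.l2 h0
  obtain ⟨l, v, gv, k, -, hv, hv0, h1, h2, h3, h4⟩ := exists_ground_state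
    (b := fun i => WithLp.toLp 2 (S i)) (C := (S⁻¹ : Matrix (Fin d) (Fin d) ℝ)) (fun j => by
      ext q
      have := congrFun (congrFun (Matrix.nonsing_inv_mul S hSu) j) q
      rw [Matrix.mul_apply, Matrix.one_apply] at this
      simpa [stdVec_apply, eq_comm] using this) hpot0 hQ2 hQ.2.2 (fun φ hφ => by
        simp only [PCell.form, zero_mul, integral_zero, add_zero]
        exact Finset.sum_nonneg fun i _ => integral_nonneg fun x => mul_self_nonneg _)
    (whole_l2 h.l2) (fun j => ⟨h.wp j, whole_l2 (h.gl2 j)⟩) (by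
      rw [hwf]
      exact hlt.trans_le (mul_nonpos_of_nonpos_of_nonneg hs hpos.le))
  have hprof : Profile v gv k := ⟨L2_whole_iff.1 hv, fun j => (h1 j).1, fun j => L2_whole_iff.1 (h1 j).2,
    fun j i => (h2 j i).1, fun j i => L2_whole_iff.1 (h2 j i).2⟩
  refine ⟨l, v, ?_, hprof.memH2, hv0, ?_⟩
  · have := h4 F gF (whole_l2 h.l2) fun j => ⟨h.wp j, whole_l2 (h.gl2 j)⟩
    rw [hwf] at this
    exact lt_of_mul_lt_mul_right (this.trans_lt hlt) hpos.le
  · filter_upwards [h3, hprof.homOp_ae A Q] with x e1 e2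
    have e3 : ∑ j, ∑ q, A j q * k q j x = ∑ i, ∑ p, ∑ q, S i p * S i q * k p q x := by
      simp only [hSA, Finset.sum_mul]
      rw [Finset.sum_comm]
      symm
      rw [Finset.sum_comm]
      refine Finset.sum_congr rfl fun j _ => ?_
      rw [Finset.sum_comm]
      exact Finset.sum_congr rfl fun q _ => Finset.sum_congr rfl fun i _ => by ring
    rw [e2, e3, ← e1]
    ring

end DefectModes

/-! ### Boundedness of `Q` and the ingredients of the final comparison. -/

namespace DefectModes

variable {d : ℕ}

open scoped FourierTransform SchwartzMap in
/-- Functions in `H^σ(ℝ^d)` with `σ > d / 2` are essentially bounded. -/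
theorem MemHs.exists_bound {σ : ℝ} {Q : Rd d → ℝ} (h : MemHs σ Q) (hσ : (d : ℝ) < 2 * σ) :
    MemLp Q 2 volume ∧ ∃ M, (whole d).Pot Q M := by
  obtain ⟨hQ, hs⟩ := h
  have hQ2 : MemLp Q 2 volume := by simpa using hQ.re
  -- Above the exponent `d / 2` the Fourier transform is integrable, so its inverse transform is a
  -- bounded continuous function; duality with Schwartz functions identifies it with `Q`.
  obtain ⟨v, hv⟩ := hs.fourier_memL1 (by simpa using hσ)
  set q := hQ.toLp (fun x => (Q x : ℂ))
  have hv1 : Integrable (v : Rd d → ℂ) := memLp_one_iff_integrable.1 (Lp.memLp v)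
  have key : ∀ g : 𝓢(Rd d, ℂ), ∫ x, g x • (Q x : ℂ) = ∫ x, g x • 𝓕⁻ (v : Rd d → ℂ) x := fun g => by
    have h1 := DFunLike.congr_fun hv (𝓕⁻ g)
    rw [TemperedDistribution.fourier_apply, FourierTransform.fourier_fourierInv_eq,
      Lp.toTemperedDistribution_apply, Lp.toTemperedDistribution_apply] at h1
    have h2 : ∫ x, g x • (Q x : ℂ) = ∫ x, g x • q x :=
      integral_congr_ae (hQ.coeFn_toLp.mono fun x hx => by simp only [q, hx])
    rw [h2, h1, SchwartzMap.fourierInv_coe]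
    have h3 := VectorFourier.integral_fourierIntegral_smul_eq_flip (μ := volume) (ν := volume)
      (L := -innerₗ (Rd d)) (f := (g : Rd d → ℂ)) (g := (v : Rd d → ℂ)) Real.continuous_fourierChar
      (by exact continuous_inner.neg) g.integrable hv1
    rwa [show (-innerₗ (Rd d)).flip = -innerₗ (Rd d) by
      ext x y; simp [real_inner_comm]] at h3
  have hb : ∀ x, ‖𝓕⁻ (v : Rd d → ℂ) x‖ ≤ ∫ y, ‖v y‖ := fun x =>
    VectorFourier.norm_fourierIntegral_le_integral_norm Real.fourierChar volume (-innerₗ (Rd d)) _ x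
  have hae : ∀ᵐ x, (Q x : ℂ) = 𝓕⁻ (v : Rd d → ℂ) x := by
    refine ae_eq_of_integral_contDiff_smul_eq (hQ.locallyIntegrable (by norm_num)) ?_ fun g hg hc => ?_
    · refine Continuous.locallyIntegrable ?_
      exact VectorFourier.fourierIntegral_continuous Real.continuous_fourierChar
        (L := -innerₗ (Rd d)) (by exact continuous_inner.neg) hv1
    · simpa only [smul_eq_mul, Complex.real_smul] using! key ((hc.comp_left (g := ((↑) : ℝ → ℂ)) Complex.ofReal_zero).toSchwartzMap
        (Complex.ofRealCLM.contDiff.comp hg))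
  refine ⟨hQ2, ∫ y, ‖v y‖, whole_per _, hQ2.1, hae.mono fun x hx => ?_⟩
  have := hb x
  rwa [← hx, Complex.norm_real] at this

theorem Edge.hom_self_nonneg (w : Rd d → ℝ) (θ : Fin d → Fin d → Rd d → ℝ) (j : Fin d) :
    0 ≤ hom w θ j j :=
  Finset.sum_nonneg fun _ _ => integral_nonneg fun _ => mul_nonneg (sq_nonneg _) (mul_self_nonneg _)

/-- Without correctors only the normalization of `w` enters, which is why the one-term function sees
`-Δ + Q`. -/
theorem Edge.hom_zero {P w : Rd d → ℝ} {gw : Fin d → Rd d → ℝ} {K B : ℝ} (h : Edge P w gw K B) :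
    hom w (fun _ _ _ => 0) = (1 : Matrix (Fin d) (Fin d) ℝ) := by
  ext j l
  simp only [hom, add_zero, integral_mul_const, h.one, one_mul, Matrix.one_apply]
  simp [eq_comm]

/-- If the gradient of the band edge state vanishes, so does the potential. -/
theorem Edge.pot_eq_zero {P w : Rd d → ℝ} {gw : Fin d → Rd d → ℝ} {K B : ℝ} (h : Edge P w gw K B)
    (hg : ∀ j, gw j =ᵐ[volume] 0) : P =ᵐ[volume] 0 := by
  have h1 : ∀ᵐ x, P x * w x = 0 := by
    refine ae_eq_zero_of_integral_contDiff_smul_eq_zero h.div.2.1 fun φ hφ hc => ?_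
    have h2 := h.div.2.2 φ ⟨hφ, hc⟩
    rw [Finset.sum_eq_zero fun j _ => integral_eq_zero_of_ae ((hg j).mono fun x hx => by simp [hx])] at h2
    simpa using h2.symm
  filter_upwards [h1, h.ne] with x e1 e2
  exact (mul_eq_zero.1 e1).resolve_right e2

theorem sum_sum_single (X : Matrix (Fin d) (Fin d) ℝ) (i : Fin d) :
    ∑ j, ∑ l, (Pi.single i 1 : Fin d → ℝ) j * (Pi.single i 1 : Fin d → ℝ) l * X j l = X i i := by
  simp [Pi.single_apply]

variable {F : Rd d → ℝ} {gF χ : Fin d → Rd d → ℝ} {kF : Fin d → Fin d → Rd d → ℝ}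

/-- Only values of the quadratic form on gradients occur, so agreement of quadratic forms replaces
equality of matrices. -/
theorem Profile.quad_congr (h : Profile F gF kF) {X Y : Matrix (Fin d) (Fin d) ℝ}
    (hXY : ∀ ξ : Fin d → ℝ, ∑ j, ∑ l, ξ j * ξ l * X j l = ∑ j, ∑ l, ξ j * ξ l * Y j l) :
    ∑ j, ∑ l, (∫ y, gF j y * gF l y) * X j l = ∑ j, ∑ l, (∫ y, gF j y * gF l y) * Y j l := by
  rw [(h.sum_integral X).2, (h.sum_integral Y).2]
  exact integral_congr_ae (ae_of_all _ fun y => hXY fun j => gF j y)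

/-- Multiplying `χ_j = 2 L_*⁻¹{∂_j w} / w` by `w` restores the second term, and the factor `ε` comes
from differentiating `F(εx)`. -/
theorem Profile.twoTerm_ae (h : Profile F gF kF) {V w : Rd d → ℝ}
    (hχ : ∀ j, (fun x => w x * χ j x) =ᵐ[volume] fun x => 2 * LstarInv V w (weakPartial j w) x)
    {ε : ℝ} (hε : ε ≠ 0) : (fun x => w x * osc F gF χ ε x) =ᵐ[volume] twoTerm V ε w F := by
  filter_upwards [eventually_countable_forall.2 hχ, eventually_countable_forall.2 fun j =>
    ((h.wp j).comp_smul (h.wp j).1 (h.wp j).2.1 hε).weakPartial_eq] with x e1 e2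
  simp only [twoTerm, e2, osc_eq, mul_add, Finset.mul_sum]
  rw [mul_comm (w x)]
  congr 1
  exact Finset.sum_congr rfl fun j _ => by linear_combination ε * gF j (ε • x) * e1 j

theorem oneTerm_eq (F w : Rd d → ℝ) (gF : Fin d → Rd d → ℝ) (ε : ℝ) :
    (fun x => w x * osc F gF (fun _ _ => 0) ε x) = oneTerm ε w F := by
  ext x
  simp [osc_eq, oneTerm, mul_comm]

theorem corrector_zero : Corrector (d := d) (fun _ _ => 0) (fun _ _ _ => 0) 0 where
  pot _ := by simpa using (lattice_pot_one d).const_mul 0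
  wp _ i := HasWeakPartial.zero i
  gpot _ _ := by simpa using (lattice_pot_one d).const_mul 0

/-- The energy of a profile for an effective mass matrix below the identity, compared with the
energy of an eigenfunction of `-Δ + Q`. -/
theorem Profile.exists_lower_eigenvalue (h : Profile F gF kF) {A : Matrix (Fin d) (Fin d) ℝ}
    (hA : A.PosDef) {Q : Rd d → ℝ} {M s : ℝ} (hQ : (whole d).Pot Q M) (hQ2 : MemLp Q 2 volume)
    (hs : s ≤ 0) (hF : IsHomEigenpair 1 Q s F)
    (hle : ∀ ξ : Fin d → ℝ, ∑ j, ∑ l, ξ j * ξ l * A j l ≤ ∑ j, ξ j ^ 2) {i : Fin d} (hi : A i i ≠ 1) :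
    ∃ l v, l < s ∧ IsHomEigenpair A Q l v := by
  refine exists_hom_eigenvalue hA hQ hQ2 h hF.2.1 hs ?_
  -- This matrix has a nonzero diagonal entry, so replacing the identity by `A` strictly lowers the
  -- gradient energy of the profile.
  have hX : (1 - A).PosSemidef :=
    Matrix.PosSemidef.of_dotProduct_mulVec_nonneg (Matrix.isHermitian_one.sub hA.1) fun ξ => by
      rw [dotProduct_quad]
      simp only [Matrix.sub_apply, mul_sub, Finset.sum_sub_distrib, sub_nonneg]
      refine (hle ξ).trans_eq (Finset.sum_congr rfl fun j _ => ?_)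
      simp [Matrix.one_apply, sq]
  have h1 := h.quad_pos hF.2.1 hX (i := i) (by simpa [sub_eq_zero] using hi.symm)
  simp only [Matrix.sub_apply, mul_sub, Finset.sum_sub_distrib, sub_pos] at h1
  rw [← h.energy hQ hF]
  linarith

theorem rayleigh_neg_of_scaled {V Q u : Rd d → ℝ} {ε : ℝ} (hε : 0 < ε)
    (h : (ε ^ 2)⁻¹ * rayleigh V Q ε u < 0) : rayleigh V Q ε u < 0 :=
  (pos_iff_neg_of_mul_neg h).1 (by positivity)

end DefectModes

end

/-! ### The proposition itself. -/

open DefectModes in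
theorem propositionB1 (d : ℕ) (hd : 1 ≤ d)
    (V Q w F : Rd d → ℝ) (σ e : ℝ)
    -- regularity of the potentials and of the lowest band
    (hVper : LatticePeriodic V) (hV : MemLp V ⊤ (volume : Measure (Rd d)))
    (hσ : (d : ℝ) < σ) (hQ : MemHs σ Q)
    (hband : BandRegular V)
    -- the lowest band edge is a simple eigenvalue and a critical point of the band
    (hw : IsSimpleBandEdgeState V w)
    (hgrad : fderiv ℝ (bandE0 V) 0 = 0)
    -- the effective mass matrix is sign definite, and the homogenized operator
    -- has a simple eigenvalue of the opposite sign with a normalized eigenfunction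
    (hsign : ((effMass V).PosDef ∧ e < 0) ∨ ((-effMass V).PosDef ∧ 0 < e))
    (hF : IsSimpleHomEigenpair (effMass V) Q e F)
    (hFnorm : ∫ y, F y ^ 2 = 1) :
    -- the functions entering the two-term trial function are well defined
    (∀ j, SolvesLstar V w (weakPartial j w) (LstarInv V w (weakPartial j w))) ∧
    -- (1) negative energy of the two-term trial function, and existence of a ground state
    (∃ ε₀ : ℝ, 0 < ε₀ ∧ ∀ ε : ℝ, 0 < ε → ε < ε₀ →
      MemH1 (twoTerm V ε w F) ∧ rayleigh V Q ε (twoTerm V ε w F) < 0 ∧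
      ∃ (m : ℝ) (ψ : Rd d → ℝ), m < bandE0 V 0 ∧ IsGroundState V Q ε m ψ) ∧
    -- (2) comparison with the one-term trial function
    ((¬ ∃ c : ℝ, V =ᵐ[volume] fun _ => c) →
      (∀ (e' : ℝ) (G : Rd d → ℝ), IsHomEigenpair (effMass V) Q e' G → e ≤ e') →
      ∀ (eI : ℝ) (FI : Rd d → ℝ), eI < 0 → IsSimpleHomEigenpair 1 Q eI FI →
        ∃ ε₀ : ℝ, 0 < ε₀ ∧ ∀ ε : ℝ, 0 < ε → ε < ε₀ →
          MemH1 (twoTerm V ε w F) ∧ MemH1 (oneTerm ε w FI) ∧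
          rayleigh V Q ε (twoTerm V ε w F) < rayleigh V Q ε (oneTerm ε w FI) ∧
          rayleigh V Q ε (oneTerm ε w FI) < 0) := by
  obtain ⟨K, hVp⟩ := hVper.pot hV
  obtain ⟨hQ2, M, hQM⟩ := hQ.exists_bound (by linarith [(Nat.cast_nonneg d : (0 : ℝ) ≤ d)])
  have hU : ∀ j, SolvesLstar V w (weakPartial j w) (LstarInv V w (weakPartial j w)) := fun j => by
    have hex := exists_solvesLstar hVp hband hw hgrad j
    rw [LstarInv, dif_pos hex]
    exact hex.choose_spec
  obtain ⟨K', B, h⟩ := exists_edge hVp hw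
  obtain ⟨χ, θ, C, hχ, hχU, hquad, hdef, hgw⟩ := exists_corrector hVp hband hw hgrad hU h
  -- The homogenized matrix has nonnegative diagonal and the same quadratic form as the effective
  -- mass, so a negative definite effective mass is impossible; `hd` provides an index.
  obtain ⟨hA, he⟩ : (effMass V).PosDef ∧ e < 0 := hsign.resolve_right fun hneg => by
    have h1 := hneg.1.diag_pos (i := ⟨0, hd⟩)
    have h2 := (sum_sum_single (hom w θ) ⟨0, hd⟩).symm.trans
      ((hquad _).trans (sum_sum_single (effMass V) _))
    rw [Matrix.neg_apply, ← h2] at h1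
    linarith [Edge.hom_self_nonneg w θ ⟨0, hd⟩]
  obtain ⟨gF, kF, hFp⟩ := hF.1.1.exists_profile
  obtain ⟨m2, t2⟩ := tendsto_rayleigh h hQM hFp hχ (by rw [hFnorm]; exact one_ne_zero)
    fun ε hε => hFp.twoTerm_ae hχU hε.ne'
  -- The energy identity for the eigenfunction turns the limit into `e`.
  rw [hFp.quad_congr (X := hom w θ) hquad, hFp.energy hQM hF.1, hFnorm, mul_one, div_one] at t2
  have hex : ∀ {p : ℝ → Prop}, (∀ᶠ ε in nhdsWithin (0 : ℝ) (Set.Ioi 0), p ε) →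
      ∃ ε₀ : ℝ, 0 < ε₀ ∧ ∀ ε, 0 < ε → ε < ε₀ → p ε := fun hp => by
    obtain ⟨a, ha, hs⟩ := mem_nhdsGT_iff_exists_Ioo_subset.1 hp
    exact ⟨a, ha, fun ε h1 h2 => hs ⟨h1, h2⟩⟩
  refine ⟨hU, hex ?_, fun hVc hmin eI FI heI hFI => hex ?_⟩
  · filter_upwards [t2.eventually_lt_const he, self_mem_nhdsWithin] with ε h1 hε
    have hneg := rayleigh_neg_of_scaled hε h1
    exact ⟨m2 ε hε, hneg, exists_isGroundState h hQM hQ2 (ne_of_gt hε) (m2 ε hε) hneg⟩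
  · obtain ⟨gI, kI, hIp⟩ := hFI.1.1.exists_profile
    have hI0 := integral_sq_pos hIp.l2 hFI.1.2.1
    obtain ⟨m1, t1⟩ := tendsto_rayleigh h hQM hIp corrector_zero hI0.ne'
      fun ε _ => (oneTerm_eq FI w gI ε).eventuallyEq
    rw [h.hom_zero, hIp.energy hQM hFI.1, mul_div_cancel_right₀ _ hI0.ne'] at t1
    -- If all diagonal entries were one, the defect would vanish on each basis vector, all `∂_j w`
    -- would be zero, and `V` would equal `E_0(0)` almost everywhere.
    obtain ⟨i, hi⟩ : ∃ i, effMass V i i ≠ 1 := by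
      by_contra! hone
      refine hVc ⟨bandE0 V 0, (h.pot_eq_zero fun j => hgw j ?_).mono fun x hx => sub_eq_zero.1 hx⟩
      have h1 := hdef (Pi.single j 1)
      rw [sum_sum_single (effMass V), hone] at h1
      simpa [Pi.single_apply] using h1.symm
    obtain ⟨l, v, hl, hv⟩ := hIp.exists_lower_eigenvalue hA hQM hQ2 heI.le hFI.1 (fun ξ => by
      have h1 := hdef ξ
      have h2 : 0 ≤ ∑ i, ∫ x, (w x * ∑ j, ξ j * θ j i x) ^ 2 ∂(lattice d).μ :=
        Finset.sum_nonneg fun _ _ => integral_nonneg fun _ => sq_nonneg _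
      linarith) hi
    -- The scaled limits satisfy `e ≤ l < e_I < 0`, so both inequalities hold for small `ε` and
    -- survive division by the positive factor.
    filter_upwards [t2.eventually_lt t1 ((hmin l v hv).trans_lt hl), t1.eventually_lt_const heI,
      self_mem_nhdsWithin] with ε h1 h2 hε
    have hε' : (0 : ℝ) < ε := hε
    exact ⟨m2 ε hε, m1 ε hε, lt_of_mul_lt_mul_left h1 (by positivity), rayleigh_neg_of_scaled hε h2⟩
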